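/- **Setting.** Let $q_\pm\in\mathbb C$ with $|q_-|=|q_+|=q_0>0$, and let $q:\mathbb R\to\mathbb C$ (the potential of the Lax pair of the focusing Kundu--Eckhaus equation at a fixed time $t\in\mathbb R$) be continuously differentiable with $q(x)\to q_\pm$ as $x\to\pm\infty$, $q_x\in L^1(\mathbb R)$ and $(1+|x|)(q-q_\pm)\in L^1(\mathbb R^\pm)$. Put $k(z)=\frac12(z-q_0^2/z)$, $\lambda(z)=\frac12(z+q_0^2/z)$, $\theta(x,t;z)=\lambda(z)(x+k(z)t)$, $\gamma(z)=1+q_0^2/z^2$, $D^\pm=\{z:\pm(|z|^2-q_0^2)\operatorname{Im}z>0\}$, $\Sigma=\mathbb R\cup\{|z|=q_0\}$ oriented so that $D^-$ lies on its left, and $\Sigma_0=\Sigma\setminus\{0,\pm iq_0\}$. Let $\psi_{\pm,j}(x;z)$, $j=1,2$, be the Jost columns: the solutions of $$\psi_x=\begin{pmatrix}-ik(z)&q(x)\\-q(x)^*&ik(z)\end{pmatrix}\psi$$ with $\psi_{\pm,1}e^{i\theta}\to(1,-iq_\pm^*/z)^T$ and $\psi_{\pm,2}e^{-i\theta}\to(-iq_\pm/z,1)^T$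 as $x\to\pm\infty$. The scattering coefficients are $s_{11}=\mathrm{Wr}(\psi_{+,1},\psi_{-,2})/\gamma$ on $D^-\cup\Sigma_0$, $s_{22}=\mathrm{Wr}(\psi_{-,1},\psi_{+,2})/\gamma$ on $D^+\cup\Sigma_0$, and $s_{12}=\mathrm{Wr}(\psi_{+,2},\psi_{-,2})/\gamma$, $s_{21}=\mathrm{Wr}(\psi_{-,1},\psi_{+,1})/\gamma$ on $\Sigma_0$. Put $\rho=s_{21}/s_{11}$, $\tilde\rho=s_{12}/s_{22}$, and write $\rho^*(z^*)=\overline{\rho(\bar z)}$. Assume that $s_{11}$ has no zeros on $\Sigma$, in the sense that $|s_{11}|\ge c$ on $\Sigma_0$ for some $c>0$, and that the zeros of $s_{11}$ in $D^-\cap\{\operatorname{Im}z<0\}$ are exactly $N\ge 0$ distinct points $z_1,\dots,z_N$, all of them double: $s_{11}(z_n)=s_{11}'(z_n)=0\ne s_{11}''(z_n)$. Put $$B(z)=\prod_{n=1}^N\frac{(z-z_n)^2(z+q_0^2/z_n^*)^2}{(z-z_n^*)^2(z+q_0^2/z_n)^2}.$$ **Conclusions.** 1. The functions $\vartheta^-=s_{11}B^{-1}$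 on $D^-\cup\Sigma_0$ and $\vartheta^+=s_{22}B$ on $D^+\cup\Sigma_0$ (with the removable singularities at the zeros of $s_{11}$, $s_{22}$ filled in) are analytic in $D^-$ and $D^+$ respectively and have no zeros there or on $\Sigma_0$. As $z\to\infty$ in $D^\mp\cup\Sigma_0$, $s_{11}$, $\vartheta^-$ and $s_{22}$, $\vartheta^+$ respectively tend to $1$. On $\Sigma_0$, $$\frac1{s_{11}s_{22}}=1-\rho\tilde\rho=1+\rho(z)\rho^*(z^*),\qquad \vartheta^+(z)\vartheta^-(z)=\frac1{1+\rho(z)\rho^*(z^*)}.$$ 2. (Trace formulae) There is a branch of $\log[1+\rho(\zeta)\rho^*(\zeta^*)]$ that is continuous on $\Sigma_0$ and real on $\mathbb R\setminus\{0\}$. With this branch the following integrals converge absolutely and $$s_{11}(z)=\exp\Bigl(-\frac1{2\pi i}\int_\Sigma\frac{\log[1+\rho(\zeta)\rho^*(\zeta^*)]}{\zeta-z}\,d\zeta\Bigr)B(z),\quad z\in D^-,$$ $$s_{22}(z)=\exp\Bigl(\frac1{2\pi i}\int_\Sigma\frac{\log[1+\rho(\zeta)\rho^*(\zeta^*)]}{\zeta-z}\,d\zeta\Bigr)B(z)^{-1},\quad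 z\in D^+.$$ 3. (Theta condition) With the same branch, $\int_\Sigma\log[1+\rho(\zeta)\rho^*(\zeta^*)]\,\frac{d\zeta}{\zeta}$ converges absolutely and is real, and modulo $2\pi$ $$\arg\frac{q_-}{q_+}=\arg q_--\arg q_+=\frac1{2\pi}\int_\Sigma\frac{\log[1+\rho(\zeta)\rho^*(\zeta^*)]}{\zeta}\,d\zeta+8\sum_{n=1}^N\arg z_n .$$ 4. In the reflectionless case ($\rho=0$ on $\Sigma_0$), $s_{11}=B$ on $D^-$, $s_{22}=B^{-1}$ on $D^+$, and $\arg(q_- /q_+)=8\sum_{n=1}^N\arg z_n$ modulo $2\pi$. -/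

import Mathlib

namespace KE

/-! ### Uniformization variable, regions and contour -/

/-- `k(z) = (z - q₀² / z) / 2`. -/
noncomputable def kOf (q0 : ℝ) (z : ℂ) : ℂ := (z - (q0 : ℂ) ^ 2 / z) / 2

/-- `λ(z) = (z + q₀² / z) / 2`. -/
noncomputable def lamOf (q0 : ℝ) (z : ℂ) : ℂ := (z + (q0 : ℂ) ^ 2 / z) / 2

/-- `θ(x, t; z) = λ(z) (x + k(z) t)`. -/
noncomputable def phase (q0 x t : ℝ) (z : ℂ) : ℂ :=
  lamOf q0 z * ((x : ℂ) + kOf q0 z * (t : ℂ))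

/-- `γ(z) = 1 + q₀² / z²`. -/
noncomputable def gam (q0 : ℝ) (z : ℂ) : ℂ := 1 + (q0 : ℂ) ^ 2 / z ^ 2

/-- The region `D⁺ = {(|z|² - q₀²) Im z > 0}`. -/
def regionPlus (q0 : ℝ) : Set ℂ := {z | 0 < (‖z‖ ^ 2 - q0 ^ 2) * z.im}

/-- The region `D⁻ = {(|z|² - q₀²) Im z < 0}`. -/
def regionMinus (q0 : ℝ) : Set ℂ := {z | (‖z‖ ^ 2 - q0 ^ 2) * z.im < 0}

/-- The contour `Σ = ℝ ∪ {|z| = q₀}` with the origin and the branch points `± i q₀` removed. -/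
def contour0 (q0 : ℝ) : Set ℂ :=
  {z | (z.im = 0 ∨ ‖z‖ = q0) ∧ z ≠ 0 ∧ z ≠ Complex.I * (q0 : ℂ) ∧ z ≠ -(Complex.I * (q0 : ℂ))}

/-- The point `q₀ e^{iα}` of the circle. -/
noncomputable def circ (q0 α : ℝ) : ℂ := (q0 : ℂ) * Complex.exp (Complex.I * (α : ℂ))

/-- `∫_Σ f(ζ) dζ`, where `Σ = ℝ ∪ {|ζ| = q₀}` is oriented so that `D⁻` lies on its left: the
half-lines `|x| > q₀` are run through from right to left, the segment `(-q₀, q₀)` from left to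
right, and both semicircles from `q₀` to `-q₀`. -/
noncomputable def contourInt (q0 : ℝ) (f : ℂ → ℂ) : ℂ :=
  (∫ x in (-q0)..q0, f (x : ℂ))
    - (∫ x in Set.Iio (-q0), f (x : ℂ)) - (∫ x in Set.Ioi q0, f (x : ℂ))
    + (∫ α in (0 : ℝ)..Real.pi, f (circ q0 α) * (Complex.I * circ q0 α))
    + (∫ α in (0 : ℝ)..(-Real.pi), f (circ q0 α) * (Complex.I * circ q0 α))

/-- `f` is absolutely integrable along `Σ`. -/
def ContourIntegrable (q0 : ℝ) (f : ℂ → ℂ) : Prop :=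
  MeasureTheory.Integrable (fun x : ℝ => f (x : ℂ)) ∧
    IntervalIntegrable (fun α : ℝ => f (circ q0 α)) MeasureTheory.volume (-Real.pi) Real.pi

/-! ### Potentials and Jost solutions -/

/-- Potentials `q` (at a fixed time) with the nonzero boundary values `q_±`, `|q_±| = q₀ > 0`, as
`x → ± ∞`: `q` is continuously differentiable, `q_x` is integrable, and `q - q_±` is integrable
over `ℝ^±` with the weight `1 + |x|`. -/
structure IsPotential (q0 : ℝ) (qm qp : ℂ) (q : ℝ → ℂ) : Prop where
  pos : 0 < q0
  norm_minus : ‖qm‖ = q0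
  norm_plus : ‖qp‖ = q0
  contDiff : ContDiff ℝ 1 q
  tendsto_minus : Filter.Tendsto q Filter.atBot (nhds qm)
  tendsto_plus : Filter.Tendsto q Filter.atTop (nhds qp)
  integrable_deriv : MeasureTheory.Integrable (deriv q)
  integrable_minus :
    MeasureTheory.IntegrableOn (fun x : ℝ => (1 + |x|) * ‖q x - qm‖) (Set.Iic 0)
  integrable_plus :
    MeasureTheory.IntegrableOn (fun x : ℝ => (1 + |x|) * ‖q x - qp‖) (Set.Ici 0)

/-- The matrix `X = -i k σ₃ + Q` of the spectral problem `ψ_x = X ψ`, where `v = q(x)`. -/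
noncomputable def laxX (q0 : ℝ) (v z : ℂ) : Matrix (Fin 2) (Fin 2) ℂ :=
  !![-(Complex.I * kOf q0 z), v; -(starRingEnd ℂ v), Complex.I * kOf q0 z]

/-- The columns of `Y_± = I - (i / z) σ₃ Q_±`, where `c = q_±`. -/
noncomputable def asympCol (c z : ℂ) : Fin 2 → (Fin 2 → ℂ) :=
  ![![1, -(Complex.I * starRingEnd ℂ c / z)], ![-(Complex.I * c / z), 1]]

/-- The diagonal entries `1` and `-1` of `σ₃`. -/
def sgn3 : Fin 2 → ℂ := ![1, -1]

/-- `ψ` is the `j`-th column of the Jost solution at time `t` and spectral parameter `z`,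
normalized at the end `l` of the line (`atBot` or `atTop`) where `q` tends to `c`: it solves
`ψ_x = X ψ`, and `ψ e^{iθσ₃} → Y`. -/
def IsJostColumn (q0 : ℝ) (q : ℝ → ℂ) (t : ℝ) (c : ℂ) (l : Filter ℝ) (j : Fin 2) (z : ℂ)
    (ψ : ℝ → (Fin 2 → ℂ)) : Prop :=
  (∀ x : ℝ, HasDerivAt ψ ((laxX q0 (q x) z).mulVec (ψ x)) x) ∧
    Filter.Tendsto (fun x : ℝ => Complex.exp (Complex.I * sgn3 j * phase q0 x t z) • ψ x) l
      (nhds (asympCol c z j))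

open Classical in
/-- The Jost column. It is unique for `(-∞, j = 1)` and `(+∞, j = 2)` in `D⁺ ∪ Σ₀`, and for
`(+∞, j = 1)` and `(-∞, j = 2)` in `D⁻ ∪ Σ₀`; it is only used there. -/
noncomputable def jost (q0 : ℝ) (q : ℝ → ℂ) (t : ℝ) (c : ℂ) (l : Filter ℝ) (j : Fin 2) (z : ℂ) :
    ℝ → (Fin 2 → ℂ) :=
  if h : ∃ ψ, IsJostColumn q0 q t c l j z ψ then h.choose else 0

/-- The Wronskian (determinant) of two columns. -/
def wr (f g : Fin 2 → ℂ) : ℂ := f 0 * g 1 - f 1 * g 0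

/-! ### Scattering coefficients

They are the entries of the matrix `S` in `ψ₊ = ψ₋ S`, expressed by Wronskians (which do not depend
on `x` and are taken at `x = 0`). -/

/-- `s₁₁ = Wr(ψ₊₁, ψ₋₂) / γ`, on `D⁻ ∪ Σ₀`. -/
noncomputable def s11 (q0 : ℝ) (qm qp : ℂ) (q : ℝ → ℂ) (t : ℝ) (z : ℂ) : ℂ :=
  wr (jost q0 q t qp Filter.atTop 0 z 0) (jost q0 q t qm Filter.atBot 1 z 0) / gam q0 z

/-- `s₂₂ = Wr(ψ₋₁, ψ₊₂) / γ`, on `D⁺ ∪ Σ₀`. -/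
noncomputable def s22 (q0 : ℝ) (qm qp : ℂ) (q : ℝ → ℂ) (t : ℝ) (z : ℂ) : ℂ :=
  wr (jost q0 q t qm Filter.atBot 0 z 0) (jost q0 q t qp Filter.atTop 1 z 0) / gam q0 z

/-- `s₁₂ = Wr(ψ₊₂, ψ₋₂) / γ`, on `Σ₀`. -/
noncomputable def s12 (q0 : ℝ) (qm qp : ℂ) (q : ℝ → ℂ) (t : ℝ) (z : ℂ) : ℂ :=
  wr (jost q0 q t qp Filter.atTop 1 z 0) (jost q0 q t qm Filter.atBot 1 z 0) / gam q0 z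

/-- `s₂₁ = Wr(ψ₋₁, ψ₊₁) / γ`, on `Σ₀`. -/
noncomputable def s21 (q0 : ℝ) (qm qp : ℂ) (q : ℝ → ℂ) (t : ℝ) (z : ℂ) : ℂ :=
  wr (jost q0 q t qm Filter.atBot 0 z 0) (jost q0 q t qp Filter.atTop 0 z 0) / gam q0 z

/-- The reflection coefficient `ρ = s₂₁ / s₁₁`. -/
noncomputable def rho (q0 : ℝ) (qm qp : ℂ) (q : ℝ → ℂ) (t : ℝ) (z : ℂ) : ℂ :=
  s21 q0 qm qp q t z / s11 q0 qm qp q t z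

/-- The reflection coefficient `ρ̃ = s₁₂ / s₂₂`. -/
noncomputable def rhoTilde (q0 : ℝ) (qm qp : ℂ) (q : ℝ → ℂ) (t : ℝ) (z : ℂ) : ℂ :=
  s12 q0 qm qp q t z / s22 q0 qm qp q t z

/-- `1 + ρ(z) ρ^*(z^*)`, where `ρ^*(z^*)` is the complex conjugate of `ρ` at the conjugate of `z`. -/
noncomputable def jump (q0 : ℝ) (qm qp : ℂ) (q : ℝ → ℂ) (t : ℝ) (z : ℂ) : ℂ :=
  1 + rho q0 qm qp q t z * starRingEnd ℂ (rho q0 qm qp q t (starRingEnd ℂ z))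

/-- `L` is the branch of `log (1 + ρ(ζ) ρ^*(ζ^*))` on `Σ₀` that is continuous, and real on the real
axis (where `ρ(ζ) ρ^*(ζ^*) = |ρ(ζ)|²`). These conditions determine `L` on `Σ₀`. -/
def IsLogJump (q0 : ℝ) (qm qp : ℂ) (q : ℝ → ℂ) (t : ℝ) (L : ℂ → ℂ) : Prop :=
  ContinuousOn L (contour0 q0) ∧
    (∀ ζ ∈ contour0 q0, Complex.exp (L ζ) = jump q0 qm qp q t ζ) ∧
    (∀ x : ℝ, x ≠ 0 → (L (x : ℂ)).im = 0)

/-! ### The squared Blaschke-type products -/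

/-- `∏ₙ (z - zₙ)² (z + q₀² / zₙ^*)² / ((z - zₙ^*)² (z + q₀² / zₙ)²)`. -/
noncomputable def blaschke (q0 : ℝ) {N : ℕ} (ζ : Fin N → ℂ) (z : ℂ) : ℂ :=
  ∏ n, ((z - ζ n) ^ 2 * (z + (q0 : ℂ) ^ 2 / starRingEnd ℂ (ζ n)) ^ 2) /
    ((z - starRingEnd ℂ (ζ n)) ^ 2 * (z + (q0 : ℂ) ^ 2 / ζ n) ^ 2)

/-- `∏ₙ (z - zₙ^*)² (z + q₀² / zₙ)² / ((z - zₙ)² (z + q₀² / zₙ^*)²)`. -/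
noncomputable def blaschkeInv (q0 : ℝ) {N : ℕ} (ζ : Fin N → ℂ) (z : ℂ) : ℂ :=
  ∏ n, ((z - starRingEnd ℂ (ζ n)) ^ 2 * (z + (q0 : ℂ) ^ 2 / ζ n) ^ 2) /
    ((z - ζ n) ^ 2 * (z + (q0 : ℂ) ^ 2 / starRingEnd ℂ (ζ n)) ^ 2)

/-- The zeros of `s₁₁` are those of the double-zero case: in the lower half-plane part
`|z| > q₀`, `Im z < 0` of `D⁻` they are exactly the distinct points `z₁, …, z_N`, and each of them
is a zero of order exactly two. (The remaining zeros `-q₀² / zₙ^*` of `s₁₁` in `D⁻`, and the zeros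
of `s₂₂` in `D⁺`, follow by symmetry.) -/
structure HasDoubleZeros (q0 : ℝ) (qm qp : ℂ) (q : ℝ → ℂ) (t : ℝ) {N : ℕ} (ζ : Fin N → ℂ) :
    Prop where
  injective : Function.Injective ζ
  mem : ∀ n, ζ n ∈ regionMinus q0 ∧ (ζ n).im < 0
  zero_iff : ∀ z ∈ regionMinus q0, z.im < 0 → (s11 q0 qm qp q t z = 0 ↔ ∃ n, z = ζ n)
  deriv_eq_zero : ∀ n, deriv (s11 q0 qm qp q t) (ζ n) = 0
  deriv_two_ne_zero : ∀ n, iteratedDeriv 2 (s11 q0 qm qp q t) (ζ n) ≠ 0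

end KE

/-! Dividing `s11` by `blaschke` leaves a function ϑ⁻ without zeros in D⁻ or on Σ₀; its reflection
ϑ⁺(z) = conj ϑ⁻(conj z) is `s22` times `blaschke`. Both have continuous logarithms. The Plücker
identity gives s₁₁s₂₂ - s₁₂s₂₁ = 1 on Σ₀, hence log ϑ⁻ + log ϑ⁺ = -log(1 + ρρ*) there. In the Cauchy
integral over Σ the logarithm of ϑ⁻ contributes only for z in D⁻ and that of ϑ⁺ only for z in D⁺,
and this is the trace formula. The theta condition is the same computation with kernel 1/ζ: since
s₁₁ → 1 at infinity, the symmetry under z ↦ -q₀²/z* (`s11_inv`) gives s₁₁ the value q₋/q₊ at the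
origin, so log ϑ⁻(0) carries the phase of q₋/q₊ minus that of the product.

Jost columns. m = ψe^{iθ} satisfies m' = (A + B)m, where B = Q - Q₊ is integrable with a first
moment and A = X₊ + iλ has rank one: A² = μA with μ = 2iλ, and A kills the normalization e. The
usual Volterra kernel I + A(e^{μ(x-y)} - 1)/μ is written as the iterated integral `tOp`, which never
divides by μ and therefore stays good at the branch points, where μ = 0. The price is that the tail
of the weight must be integrable, and the first moment pays it. For large z one does divide by μ,
and `norm_tOp_le_of_ne` gives bounds uniform in z. One integration by parts, which uses q_x ∈ L¹,
then yields s₁₁ = 1 + O(1/z) (`s11_asymp`).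

Branch points. γ has a simple zero at ±iq₀. `HalfPotential.wr_branch` and `wrAB_branch` show that
γs₁₁ is either nonzero at the branch point or divisible by z minus that point with a continuous
quotient. With the lower bound for s₁₁ on Σ₀, s₁₁ has a nonzero limit or behaves like a simple pole
(`s11_branch`), and its logarithm has at most a logarithmic singularity.

Geometry. D⁻ consists of the upper half of the disc |z| < q₀ and of the part of the lower half-plane
outside it. `inv` exchanges the two pieces, and infinity with the origin. One logarithm l on the
half disc therefore describes everything: on the outer piece the logarithm is conj(l(inv z)) + l(0).
Cauchy's theorem is needed only on a half disc (`HalfDiscFun.bdInt_eq_zero`,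
`HalfDiscFun.bdInt_div_sub`), and `contour_glue` transports integrals over Σ to its boundary. The
estimate 1 + O(1/z) at infinity becomes l(η) - l(0) = O(η), which gives absolute convergence at 0
and at infinity. -/

namespace KE

open MeasureTheory Set Filter Topology

local notation "conj" => starRingEnd ℂ

/-! ### Integrals over half-lines and weights at infinity -/

section Tail

variable {V : Type*} [NormedAddCommGroup V] [NormedSpace ℝ V]

/-- The tail integral `∫_x^∞ f`. -/
noncomputable def tail (f : ℝ → V) (x : ℝ) : V := ∫ y in Ioi x, f y

theorem tail_eq_sub {f : ℝ → V} (hi : ∀ x, IntegrableOn f (Ioi x)) (x : ℝ) :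
    tail f x = tail f 0 - ∫ y in (0 : ℝ)..x, f y := by
  have := intervalIntegral.integral_interval_add_Ioi (hi 0) (hi x)
  unfold tail
  rw [← this, add_sub_cancel_left]

theorem hasDerivAt_tail [CompleteSpace V] {f : ℝ → V} (hf : Continuous f)
    (hi : ∀ x, IntegrableOn f (Ioi x)) (x : ℝ) : HasDerivAt (tail f) (-f x) x := by
  have h : tail f = fun x => tail f 0 - ∫ y in (0 : ℝ)..x, f y := funext (tail_eq_sub hi)
  rw [h]
  exact (intervalIntegral.integral_hasDerivAt_right (hf.intervalIntegrable _ _)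
    (hf.stronglyMeasurableAtFilter _ _) hf.continuousAt).const_sub _

theorem continuous_tail [CompleteSpace V] {f : ℝ → V} (hf : Continuous f)
    (hi : ∀ x, IntegrableOn f (Ioi x)) : Continuous (tail f) :=
  continuous_iff_continuousAt.2 fun x => (hasDerivAt_tail hf hi x).continuousAt

theorem tendsto_tail {f : ℝ → V} (hi : ∀ x, IntegrableOn f (Ioi x)) :
    Tendsto (tail f) atTop (𝓝 0) := by
  have h : tail f = fun x => tail f 0 - ∫ y in (0 : ℝ)..x, f y := funext (tail_eq_sub hi)
  rw [h]
  have := (intervalIntegral_tendsto_integral_Ioi 0 (hi 0) tendsto_id).const_sub (tail f 0)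
  simpa [tail] using this

theorem tail_nonneg {f : ℝ → ℝ} (h : ∀ x, 0 ≤ f x) (x : ℝ) : 0 ≤ tail f x :=
  integral_nonneg h

theorem tail_antitone {f : ℝ → ℝ} (h : ∀ x, 0 ≤ f x) (hi : ∀ x, IntegrableOn f (Ioi x)) :
    Antitone (tail f) := fun x y hxy =>
  setIntegral_mono_set (hi x) (Eventually.of_forall h)
    (LE.le.eventuallyLE (Ioi_subset_Ioi hxy))

theorem norm_tail_le {f : ℝ → V} {g : ℝ → ℝ} {x : ℝ} (hg : IntegrableOn g (Ioi x))
    (h : ∀ y, x < y → ‖f y‖ ≤ g y) : ‖tail f x‖ ≤ tail g x :=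
  norm_integral_le_of_norm_le hg
    ((ae_restrict_iff' measurableSet_Ioi).2 (Eventually.of_forall fun y hy => h y hy))

theorem integrableOn_Ioi_of_bound {f : ℝ → V} {g : ℝ → ℝ} {x : ℝ} (hf : Continuous f)
    (hg : IntegrableOn g (Ioi x)) (h : ∀ y, x < y → ‖f y‖ ≤ g y) : IntegrableOn f (Ioi x) :=
  Integrable.mono' hg hf.aestronglyMeasurable
    ((ae_restrict_iff' measurableSet_Ioi).2 (Eventually.of_forall fun y hy => h y hy))

end Tail

/-- A continuous nonnegative weight that is integrable at `+∞`. -/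
structure Weight (w : ℝ → ℝ) : Prop where
  cont : Continuous w
  nonneg : ∀ x, 0 ≤ w x
  integrable : ∀ x, IntegrableOn w (Ioi x)

namespace Weight

variable {w : ℝ → ℝ} (hw : Weight w)
include hw

theorem tail_nonneg (x : ℝ) : 0 ≤ tail w x := KE.tail_nonneg hw.nonneg x

theorem antitone : Antitone (tail w) := tail_antitone hw.nonneg hw.integrable

theorem continuous_tail : Continuous (tail w) := KE.continuous_tail hw.cont hw.integrable

theorem one_le_exp (x : ℝ) : 1 ≤ Real.exp (2 * tail w x) :=
  Real.one_le_exp (by have := hw.tail_nonneg x; linarith)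

theorem exp_antitone {x y : ℝ} (h : x ≤ y) :
    Real.exp (2 * tail w y) ≤ Real.exp (2 * tail w x) := by
  have := hw.antitone h
  gcongr

theorem const_mul {c : ℝ} (hc : 0 ≤ c) : Weight fun x => c * w x :=
  ⟨continuous_const.mul hw.cont, fun x => mul_nonneg hc (hw.nonneg x),
    fun x => (hw.integrable x).const_mul c⟩

theorem add {v : ℝ → ℝ} (hv : Weight v) : Weight fun x => w x + v x :=
  ⟨hw.cont.add hv.cont, fun x => add_nonneg (hw.nonneg x) (hv.nonneg x),
    fun x => (hw.integrable x).add (hv.integrable x)⟩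

/-- The integrand is the exact derivative of -e^{2 tail w}/2. -/
theorem integral_exp (x : ℝ) :
    IntegrableOn (fun y => w y * Real.exp (2 * tail w y)) (Ioi x) ∧
      tail (fun y => w y * Real.exp (2 * tail w y)) x = (Real.exp (2 * tail w x) - 1) / 2 := by
  have hd : ∀ y ∈ Ici x, HasDerivAt (fun y => -(Real.exp (2 * tail w y) / 2))
      (w y * Real.exp (2 * tail w y)) y := fun y _ => by
    have := ((((hasDerivAt_tail hw.cont hw.integrable y).const_mul 2).exp).div_const 2).neg
    exact this.congr_deriv (by ring)
  have ht : Tendsto (fun y => -(Real.exp (2 * tail w y) / 2)) atTop (𝓝 (-(Real.exp (2 * 0) / 2))) :=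
    (((Real.continuous_exp.tendsto _).comp ((tendsto_tail hw.integrable).const_mul 2)).div_const
      2).neg
  have hp : ∀ y ∈ Ioi x, 0 ≤ w y * Real.exp (2 * tail w y) := fun y _ =>
    mul_nonneg (hw.nonneg y) (Real.exp_pos _).le
  refine ⟨integrableOn_Ioi_deriv_of_nonneg' hd hp ht, ?_⟩
  rw [tail, integral_Ioi_of_hasDerivAt_of_nonneg' hd hp ht]
  simp; ring

/-- Integration against `w` halves the constant in front of e^{2 tail w}. The 2 in the exponent is
chosen for this: in the norm weighted by the exponential, Volterra operators are contractions with
ratio 1/2. -/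
theorem tail_bound {V : Type*} [NormedAddCommGroup V] [NormedSpace ℝ V] {f : ℝ → V} {C : ℝ}
    (hC : 0 ≤ C) (h : ∀ y, ‖f y‖ ≤ w y * (C * Real.exp (2 * tail w y))) (x : ℝ) :
    ‖tail f x‖ ≤ C / 2 * Real.exp (2 * tail w x) := by
  obtain ⟨hi, he⟩ := hw.integral_exp x
  have h1 : ‖tail f x‖ ≤ tail (fun y => C * (w y * Real.exp (2 * tail w y))) x :=
    norm_tail_le (hi.const_mul C) fun y _ => (h y).trans_eq (by ring)
  refine h1.trans ?_
  have h2 : tail (fun y => C * (w y * Real.exp (2 * tail w y))) x =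
      C * ((Real.exp (2 * tail w x) - 1) / 2) := by
    rw [← he]; exact integral_const_mul _ _
  rw [h2]
  nlinarith

theorem integrableOn_bound {V : Type*} [NormedAddCommGroup V] [NormedSpace ℝ V] {f : ℝ → V}
    {M : ℝ → ℝ} (hM : Antitone M) (hf : Continuous f) (h : ∀ y, ‖f y‖ ≤ w y * M y) (x : ℝ) :
    IntegrableOn f (Ioi x) :=
  integrableOn_Ioi_of_bound hf ((hw.integrable x).mul_const (M x)) fun y hy =>
    (h y).trans (mul_le_mul_of_nonneg_left (hM hy.le) (hw.nonneg y))

end Weight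

/-- A weight with finite first moment has an integrable tail. -/
theorem weight_tail {w : ℝ → ℝ} (hw : Weight w)
    (h1 : IntegrableOn (fun x => (1 + |x|) * w x) (Ioi 0)) : Weight (tail w) := by
  have h2 : IntegrableOn (fun x => x * w x) (Ioi 0) := by
    refine Integrable.mono' h1 (continuous_id.mul hw.cont).aestronglyMeasurable
      ((ae_restrict_iff' measurableSet_Ioi).2 (Eventually.of_forall fun y (hy : 0 < y) => ?_))
    have := hw.nonneg y
    simp only [norm_mul, Real.norm_eq_abs, abs_of_nonneg this, abs_of_pos hy]
    nlinarith
  have hmain : IntegrableOn (tail w) (Ioi 0) := by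
    -- Integration by parts gives ∫₀ᴿ tail w = ∫₀ᴿ y w + R tail w(R), and each of the two terms is
    -- at most ∫₀^∞ y w; hence the factor 2.
    refine integrableOn_Ioi_of_intervalIntegral_norm_bounded (2 * ∫ x in Ioi (0 : ℝ), x * w x) 0
      (fun R => (hw.continuous_tail.integrableOn_Ioc)) tendsto_id ?_
    filter_upwards [eventually_ge_atTop 0] with R hR
    have hd : ∀ y ∈ uIcc 0 R, HasDerivAt (fun y => y * tail w y) (tail w y - y * w y) y :=
      fun y _ => by
        have := (hasDerivAt_id y).mul (hasDerivAt_tail hw.cont hw.integrable y)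
        exact this.congr_deriv (by simp only [id]; ring)
    have hc1 : Continuous (tail w) := hw.continuous_tail
    have hc2 : Continuous fun y => y * w y := continuous_id.mul hw.cont
    have e := intervalIntegral.integral_eq_sub_of_hasDerivAt hd
      ((hc1.sub hc2).intervalIntegrable _ _)
    rw [intervalIntegral.integral_sub (hc1.intervalIntegrable _ _) (hc2.intervalIntegrable _ _)]
      at e
    have e0 : ∫ x in (0 : ℝ)..id R, ‖tail w x‖ = ∫ x in (0 : ℝ)..R, tail w x :=
      intervalIntegral.integral_congr fun y _ => by simp [abs_of_nonneg (hw.tail_nonneg y)]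
    have e1 : (∫ x in (0 : ℝ)..R, x * w x) ≤ ∫ x in Ioi (0 : ℝ), x * w x := by
      rw [intervalIntegral.integral_of_le hR]
      exact setIntegral_mono_set h2
        ((ae_restrict_iff' measurableSet_Ioi).2 (Eventually.of_forall fun y (hy : 0 < y) =>
          mul_nonneg hy.le (hw.nonneg y)))
        (LE.le.eventuallyLE Ioc_subset_Ioi_self)
    have e2 : R * tail w R ≤ ∫ x in Ioi (0 : ℝ), x * w x := by
      have : R * tail w R = ∫ y in Ioi R, R * w y := (integral_const_mul _ _).symm
      rw [this]
      refine (setIntegral_mono_on ((hw.integrable R).const_mul R)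
        (h2.mono_set (Ioi_subset_Ioi hR)) measurableSet_Ioi fun y (hy : R < y) =>
          mul_le_mul_of_nonneg_right hy.le (hw.nonneg y)).trans ?_
      exact setIntegral_mono_set h2
        ((ae_restrict_iff' measurableSet_Ioi).2 (Eventually.of_forall fun y (hy : 0 < y) =>
          mul_nonneg hy.le (hw.nonneg y)))
        (LE.le.eventuallyLE (Ioi_subset_Ioi hR))
    rw [e0]
    linarith [zero_mul (tail w 0)]
  refine ⟨hw.continuous_tail, hw.tail_nonneg, fun x => ?_⟩
  rcases le_or_gt 0 x with h | h
  · exact hmain.mono_set (Ioi_subset_Ioi h)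
  · rw [← Ioc_union_Ioi_eq_Ioi h.le]
    exact hw.continuous_tail.integrableOn_Ioc.union hmain

/-- Holomorphic dependence of an integral on a parameter. -/
theorem differentiableOn_integral_of_dominated {V : Type*} [NormedAddCommGroup V] [NormedSpace ℂ V]
    [CompleteSpace V] {μ : Measure ℝ} {U : Set ℂ} (hU : IsOpen U) {F : ℂ → ℝ → V} {g : ℝ → ℝ}
    (hm : ∀ z ∈ U, AEStronglyMeasurable (F z) μ) (hg : Integrable g μ)
    (hb : ∀ᵐ y ∂μ, ∀ z ∈ U, ‖F z y‖ ≤ g y)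
    (hd : ∀ᵐ y ∂μ, DifferentiableOn ℂ (fun z => F z y) U) :
    DifferentiableOn ℂ (fun z => ∫ y, F z y ∂μ) U := by
  intro z0 hz0
  obtain ⟨r, hr, hrU⟩ := Metric.isOpen_iff.1 hU z0 hz0
  have hsub : ∀ z ∈ Metric.ball z0 (r / 2), Metric.closedBall z (r / 4) ⊆ U := fun z hz y hy =>
    hrU (by
      have h1 := Metric.mem_ball.1 hz
      have h2 := Metric.mem_closedBall.1 hy
      have := dist_triangle y z z0
      exact Metric.mem_ball.2 (by linarith))
  have hz0' : z0 ∈ Metric.ball z0 (r / 2) := Metric.mem_ball_self (by linarith)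
  have hballU : Metric.ball z0 (r / 2) ⊆ U := fun z hz =>
    hsub z hz (Metric.mem_closedBall_self (by linarith))
  -- The derivative is measurable in y as a limit of difference quotients along a sequence of real
  -- increments.
  have hmeas : AEStronglyMeasurable (fun y => deriv (fun z => F z y) z0) μ := by
    have hlim : ∀ᵐ y ∂μ, Tendsto (fun n : ℕ => ((r / 4 / ((n : ℝ) + 1) : ℝ) : ℂ)⁻¹ •
        (F (z0 + ((r / 4 / ((n : ℝ) + 1) : ℝ) : ℂ)) y - F z0 y)) atTop
        (𝓝 (deriv (fun z => F z y) z0)) := by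
      filter_upwards [hd] with y hy
      have h1 := (hy.differentiableAt (hU.mem_nhds hz0)).hasDerivAt.tendsto_slope_zero
      refine h1.comp (tendsto_nhdsWithin_iff.2 ⟨?_, Eventually.of_forall fun n => ?_⟩)
      · have : Tendsto (fun n : ℕ => r / 4 / ((n : ℝ) + 1)) atTop (𝓝 0) :=
          tendsto_const_nhds.div_atTop (tendsto_natCast_atTop_atTop.atTop_add tendsto_const_nhds)
        exact (Complex.continuous_ofReal.tendsto 0).comp this
      · have : r / 4 / ((n : ℝ) + 1) ≠ 0 := by positivity
        exact Complex.ofReal_ne_zero.2 this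
    refine aestronglyMeasurable_of_tendsto_ae atTop (fun n => ?_) hlim
    refine AEStronglyMeasurable.const_smul (AEStronglyMeasurable.sub (hm _ ?_) (hm _ hz0)) _
    refine hsub z0 hz0' (Metric.mem_closedBall.2 ?_)
    rw [dist_eq_norm, add_sub_cancel_left, Complex.norm_real, Real.norm_eq_abs,
      abs_of_pos (by positivity)]
    exact div_le_self (by linarith) (by linarith [(Nat.cast_nonneg n : (0 : ℝ) ≤ n)])
  -- Cauchy's estimate on circles of radius r/4, which stay in U for centres within r/2 of z0,
  -- dominates the derivative by 4g/r. No bound on the derivative has to be assumed.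
  have key := hasDerivAt_integral_of_dominated_loc_of_deriv_le (𝕜 := ℂ) (μ := μ) (F := F)
    (F' := fun z y => deriv (fun z => F z y) z) (bound := fun y => g y / (r / 4)) (x₀ := z0)
    (s := Metric.ball z0 (r / 2)) (Metric.ball_mem_nhds _ (by linarith))
    ((hU.eventually_mem hz0).mono hm) (hg.mono' (hm _ hz0) (hb.mono fun y h => h z0 hz0))
    hmeas (by
      filter_upwards [hb, hd] with y hby hdy z hz
      refine Complex.norm_deriv_le_of_forall_mem_sphere_norm_le (by linarith) ?_ fun w hw =>
        hby w (hsub z hz (Metric.sphere_subset_closedBall hw))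
      exact (hdy.mono (hsub z hz)).diffContOnCl_ball Subset.rfl)
    (hg.div_const _) (by
      filter_upwards [hd] with y hdy z hz
      exact (hdy.differentiableAt (hU.mem_nhds (hballU hz))).hasDerivAt)
  exact key.2.differentiableAt.differentiableWithinAt

/-! ### The Volterra equation m = e + Tm and its solution by iteration -/

section Volterra

variable {V : Type*} [NormedAddCommGroup V] [NormedSpace ℂ V]

/-- A continuous operator-valued perturbation dominated by a weight with integrable tail. -/
structure Perturbation (B : ℝ → V →L[ℂ] V) (b : ℝ → ℝ) : Prop where
  cont : Continuous B
  bound : ∀ x, ‖B x‖ ≤ b x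
  weight : Weight b
  weight_tail : Weight (tail b)

/-- `J(x) = ∫_x^∞ e^{μ(x-y)} B(y) u(y) dy`. -/
noncomputable def jOp (μ : ℂ) (B : ℝ → V →L[ℂ] V) (u : ℝ → V) (x : ℝ) : V :=
  tail (fun y : ℝ => Complex.exp (μ * ((x : ℂ) - y)) • B y (u y)) x

/-- `(T u)(x) = -∫_x^∞ (B u - A J)`. -/
noncomputable def tOp (A : V →L[ℂ] V) (μ : ℂ) (B : ℝ → V →L[ℂ] V) (u : ℝ → V) (x : ℝ) : V :=
  -tail (fun y => B y (u y) - A (jOp μ B u y)) x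

theorem norm_exp_mul_sub_le {μ : ℂ} (hμ : 0 ≤ μ.re) {x y : ℝ} (h : x ≤ y) :
    ‖Complex.exp (μ * ((x : ℂ) - y))‖ ≤ 1 := by
  rw [Complex.norm_exp, Real.exp_le_one_iff, ← Complex.ofReal_sub, Complex.re_mul_ofReal]
  exact mul_nonpos_of_nonneg_of_nonpos hμ (by linarith)

namespace Perturbation

variable {B : ℝ → V →L[ℂ] V} {b : ℝ → ℝ} (hB : Perturbation B b) {A : V →L[ℂ] V} {μ : ℂ}
  {u v : ℝ → V} {M : ℝ → ℝ}
include hB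

theorem norm_apply_le (hb : ∀ x, ‖u x‖ ≤ M x) (y : ℝ) : ‖B y (u y)‖ ≤ b y * M y :=
  ((B y).le_opNorm _).trans (mul_le_mul (hB.bound y) (hb y) (norm_nonneg _) (hB.weight.nonneg y))

theorem cont_apply (hu : Continuous u) : Continuous fun y => B y (u y) :=
  hB.cont.clm_apply hu

theorem integrable_apply (hu : Continuous u) (hM : Antitone M) (hb : ∀ x, ‖u x‖ ≤ M x) (x : ℝ) :
    IntegrableOn (fun y => B y (u y)) (Ioi x) :=
  hB.weight.integrableOn_bound hM (hB.cont_apply hu) (hB.norm_apply_le hb) x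

/-- The base point x0 is separate from x because the factored form of J uses the kernel for x = 0 on
every half-line. -/
theorem integrable_kernel (hμ : 0 ≤ μ.re) (hu : Continuous u) (hM : Antitone M)
    (hb : ∀ x, ‖u x‖ ≤ M x) (x x0 : ℝ) :
    IntegrableOn (fun y : ℝ => Complex.exp (μ * ((x : ℂ) - y)) • B y (u y)) (Ioi x0) := by
  have hc : Continuous fun y : ℝ => Complex.exp (μ * ((x : ℂ) - y)) • B y (u y) :=
    Continuous.smul (by fun_prop) (hB.cont_apply hu)
  refine integrableOn_Ioi_of_bound hc
    (g := fun y => ‖Complex.exp (μ * ((x : ℂ) - x0))‖ * ‖B y (u y)‖)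
    ((hB.integrable_apply hu hM hb x0).norm.const_mul _) fun y hy => ?_
  have h1 : μ * ((x : ℂ) - y) = μ * ((x : ℂ) - x0) + μ * ((x0 : ℂ) - y) := by ring
  rw [norm_smul, h1, Complex.exp_add, norm_mul]
  gcongr
  exact mul_le_of_le_one_right (norm_nonneg _) (norm_exp_mul_sub_le hμ hy.le)

-- Once e^{μx} is factored out, the remaining tail integral has an integrand independent of x and
-- can be differentiated.
omit hB in
theorem jOp_eq (x : ℝ) : jOp μ B u x =
    Complex.exp (μ * x) • tail (fun y : ℝ => Complex.exp (μ * (((0 : ℝ) : ℂ) - y)) • B y (u y)) x := by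
  unfold jOp tail
  rw [← integral_smul]
  refine integral_congr_ae (Eventually.of_forall fun y => ?_)
  simp only [smul_smul, ← Complex.exp_add]
  congr 2; push_cast; ring

theorem norm_jOp_le' (hμ : 0 ≤ μ.re) (hu : Continuous u) (hM : Antitone M)
    (hb : ∀ x, ‖u x‖ ≤ M x) (x : ℝ) : ‖jOp μ B u x‖ ≤ tail (fun y => ‖B y (u y)‖) x := by
  refine norm_tail_le (hB.integrable_apply hu hM hb x).norm fun y hy => ?_
  rw [norm_smul]
  exact mul_le_of_le_one_left (norm_nonneg _) (norm_exp_mul_sub_le hμ hy.le)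

/-- J costs one tail of `b`, so ∫J costs the tail of a tail. This is why `Perturbation` demands that
`tail b` be a weight. -/
theorem norm_jOp_le (hμ : 0 ≤ μ.re) (hM : Antitone M)
    (hb : ∀ x, ‖u x‖ ≤ M x) (x : ℝ) : ‖jOp μ B u x‖ ≤ tail b x * M x := by
  have h : tail b x * M x = tail (fun y => b y * M x) x := (integral_mul_const _ _).symm
  rw [h]
  refine norm_tail_le ((hB.weight.integrable x).mul_const _) fun y hy => ?_
  rw [norm_smul]
  refine (mul_le_of_le_one_left (norm_nonneg _) (norm_exp_mul_sub_le hμ hy.le)).trans ?_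
  exact (hB.norm_apply_le hb y).trans
    (mul_le_mul_of_nonneg_left (hM hy.le) (hB.weight.nonneg y))

theorem hasDerivAt_jOp [CompleteSpace V] (hμ : 0 ≤ μ.re) (hu : Continuous u) (hM : Antitone M)
    (hb : ∀ x, ‖u x‖ ≤ M x) (x : ℝ) :
    HasDerivAt (jOp μ B u) (μ • jOp μ B u x - B x (u x)) x := by
  have hfun : jOp μ B u = fun x : ℝ => Complex.exp (μ * x) •
      tail (fun y : ℝ => Complex.exp (μ * (((0 : ℝ) : ℂ) - y)) • B y (u y)) x :=
    funext fun x => jOp_eq x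
  have hc : Continuous fun y : ℝ => Complex.exp (μ * (((0 : ℝ) : ℂ) - y)) • B y (u y) :=
    Continuous.smul (by fun_prop) (hB.cont_apply hu)
  have h1 := hasDerivAt_tail hc (hB.integrable_kernel hμ hu hM hb 0) x
  have h2 : HasDerivAt (fun x : ℝ => Complex.exp (μ * x)) (Complex.exp (μ * x) * μ) x := by
    have := ((Complex.ofRealCLM.hasDerivAt (x := x)).const_mul μ).cexp
    simpa using this
  have h3 := h2.smul h1
  rw [hfun]
  refine h3.congr_deriv ?_
  rw [smul_neg, smul_smul, ← Complex.exp_add, smul_smul]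
  have : μ * (x : ℂ) + μ * (((0 : ℝ) : ℂ) - x) = 0 := by push_cast; ring
  rw [this, Complex.exp_zero, one_smul, mul_comm μ (Complex.exp _), neg_add_eq_sub]

theorem continuous_jOp [CompleteSpace V] (hμ : 0 ≤ μ.re) (hu : Continuous u) (hM : Antitone M)
    (hb : ∀ x, ‖u x‖ ≤ M x) : Continuous (jOp μ B u) :=
  continuous_iff_continuousAt.2 fun x => (hB.hasDerivAt_jOp hμ hu hM hb x).continuousAt

theorem integrable_jOp [CompleteSpace V] (hμ : 0 ≤ μ.re) (hu : Continuous u) (hM : Antitone M)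
    (hb : ∀ x, ‖u x‖ ≤ M x) (x : ℝ) : IntegrableOn (jOp μ B u) (Ioi x) :=
  hB.weight_tail.integrableOn_bound hM (hB.continuous_jOp hμ hu hM hb) (hB.norm_jOp_le hμ hM hb) x

theorem tendsto_jOp (hμ : 0 ≤ μ.re) (hM : Antitone M)
    (hb : ∀ x, ‖u x‖ ≤ M x) : Tendsto (jOp μ B u) atTop (𝓝 0) := by
  refine squeeze_zero_norm' (a := fun x => tail b x * M 0) ?_ ?_
  · filter_upwards [eventually_ge_atTop 0] with x hx
    exact (hB.norm_jOp_le hμ hM hb x).trans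
      (mul_le_mul_of_nonneg_left (hM hx) (hB.weight.tail_nonneg x))
  · simpa using (tendsto_tail hB.weight.integrable).mul_const (M 0)

/-- J' = μJ - Bu, and J vanishes at infinity. For μ ≠ 0 this exchanges the integral of J for a
factor 1/μ. -/
theorem tail_jOp [CompleteSpace V] (hμ : 0 ≤ μ.re) (hu : Continuous u) (hM : Antitone M)
    (hb : ∀ x, ‖u x‖ ≤ M x) (x : ℝ) :
    tail (fun y => B y (u y) - μ • jOp μ B u y) x = jOp μ B u x := by
  have h := integral_Ioi_of_hasDerivAt_of_tendsto' (a := x) (f := fun y => -jOp μ B u y)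
    (f' := fun y => B y (u y) - μ • jOp μ B u y)
    (fun y _ => ((hB.hasDerivAt_jOp hμ hu hM hb y).neg).congr_deriv (by abel))
    ((hB.integrable_apply hu hM hb x).sub ((hB.integrable_jOp hμ hu hM hb x).smul μ))
    ((hB.tendsto_jOp hμ hM hb).neg)
  rw [tail, h]; simp

theorem integrable_step [CompleteSpace V] (hμ : 0 ≤ μ.re) (hu : Continuous u) (hM : Antitone M)
    (hb : ∀ x, ‖u x‖ ≤ M x) (x : ℝ) :
    IntegrableOn (fun y => B y (u y) - A (jOp μ B u y)) (Ioi x) :=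
  (hB.integrable_apply hu hM hb x).sub (A.integrable_comp (hB.integrable_jOp hμ hu hM hb x))

theorem continuous_step [CompleteSpace V] (hμ : 0 ≤ μ.re) (hu : Continuous u) (hM : Antitone M)
    (hb : ∀ x, ‖u x‖ ≤ M x) : Continuous fun y => B y (u y) - A (jOp μ B u y) :=
  (hB.cont_apply hu).sub (A.continuous.comp (hB.continuous_jOp hμ hu hM hb))

theorem hasDerivAt_tOp [CompleteSpace V] (hμ : 0 ≤ μ.re) (hu : Continuous u) (hM : Antitone M)
    (hb : ∀ x, ‖u x‖ ≤ M x) (x : ℝ) :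
    HasDerivAt (tOp A μ B u) (B x (u x) - A (jOp μ B u x)) x :=
  ((hasDerivAt_tail (hB.continuous_step hμ hu hM hb) (hB.integrable_step hμ hu hM hb)
    x).neg).congr_deriv (neg_neg _)

theorem continuous_tOp [CompleteSpace V] (hμ : 0 ≤ μ.re) (hu : Continuous u) (hM : Antitone M)
    (hb : ∀ x, ‖u x‖ ≤ M x) : Continuous (tOp A μ B u) :=
  continuous_iff_continuousAt.2 fun x => (hB.hasDerivAt_tOp hμ hu hM hb x).continuousAt

theorem jOp_sub (hμ : 0 ≤ μ.re) (hu : Continuous u) (hM : Antitone M)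
    (hb : ∀ x, ‖u x‖ ≤ M x) (hv : Continuous v) (hb' : ∀ x, ‖v x‖ ≤ M x) (x : ℝ) :
    jOp μ B (fun y => u y - v y) x = jOp μ B u x - jOp μ B v x := by
  unfold jOp tail
  rw [← integral_sub (hB.integrable_kernel hμ hu hM hb x x)
    (hB.integrable_kernel hμ hv hM hb' x x)]
  simp only [map_sub, smul_sub]

theorem tOp_sub [CompleteSpace V] (hμ : 0 ≤ μ.re) (hu : Continuous u) (hM : Antitone M)
    (hb : ∀ x, ‖u x‖ ≤ M x) (hv : Continuous v) (hb' : ∀ x, ‖v x‖ ≤ M x) (x : ℝ) :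
    tOp A μ B (fun y => u y - v y) x = tOp A μ B u x - tOp A μ B v x := by
  unfold tOp tail
  rw [← neg_sub', ← integral_sub (hB.integrable_step hμ hu hM hb x)
    (hB.integrable_step hμ hv hM hb' x)]
  congr 1
  refine integral_congr_ae (Eventually.of_forall fun y => ?_)
  simp only [map_sub, hB.jOp_sub hμ hu hM hb hv hb']
  abel

/-- The weight that controls the Volterra iteration for `‖A‖ ≤ K`. -/
theorem weight_add {K : ℝ} (hK : 0 ≤ K) : Weight fun x => b x + K * tail b x :=
  hB.weight.add (hB.weight_tail.const_mul hK)

/-- The half contraction that holds for every μ with nonnegative real part, μ = 0 included: the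
integrand of T is bounded by (b + K tail b) times a bound of u. -/
theorem norm_tOp_le {K C : ℝ} (hK : ‖A‖ ≤ K) (hC : 0 ≤ C) (hμ : 0 ≤ μ.re)
    (hb : ∀ x, ‖u x‖ ≤ C * Real.exp (2 * tail (fun x => b x + K * tail b x) x)) (x : ℝ) :
    ‖tOp A μ B u x‖ ≤ C / 2 * Real.exp (2 * tail (fun x => b x + K * tail b x) x) := by
  have hw := hB.weight_add ((norm_nonneg A).trans hK)
  have hM : Antitone fun x => C * Real.exp (2 * tail (fun x => b x + K * tail b x) x) :=
    fun x y h => mul_le_mul_of_nonneg_left (hw.exp_antitone h) hC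
  rw [tOp, norm_neg]
  refine hw.tail_bound hC (fun y => ?_) x
  refine (norm_sub_le _ _).trans ?_
  rw [add_mul]
  refine add_le_add (hB.norm_apply_le hb y) ((A.le_opNorm _).trans ?_)
  rw [mul_assoc]
  exact mul_le_mul hK (hB.norm_jOp_le hμ hM hb y) (norm_nonneg _) ((norm_nonneg A).trans hK)

/-- Here ∫J = μ⁻¹(∫Bu - J(x)), so only the ratio of the norms of A and μ enters. That ratio stays
bounded as z → ∞, whereas the norm of A alone does not. -/
theorem norm_tOp_le_of_ne [CompleteSpace V] {K C : ℝ} (h0 : μ ≠ 0) (hK : 1 + 2 * ‖A‖ / ‖μ‖ ≤ K)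
    (hC : 0 ≤ C) (hμ : 0 ≤ μ.re) (hu : Continuous u)
    (hb : ∀ x, ‖u x‖ ≤ C * Real.exp (2 * tail (fun x => K * b x) x)) (x : ℝ) :
    ‖tOp A μ B u x‖ ≤ C / 2 * Real.exp (2 * tail (fun x => K * b x) x) := by
  have hK0 : 0 ≤ K := le_trans (by positivity) hK
  have hw := hB.weight.const_mul hK0
  have hM : Antitone fun x => C * Real.exp (2 * tail (fun x => K * b x) x) :=
    fun x y h => mul_le_mul_of_nonneg_left (hw.exp_antitone h) hC
  have i1 := hB.integrable_apply hu hM hb x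
  have i2 := hB.integrable_jOp hμ hu hM hb x
  have e1 : tOp A μ B u x = A (tail (jOp μ B u) x) - tail (fun y => B y (u y)) x := by
    rw [tOp, tail, integral_sub i1 (A.integrable_comp i2), A.integral_comp_comm i2]
    unfold tail; abel
  have e2 : tail (jOp μ B u) x = μ⁻¹ • (tail (fun y => B y (u y)) x - jOp μ B u x) := by
    have := hB.tail_jOp hμ hu hM hb x
    have i3 : IntegrableOn (fun y => μ • jOp μ B u y) (Ioi x) := i2.smul μ
    rw [tail, integral_sub i1 i3, integral_smul] at this
    rw [← this]
    simp only [tail, sub_sub_cancel]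
    rw [smul_smul, inv_mul_cancel₀ h0, one_smul]
  have n1 : ‖tail (fun y => B y (u y)) x‖ ≤ tail (fun y => ‖B y (u y)‖) x :=
    norm_tail_le i1.norm fun _ _ => le_rfl
  have n2 := hB.norm_jOp_le' hμ hu hM hb x
  set N := tail (fun y => ‖B y (u y)‖) x with hN
  have n3 : ‖tOp A μ B u x‖ ≤ (1 + 2 * ‖A‖ / ‖μ‖) * N := by
    rw [e1, e2]
    refine (norm_sub_le _ _).trans ?_
    have : ‖A (μ⁻¹ • (tail (fun y => B y (u y)) x - jOp μ B u x))‖ ≤ ‖A‖ * (‖μ‖⁻¹ * (N + N)) := by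
      refine (A.le_opNorm _).trans ?_
      rw [norm_smul, norm_inv]
      gcongr
      exact (norm_sub_le _ _).trans (add_le_add n1 n2)
    calc _ ≤ ‖A‖ * (‖μ‖⁻¹ * (N + N)) + N := add_le_add this n1
      _ = _ := by rw [div_eq_mul_inv]; ring
  have hN0 : 0 ≤ N := KE.tail_nonneg (fun _ => norm_nonneg _) x
  have hK' : K * N = tail (fun y => K * ‖B y (u y)‖) x := (integral_const_mul _ _).symm
  have n4 : K * N ≤ C / 2 * Real.exp (2 * tail (fun x => K * b x) x) := by
    rw [hK']
    refine (le_abs_self _).trans (hw.tail_bound (f := fun y => K * ‖B y (u y)‖) hC (fun y => ?_) x)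
    rw [Real.norm_of_nonneg (mul_nonneg hK0 (norm_nonneg _)), mul_assoc]
    exact mul_le_mul_of_nonneg_left (hB.norm_apply_le hb y) hK0
  exact n3.trans ((mul_le_mul_of_nonneg_right hK hN0).trans n4)

end Perturbation

/-- Picard iterates of `m = e + T m`. -/
noncomputable def picard (A : V →L[ℂ] V) (μ : ℂ) (B : ℝ → V →L[ℂ] V) (e : V) : ℕ → ℝ → V
  | 0 => fun _ => 0
  | n + 1 => fun x => e + tOp A μ B (picard A μ B e n) x

/-- The solution of the Volterra equation `m = e + T m`. -/
noncomputable def volterra (A : V →L[ℂ] V) (μ : ℂ) (B : ℝ → V →L[ℂ] V) (e : V) (x : ℝ) : V :=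
  limUnder atTop fun n => picard A μ B e n x

namespace Perturbation

variable [CompleteSpace V] {B : ℝ → V →L[ℂ] V} {b : ℝ → ℝ} (hB : Perturbation B b)
  {A : V →L[ℂ] V} {μ : ℂ} {e : V} {K : ℝ}
include hB

theorem antitone_bound (hK : 0 ≤ K) {C : ℝ} (hC : 0 ≤ C) :
    Antitone fun x => C * Real.exp (2 * tail (fun x => b x + K * tail b x) x) :=
  fun _ _ h => mul_le_mul_of_nonneg_left ((hB.weight_add hK).exp_antitone h) hC

/-- The constant 2‖e‖ reproduces itself: T halves it to ‖e‖, and the added e is at most ‖e‖ times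
the exponential, which is at least 1. -/
theorem picard_spec (hK : ‖A‖ ≤ K) (hμ : 0 ≤ μ.re) (n : ℕ) :
    Continuous (picard A μ B e n) ∧ ∀ x, ‖picard A μ B e n x‖ ≤
      2 * ‖e‖ * Real.exp (2 * tail (fun x => b x + K * tail b x) x) := by
  have hK0 := (norm_nonneg A).trans hK
  have hC : 0 ≤ 2 * ‖e‖ := by positivity
  induction n with
  | zero => exact ⟨continuous_const, fun x => by simp only [picard, norm_zero]; positivity⟩
  | succ n ih =>
    refine ⟨continuous_const.add (hB.continuous_tOp hμ ih.1 (hB.antitone_bound hK0 hC) ih.2),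
      fun x => ?_⟩
    refine (norm_add_le _ _).trans ?_
    have h1 := hB.norm_tOp_le hK hC hμ ih.2 x
    have h2 := (hB.weight_add hK0).one_le_exp x
    have := norm_nonneg e
    nlinarith

theorem norm_picard_le_of_ne (h0 : μ ≠ 0) {K' : ℝ} (hK' : 1 + 2 * ‖A‖ / ‖μ‖ ≤ K')
    (hμ : 0 ≤ μ.re) (n : ℕ) (x : ℝ) : ‖picard A μ B e n x‖ ≤
      2 * ‖e‖ * Real.exp (2 * tail (fun x => K' * b x) x) := by
  have hC : 0 ≤ 2 * ‖e‖ := by positivity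
  have hw := hB.weight.const_mul (c := K') (le_trans (by positivity) hK')
  induction n generalizing x with
  | zero => simp only [picard, norm_zero]; positivity
  | succ n ih =>
    refine (norm_add_le _ _).trans ?_
    have h1 := hB.norm_tOp_le_of_ne h0 hK' hC hμ (hB.picard_spec (e := e) le_rfl hμ n).1 ih x
    have h2 := hw.one_le_exp x
    have := norm_nonneg e
    nlinarith

theorem norm_picard_succ_sub_le (hK : ‖A‖ ≤ K) (hμ : 0 ≤ μ.re) (n : ℕ) (x : ℝ) :
    ‖picard A μ B e (n + 1) x - picard A μ B e n x‖ ≤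
      ‖e‖ * (1 / 2) ^ n * Real.exp (2 * tail (fun x => b x + K * tail b x) x) := by
  have hK0 := (norm_nonneg A).trans hK
  have hw := hB.weight_add hK0
  induction n generalizing x with
  | zero =>
    have h2 := hw.one_le_exp x
    have h3 : tOp A μ B (fun _ => 0) x = 0 := by simp [tOp, jOp, tail]
    simp only [picard, h3, add_zero, sub_zero, pow_zero, mul_one]
    exact le_mul_of_one_le_right (norm_nonneg _) h2
  | succ n ih =>
    have h1 : picard A μ B e (n + 1 + 1) x - picard A μ B e (n + 1) x =
        tOp A μ B (fun y => picard A μ B e (n + 1) y - picard A μ B e n y) x := by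
      rw [hB.tOp_sub hμ (hB.picard_spec hK hμ _).1
        (hB.antitone_bound hK0 (by positivity : 0 ≤ 2 * ‖e‖)) (hB.picard_spec hK hμ _).2
        (hB.picard_spec hK hμ _).1 (hB.picard_spec hK hμ _).2]
      exact add_sub_add_left_eq_sub _ _ _
    rw [h1]
    refine (hB.norm_tOp_le hK (by positivity) hμ ih x).trans_eq ?_
    ring

theorem tendsto_picard (hμ : 0 ≤ μ.re) (x : ℝ) :
    Tendsto (fun n => picard A μ B e n x) atTop (𝓝 (volterra A μ B e x)) := by
  have h : CauchySeq fun n => picard A μ B e n x := by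
    refine cauchySeq_of_le_geometric (1 / 2)
      (‖e‖ * Real.exp (2 * tail (fun x => b x + ‖A‖ * tail b x) x)) (by norm_num) fun n => ?_
    rw [dist_comm, dist_eq_norm]
    exact (hB.norm_picard_succ_sub_le le_rfl hμ n x).trans_eq (by ring)
  exact h.tendsto_limUnder

theorem norm_picard_sub_le (hK : ‖A‖ ≤ K) (hμ : 0 ≤ μ.re) (n : ℕ) (x : ℝ) :
    ‖volterra A μ B e x - picard A μ B e n x‖ ≤
      2 * ‖e‖ * (1 / 2) ^ n * Real.exp (2 * tail (fun x => b x + K * tail b x) x) := by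
  have h := dist_le_of_le_geometric_of_tendsto (1 / 2)
      (‖e‖ * Real.exp (2 * tail (fun x => b x + K * tail b x) x)) (by norm_num) (fun n => by
        rw [dist_comm, dist_eq_norm]
        exact (hB.norm_picard_succ_sub_le (e := e) hK hμ n x).trans_eq (by ring))
      (hB.tendsto_picard hμ x) n
  rw [dist_comm, dist_eq_norm] at h
  refine h.trans_eq ?_
  ring

theorem norm_volterra_le (hK : ‖A‖ ≤ K) (hμ : 0 ≤ μ.re) (x : ℝ) : ‖volterra A μ B e x‖ ≤
    2 * ‖e‖ * Real.exp (2 * tail (fun x => b x + K * tail b x) x) :=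
  le_of_tendsto (hB.tendsto_picard hμ x).norm
    (Eventually.of_forall fun n => (hB.picard_spec hK hμ n).2 x)

theorem norm_volterra_le_of_ne (h0 : μ ≠ 0) {K' : ℝ} (hK' : 1 + 2 * ‖A‖ / ‖μ‖ ≤ K')
    (hμ : 0 ≤ μ.re) (x : ℝ) : ‖volterra A μ B e x‖ ≤
      2 * ‖e‖ * Real.exp (2 * tail (fun x => K' * b x) x) :=
  le_of_tendsto (hB.tendsto_picard hμ x).norm
    (Eventually.of_forall fun n => hB.norm_picard_le_of_ne h0 hK' hμ n x)

theorem continuous_volterra (hμ : 0 ≤ μ.re) : Continuous (volterra A μ B e) := by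
  refine continuous_iff_continuousAt.2 fun x => ?_
  have hw := hB.weight_add (norm_nonneg A)
  have hu : TendstoUniformlyOn (fun n => picard A μ B e n) (volterra A μ B e) atTop
      (Ioi (x - 1)) := by
    rw [Metric.tendstoUniformlyOn_iff]
    intro ε hε
    have ht : Tendsto (fun n : ℕ => 2 * ‖e‖ * (1 / 2) ^ n *
        Real.exp (2 * tail (fun x => b x + ‖A‖ * tail b x) (x - 1))) atTop (𝓝 0) := by
      have := ((tendsto_pow_atTop_nhds_zero_of_lt_one (r := (1 / 2 : ℝ)) (by norm_num)
        (by norm_num)).const_mul (2 * ‖e‖)).mul_const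
        (Real.exp (2 * tail (fun x => b x + ‖A‖ * tail b x) (x - 1)))
      simpa using this
    filter_upwards [ht.eventually_lt_const hε] with n hn y hy
    rw [dist_eq_norm]
    refine ((hB.norm_picard_sub_le le_rfl hμ n y).trans ?_).trans_lt hn
    exact mul_le_mul_of_nonneg_left (hw.exp_antitone (le_of_lt hy)) (by positivity)
  exact (hu.continuousOn (Eventually.of_forall fun n =>
    (hB.picard_spec le_rfl hμ n).1.continuousOn).frequently).continuousAt
      (Ioi_mem_nhds (by linarith))

/-- T passes to the limit because it contracts the geometric error of the iterates. -/
theorem volterra_eq (hμ : 0 ≤ μ.re) (x : ℝ) :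
    volterra A μ B e x = e + tOp A μ B (volterra A μ B e) x := by
  have hC : (0 : ℝ) ≤ 2 * ‖e‖ := by positivity
  have h1 : Tendsto (fun n => picard A μ B e (n + 1) x) atTop
      (𝓝 (e + tOp A μ B (volterra A μ B e) x)) := by
    refine tendsto_iff_norm_sub_tendsto_zero.2 ?_
    refine squeeze_zero (fun _ => norm_nonneg _) (g := fun n : ℕ => 2 * ‖e‖ * (1 / 2) ^ n / 2 *
        Real.exp (2 * tail (fun x => b x + ‖A‖ * tail b x) x)) (fun n => ?_) ?_
    · have : picard A μ B e (n + 1) x - (e + tOp A μ B (volterra A μ B e) x) =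
          -tOp A μ B (fun y => volterra A μ B e y - picard A μ B e n y) x := by
        rw [hB.tOp_sub hμ (hB.continuous_volterra hμ) (hB.antitone_bound (norm_nonneg A) hC)
          (hB.norm_volterra_le le_rfl hμ) (hB.picard_spec le_rfl hμ _).1
          (hB.picard_spec le_rfl hμ _).2]
        simp only [picard]; abel
      rw [this, norm_neg]
      exact hB.norm_tOp_le le_rfl (by positivity) hμ (hB.norm_picard_sub_le le_rfl hμ n) x
    · have := (((tendsto_pow_atTop_nhds_zero_of_lt_one (r := (1 / 2 : ℝ)) (by norm_num)
        (by norm_num)).const_mul (2 * ‖e‖)).div_const 2).mul_const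
        (Real.exp (2 * tail (fun x => b x + ‖A‖ * tail b x) x))
      simpa using this
  exact tendsto_nhds_unique ((tendsto_add_atTop_iff_nat 1).2 (hB.tendsto_picard hμ x)) h1

theorem volterra_dom (hμ : 0 ≤ μ.re) : ∃ M : ℝ → ℝ, Antitone M ∧
    ∀ x, ‖volterra A μ B e x‖ ≤ M x :=
  ⟨_, hB.antitone_bound (norm_nonneg A) (by positivity), hB.norm_volterra_le le_rfl hμ⟩

theorem hasDerivAt_volterra (hμ : 0 ≤ μ.re) (x : ℝ) :
    HasDerivAt (volterra A μ B e)
      (B x (volterra A μ B e x) - A (jOp μ B (volterra A μ B e) x)) x := by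
  obtain ⟨M, hM, hb⟩ := hB.volterra_dom (A := A) (e := e) hμ
  have h := hB.hasDerivAt_tOp (A := A) hμ (hB.continuous_volterra hμ) hM hb x
  have hf : volterra A μ B e = fun x => e + tOp A μ B (volterra A μ B e) x :=
    funext (hB.volterra_eq hμ)
  exact (h.const_add e).congr_of_eventuallyEq (Eventually.of_forall fun y => hB.volterra_eq hμ y)

/-- Apply A to the Volterra equation: Ae = 0 and A² = μA turn the integrand into A(Bm - μJ), whose
tail integral is AJ. Hence m' = Bm - AJ is Bm + Am. -/
theorem apply_volterra (hμ : 0 ≤ μ.re) (he : A e = 0) (hA : ∀ v, A (A v) = μ • A v) (x : ℝ) :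
    A (volterra A μ B e x) = -A (jOp μ B (volterra A μ B e) x) := by
  obtain ⟨M, hM, hb⟩ := hB.volterra_dom (A := A) (e := e) hμ
  have hc := hB.continuous_volterra (A := A) (e := e) hμ
  have i1 := hB.integrable_apply hc hM hb x
  have i2 := hB.integrable_jOp hμ hc hM hb x
  conv_lhs => rw [hB.volterra_eq hμ x]
  rw [map_add, he, zero_add, tOp, map_neg]
  conv_rhs => rw [← hB.tail_jOp hμ hc hM hb x]
  unfold tail
  have i3 : IntegrableOn (fun y => B y (volterra A μ B e y) - A (jOp μ B (volterra A μ B e) y))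
    (Ioi x) := i1.sub (A.integrable_comp i2)
  have i4 : IntegrableOn (fun y => B y (volterra A μ B e y) - μ • jOp μ B (volterra A μ B e) y)
    (Ioi x) := i1.sub (i2.smul μ)
  rw [← A.integral_comp_comm i3, ← A.integral_comp_comm i4]
  simp only [map_sub, hA, map_smul]

/-- The solution of the Volterra equation solves `m' = (A + B) m`. -/
theorem hasDerivAt_volterra' (hμ : 0 ≤ μ.re) (he : A e = 0) (hA : ∀ v, A (A v) = μ • A v)
    (x : ℝ) : HasDerivAt (volterra A μ B e)
      (A (volterra A μ B e x) + B x (volterra A μ B e x)) x := by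
  rw [hB.apply_volterra hμ he hA x, add_comm, ← sub_eq_add_neg]
  exact hB.hasDerivAt_volterra hμ x

theorem tendsto_volterra (hμ : 0 ≤ μ.re) : Tendsto (volterra A μ B e) atTop (𝓝 e) := by
  obtain ⟨M, hM, hb⟩ := hB.volterra_dom (A := A) (e := e) hμ
  have hc := hB.continuous_volterra (A := A) (e := e) hμ
  have h := (tendsto_tail (hB.integrable_step (A := A) hμ hc hM hb)).neg.const_add e
  rw [neg_zero, add_zero] at h
  exact h.congr fun x => (hB.volterra_eq hμ x).symm

end Perturbation

/-! ### Dependence of the Volterra solution on the spectral parameter -/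

section Parameter

variable [CompleteSpace V] {B : ℝ → V →L[ℂ] V} {b : ℝ → ℝ} (hB : Perturbation B b)
  {A : ℂ → V →L[ℂ] V} {μ : ℂ → ℂ} {e : ℂ → V} {K K' : ℝ} {S : Set ℂ}
include hB

/-- Induction on the iterates, first for J and then for T, by dominated convergence with the bound
of `picard_spec` made uniform over S. The iterates converge uniformly on S, so the regularity passes
to the solution; the analytic version below has the same structure. -/
theorem Perturbation.continuousOn_picard (hμ : ∀ z ∈ S, 0 ≤ (μ z).re) (hK : ∀ z ∈ S, ‖A z‖ ≤ K)
    (hK' : ∀ z ∈ S, ‖e z‖ ≤ K') (cA : ContinuousOn A S) (cμ : ContinuousOn μ S)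
    (ce : ContinuousOn e S) (n : ℕ) (x : ℝ) :
    ContinuousOn (fun z => picard (A z) (μ z) B (e z) n x) S := by
  rcases S.eq_empty_or_nonempty with rfl | ⟨z1, hz1⟩
  · exact continuousOn_empty _
  have hK0 : 0 ≤ K := (norm_nonneg _).trans (hK z1 hz1)
  have hK'0 : 0 ≤ K' := (norm_nonneg _).trans (hK' z1 hz1)
  set M : ℝ → ℝ := fun x => 2 * K' * Real.exp (2 * tail (fun x => b x + K * tail b x) x) with hMdef
  have hM : Antitone M := hB.antitone_bound hK0 (by positivity)
  have hb : ∀ n, ∀ z ∈ S, ∀ x, ‖picard (A z) (μ z) B (e z) n x‖ ≤ M x := fun n z hz x =>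
    ((hB.picard_spec (hK z hz) (hμ z hz) n).2 x).trans (by
      have := hK' z hz
      simp only [hMdef]; gcongr)
  have hcx : ∀ n, ∀ z ∈ S, Continuous (picard (A z) (μ z) B (e z) n) := fun n z hz =>
    (hB.picard_spec (hK z hz) (hμ z hz) n).1
  induction n generalizing x with
  | zero => exact continuousOn_const
  | succ n ih =>
    have cj : ∀ x, ContinuousOn (fun z => jOp (μ z) B (picard (A z) (μ z) B (e z) n) x) S := by
      intro x z hz
      refine continuousWithinAt_of_dominated (bound := fun y => b y * M x) ?_ ?_ ?_ ?_
      · filter_upwards [self_mem_nhdsWithin] with w hw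
        exact (hB.integrable_kernel (hμ w hw) (hcx n w hw) hM (hb n w hw) x x).aestronglyMeasurable
      · filter_upwards [self_mem_nhdsWithin] with w hw
        refine (ae_restrict_iff' measurableSet_Ioi).2 (Eventually.of_forall fun y hy => ?_)
        rw [norm_smul]
        refine (mul_le_of_le_one_left (norm_nonneg _)
          (norm_exp_mul_sub_le (hμ w hw) (le_of_lt hy))).trans ?_
        exact (hB.norm_apply_le (hb n w hw) y).trans
          (mul_le_mul_of_nonneg_left (hM (le_of_lt hy)) (hB.weight.nonneg y))
      · exact (hB.weight.integrable x).mul_const _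
      · refine Eventually.of_forall fun y => ?_
        exact ((cμ z hz).mul continuousWithinAt_const).cexp.smul
          ((B y).continuous.continuousAt.comp_continuousWithinAt (ih y z hz))
    refine ce.add (ContinuousOn.neg ?_)
    intro z hz
    refine continuousWithinAt_of_dominated (bound := fun y => (b y + K * tail b y) * M x) ?_ ?_ ?_ ?_
    · filter_upwards [self_mem_nhdsWithin] with w hw
      exact (hB.integrable_step (hμ w hw) (hcx n w hw) hM (hb n w hw) x).aestronglyMeasurable
    · filter_upwards [self_mem_nhdsWithin] with w hw
      refine (ae_restrict_iff' measurableSet_Ioi).2 (Eventually.of_forall fun y hy => ?_)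
      refine le_trans ?_ (mul_le_mul_of_nonneg_left (hM (le_of_lt hy))
        ((hB.weight_add hK0).nonneg y))
      refine (norm_sub_le _ _).trans ?_
      rw [add_mul]
      refine add_le_add (hB.norm_apply_le (hb n w hw) y) (((A w).le_opNorm _).trans ?_)
      rw [mul_assoc]
      exact mul_le_mul (hK w hw) (hB.norm_jOp_le (hμ w hw) hM (hb n w hw) y) (norm_nonneg _) hK0
    · exact ((hB.weight_add hK0).integrable x).mul_const _
    · refine Eventually.of_forall fun y => ?_
      exact ((B y).continuous.continuousAt.comp_continuousWithinAt (ih y z hz)).sub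
        ((cA z hz).clm_apply (cj y z hz))

theorem Perturbation.differentiableOn_picard (hS : IsOpen S) (hμ : ∀ z ∈ S, 0 ≤ (μ z).re)
    (hK : ∀ z ∈ S, ‖A z‖ ≤ K)
    (hK' : ∀ z ∈ S, ‖e z‖ ≤ K') (cA : DifferentiableOn ℂ A S) (cμ : DifferentiableOn ℂ μ S)
    (ce : DifferentiableOn ℂ e S) (n : ℕ) (x : ℝ) :
    DifferentiableOn ℂ (fun z => picard (A z) (μ z) B (e z) n x) S := by
  rcases S.eq_empty_or_nonempty with rfl | ⟨z1, hz1⟩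
  · exact fun z hz => absurd hz (Set.notMem_empty z)
  have hK0 : 0 ≤ K := (norm_nonneg _).trans (hK z1 hz1)
  have hK'0 : 0 ≤ K' := (norm_nonneg _).trans (hK' z1 hz1)
  set M : ℝ → ℝ := fun x => 2 * K' * Real.exp (2 * tail (fun x => b x + K * tail b x) x) with hMdef
  have hM : Antitone M := hB.antitone_bound hK0 (by positivity)
  have hb : ∀ n, ∀ z ∈ S, ∀ x, ‖picard (A z) (μ z) B (e z) n x‖ ≤ M x := fun n z hz x =>
    ((hB.picard_spec (hK z hz) (hμ z hz) n).2 x).trans (by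
      have := hK' z hz
      simp only [hMdef]; gcongr)
  have hcx : ∀ n, ∀ z ∈ S, Continuous (picard (A z) (μ z) B (e z) n) := fun n z hz =>
    (hB.picard_spec (hK z hz) (hμ z hz) n).1
  induction n generalizing x with
  | zero => exact differentiableOn_const _
  | succ n ih =>
    have cj : ∀ x, DifferentiableOn ℂ
        (fun z => jOp (μ z) B (picard (A z) (μ z) B (e z) n) x) S := by
      intro x
      refine differentiableOn_integral_of_dominated hS (g := fun y => b y * M x) ?_ ?_ ?_ ?_
      · intro w hw
        exact (hB.integrable_kernel (hμ w hw) (hcx n w hw) hM (hb n w hw) x x).aestronglyMeasurable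
      · exact (hB.weight.integrable x).mul_const _
      · refine (ae_restrict_iff' measurableSet_Ioi).2 (Eventually.of_forall fun y hy w hw => ?_)
        rw [norm_smul]
        refine (mul_le_of_le_one_left (norm_nonneg _)
          (norm_exp_mul_sub_le (hμ w hw) (le_of_lt hy))).trans ?_
        exact (hB.norm_apply_le (hb n w hw) y).trans
          (mul_le_mul_of_nonneg_left (hM (le_of_lt hy)) (hB.weight.nonneg y))
      · refine Eventually.of_forall fun y => ?_
        exact (cμ.mul (differentiableOn_const _)).cexp.smul
          ((B y).differentiable.comp_differentiableOn (ih y))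
    refine ce.add (DifferentiableOn.neg ?_)
    refine differentiableOn_integral_of_dominated hS
      (g := fun y => (b y + K * tail b y) * M x) ?_ ?_ ?_ ?_
    · intro w hw
      exact (hB.integrable_step (hμ w hw) (hcx n w hw) hM (hb n w hw) x).aestronglyMeasurable
    · exact ((hB.weight_add hK0).integrable x).mul_const _
    · refine (ae_restrict_iff' measurableSet_Ioi).2 (Eventually.of_forall fun y hy w hw => ?_)
      refine le_trans ?_ (mul_le_mul_of_nonneg_left (hM (le_of_lt hy))
        ((hB.weight_add hK0).nonneg y))
      refine (norm_sub_le _ _).trans ?_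
      rw [add_mul]
      refine add_le_add (hB.norm_apply_le (hb n w hw) y) (((A w).le_opNorm _).trans ?_)
      rw [mul_assoc]
      exact mul_le_mul (hK w hw) (hB.norm_jOp_le (hμ w hw) hM (hb n w hw) y) (norm_nonneg _) hK0
    · refine Eventually.of_forall fun y => ?_
      exact ((B y).differentiable.comp_differentiableOn (ih y)).sub (cA.clm_apply (cj y))

theorem Perturbation.tendstoUniformlyOn_picard (hμ : ∀ z ∈ S, 0 ≤ (μ z).re)
    (hK : ∀ z ∈ S, ‖A z‖ ≤ K) (hK' : ∀ z ∈ S, ‖e z‖ ≤ K') (x : ℝ) :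
    TendstoUniformlyOn (fun n z => picard (A z) (μ z) B (e z) n x)
      (fun z => volterra (A z) (μ z) B (e z) x) atTop S := by
  rw [Metric.tendstoUniformlyOn_iff]
  intro ε hε
  have ht : Tendsto (fun n : ℕ => 2 * K' * (1 / 2) ^ n *
      Real.exp (2 * tail (fun x => b x + K * tail b x) x)) atTop (𝓝 0) := by
    have := ((tendsto_pow_atTop_nhds_zero_of_lt_one (r := (1 / 2 : ℝ)) (by norm_num)
      (by norm_num)).const_mul (2 * K')).mul_const
      (Real.exp (2 * tail (fun x => b x + K * tail b x) x))
    simpa using this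
  filter_upwards [ht.eventually_lt_const hε] with n hn z hz
  rw [dist_eq_norm]
  refine ((hB.norm_picard_sub_le (hK z hz) (hμ z hz) n x).trans ?_).trans_lt hn
  have := hK' z hz
  gcongr

theorem Perturbation.continuousOn_volterra (hμ : ∀ z ∈ S, 0 ≤ (μ z).re) (hK : ∀ z ∈ S, ‖A z‖ ≤ K)
    (hK' : ∀ z ∈ S, ‖e z‖ ≤ K') (cA : ContinuousOn A S) (cμ : ContinuousOn μ S)
    (ce : ContinuousOn e S) (x : ℝ) :
    ContinuousOn (fun z => volterra (A z) (μ z) B (e z) x) S :=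
  (hB.tendstoUniformlyOn_picard hμ hK hK' x).continuousOn (Eventually.of_forall fun n =>
    hB.continuousOn_picard hμ hK hK' cA cμ ce n x).frequently

theorem Perturbation.differentiableOn_volterra (hS : IsOpen S) (hμ : ∀ z ∈ S, 0 ≤ (μ z).re)
    (hK : ∀ z ∈ S, ‖A z‖ ≤ K)
    (hK' : ∀ z ∈ S, ‖e z‖ ≤ K') (cA : DifferentiableOn ℂ A S) (cμ : DifferentiableOn ℂ μ S)
    (ce : DifferentiableOn ℂ e S) (x : ℝ) :
    DifferentiableOn ℂ (fun z => volterra (A z) (μ z) B (e z) x) S :=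
  (hB.tendstoUniformlyOn_picard hμ hK hK' x).tendstoLocallyUniformlyOn.differentiableOn
    (Eventually.of_forall fun n => hB.differentiableOn_picard hS hμ hK hK' cA cμ ce n x) hS

end Parameter

end Volterra

/-! ### Solutions of the spectral problem -/

/-- `ψ_x = X ψ` on the line. -/
def IsSol (q0 : ℝ) (q : ℝ → ℂ) (z : ℂ) (ψ : ℝ → (Fin 2 → ℂ)) : Prop :=
  ∀ x : ℝ, HasDerivAt ψ ((laxX q0 (q x) z).mulVec (ψ x)) x

theorem isSol_iff {q0 : ℝ} {q : ℝ → ℂ} {z : ℂ} {ψ : ℝ → (Fin 2 → ℂ)} :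
    IsSol q0 q z ψ ↔ ∀ x : ℝ,
      HasDerivAt (fun x => ψ x 0) (-(Complex.I * kOf q0 z) * ψ x 0 + q x * ψ x 1) x ∧
      HasDerivAt (fun x => ψ x 1) (-(conj (q x)) * ψ x 0 + Complex.I * kOf q0 z * ψ x 1) x := by
  refine forall_congr' fun x => ?_
  rw [hasDerivAt_pi, Fin.forall_fin_two]
  simp [laxX, Matrix.mulVec, dotProduct, Fin.sum_univ_two]

theorem isJostColumn_iff {q0 : ℝ} {q : ℝ → ℂ} {t : ℝ} {c : ℂ} {l : Filter ℝ} {j : Fin 2} {z : ℂ}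
    {ψ : ℝ → (Fin 2 → ℂ)} :
    IsJostColumn q0 q t c l j z ψ ↔ IsSol q0 q z ψ ∧
      Tendsto (fun x => Complex.exp (Complex.I * sgn3 j * phase q0 x t z) * ψ x 0) l
        (𝓝 (asympCol c z j 0)) ∧
      Tendsto (fun x => Complex.exp (Complex.I * sgn3 j * phase q0 x t z) * ψ x 1) l
        (𝓝 (asympCol c z j 1)) := by
  unfold IsJostColumn IsSol
  rw [tendsto_pi_nhds, Fin.forall_fin_two]
  simp only [Pi.smul_apply, smul_eq_mul]

theorem hasDerivAt_conj {f : ℝ → ℂ} {f' : ℂ} {x : ℝ} (h : HasDerivAt f f' x) :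
    HasDerivAt (fun x => conj (f x)) (conj f') x :=
  h.star

theorem tendsto_conj {α : Type*} {l : Filter α} {f : α → ℂ} {a : ℂ} (h : Tendsto f l (𝓝 a)) :
    Tendsto (fun x => conj (f x)) l (𝓝 (conj a)) :=
  (Complex.continuous_conj.tendsto a).comp h

theorem tendsto_nhds_of_eq {α : Type*} {l : Filter α} {f : α → ℂ} {a b : ℂ}
    (h : Tendsto f l (𝓝 a)) (e : a = b) : Tendsto f l (𝓝 b) := e ▸ h

theorem norm_op_le {v : ℂ} {k : ℂ} (C : ℝ) (h : ‖v‖ ≤ C) (x : Fin 2 → ℂ) :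
    ‖(!![-k, v; -(conj v), k] : Matrix (Fin 2) (Fin 2) ℂ).mulVec x‖ ≤ (‖k‖ + C) * ‖x‖ := by
  have hC : 0 ≤ C := (norm_nonneg _).trans h
  have h0 := norm_le_pi_norm x 0
  have h1 := norm_le_pi_norm x 1
  refine (pi_norm_le_iff_of_nonneg (by positivity)).2 fun i => ?_
  fin_cases i
  · simp only [Matrix.mulVec, dotProduct, Fin.sum_univ_two]
    refine (norm_add_le _ _).trans ?_
    simp
    rw [add_mul]; gcongr
  · simp only [Matrix.mulVec, dotProduct, Fin.sum_univ_two]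
    refine (norm_add_le _ _).trans ?_
    simp
    rw [add_mul, add_comm]; gcongr

/-- Solutions are determined by their value at `0`. -/
theorem IsSol.eq_of_eq {q0 : ℝ} {q : ℝ → ℂ} {z : ℂ} {ψ φ : ℝ → (Fin 2 → ℂ)} {C : ℝ}
    (hq : ∀ x, ‖q x‖ ≤ C) (h : IsSol q0 q z ψ) (h' : IsSol q0 q z φ) (h0 : ψ 0 = φ 0) : ψ = φ := by
  refine ODE_solution_unique_univ (v := fun x y => (laxX q0 (q x) z).mulVec y)
    (s := fun _ => univ) (K := (‖Complex.I * kOf q0 z‖ + C).toNNReal) (fun x => ?_)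
    (fun x => ⟨h x, trivial⟩) (fun x => ⟨h' x, trivial⟩) h0
  refine LipschitzOnWith.of_dist_le_mul fun y _ y' _ => ?_
  have hC : 0 ≤ C := (norm_nonneg _).trans (hq x)
  rw [dist_eq_norm, dist_eq_norm, ← Matrix.mulVec_sub, Real.coe_toNNReal _ (by positivity)]
  exact norm_op_le C (hq x) _

theorem isSol_zero {q0 : ℝ} {q : ℝ → ℂ} {z : ℂ} : IsSol q0 q z 0 := fun x => by
  simpa using hasDerivAt_const x (0 : Fin 2 → ℂ)

theorem IsSol.smul {q0 : ℝ} {q : ℝ → ℂ} {z : ℂ} {ψ : ℝ → (Fin 2 → ℂ)} (h : IsSol q0 q z ψ) (r : ℂ) :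
    IsSol q0 q z fun x => r • ψ x := fun x => by
  rw [Matrix.mulVec_smul]
  exact (h x).const_smul r

/-- The matrix `laxX` has trace zero. -/
theorem IsSol.wr_eq {q0 : ℝ} {q : ℝ → ℂ} {z : ℂ} {ψ φ : ℝ → (Fin 2 → ℂ)}
    (h : IsSol q0 q z ψ) (h' : IsSol q0 q z φ) (x : ℝ) : wr (ψ x) (φ x) = wr (ψ 0) (φ 0) := by
  have hd : ∀ x, HasDerivAt (fun x => wr (ψ x) (φ x)) 0 x := fun x => by
    obtain ⟨a, b⟩ := isSol_iff.1 h x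
    obtain ⟨a', b'⟩ := isSol_iff.1 h' x
    exact ((a.mul b').sub (b.mul a')).congr_deriv (by ring)
  exact is_const_of_deriv_eq_zero (fun x => (hd x).differentiableAt) (fun x => (hd x).deriv) x 0

theorem wr_smul_smul (a b : ℂ) (f g : Fin 2 → ℂ) : wr (a • f) (b • g) = a * b * wr f g := by
  simp [wr]; ring

theorem tendsto_wr {α : Type*} {l : Filter α} {f g : α → Fin 2 → ℂ} {a b : Fin 2 → ℂ}
    (hf : Tendsto f l (𝓝 a)) (hg : Tendsto g l (𝓝 b)) :
    Tendsto (fun x => wr (f x) (g x)) l (𝓝 (wr a b)) := by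
  rw [tendsto_pi_nhds] at hf hg
  exact ((hf 0).mul (hg 1)).sub ((hf 1).mul (hg 0))

theorem asympCol_ne_zero (c z : ℂ) (j : Fin 2) : asympCol c z j ≠ 0 := by
  intro h
  fin_cases j
  · simpa [asympCol] using congrFun h 0
  · simpa [asympCol] using congrFun h 1

theorem exists_smul_of_wr_eq_zero {f g : Fin 2 → ℂ} (hf : f ≠ 0) (h : wr f g = 0) :
    ∃ r : ℂ, g = r • f := by
  unfold wr at h
  by_cases h0 : f 0 = 0
  · have h1 : f 1 ≠ 0 := fun h1 => hf (funext fun i => by fin_cases i <;> assumption)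
    refine ⟨g 1 / f 1, funext fun i => ?_⟩
    fin_cases i
    · have : g 0 = 0 := by simpa [h0, h1] using h
      simp [this, h0]
    · simp [h1]
  · refine ⟨g 0 / f 0, funext fun i => ?_⟩
    fin_cases i
    · simp [h0]
    · simp only [Fin.mk_one, Pi.smul_apply, smul_eq_mul]
      field_simp
      linear_combination h

theorem phase_eq (q0 x t : ℝ) (z : ℂ) :
    phase q0 x t z = lamOf q0 z * x + lamOf q0 z * kOf q0 z * t := by
  unfold phase; ring

/-- The Jost column is unique where its normalization does not grow. -/
theorem IsJostColumn.unique {q0 : ℝ} {q : ℝ → ℂ} {t : ℝ} {c : ℂ} {l : Filter ℝ} [l.NeBot]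
    {j : Fin 2} {z : ℂ} {ψ φ : ℝ → (Fin 2 → ℂ)} {C : ℝ} (hq : ∀ x, ‖q x‖ ≤ C)
    (hl : ∀ᶠ x : ℝ in l, ‖Complex.exp (-(2 * Complex.I * sgn3 j * lamOf q0 z * x))‖ ≤ 1)
    (h : IsJostColumn q0 q t c l j z ψ) (h' : IsJostColumn q0 q t c l j z φ) : ψ = φ := by
  have hs : IsSol q0 q z ψ := h.1
  have hs' : IsSol q0 q z φ := h'.1
  have hw : wr (ψ 0) (φ 0) = 0 := by
    have h1 := tendsto_wr h.2 h'.2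
    have h2 : wr (asympCol c z j) (asympCol c z j) = 0 := by unfold wr; ring
    rw [h2] at h1
    have h3 := h1.norm.const_mul
      ‖Complex.exp (-(2 * Complex.I * sgn3 j * lamOf q0 z * kOf q0 z * t))‖
    rw [norm_zero, mul_zero] at h3
    have h4 : ‖wr (ψ 0) (φ 0)‖ ≤ 0 := by
      refine ge_of_tendsto h3 ?_
      filter_upwards [hl] with x hx
      rw [wr_smul_smul, hs.wr_eq hs' x]
      -- The Wronskian does not depend on x, while the normalized one tends to 0. The product of the
      -- two normalizing exponentials is undone by a factor constant in x and one that `hl` bounds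
      -- by 1.
      have e : wr (ψ 0) (φ 0) = Complex.exp (-(2 * Complex.I * sgn3 j * lamOf q0 z * x)) *
          (Complex.exp (-(2 * Complex.I * sgn3 j * lamOf q0 z * kOf q0 z * t)) *
          (Complex.exp (Complex.I * sgn3 j * phase q0 x t z) *
            Complex.exp (Complex.I * sgn3 j * phase q0 x t z) * wr (ψ 0) (φ 0))) := by
        rw [← mul_assoc, ← mul_assoc, ← Complex.exp_add, ← Complex.exp_add, ← Complex.exp_add,
          phase_eq]
        ring_nf
        simp
      conv_lhs => rw [e, norm_mul, norm_mul]
      refine mul_le_of_le_one_left ?_ hx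
      positivity
    exact norm_le_zero_iff.1 h4
  -- A solution that vanishes at 0 vanishes identically, which contradicts its normalization.
  have hne : ψ 0 ≠ 0 := by
    intro h0
    have := IsSol.eq_of_eq hq hs isSol_zero h0
    have h2 := h.2
    rw [this] at h2
    simp only [Pi.zero_apply, smul_zero] at h2
    exact asympCol_ne_zero c z j (tendsto_nhds_unique h2 tendsto_const_nhds)
  obtain ⟨r, hr⟩ := exists_smul_of_wr_eq_zero hne hw
  have e : φ = fun x => r • ψ x := IsSol.eq_of_eq hq hs' (hs.smul r) hr
  have h2 := h'.2
  rw [e] at h2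
  have h3 := tendsto_nhds_unique h2 ((h.2.const_smul r).congr fun x => smul_comm _ _ _)
  have hr1 : r = 1 := by
    by_contra hne1
    have : (1 - r) • asympCol c z j = 0 := by rw [sub_smul, one_smul, ← h3, sub_self]
    rcases smul_eq_zero.1 this with h | h
    · exact hne1 (sub_eq_zero.1 h).symm
    · exact asympCol_ne_zero c z j h
  rw [e, hr1]; simp

theorem IsJostColumn.jost {q0 : ℝ} {q : ℝ → ℂ} {t : ℝ} {c : ℂ} {l : Filter ℝ}
    {j : Fin 2} {z : ℂ} {ψ : ℝ → (Fin 2 → ℂ)} (h : IsJostColumn q0 q t c l j z ψ) :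
    IsJostColumn q0 q t c l j z (jost q0 q t c l j z) := by
  have h' : ∃ ψ, IsJostColumn q0 q t c l j z ψ := ⟨ψ, h⟩
  rw [KE.jost, dif_pos h']
  exact h'.choose_spec

/-! ### Symmetries -/

theorem kOf_conj (q0 : ℝ) (z : ℂ) : kOf q0 (conj z) = conj (kOf q0 z) := by simp [kOf, map_ofNat]

theorem lamOf_conj (q0 : ℝ) (z : ℂ) : lamOf q0 (conj z) = conj (lamOf q0 z) := by simp [lamOf, map_ofNat]

theorem phase_conj (q0 x t : ℝ) (z : ℂ) : phase q0 x t (conj z) = conj (phase q0 x t z) := by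
  simp [phase, kOf_conj, lamOf_conj]

/-- The point `-q₀² / z^*`. -/
noncomputable def inv (q0 : ℝ) (z : ℂ) : ℂ := -((q0 : ℂ) ^ 2 / conj z)

theorem kOf_inv {q0 : ℝ} (h0 : q0 ≠ 0) {z : ℂ} (hz : z ≠ 0) :
    kOf q0 (inv q0 z) = conj (kOf q0 z) := by
  have h0' : (q0 : ℂ) ≠ 0 := by exact_mod_cast h0
  have hz' : conj z ≠ 0 := by simpa using hz
  simp only [kOf, inv, map_div₀, map_sub, map_pow, Complex.conj_ofReal, map_ofNat]
  field_simp; ring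

theorem lamOf_inv {q0 : ℝ} (h0 : q0 ≠ 0) {z : ℂ} (hz : z ≠ 0) :
    lamOf q0 (inv q0 z) = -conj (lamOf q0 z) := by
  have h0' : (q0 : ℂ) ≠ 0 := by exact_mod_cast h0
  have hz' : conj z ≠ 0 := by simpa using hz
  simp only [lamOf, inv, map_div₀, map_add, map_pow, Complex.conj_ofReal, map_ofNat]
  field_simp; ring

theorem phase_inv {q0 : ℝ} (h0 : q0 ≠ 0) (x t : ℝ) {z : ℂ} (hz : z ≠ 0) :
    phase q0 x t (inv q0 z) = -conj (phase q0 x t z) := by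
  simp [phase, kOf_inv h0 hz, lamOf_inv h0 hz]

/-- `σ v^*` with `σ = ((0, 1), (-1, 0))`. -/
noncomputable def sig (v : Fin 2 → ℂ) : Fin 2 → ℂ := ![conj (v 1), -conj (v 0)]

/-- Exchange of the two components. -/
def swap (v : Fin 2 → ℂ) : Fin 2 → ℂ := ![v 1, v 0]

theorem wr_sig (f g : Fin 2 → ℂ) : wr (sig f) (sig g) = conj (wr f g) := by
  simp only [wr, sig, Matrix.cons_val_zero, Matrix.cons_val_one, map_sub, map_mul]
  ring

theorem wr_swap (f g : Fin 2 → ℂ) : wr (swap f) (swap g) = -wr f g := by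
  simp [wr, swap]

/-- Only k enters the equation. Both z ↦ conj z and z ↦ -q₀²/z* conjugate k, so this one computation
serves both symmetries. -/
theorem IsSol.sig {q0 : ℝ} {q : ℝ → ℂ} {z z' : ℂ} {ψ : ℝ → (Fin 2 → ℂ)} (h : IsSol q0 q z ψ)
    (hk : kOf q0 z' = conj (kOf q0 z)) : IsSol q0 q z' fun x => sig (ψ x) := by
  refine isSol_iff.2 fun x => ?_
  obtain ⟨a, b⟩ := isSol_iff.1 h x
  refine ⟨(hasDerivAt_conj b).congr_deriv ?_, (hasDerivAt_conj a).neg.congr_deriv ?_⟩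
  · simp [KE.sig, hk]; ring
  · simp [KE.sig, hk]

/-- The reflected potential `q(-x)^*`. -/
noncomputable def refl (q : ℝ → ℂ) (x : ℝ) : ℂ := conj (q (-x))

theorem IsSol.swap {q0 : ℝ} {q : ℝ → ℂ} {z : ℂ} {ψ : ℝ → (Fin 2 → ℂ)}
    (h : IsSol q0 (refl q) z ψ) : IsSol q0 q z fun x => swap (ψ (-x)) := by
  refine isSol_iff.2 fun x => ?_
  obtain ⟨a, b⟩ := isSol_iff.1 h (-x)
  have a' := a.scomp x (hasDerivAt_neg x)
  have b' := b.scomp x (hasDerivAt_neg x)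
  refine ⟨b'.congr_deriv ?_, a'.congr_deriv ?_⟩
  · simp [KE.swap, refl]; ring
  · simp [KE.swap, refl]; ring

theorem sgn3_zero : sgn3 0 = 1 := rfl
theorem sgn3_one : sgn3 1 = -1 := rfl

/-- Reflection of the line carries the first column at +∞ for the reflected potential and reversed
time to the second column at -∞. The analysis at -∞ is thereby reduced to that at +∞. -/
theorem IsJostColumn.swap {q0 : ℝ} {q : ℝ → ℂ} {t : ℝ} {c : ℂ} {z : ℂ} {ψ : ℝ → (Fin 2 → ℂ)}
    (h : IsJostColumn q0 (refl q) (-t) (conj c) atTop 0 z ψ) :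
    IsJostColumn q0 q t c atBot 1 z fun x => KE.swap (ψ (-x)) := by
  rw [isJostColumn_iff] at h ⊢
  obtain ⟨hs, h1, h2⟩ := h
  refine ⟨hs.swap, ?_, ?_⟩
  · have := h2.comp tendsto_neg_atBot_atTop
    refine Tendsto.congr (fun x => ?_) (by simpa [asympCol] using this)
    simp only [Function.comp, sgn3_zero, sgn3_one, phase_eq, KE.swap]
    push_cast
    congr 2; ring
  · have := h1.comp tendsto_neg_atBot_atTop
    refine Tendsto.congr (fun x => ?_) (by simpa [asympCol] using this)
    simp only [Function.comp, sgn3_zero, sgn3_one, phase_eq, KE.swap]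
    push_cast
    congr 2; ring

/-- θ(conj z) = conj θ(z), and conjugating e^{iθ} changes the sign in the exponent; this exchanges
the two columns. -/
theorem IsJostColumn.conj_zero {q0 : ℝ} {q : ℝ → ℂ} {t : ℝ} {c : ℂ} {l : Filter ℝ} {z : ℂ}
    {ψ : ℝ → (Fin 2 → ℂ)} (h : IsJostColumn q0 q t c l 0 (conj z) ψ) :
    IsJostColumn q0 q t c l 1 z fun x => (-1 : ℂ) • KE.sig (ψ x) := by
  rw [isJostColumn_iff] at h ⊢
  obtain ⟨hs, h1, h2⟩ := h
  refine ⟨(hs.sig (by rw [kOf_conj, Complex.conj_conj])).smul _, ?_, ?_⟩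
  · have := (tendsto_conj h2).neg
    refine Tendsto.congr (fun x => ?_) (tendsto_nhds_of_eq this ?_)
    · simp [sgn3_zero, sgn3_one, KE.sig, phase_conj, ← Complex.exp_conj]
    · simp [asympCol, neg_div]
  · have := tendsto_conj h1
    refine Tendsto.congr (fun x => ?_) (tendsto_nhds_of_eq this ?_)
    · simp [sgn3_zero, sgn3_one, KE.sig, phase_conj, ← Complex.exp_conj]
    · simp [asympCol, neg_div]

theorem IsJostColumn.conj_one {q0 : ℝ} {q : ℝ → ℂ} {t : ℝ} {c : ℂ} {l : Filter ℝ} {z : ℂ}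
    {ψ : ℝ → (Fin 2 → ℂ)} (h : IsJostColumn q0 q t c l 1 (conj z) ψ) :
    IsJostColumn q0 q t c l 0 z fun x => KE.sig (ψ x) := by
  rw [isJostColumn_iff] at h ⊢
  obtain ⟨hs, h1, h2⟩ := h
  refine ⟨hs.sig (by rw [kOf_conj, Complex.conj_conj]), ?_, ?_⟩
  · have := tendsto_conj h2
    refine Tendsto.congr (fun x => ?_) (tendsto_nhds_of_eq this ?_)
    · simp [sgn3_zero, sgn3_one, KE.sig, phase_conj, ← Complex.exp_conj]
    · simp [asympCol]
  · have := (tendsto_conj h1).neg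
    refine Tendsto.congr (fun x => ?_) (tendsto_nhds_of_eq this ?_)
    · simp [sgn3_zero, sgn3_one, KE.sig, phase_conj, ← Complex.exp_conj]
    · simp [asympCol, neg_div]

theorem mul_conj_eq {q0 : ℝ} {c : ℂ} (hc : ‖c‖ = q0) : c * conj c = (q0 : ℂ) ^ 2 := by
  rw [Complex.mul_conj, Complex.normSq_eq_norm_sq, hc]; push_cast; rfl

/-- At -q₀²/z* the phase is -conj θ, so the two sign changes cancel and the column index is
preserved. The scalar factor restores the normalization, by c conj c = q₀². -/
theorem IsJostColumn.inv_zero {q0 : ℝ} {q : ℝ → ℂ} {t : ℝ} {c : ℂ} {l : Filter ℝ} {z : ℂ}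
    {ψ : ℝ → (Fin 2 → ℂ)} (h0 : q0 ≠ 0) (hc : ‖c‖ = q0) (hz : z ≠ 0)
    (h : IsJostColumn q0 q t c l 0 z ψ) :
    IsJostColumn q0 q t c l 0 (inv q0 z) fun x => (conj z / (Complex.I * c)) • KE.sig (ψ x) := by
  have h0' : (q0 : ℂ) ≠ 0 := by exact_mod_cast h0
  have hz' : conj z ≠ 0 := by simpa using hz
  have hc' : c ≠ 0 := fun h => h0 (by rw [← hc, h, norm_zero])
  have hcc := mul_conj_eq hc
  rw [isJostColumn_iff] at h ⊢
  obtain ⟨hs, h1, h2⟩ := h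
  refine ⟨(hs.sig (kOf_inv h0 hz)).smul _, ?_, ?_⟩
  · have := (tendsto_conj h2).const_mul (conj z / (Complex.I * c))
    have e : conj z / (Complex.I * c) * conj (asympCol c z 0 1) = asympCol c (inv q0 z) 0 0 := by
      simp only [asympCol, Matrix.cons_val_zero, Matrix.cons_val_one, map_neg, map_div₀, map_mul,
        Complex.conj_I, Complex.conj_conj]
      field_simp
    rw [e] at this
    refine Tendsto.congr (fun x => ?_) this
    simp [sgn3_zero, KE.sig, phase_inv h0 _ _ hz, ← Complex.exp_conj]
    ring
  · have := ((tendsto_conj h1).neg).const_mul (conj z / (Complex.I * c))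
    have e : conj z / (Complex.I * c) * -conj (asympCol c z 0 0) = asympCol c (inv q0 z) 0 1 := by
      simp only [asympCol, Matrix.cons_val_zero, Matrix.cons_val_one, map_one, inv]
      field_simp
      rw [Complex.I_sq, ← hcc]; ring
    rw [e] at this
    refine Tendsto.congr (fun x => ?_) this
    simp [sgn3_zero, KE.sig, phase_inv h0 _ _ hz, ← Complex.exp_conj]
    ring

theorem IsJostColumn.inv_one {q0 : ℝ} {q : ℝ → ℂ} {t : ℝ} {c : ℂ} {l : Filter ℝ} {z : ℂ}
    {ψ : ℝ → (Fin 2 → ℂ)} (h0 : q0 ≠ 0) (hc : ‖c‖ = q0) (hz : z ≠ 0)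
    (h : IsJostColumn q0 q t c l 1 z ψ) :
    IsJostColumn q0 q t c l 1 (inv q0 z)
      fun x => (Complex.I * conj z / conj c) • KE.sig (ψ x) := by
  have h0' : (q0 : ℂ) ≠ 0 := by exact_mod_cast h0
  have hz' : conj z ≠ 0 := by simpa using hz
  have hc' : c ≠ 0 := fun h => h0 (by rw [← hc, h, norm_zero])
  have hc'' : conj c ≠ 0 := by simpa using hc'
  have hcc := mul_conj_eq hc
  rw [isJostColumn_iff] at h ⊢
  obtain ⟨hs, h1, h2⟩ := h
  refine ⟨(hs.sig (kOf_inv h0 hz)).smul _, ?_, ?_⟩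
  · have := (tendsto_conj h2).const_mul (Complex.I * conj z / conj c)
    have e : Complex.I * conj z / conj c * conj (asympCol c z 1 1) = asympCol c (inv q0 z) 1 0 := by
      simp only [asympCol, Matrix.cons_val_zero, Matrix.cons_val_one, map_one, inv]
      field_simp
      rw [← hcc]; ring
    rw [e] at this
    refine Tendsto.congr (fun x => ?_) this
    simp [sgn3_one, KE.sig, phase_inv h0 _ _ hz, ← Complex.exp_conj]
    ring
  · have := ((tendsto_conj h1).neg).const_mul (Complex.I * conj z / conj c)
    have e : Complex.I * conj z / conj c * -conj (asympCol c z 1 0) = asympCol c (inv q0 z) 1 1 := by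
      simp only [asympCol, Matrix.cons_val_zero, Matrix.cons_val_one, map_neg, map_div₀, map_mul,
        Complex.conj_I]
      field_simp
      rw [Complex.I_sq]; ring
    rw [e] at this
    refine Tendsto.congr (fun x => ?_) this
    simp [sgn3_one, KE.sig, phase_inv h0 _ _ hz, ← Complex.exp_conj]
    ring

/-! ### Jost columns from the Volterra equation -/

/-- The elementary operator `e_i ⊗ e_j` on `ℂ²`. -/
noncomputable def unitOp (i j : Fin 2) : (Fin 2 → ℂ) →L[ℂ] (Fin 2 → ℂ) :=
  (ContinuousLinearMap.single ℂ (fun _ => ℂ) i).comp (ContinuousLinearMap.proj j)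

/-- The operator with matrix `((a, b), (c, d))`. -/
noncomputable def op2 (a b c d : ℂ) : (Fin 2 → ℂ) →L[ℂ] (Fin 2 → ℂ) :=
  a • unitOp 0 0 + b • unitOp 0 1 + c • unitOp 1 0 + d • unitOp 1 1

theorem op2_zero (a b c d : ℂ) (v : Fin 2 → ℂ) : op2 a b c d v 0 = a * v 0 + b * v 1 := by
  simp [op2, unitOp]

theorem op2_one (a b c d : ℂ) (v : Fin 2 → ℂ) : op2 a b c d v 1 = c * v 0 + d * v 1 := by
  simp [op2, unitOp]

theorem norm_unitOp_le (i j : Fin 2) : ‖unitOp i j‖ ≤ 1 := by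
  refine ContinuousLinearMap.opNorm_le_bound _ zero_le_one fun v => ?_
  rw [one_mul]
  refine (pi_norm_le_iff_of_nonneg (norm_nonneg _)).2 fun k => ?_
  have h := norm_le_pi_norm v j
  simp only [unitOp, ContinuousLinearMap.comp_apply, ContinuousLinearMap.proj_apply,
    ContinuousLinearMap.single_apply]
  by_cases hk : k = i
  · subst hk; simpa using h
  · simp [hk]

theorem norm_op2_le (a b c d : ℂ) : ‖op2 a b c d‖ ≤ ‖a‖ + ‖b‖ + ‖c‖ + ‖d‖ := by
  have key : ∀ (a : ℂ) i j, ‖a • unitOp i j‖ ≤ ‖a‖ := fun a i j => by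
    rw [norm_smul]
    exact mul_le_of_le_one_right (norm_nonneg _) (norm_unitOp_le i j)
  refine (norm_add_le _ _).trans (add_le_add ((norm_add_le _ _).trans (add_le_add
    ((norm_add_le _ _).trans (add_le_add ?_ ?_)) ?_)) ?_) <;> exact key _ _ _

/-- Potentials that approach the value `c` of modulus `q₀` at `+∞`. -/
structure HalfPotential (q0 : ℝ) (c : ℂ) (q : ℝ → ℂ) : Prop where
  pos : 0 < q0
  norm_eq : ‖c‖ = q0
  contDiff : ContDiff ℝ 1 q
  tendsto : Tendsto q atTop (𝓝 c)
  bounded : ∃ C, ∀ x, ‖q x‖ ≤ C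
  integrable_deriv : IntegrableOn (deriv q) (Ioi 0)
  integrable : IntegrableOn (fun x : ℝ => (1 + |x|) * ‖q x - c‖) (Ioi 0)

theorem IsPotential.bounded {q0 : ℝ} {qm qp : ℂ} {q : ℝ → ℂ} (h : IsPotential q0 qm qp q) :
    ∃ C, ∀ x, ‖q x‖ ≤ C := by
  obtain ⟨a, ha⟩ := eventually_atBot.1 (h.tendsto_minus.norm.eventually_le_const (lt_add_one _))
  obtain ⟨b, hb⟩ := eventually_atTop.1 (h.tendsto_plus.norm.eventually_le_const (lt_add_one _))
  obtain ⟨C, hC⟩ := (isCompact_Icc (a := a) (b := b)).exists_bound_of_continuousOn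
    h.contDiff.continuous.continuousOn
  refine ⟨max C (max (‖qm‖ + 1) (‖qp‖ + 1)), fun x => ?_⟩
  rcases le_total x a with hx | hx
  · exact (ha x hx).trans ((le_max_left _ _).trans (le_max_right _ _))
  rcases le_total b x with hx' | hx'
  · exact (hb x hx').trans ((le_max_right _ _).trans (le_max_right _ _))
  · exact (hC x ⟨hx, hx'⟩).trans (le_max_left _ _)

theorem IsPotential.right {q0 : ℝ} {qm qp : ℂ} {q : ℝ → ℂ} (h : IsPotential q0 qm qp q) :
    HalfPotential q0 qp q where
  pos := h.pos
  norm_eq := h.norm_plus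
  contDiff := h.contDiff
  tendsto := h.tendsto_plus
  bounded := h.bounded
  integrable_deriv := h.integrable_deriv.integrableOn
  integrable := h.integrable_plus.mono_set Ioi_subset_Ici_self

theorem deriv_refl {q : ℝ → ℂ} (h : ContDiff ℝ 1 q) :
    deriv (refl q) = fun x => -conj (deriv q (-x)) := by
  funext x
  have h1 := ((h.differentiable one_ne_zero) (-x)).hasDerivAt.scomp x (hasDerivAt_neg x)
  have h2 := hasDerivAt_conj h1
  have h3 : HasDerivAt (refl q) (conj ((-1 : ℝ) • deriv q (-x))) x := h2
  simpa using h3.deriv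

/-- With this, every estimate at +∞ also serves the columns normalized at -∞. -/
theorem IsPotential.left {q0 : ℝ} {qm qp : ℂ} {q : ℝ → ℂ} (h : IsPotential q0 qm qp q) :
    HalfPotential q0 (conj qm) (refl q) where
  pos := h.pos
  norm_eq := by rw [RCLike.norm_conj, h.norm_minus]
  contDiff := Complex.conjCLE.contDiff.comp (h.contDiff.comp contDiff_neg)
  tendsto := tendsto_conj (h.tendsto_minus.comp tendsto_neg_atTop_atBot)
  bounded := by
    obtain ⟨C, hC⟩ := h.bounded
    exact ⟨C, fun x => by rw [refl, RCLike.norm_conj]; exact hC _⟩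
  integrable_deriv := by
    rw [deriv_refl h.contDiff]
    have h1 : Integrable fun x => deriv q (-x) := h.integrable_deriv.comp_neg
    exact ((Complex.conjCLE.toContinuousLinearMap.integrable_comp h1).neg).integrableOn
  integrable := by
    have h1 := h.integrable_minus
    rw [← neg_zero, ← integrableOn_Ici_iff_integrableOn_Ioi]
    have h2 := (integrable_indicator_iff measurableSet_Iic).2 h1
    have h3 := h2.comp_neg
    refine (integrable_indicator_iff measurableSet_Ici).1 (h3.congr (Eventually.of_forall fun x => ?_))
    by_cases hx : 0 ≤ x
    · have : (-x) ∈ Iic (0 : ℝ) := by simpa using hx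
      have h' : x ∈ Ici (-0 : ℝ) := by simpa using hx
      simp only [indicator_of_mem this, indicator_of_mem h', refl, abs_neg]
      rw [← map_sub, RCLike.norm_conj]
    · have : (-x) ∉ Iic (0 : ℝ) := by simpa using hx
      have h' : x ∉ Ici (-0 : ℝ) := by simpa using hx
      simp only [indicator_of_notMem this, indicator_of_notMem h']

/-- `Q - Q_+`. -/
noncomputable def bOp (c : ℂ) (q : ℝ → ℂ) (x : ℝ) : (Fin 2 → ℂ) →L[ℂ] (Fin 2 → ℂ) :=
  op2 0 (q x - c) (-conj (q x - c)) 0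

/-- `X_+ + i λ`. -/
noncomputable def aOp (q0 : ℝ) (c z : ℂ) : (Fin 2 → ℂ) →L[ℂ] (Fin 2 → ℂ) :=
  op2 (Complex.I * (q0 : ℂ) ^ 2 / z) c (-conj c) (Complex.I * z)

/-- `μ = 2 i λ`. -/
noncomputable def mu (q0 : ℝ) (z : ℂ) : ℂ := 2 * Complex.I * lamOf q0 z

/-- The Jost column `ψ e^{iλx}` normalized at `+∞`. -/
noncomputable def jm (q0 : ℝ) (c : ℂ) (q : ℝ → ℂ) (z : ℂ) : ℝ → (Fin 2 → ℂ) :=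
  volterra (aOp q0 c z) (mu q0 z) (bOp c q) (asympCol c z 0)

/-- The closed region where `ψ_{+,1}` and `ψ_{-,2}` exist. -/
def lowerSet (q0 : ℝ) : Set ℂ := {z | z ≠ 0 ∧ (lamOf q0 z).im ≤ 0}

theorem HalfPotential.weight {q0 : ℝ} {c : ℂ} {q : ℝ → ℂ} (h : HalfPotential q0 c q) :
    Weight fun x => 2 * ‖q x - c‖ := by
  have hc : Continuous fun x => ‖q x - c‖ := (h.contDiff.continuous.sub continuous_const).norm
  have h0 : IntegrableOn (fun x => ‖q x - c‖) (Ioi 0) := by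
    refine Integrable.mono' h.integrable hc.aestronglyMeasurable (Eventually.of_forall fun x => ?_)
    rw [norm_norm]
    exact le_mul_of_one_le_left (norm_nonneg _) (by linarith [abs_nonneg x])
  refine Weight.const_mul ⟨hc, fun x => norm_nonneg _, fun x => ?_⟩ zero_le_two
  rcases le_or_gt 0 x with hx | hx
  · exact h0.mono_set (Ioi_subset_Ioi hx)
  · rw [← Ioc_union_Ioi_eq_Ioi hx.le]
    exact hc.integrableOn_Ioc.union h0

/-- The first moment of q - c enters in the last field, through the integrability of the tail. -/
theorem HalfPotential.perturbation {q0 : ℝ} {c : ℂ} {q : ℝ → ℂ} (h : HalfPotential q0 c q) :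
    Perturbation (bOp c q) fun x => 2 * ‖q x - c‖ where
  cont := by
    have := h.contDiff.continuous
    have hc : Continuous fun x => conj (q x - c) :=
      Complex.continuous_conj.comp (this.sub continuous_const)
    unfold bOp op2
    fun_prop
  bound x := (norm_op2_le _ _ _ _).trans (by rw [norm_neg, RCLike.norm_conj, norm_zero]; linarith)
  weight := h.weight
  weight_tail := by
    refine KE.weight_tail h.weight ((h.integrable.const_mul 2).congr
      (Eventually.of_forall fun x => ?_))
    simp only; ring

theorem mu_re (q0 : ℝ) (z : ℂ) : (mu q0 z).re = -2 * (lamOf q0 z).im := by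
  simp [mu]

theorem mu_re_nonneg {q0 : ℝ} {z : ℂ} (hz : z ∈ lowerSet q0) : 0 ≤ (mu q0 z).re := by
  rw [mu_re]; linarith [hz.2]

/-- A is singular: its determinant is -q₀² + c conj c = 0, and the normalization column spans its
kernel. -/
theorem aOp_asympCol {q0 : ℝ} {c z : ℂ} (hc : ‖c‖ = q0) (hz : z ≠ 0) :
    aOp q0 c z (asympCol c z 0) = 0 := by
  have := mul_conj_eq hc
  ext i
  fin_cases i
  · simp only [aOp, Fin.zero_eta, op2_zero, asympCol, Matrix.cons_val_zero, Matrix.cons_val_one,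
      Pi.zero_apply]
    field_simp
    rw [← this]; ring
  · simp only [aOp, Fin.mk_one, op2_one, asympCol, Matrix.cons_val_zero, Matrix.cons_val_one,
      Pi.zero_apply]
    field_simp
    rw [Complex.I_sq]; ring

/-- Cayley–Hamilton for a matrix of determinant 0 and trace i(z + q₀²/z) = 2iλ = μ. -/
theorem aOp_aOp {q0 : ℝ} {c z : ℂ} (hc : ‖c‖ = q0) (hz : z ≠ 0) (v : Fin 2 → ℂ) :
    aOp q0 c z (aOp q0 c z v) = mu q0 z • aOp q0 c z v := by
  have := mul_conj_eq hc
  ext i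
  fin_cases i
  · simp only [aOp, Fin.zero_eta, op2_zero, op2_one, mu, lamOf, Pi.smul_apply, smul_eq_mul]
    field_simp
    linear_combination (-(v 0) * z * z) * this - (v 0) * z * z * q0 ^ 2 * Complex.I_sq
  · simp only [aOp, Fin.mk_one, op2_zero, op2_one, mu, lamOf, Pi.smul_apply, smul_eq_mul]
    field_simp
    linear_combination (-(v 1) * z) * this - (v 1) * z * q0 ^ 2 * Complex.I_sq

theorem HalfPotential.hasDerivAt_jm {q0 : ℝ} {c : ℂ} {q : ℝ → ℂ} (h : HalfPotential q0 c q) {z : ℂ}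
    (hz : z ∈ lowerSet q0) (x : ℝ) : HasDerivAt (jm q0 c q z)
      (aOp q0 c z (jm q0 c q z x) + bOp c q x (jm q0 c q z x)) x :=
  h.perturbation.hasDerivAt_volterra' (mu_re_nonneg hz) (aOp_asympCol h.norm_eq hz.1)
    (aOp_aOp h.norm_eq hz.1) x

theorem HalfPotential.tendsto_jm {q0 : ℝ} {c : ℂ} {q : ℝ → ℂ} (h : HalfPotential q0 c q) {z : ℂ}
    (hz : z ∈ lowerSet q0) : Tendsto (jm q0 c q z) atTop (𝓝 (asympCol c z 0)) :=
  h.perturbation.tendsto_volterra (mu_re_nonneg hz)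

/-- The components of `m = ψ e^{iλx}` satisfy `m' = (X + iλ) m`. -/
theorem HalfPotential.hasDerivAt_jm_comp {q0 : ℝ} {c : ℂ} {q : ℝ → ℂ} (h : HalfPotential q0 c q)
    {z : ℂ} (hz : z ∈ lowerSet q0) (x : ℝ) :
    HasDerivAt (fun x => jm q0 c q z x 0)
      (Complex.I * (lamOf q0 z - kOf q0 z) * jm q0 c q z x 0 + q x * jm q0 c q z x 1) x ∧
    HasDerivAt (fun x => jm q0 c q z x 1)
      (-(conj (q x)) * jm q0 c q z x 0 + Complex.I * (lamOf q0 z + kOf q0 z) * jm q0 c q z x 1)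
      x := by
  have h1 := hasDerivAt_pi.1 (h.hasDerivAt_jm hz x)
  refine ⟨(h1 0).congr_deriv ?_, (h1 1).congr_deriv ?_⟩
  · simp only [aOp, bOp, Pi.add_apply, op2_zero, lamOf, kOf]; ring
  · simp only [aOp, bOp, Pi.add_apply, op2_one, lamOf, kOf, map_sub]; ring

theorem HalfPotential.isJostColumn {q0 : ℝ} {c : ℂ} {q : ℝ → ℂ} (h : HalfPotential q0 c q) {z : ℂ}
    (hz : z ∈ lowerSet q0) (t : ℝ) : IsJostColumn q0 q t c atTop 0 z
      fun x => Complex.exp (-(Complex.I * phase q0 x t z)) • jm q0 c q z x := by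
  refine ⟨isSol_iff.2 fun x => ?_, ?_⟩
  · obtain ⟨a, b⟩ := h.hasDerivAt_jm_comp hz x
    have he : HasDerivAt (fun x : ℝ => Complex.exp (-(Complex.I * phase q0 x t z)))
        (Complex.exp (-(Complex.I * phase q0 x t z)) * -(Complex.I * lamOf q0 z)) x := by
      have h1 : HasDerivAt (fun x : ℝ => -(Complex.I * phase q0 x t z))
          (-(Complex.I * lamOf q0 z)) x := by
        unfold phase
        have := ((((Complex.ofRealCLM.hasDerivAt (x := x)).add_const
          (kOf q0 z * (t : ℂ))).const_mul (lamOf q0 z)).const_mul Complex.I).neg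
        exact this.congr_deriv (by simp)
      exact h1.cexp
    refine ⟨(he.mul a).congr_deriv ?_, (he.mul b).congr_deriv ?_⟩
    · simp only [Pi.smul_apply, smul_eq_mul]; ring
    · simp only [Pi.smul_apply, smul_eq_mul]; ring
  · refine (h.tendsto_jm hz).congr fun x => ?_
    rw [smul_smul, ← Complex.exp_add, sgn3_zero]
    ring_nf
    simp

/-! ### Regions -/

/-- The sign of Im λ is what separates D⁺ from D⁻ and what decides whether e^{iλx} decays.
Multiplying by |z|² keeps the identity valid at z = 0. -/
theorem im_lamOf (q0 : ℝ) (z : ℂ) :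
    2 * ‖z‖ ^ 2 * (lamOf q0 z).im = (‖z‖ ^ 2 - q0 ^ 2) * z.im := by
  by_cases hz : z = 0
  · simp [hz]
  have hn : ‖z‖ ^ 2 ≠ 0 := by simpa using hz
  rw [← Complex.normSq_eq_norm_sq] at hn ⊢
  have : (lamOf q0 z).im = (z.im - q0 ^ 2 * z.im / Complex.normSq z) / 2 := by
    unfold lamOf
    rw [← Complex.ofReal_pow, Complex.div_ofNat_im, Complex.add_im, Complex.div_im,
      Complex.ofReal_re, Complex.ofReal_im]
    ring
  rw [this]; field_simp

theorem im_lamOf_neg_iff {q0 : ℝ} {z : ℂ} (hz : z ≠ 0) : (lamOf q0 z).im < 0 ↔ z ∈ regionMinus q0 := by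
  have h := im_lamOf q0 z
  have : 0 < 2 * ‖z‖ ^ 2 := by positivity
  rw [regionMinus, mem_ofPred_eq, ← h]
  constructor
  · intro h; exact mul_neg_of_pos_of_neg this h
  · intro h; exact neg_of_mul_neg_right h this.le

theorem regionMinus_ne_zero {q0 : ℝ} {z : ℂ} (hz : z ∈ regionMinus q0) : z ≠ 0 := fun h => by
  simp [regionMinus, h] at hz

theorem im_lamOf_contour {q0 : ℝ} {z : ℂ} (hz : z ∈ contour0 q0) : (lamOf q0 z).im = 0 := by
  have h := im_lamOf q0 z
  have h0 : z ≠ 0 := hz.2.1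
  have : 0 < 2 * ‖z‖ ^ 2 := by positivity
  have h2 : (‖z‖ ^ 2 - q0 ^ 2) * z.im = 0 := by
    rcases hz.1 with h | h <;> simp [h]
  rw [h2] at h
  exact (mul_eq_zero.1 h).resolve_left this.ne'

theorem regionMinus_subset (q0 : ℝ) : regionMinus q0 ⊆ lowerSet q0 := fun z hz =>
  ⟨regionMinus_ne_zero hz, ((im_lamOf_neg_iff (regionMinus_ne_zero hz)).2 hz).le⟩

theorem contour0_subset (q0 : ℝ) : contour0 q0 ⊆ lowerSet q0 := fun _ hz =>
  ⟨hz.2.1, (im_lamOf_contour hz).le⟩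

theorem conj_mem_regionMinus {q0 : ℝ} {z : ℂ} : conj z ∈ regionMinus q0 ↔ z ∈ regionPlus q0 := by
  simp only [regionMinus, regionPlus, mem_ofPred_eq, RCLike.norm_conj, Complex.conj_im, mul_neg,
    Left.neg_neg_iff]

theorem conj_mem_contour0 {q0 : ℝ} {z : ℂ} : conj z ∈ contour0 q0 ↔ z ∈ contour0 q0 := by
  have key : ∀ z : ℂ, z ∈ contour0 q0 → conj z ∈ contour0 q0 := by
    rintro z ⟨h1, h2, h3, h4⟩
    refine ⟨by simpa using h1, by simpa using h2, fun h => h4 ?_, fun h => h3 ?_⟩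
    · rw [← Complex.conj_conj z, h]; simp
    · rw [← Complex.conj_conj z, h]; simp
  exact ⟨fun h => by simpa using key _ h, key z⟩

theorem inv_ne_zero' {q0 : ℝ} (h0 : q0 ≠ 0) {z : ℂ} (hz : z ≠ 0) : inv q0 z ≠ 0 := by
  have h0' : (q0 : ℂ) ≠ 0 := by exact_mod_cast h0
  have hz' : conj z ≠ 0 := by simpa using hz
  exact neg_ne_zero.2 (div_ne_zero (pow_ne_zero _ h0') hz')

theorem inv_inv' {q0 : ℝ} (h0 : q0 ≠ 0) {z : ℂ} (hz : z ≠ 0) : inv q0 (inv q0 z) = z := by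
  have h0' : (q0 : ℂ) ≠ 0 := by exact_mod_cast h0
  simp only [inv, map_neg, map_div₀, map_pow, Complex.conj_ofReal, Complex.conj_conj]
  field_simp

theorem inv_mem_lowerSet {q0 : ℝ} (h0 : q0 ≠ 0) {z : ℂ} (hz : z ∈ lowerSet q0) :
    inv q0 z ∈ lowerSet q0 :=
  ⟨inv_ne_zero' h0 hz.1, by rw [lamOf_inv h0 hz.1]; simpa using hz.2⟩

theorem gam_conj (q0 : ℝ) (z : ℂ) : gam q0 (conj z) = conj (gam q0 z) := by simp [gam]

theorem gam_inv {q0 : ℝ} (h0 : q0 ≠ 0) {z : ℂ} (hz : z ≠ 0) :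
    gam q0 (inv q0 z) = conj z ^ 2 / (q0 : ℂ) ^ 2 * conj (gam q0 z) := by
  have h0' : (q0 : ℂ) ≠ 0 := by exact_mod_cast h0
  have hz' : conj z ≠ 0 := by simpa using hz
  simp only [gam, inv, map_add, map_div₀, map_pow, Complex.conj_ofReal, map_one]
  field_simp; ring

theorem gam_eq {q0 : ℝ} {z : ℂ} (hz : z ≠ 0) :
    gam q0 z = (z - Complex.I * q0) * (z + Complex.I * q0) / z ^ 2 := by
  unfold gam
  field_simp
  linear_combination ((q0 : ℂ) ^ 2) * Complex.I_sq

theorem gam_ne_zero {q0 : ℝ} {z : ℂ} (hz : z ≠ 0) (h1 : z ≠ Complex.I * q0)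
    (h2 : z ≠ -(Complex.I * q0)) : gam q0 z ≠ 0 := by
  rw [gam_eq hz]
  refine div_ne_zero (mul_ne_zero (sub_ne_zero.2 h1) fun h => h2 ?_) (pow_ne_zero _ hz)
  exact eq_neg_of_add_eq_zero_left h

theorem gam_ne_zero_contour {q0 : ℝ} {z : ℂ} (hz : z ∈ contour0 q0) : gam q0 z ≠ 0 :=
  gam_ne_zero hz.2.1 hz.2.2.1 hz.2.2.2

/-- λ = zγ/2, and Im λ < 0 in D⁻. -/
theorem gam_ne_zero_regionMinus {q0 : ℝ} {z : ℂ} (hz : z ∈ regionMinus q0) : gam q0 z ≠ 0 := by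
  have h := (im_lamOf_neg_iff (regionMinus_ne_zero hz)).2 hz
  intro h0
  have : lamOf q0 z = z * gam q0 z / 2 := by
    have := regionMinus_ne_zero hz
    unfold lamOf gam; field_simp
  rw [this, h0] at h
  simp at h

/-! ### Scattering coefficients -/

section Scattering

variable {q0 : ℝ} {qm qp : ℂ} {q : ℝ → ℂ} {t : ℝ} {z : ℂ}

theorem exists_bound_eventually (hz : (lamOf q0 z).im ≤ 0) :
    ∀ᶠ x : ℝ in atTop, ‖Complex.exp (-(2 * Complex.I * sgn3 0 * lamOf q0 z * x))‖ ≤ 1 := by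
  filter_upwards [eventually_ge_atTop 0] with x hx
  rw [Complex.norm_exp, Real.exp_le_one_iff, sgn3_zero, Complex.neg_re, Complex.re_mul_ofReal]
  simp
  nlinarith

theorem exists_bound_eventually' (hz : (lamOf q0 z).im ≤ 0) :
    ∀ᶠ x : ℝ in atBot, ‖Complex.exp (-(2 * Complex.I * sgn3 1 * lamOf q0 z * x))‖ ≤ 1 := by
  filter_upwards [eventually_le_atBot 0] with x hx
  rw [Complex.norm_exp, Real.exp_le_one_iff, sgn3_one, Complex.neg_re, Complex.re_mul_ofReal]
  simp
  nlinarith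

theorem exists_bound_eventually_conj (hz : (lamOf q0 (conj z)).im ≤ 0) :
    ∀ᶠ x : ℝ in atTop, ‖Complex.exp (-(2 * Complex.I * sgn3 1 * lamOf q0 z * x))‖ ≤ 1 := by
  filter_upwards [eventually_ge_atTop 0] with x hx
  rw [lamOf_conj, Complex.conj_im] at hz
  rw [Complex.norm_exp, Real.exp_le_one_iff, sgn3_one, Complex.neg_re, Complex.re_mul_ofReal]
  simp
  nlinarith

theorem exists_bound_eventually_conj' (hz : (lamOf q0 (conj z)).im ≤ 0) :
    ∀ᶠ x : ℝ in atBot, ‖Complex.exp (-(2 * Complex.I * sgn3 0 * lamOf q0 z * x))‖ ≤ 1 := by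
  filter_upwards [eventually_le_atBot 0] with x hx
  rw [lamOf_conj, Complex.conj_im] at hz
  rw [Complex.norm_exp, Real.exp_le_one_iff, sgn3_zero, Complex.neg_re, Complex.re_mul_ofReal]
  simp
  nlinarith

/-- The value `ψ_{+,1}(0; z)` at `t = 0`. -/
noncomputable def colA (q0 : ℝ) (qp : ℂ) (q : ℝ → ℂ) (z : ℂ) : Fin 2 → ℂ := jm q0 qp q z 0

/-- The value `ψ_{-,2}(0; z)` at `t = 0`. -/
noncomputable def colB (q0 : ℝ) (qm : ℂ) (q : ℝ → ℂ) (z : ℂ) : Fin 2 → ℂ :=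
  swap (jm q0 (conj qm) (refl q) z 0)

/-- `γ s₁₁`. -/
noncomputable def wrAB (q0 : ℝ) (qm qp : ℂ) (q : ℝ → ℂ) (z : ℂ) : ℂ :=
  wr (colA q0 qp q z) (colB q0 qm q z)

variable (hq : IsPotential q0 qm qp q)
include hq

theorem isJost_plus_zero (hz : z ∈ lowerSet q0) :
    IsJostColumn q0 q t qp atTop 0 z (jost q0 q t qp atTop 0 z) ∧
    jost q0 q t qp atTop 0 z 0 =
      Complex.exp (-(Complex.I * lamOf q0 z * kOf q0 z * t)) • colA q0 qp q z := by
  have h := hq.right.isJostColumn hz t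
  obtain ⟨C, hC⟩ := hq.bounded
  refine ⟨h.jost, ?_⟩
  rw [← h.unique hC (exists_bound_eventually hz.2) h.jost]
  simp only [phase, colA]
  congr 2; push_cast; ring

theorem isJost_minus_one (hz : z ∈ lowerSet q0) :
    IsJostColumn q0 q t qm atBot 1 z (jost q0 q t qm atBot 1 z) ∧
    jost q0 q t qm atBot 1 z 0 =
      Complex.exp (Complex.I * lamOf q0 z * kOf q0 z * t) • colB q0 qm q z := by
  have h := (hq.left.isJostColumn hz (-t)).swap
  obtain ⟨C, hC⟩ := hq.bounded
  refine ⟨h.jost, ?_⟩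
  rw [← h.unique hC (exists_bound_eventually' hz.2) h.jost]
  ext i
  fin_cases i
  · simp [phase, colB, swap, mul_assoc]
  · simp [phase, colB, swap, mul_assoc]

theorem isJost_plus_one (hz : conj z ∈ lowerSet q0) :
    IsJostColumn q0 q t qp atTop 1 z (jost q0 q t qp atTop 1 z) ∧
    jost q0 q t qp atTop 1 z 0 = (-1 : ℂ) • sig (jost q0 q t qp atTop 0 (conj z) 0) := by
  have h := (isJost_plus_zero (t := t) hq hz).1.conj_zero
  obtain ⟨C, hC⟩ := hq.bounded
  exact ⟨h.jost, by rw [← h.unique hC (exists_bound_eventually_conj hz.2) h.jost]⟩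

theorem isJost_minus_zero (hz : conj z ∈ lowerSet q0) :
    IsJostColumn q0 q t qm atBot 0 z (jost q0 q t qm atBot 0 z) ∧
    jost q0 q t qm atBot 0 z 0 = sig (jost q0 q t qm atBot 1 (conj z) 0) := by
  have h := (isJost_minus_one (t := t) hq hz).1.conj_one
  obtain ⟨C, hC⟩ := hq.bounded
  exact ⟨h.jost, by rw [← h.unique hC (exists_bound_eventually_conj' hz.2) h.jost]⟩

/-- The time factors of the two columns are inverse to each other, so `s11` does not depend on t. -/
theorem s11_eq (hz : z ∈ lowerSet q0) : s11 q0 qm qp q t z = wrAB q0 qm qp q z / gam q0 z := by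
  rw [s11, (isJost_plus_zero hq hz).2, (isJost_minus_one hq hz).2, wr_smul_smul, ← Complex.exp_add,
    neg_add_cancel, Complex.exp_zero, one_mul, wrAB]

theorem s22_eq (hz : conj z ∈ lowerSet q0) :
    s22 q0 qm qp q t z = conj (s11 q0 qm qp q t (conj z)) := by
  rw [s22, s11, (isJost_minus_zero hq hz).2, (isJost_plus_one hq hz).2, gam_conj, map_div₀,
    Complex.conj_conj, ← wr_sig]
  congr 1
  simp [wr]; ring

theorem s12_eq (hz : z ∈ lowerSet q0) (hz' : conj z ∈ lowerSet q0) :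
    s12 q0 qm qp q t z = -conj (s21 q0 qm qp q t (conj z)) := by
  have hz'' : conj (conj z) ∈ lowerSet q0 := by simpa using hz
  rw [s12, s21, (isJost_minus_zero hq hz'').2, (isJost_plus_one hq hz').2, gam_conj, map_div₀,
    Complex.conj_conj, Complex.conj_conj, ← wr_sig, neg_div']
  congr 1
  simp [wr, sig]; ring

/-- The constants collected from the two columns and from γ multiply to q₀²/(q₊ conj q₋) = q₋/q₊.
This symmetry identifies the two components of D⁻ and fixes the limit of `s11` at the origin. -/
theorem s11_inv (hz : z ∈ lowerSet q0) :
    s11 q0 qm qp q t (inv q0 z) = qm / qp * conj (s11 q0 qm qp q t z) := by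
  have h0 := hq.pos.ne'
  obtain ⟨C, hC⟩ := hq.bounded
  have hz' := inv_mem_lowerSet h0 hz
  have a := (isJost_plus_zero (t := t) hq hz).1.inv_zero h0 hq.norm_plus hz.1
  have b := (isJost_minus_one (t := t) hq hz).1.inv_one h0 hq.norm_minus hz.1
  rw [s11, s11, ← a.unique hC (exists_bound_eventually hz'.2) a.jost,
    ← b.unique hC (exists_bound_eventually' hz'.2) b.jost, wr_smul_smul, wr_sig, gam_inv h0 hz.1,
    map_div₀]
  have h0' : (q0 : ℂ) ≠ 0 := by exact_mod_cast h0
  have hzc : conj z ≠ 0 := by simpa using hz.1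
  have hp : qp ≠ 0 := fun h => h0 (by rw [← hq.norm_plus, h, norm_zero])
  have hm : qm ≠ 0 := fun h => h0 (by rw [← hq.norm_minus, h, norm_zero])
  have hmm := mul_conj_eq hq.norm_minus
  have hm' : conj qm ≠ 0 := by simpa using hm
  rw [← hmm]
  field_simp

omit hq in
/-- `Wr(ψ₁, ψ₂) = γ` for each of the two matrix solutions. -/
theorem wr_jost {l : Filter ℝ} [l.NeBot] {c : ℂ} (hc : ‖c‖ = q0) (hz : z ≠ 0)
    {ψ φ : ℝ → Fin 2 → ℂ} (h : IsJostColumn q0 q t c l 0 z ψ)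
    (h' : IsJostColumn q0 q t c l 1 z φ) : wr (ψ 0) (φ 0) = gam q0 z := by
  have h1 := tendsto_wr h.2 h'.2
  have h2 : wr (asympCol c z 0) (asympCol c z 1) = gam q0 z := by
    simp only [wr, asympCol, Matrix.cons_val_zero, Matrix.cons_val_one, gam, ← mul_conj_eq hc]
    field_simp
    rw [Complex.I_sq]; ring
  rw [h2] at h1
  refine tendsto_nhds_unique (tendsto_const_nhds.congr fun x => ?_) h1
  rw [wr_smul_smul, ← Complex.exp_add, IsSol.wr_eq h.1 h'.1 x, sgn3_zero, sgn3_one]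
  ring_nf
  simp

/-- The Plücker identity for the four columns, since each of the pairs (ψ₊₁, ψ₊₂) and (ψ₋₁, ψ₋₂) has
Wronskian γ. -/
theorem s_det (hz : z ∈ contour0 q0) :
    s11 q0 qm qp q t z * s22 q0 qm qp q t z - s12 q0 qm qp q t z * s21 q0 qm qp q t z = 1 := by
  have hl := contour0_subset q0 hz
  have hl' := contour0_subset q0 (conj_mem_contour0.2 hz)
  have h1 := wr_jost hq.norm_plus hl.1 (isJost_plus_zero (t := t) hq hl).1
    (isJost_plus_one hq hl').1
  have h2 := wr_jost hq.norm_minus hl.1 (isJost_minus_zero (t := t) hq hl').1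
    (isJost_minus_one hq hl).1
  have hg := gam_ne_zero_contour hz
  rw [s11, s22, s12, s21, div_mul_div_comm, div_mul_div_comm, ← sub_div, div_eq_one_iff_eq
    (mul_ne_zero hg hg)]
  have : gam q0 z * gam q0 z = wr (jost q0 q t qp atTop 0 z 0) (jost q0 q t qp atTop 1 z 0) *
    wr (jost q0 q t qm atBot 0 z 0) (jost q0 q t qm atBot 1 z 0) := by rw [h1, h2]
  rw [this]
  unfold wr; ring

end Scattering

/-! ### Regularity in the spectral parameter -/

section Local

variable {V : Type*} [NormedAddCommGroup V] [NormedSpace ℂ V] [CompleteSpace V]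
  {B : ℝ → V →L[ℂ] V} {b : ℝ → ℝ} (hB : Perturbation B b)
  {A : ℂ → V →L[ℂ] V} {μ : ℂ → ℂ} {e : ℂ → V} {S : Set ℂ}
include hB

/-- Regularity is local, so the uniform bounds on A and e are needed only near the given point. -/
theorem Perturbation.continuousOn_volterra_local (hμ : ∀ z ∈ S, 0 ≤ (μ z).re)
    (cA : ContinuousOn A S) (cμ : ContinuousOn μ S) (ce : ContinuousOn e S) (x : ℝ) :
    ContinuousOn (fun z => volterra (A z) (μ z) B (e z) x) S := by
  intro z0 hz0
  set T : Set ℂ := {z | z ∈ S ∧ ‖A z‖ ≤ ‖A z0‖ + 1 ∧ ‖e z‖ ≤ ‖e z0‖ + 1} with hT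
  have hTS : T ⊆ S := fun z h => h.1
  have hTn : T ∈ 𝓝[S] z0 := by
    filter_upwards [self_mem_nhdsWithin, (cA z0 hz0).norm.eventually_le_const (lt_add_one _),
      (ce z0 hz0).norm.eventually_le_const (lt_add_one _)] with z h1 h2 h3 using ⟨h1, h2, h3⟩
  have h := hB.continuousOn_volterra (S := T) (fun z h => hμ z h.1) (fun z h => h.2.1)
    (fun z h => h.2.2) (cA.mono hTS) (cμ.mono hTS) (ce.mono hTS) x z0
    ⟨hz0, by linarith, by linarith⟩
  exact h.mono_of_mem_nhdsWithin hTn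

theorem Perturbation.differentiableOn_volterra_local (hS : IsOpen S) (hμ : ∀ z ∈ S, 0 ≤ (μ z).re)
    (cA : DifferentiableOn ℂ A S) (cμ : DifferentiableOn ℂ μ S) (ce : DifferentiableOn ℂ e S)
    (x : ℝ) : DifferentiableOn ℂ (fun z => volterra (A z) (μ z) B (e z) x) S := by
  intro z0 hz0
  have h1 : ∀ᶠ z in 𝓝 z0, z ∈ S ∧ ‖A z‖ ≤ ‖A z0‖ + 1 ∧ ‖e z‖ ≤ ‖e z0‖ + 1 := by
    have hn := hS.mem_nhds hz0
    filter_upwards [hn, (cA.continuousOn.continuousAt hn).norm.eventually_le_const (lt_add_one _),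
      (ce.continuousOn.continuousAt hn).norm.eventually_le_const (lt_add_one _)] with z h1 h2 h3
      using ⟨h1, h2, h3⟩
  obtain ⟨T, hT, hTo, hz⟩ := eventually_nhds_iff.1 h1
  have hTS : T ⊆ S := fun z h => (hT z h).1
  have h := hB.differentiableOn_volterra hTo (fun z h => hμ z (hTS h)) (fun z h => (hT z h).2.1)
    (fun z h => (hT z h).2.2) (cA.mono hTS) (cμ.mono hTS) (ce.mono hTS) x
  exact (h.differentiableAt (hTo.mem_nhds hz)).differentiableWithinAt

end Local

theorem differentiableOn_aOp (q0 : ℝ) (c : ℂ) : DifferentiableOn ℂ (aOp q0 c) {z | z ≠ 0} := by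
  intro z hz
  refine DifferentiableAt.differentiableWithinAt ?_
  have hz' : z ≠ 0 := hz
  unfold aOp op2
  fun_prop (disch := assumption)

theorem differentiableOn_mu (q0 : ℝ) : DifferentiableOn ℂ (mu q0) {z | z ≠ 0} := by
  intro z hz
  refine DifferentiableAt.differentiableWithinAt ?_
  have hz' : z ≠ 0 := hz
  unfold mu lamOf
  fun_prop (disch := assumption)

theorem differentiableOn_asympCol (c : ℂ) :
    DifferentiableOn ℂ (fun z => asympCol c z 0) {z | z ≠ 0} := by
  intro z hz
  refine DifferentiableAt.differentiableWithinAt ?_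
  have hz' : z ≠ 0 := hz
  refine differentiableAt_pi.2 fun i => ?_
  fin_cases i
  · simp [asympCol]
  · simp only [asympCol, Fin.mk_one, Matrix.cons_val_zero, Matrix.cons_val_one]
    fun_prop (disch := assumption)

theorem isOpen_regionMinus (q0 : ℝ) : IsOpen (regionMinus q0) :=
  isOpen_lt (by fun_prop) continuous_const

theorem HalfPotential.continuousOn_jm {q0 : ℝ} {c : ℂ} {q : ℝ → ℂ} (h : HalfPotential q0 c q)
    (x : ℝ) : ContinuousOn (fun z => jm q0 c q z x) (lowerSet q0) := by
  have hs : lowerSet q0 ⊆ {z | z ≠ 0} := fun z hz => hz.1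
  exact h.perturbation.continuousOn_volterra_local (fun z hz => mu_re_nonneg hz)
    ((differentiableOn_aOp q0 c).continuousOn.mono hs)
    ((differentiableOn_mu q0).continuousOn.mono hs)
    ((differentiableOn_asympCol c).continuousOn.mono hs) x

theorem HalfPotential.differentiableOn_jm {q0 : ℝ} {c : ℂ} {q : ℝ → ℂ} (h : HalfPotential q0 c q)
    (x : ℝ) : DifferentiableOn ℂ (fun z => jm q0 c q z x) (regionMinus q0) := by
  have hs : regionMinus q0 ⊆ {z | z ≠ 0} := fun z hz => regionMinus_ne_zero hz
  exact h.perturbation.differentiableOn_volterra_local (isOpen_regionMinus q0)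
    (fun z hz => mu_re_nonneg (regionMinus_subset q0 hz))
    ((differentiableOn_aOp q0 c).mono hs) ((differentiableOn_mu q0).mono hs)
    ((differentiableOn_asympCol c).mono hs) x

section

variable {q0 : ℝ} {qm qp : ℂ} {q : ℝ → ℂ} (hq : IsPotential q0 qm qp q)
include hq

theorem continuousOn_colA : ContinuousOn (colA q0 qp q) (lowerSet q0) := hq.right.continuousOn_jm 0

omit hq in
theorem continuous_swap : Continuous swap := by
  refine continuous_pi fun i => ?_
  fin_cases i
  · exact continuous_apply 1
  · exact continuous_apply 0

theorem continuousOn_colB : ContinuousOn (colB q0 qm q) (lowerSet q0) :=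
  continuous_swap.comp_continuousOn (hq.left.continuousOn_jm 0)

theorem continuousOn_wrAB : ContinuousOn (wrAB q0 qm qp q) (lowerSet q0) := fun z hz =>
  tendsto_wr (continuousOn_colA hq z hz) (continuousOn_colB hq z hz)

theorem differentiableOn_wrAB : DifferentiableOn ℂ (wrAB q0 qm qp q) (regionMinus q0) := by
  have ha := hq.right.differentiableOn_jm 0
  have hb := hq.left.differentiableOn_jm 0
  rw [differentiableOn_pi] at ha hb
  exact ((ha 0).mul (hb 0)).sub ((ha 1).mul (hb 1))

theorem differentiableOn_s11 (t : ℝ) :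
    DifferentiableOn ℂ (s11 q0 qm qp q t) (regionMinus q0) := by
  have hg : DifferentiableOn ℂ (gam q0) (regionMinus q0) := fun z hz => by
    have : z ^ 2 ≠ 0 := pow_ne_zero _ (regionMinus_ne_zero hz)
    refine DifferentiableAt.differentiableWithinAt ?_
    unfold gam
    fun_prop (disch := assumption)
  exact ((differentiableOn_wrAB hq).div hg fun z hz => gam_ne_zero_regionMinus hz).congr
    fun z hz => s11_eq hq (regionMinus_subset q0 hz)

theorem continuousOn_s11 (t : ℝ) : ContinuousOn (s11 q0 qm qp q t)
    {z | z ∈ lowerSet q0 ∧ z ≠ Complex.I * q0 ∧ z ≠ -(Complex.I * q0)} := by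
  have hs : {z | z ∈ lowerSet q0 ∧ z ≠ Complex.I * q0 ∧ z ≠ -(Complex.I * q0)} ⊆ lowerSet q0 :=
    fun z h => h.1
  have hg : ContinuousOn (gam q0)
      {z | z ∈ lowerSet q0 ∧ z ≠ Complex.I * q0 ∧ z ≠ -(Complex.I * q0)} := fun z hz => by
    have : z ^ 2 ≠ 0 := pow_ne_zero _ hz.1.1
    refine ContinuousAt.continuousWithinAt ?_
    unfold gam
    fun_prop (disch := assumption)
  exact (((continuousOn_wrAB hq).mono hs).div hg fun z hz =>
    gam_ne_zero hz.1.1 hz.2.1 hz.2.2).congr fun z hz => s11_eq hq hz.1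

end

/-! ### Behaviour at infinity -/

theorem im_nonpos_of_mem_lowerSet {q0 : ℝ} {z : ℂ} (h0 : 0 < q0) (hz : z ∈ lowerSet q0)
    (h : q0 < ‖z‖) : z.im ≤ 0 := by
  have h1 := im_lamOf q0 z
  have h2 : 2 * ‖z‖ ^ 2 * (lamOf q0 z).im ≤ 0 :=
    mul_nonpos_of_nonneg_of_nonpos (by positivity) hz.2
  rw [h1] at h2
  have h3 : 0 < ‖z‖ ^ 2 - q0 ^ 2 := by nlinarith
  exact nonpos_of_mul_nonpos_right h2 h3

/-- μ = i(z + q₀²/z), and the second term is small compared with z once |z| ≥ 2q₀. -/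
theorem norm_mu_ge {q0 : ℝ} {z : ℂ} (h0 : 0 < q0) (h : 2 * q0 ≤ ‖z‖) : ‖z‖ / 2 ≤ ‖mu q0 z‖ := by
  have hz : 0 < ‖z‖ := by linarith
  have h1 : mu q0 z = Complex.I * (z + (q0 : ℂ) ^ 2 / z) := by unfold mu lamOf; ring
  rw [h1, norm_mul, Complex.norm_I, one_mul]
  have h2 := norm_sub_le_norm_add z ((q0 : ℂ) ^ 2 / z)
  have h3 : ‖(q0 : ℂ) ^ 2 / z‖ ≤ ‖z‖ / 2 := by
    rw [norm_div, norm_pow, Complex.norm_real, Real.norm_of_nonneg h0.le, div_le_iff₀ hz]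
    nlinarith
  linarith

theorem asympCol_norm_le {q0 : ℝ} {c z : ℂ} (h0 : 0 < q0) (hc : ‖c‖ = q0) (h : 2 * q0 ≤ ‖z‖) :
    ‖asympCol c z 0‖ ≤ 1 := by
  have hz : 0 < ‖z‖ := by linarith
  refine (pi_norm_le_iff_of_nonneg zero_le_one).2 fun i => ?_
  fin_cases i
  · simp [asympCol]
  · simp only [asympCol, Fin.mk_one, Matrix.cons_val_zero, Matrix.cons_val_one, norm_neg, norm_div,
      norm_mul, Complex.norm_I, one_mul, RCLike.norm_conj, hc]
    rw [div_le_one hz]; linarith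

theorem norm_aOp_le {q0 : ℝ} {c z : ℂ} (h0 : 0 < q0) (hc : ‖c‖ = q0) (h : 2 * q0 ≤ ‖z‖) :
    ‖aOp q0 c z‖ ≤ 3 * ‖z‖ := by
  have hz : 0 < ‖z‖ := by linarith
  refine (norm_op2_le _ _ _ _).trans ?_
  have h3 : ‖Complex.I * (q0 : ℂ) ^ 2 / z‖ ≤ ‖z‖ / 2 := by
    rw [norm_div, norm_mul, Complex.norm_I, one_mul, norm_pow, Complex.norm_real,
      Real.norm_of_nonneg h0.le, div_le_iff₀ hz]
    nlinarith
  rw [norm_neg, RCLike.norm_conj, hc, norm_mul, Complex.norm_I, one_mul]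
  linarith

theorem HalfPotential.jm_bound {q0 : ℝ} {c : ℂ} {q : ℝ → ℂ} (h : HalfPotential q0 c q) :
    ∃ M, 0 ≤ M ∧ ∀ z ∈ lowerSet q0, 2 * q0 ≤ ‖z‖ → ∀ x, 0 ≤ x → ‖jm q0 c q z x‖ ≤ M := by
  -- 13 = 1 + 2 · 3|z| / (|z|/2), from the bounds of A by 3|z| and of μ from below by |z|/2.
  have hw := h.weight.const_mul (c := 13) (by norm_num)
  refine ⟨2 * 1 * Real.exp (2 * tail (fun x => 13 * (2 * ‖q x - c‖)) 0), by positivity,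
    fun z hz hzn x hx => ?_⟩
  have hzp : 0 < ‖z‖ := by linarith [h.pos]
  have hμ := norm_mu_ge h.pos hzn
  have hμ0 : mu q0 z ≠ 0 := norm_pos_iff.1 (by linarith)
  refine (h.perturbation.norm_volterra_le_of_ne hμ0 (K' := 13) ?_ (mu_re_nonneg hz) x).trans ?_
  · have h1 := norm_aOp_le h.pos h.norm_eq hzn
    have : 2 * ‖aOp q0 c z‖ / ‖mu q0 z‖ ≤ 12 := by
      rw [div_le_iff₀ (by linarith)]; linarith
    linarith
  · have h1 := asympCol_norm_le h.pos h.norm_eq hzn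
    have h2 := hw.exp_antitone hx
    gcongr

/-- Only the lower row of A grows with z. Boundedness of the upper row is what makes the first
component of AJ uniformly integrable and gives it the full decay 1/μ after integration. -/
theorem aOp_zero_le {q0 : ℝ} {c z : ℂ} (h0 : 0 < q0) (hc : ‖c‖ = q0) (h : 2 * q0 ≤ ‖z‖)
    (v : Fin 2 → ℂ) : ‖aOp q0 c z v 0‖ ≤ 2 * q0 * ‖v‖ := by
  have hz : 0 < ‖z‖ := by linarith
  rw [aOp, op2_zero]
  have h3 : ‖Complex.I * (q0 : ℂ) ^ 2 / z‖ ≤ q0 := by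
    rw [norm_div, norm_mul, Complex.norm_I, one_mul, norm_pow, Complex.norm_real,
      Real.norm_of_nonneg h0.le, div_le_iff₀ hz]
    nlinarith
  refine (norm_add_le _ _).trans ?_
  rw [norm_mul, norm_mul, hc]
  have e0 := norm_le_pi_norm v 0
  have e1 := norm_le_pi_norm v 1
  nlinarith [norm_nonneg (v 0), norm_nonneg (v 1)]

theorem HalfPotential.continuous_deriv {q0 : ℝ} {c : ℂ} {q : ℝ → ℂ} (h : HalfPotential q0 c q) :
    Continuous (deriv q) := h.contDiff.continuous_deriv_one

theorem HalfPotential.hasDerivAt {q0 : ℝ} {c : ℂ} {q : ℝ → ℂ} (h : HalfPotential q0 c q) (x : ℝ) :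
    HasDerivAt q (deriv q x) x := ((h.contDiff.differentiable one_ne_zero) x).hasDerivAt

theorem lam_add_k (q0 : ℝ) (z : ℂ) : lamOf q0 z + kOf q0 z = z := by
  unfold lamOf kOf; ring

/-- The second component of `m` is `O(1/z)`, uniformly on the half-line. -/
theorem HalfPotential.jm_one_bound {q0 : ℝ} {c : ℂ} {q : ℝ → ℂ} (h : HalfPotential q0 c q) :
    ∃ C, 0 ≤ C ∧ ∀ z ∈ lowerSet q0, 2 * q0 ≤ ‖z‖ → ∀ x, 0 ≤ x → ‖jm q0 c q z x 1‖ ≤ C / ‖z‖ := by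
  obtain ⟨M, hM0, hM⟩ := h.jm_bound
  obtain ⟨Q, hQ⟩ := h.bounded
  have hQ0 : 0 ≤ Q := (norm_nonneg _).trans (hQ 0)
  set b : ℝ → ℝ := fun x => 2 * ‖q x - c‖ with hb
  have hP := h.perturbation
  -- An integrable bound, independent of z, for G = (conj q · m₀)' below. The first summand is where
  -- q_x ∈ L¹ is used.
  set g : ℝ → ℝ := fun x => ‖deriv q x‖ * M + Q * ((b x + 2 * q0 * tail b x) * M) with hg
  have hgi : IntegrableOn g (Ioi 0) := by
    refine (h.integrable_deriv.norm.mul_const M).add (Integrable.const_mul (Integrable.mul_const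
      ?_ M) Q)
    exact (h.weight.integrable 0).add ((hP.weight_tail.integrable 0).const_mul _)
  have hg0 : ∀ x, 0 ≤ g x := fun x => by
    have h1 := h.weight.nonneg x
    have h2 := h.weight.tail_nonneg x
    have h3 := h.pos.le
    simp only [hg, hb] at *
    positivity
  refine ⟨(∫ x in Ioi (0 : ℝ), g x) + Q * M,
    add_nonneg (integral_nonneg hg0) (mul_nonneg hQ0 hM0), fun z hz hzn x hx => ?_⟩
  have hzp : 0 < ‖z‖ := by linarith [h.pos]
  have hz0 : z ≠ 0 := hz.1
  have him := im_nonpos_of_mem_lowerSet h.pos hz (by linarith [h.pos])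
  set m := jm q0 c q z with hm
  obtain ⟨N, hN, hmN⟩ := hP.volterra_dom (A := aOp q0 c z) (e := asympCol c z 0) (mu_re_nonneg hz)
  have hmc : Continuous m := hP.continuous_volterra (mu_re_nonneg hz)
  set d : ℝ → ℂ := fun x => Complex.I * (lamOf q0 z - kOf q0 z) * m x 0 + q x * m x 1 with hd
  have hdm : ∀ x, HasDerivAt (fun x => m x 0) (d x) x := fun x => (h.hasDerivAt_jm_comp hz x).1
  have hdb : ∀ x, 0 ≤ x → ‖d x‖ ≤ (b x + 2 * q0 * tail b x) * M := fun x hx => by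
    -- The differential equation alone shows no decay of m₀'. The form m' = Bm - AJ does, because
    -- both terms carry an integrable weight.
    have e1 : d x = bOp c q x (m x) 0 - aOp q0 c z (jOp (mu q0 z) (bOp c q) m x) 0 :=
      (hdm x).unique (hasDerivAt_pi.1 (hP.hasDerivAt_volterra (mu_re_nonneg hz) x) 0)
    rw [e1]
    refine (norm_sub_le _ _).trans ?_
    rw [add_mul]
    refine add_le_add ?_ ?_
    · refine (norm_le_pi_norm _ 0).trans (((bOp c q x).le_opNorm _).trans ?_)
      exact mul_le_mul (hP.bound x) (hM z hz hzn x hx) (norm_nonneg _) (h.weight.nonneg x)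
    · refine (aOp_zero_le h.pos h.norm_eq hzn _).trans ?_
      rw [mul_assoc (2 * q0) (tail b x) M]
      refine mul_le_mul_of_nonneg_left ?_ (mul_nonneg zero_le_two h.pos.le)
      have : tail b x * M = tail (fun y => b y * M) x := (integral_mul_const _ _).symm
      rw [this]
      refine norm_tail_le ((h.weight.integrable x).mul_const _) fun y hy => ?_
      rw [norm_smul]
      refine (mul_le_of_le_one_left (norm_nonneg _)
        (norm_exp_mul_sub_le (mu_re_nonneg hz) hy.le)).trans ?_
      refine ((bOp c q y).le_opNorm _).trans ?_
      exact mul_le_mul (hP.bound y) (hM z hz hzn y (hx.trans hy.le)) (norm_nonneg _)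
        (h.weight.nonneg y)
  set G : ℝ → ℂ := fun y => conj (deriv q y) * m y 0 + conj (q y) * d y with hG
  have hGb : ∀ y, 0 ≤ y → ‖G y‖ ≤ g y := fun y hy => by
    refine (norm_add_le _ _).trans (add_le_add ?_ ?_)
    · rw [norm_mul, RCLike.norm_conj]
      exact mul_le_mul_of_nonneg_left ((norm_le_pi_norm _ 0).trans (hM z hz hzn y hy))
        (norm_nonneg _)
    · rw [norm_mul, RCLike.norm_conj]
      exact mul_le_mul (hQ y) (hdb y hy) (norm_nonneg _) hQ0
  -- One integration by parts: the correction removes the source -conj q · m₀ from m₁' = izm₁ - conj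
  -- q · m₀ and leaves one of size 1/z. It also cancels the limit of m₁ at +∞.
  set n : ℝ → ℂ := fun y => m y 1 + Complex.I * conj (q y) * m y 0 / z with hn
  have hnd : ∀ y, HasDerivAt n (Complex.I * z * n y + Complex.I / z * G y) y := fun y => by
    have h1 := (h.hasDerivAt_jm_comp hz y).2
    have h2 := ((hasDerivAt_conj (h.hasDerivAt y)).const_mul Complex.I).mul (hdm y)
    refine (h1.add (h2.div_const z)).congr_deriv ?_
    simp only [hn, hG, ← hm, lam_add_k]
    field_simp
    linear_combination (-(conj (q y)) * m y 0 * z) * Complex.I_sq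
  have hnt : Tendsto n atTop (𝓝 0) := by
    have h1 := tendsto_pi_nhds.1 (h.tendsto_jm hz)
    have h2 := (h1 1).add ((((tendsto_conj h.tendsto).const_mul Complex.I).mul (h1 0)).div_const z)
    refine tendsto_nhds_of_eq h2 ?_
    simp only [asympCol, Matrix.cons_val_zero, Matrix.cons_val_one]
    ring
  have hexp : ∀ y, x ≤ y → ‖Complex.exp (-(Complex.I * z * ((y : ℂ) - x)))‖ ≤ 1 := fun y hy => by
    rw [Complex.norm_exp, Real.exp_le_one_iff, ← Complex.ofReal_sub, Complex.neg_re,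
      Complex.re_mul_ofReal]
    simp
    nlinarith
  -- Variation of constants from +∞; the kernel e^{-iz(y-x)} is at most 1 in modulus because Im z ≤
  -- 0.
  have hmain := integral_Ioi_of_hasDerivAt_of_tendsto' (a := x)
    (f := fun y : ℝ => Complex.exp (-(Complex.I * z * ((y : ℂ) - x))) * n y)
    (f' := fun y : ℝ => Complex.exp (-(Complex.I * z * ((y : ℂ) - x))) * (Complex.I / z * G y))
    (m := 0) (fun y _ => by
      have h1 : HasDerivAt (fun y : ℝ => Complex.exp (-(Complex.I * z * ((y : ℂ) - x))))
          (Complex.exp (-(Complex.I * z * ((y : ℂ) - x))) * -(Complex.I * z)) y := by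
        have := (((Complex.ofRealCLM.hasDerivAt (x := y)).sub_const (x : ℂ)).const_mul
          (Complex.I * z)).neg.cexp
        exact this.congr_deriv (by simp)
      exact (h1.mul (hnd y)).congr_deriv (by ring))
    (by
      have hmc0 : Continuous fun y => m y 0 := (continuous_apply 0).comp hmc
      have hmc1 : Continuous fun y => m y 1 := (continuous_apply 1).comp hmc
      have hqc := h.contDiff.continuous
      have hqd := h.continuous_deriv
      have hGc : Continuous G := by
        simp only [hG, hd]
        refine ((Complex.continuous_conj.comp hqd).mul hmc0).add
          ((Complex.continuous_conj.comp hqc).mul ?_)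
        fun_prop
      refine integrableOn_Ioi_of_bound (g := fun y => ‖Complex.I / z‖ * g y) (by fun_prop)
        ((hgi.mono_set (Ioi_subset_Ioi hx)).const_mul _) fun y hy => ?_
      rw [norm_mul, norm_mul]
      refine (mul_le_of_le_one_left (by positivity) (hexp y hy.le)).trans ?_
      exact mul_le_mul_of_nonneg_left (hGb y (hx.trans hy.le)) (norm_nonneg _))
    (by
      refine squeeze_zero_norm' ?_ (tendsto_norm_zero.comp hnt)
      filter_upwards [eventually_ge_atTop x] with y hy
      rw [norm_mul]
      exact mul_le_of_le_one_left (norm_nonneg _) (hexp y hy))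
  have hnx : ‖n x‖ ≤ (∫ x in Ioi (0 : ℝ), g x) / ‖z‖ := by
    have e1 : n x = -∫ y in Ioi x, Complex.exp (-(Complex.I * z * ((y : ℂ) - x))) *
        (Complex.I / z * G y) := by rw [hmain]; simp
    rw [e1, norm_neg]
    have h1 : (∫ x in Ioi (0 : ℝ), g x) / ‖z‖ = ∫ x in Ioi (0 : ℝ), g x / ‖z‖ :=
      (integral_div _ _).symm
    rw [h1]
    refine (norm_integral_le_of_norm_le (hgi.mono_set (Ioi_subset_Ioi hx) |>.div_const ‖z‖)
      ((ae_restrict_iff' measurableSet_Ioi).2 (Eventually.of_forall fun y hy => ?_))).trans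
      (setIntegral_mono_set (hgi.div_const _)
        (Eventually.of_forall fun y => div_nonneg (hg0 y) (norm_nonneg _))
        (LE.le.eventuallyLE (Ioi_subset_Ioi hx)))
    have hy' : x < y := hy
    rw [norm_mul, norm_mul, norm_div, Complex.norm_I]
    refine (mul_le_of_le_one_left (by positivity) (hexp y hy'.le)).trans ?_
    rw [div_mul_eq_mul_div, one_mul]
    gcongr
    exact hGb y (hx.trans hy'.le)
  have e2 : m x 1 = n x - Complex.I * conj (q x) * m x 0 / z := by simp only [hn]; ring
  rw [e2, add_div]
  refine (norm_sub_le _ _).trans (add_le_add hnx ?_)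
  rw [norm_div, norm_mul, norm_mul, Complex.norm_I, one_mul, RCLike.norm_conj]
  gcongr
  · exact hQ x
  · exact (norm_le_pi_norm _ 0).trans (hM z hz hzn x hx)

/-- `m(0; z) = (1, 0) + O(1/z)`. -/
theorem HalfPotential.jm_asymp {q0 : ℝ} {c : ℂ} {q : ℝ → ℂ} (h : HalfPotential q0 c q) :
    ∃ C, 0 ≤ C ∧ ∀ z ∈ lowerSet q0, 2 * q0 ≤ ‖z‖ →
      ‖jm q0 c q z 0 0 - 1‖ ≤ C / ‖z‖ ∧ ‖jm q0 c q z 0 1‖ ≤ C / ‖z‖ := by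
  obtain ⟨M, hM0, hM⟩ := h.jm_bound
  obtain ⟨C, hC0, hC⟩ := h.jm_one_bound
  set b : ℝ → ℝ := fun x => 2 * ‖q x - c‖ with hb
  have hP := h.perturbation
  set I := tail b 0 with hI
  have hI0 : 0 ≤ I := h.weight.tail_nonneg 0
  refine ⟨C + (I * C + 2 * q0 * (2 * (2 * (I * M)))), ?_, fun z hz hzn => ⟨?_, ?_⟩⟩
  · have := h.pos.le
    positivity
  · have hzp : 0 < ‖z‖ := by linarith [h.pos]
    set m := jm q0 c q z with hm
    have hμ := norm_mu_ge h.pos hzn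
    have hμ0 : mu q0 z ≠ 0 := norm_pos_iff.1 (by linarith)
    have hre := mu_re_nonneg hz
    obtain ⟨N, hN, hmN⟩ := hP.volterra_dom (A := aOp q0 c z) (e := asympCol c z 0) hre
    have hmc : Continuous m := hP.continuous_volterra hre
    have i1 := hP.integrable_apply hmc hN hmN 0
    have i2 := hP.integrable_jOp hre hmc hN hmN 0
    have i3 : IntegrableOn (fun y => mu q0 z • jOp (mu q0 z) (bOp c q) m y) (Ioi 0) := i2.smul (mu q0 z)
    have e0 : m 0 = asympCol c z 0 + tOp (aOp q0 c z) (mu q0 z) (bOp c q) m 0 :=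
      hP.volterra_eq hre 0
    have e1 : tOp (aOp q0 c z) (mu q0 z) (bOp c q) m 0 =
        aOp q0 c z (tail (jOp (mu q0 z) (bOp c q) m) 0) - tail (fun y => bOp c q y (m y)) 0 := by
      rw [tOp, tail, integral_sub i1 ((aOp q0 c z).integrable_comp i2),
        (aOp q0 c z).integral_comp_comm i2]
      unfold tail; abel
    -- Division by μ turns the integral of J into O(1/z).
    have e2 : tail (jOp (mu q0 z) (bOp c q) m) 0 = (mu q0 z)⁻¹ •
        (tail (fun y => bOp c q y (m y)) 0 - jOp (mu q0 z) (bOp c q) m 0) := by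
      have := hP.tail_jOp hre hmc hN hmN 0
      rw [tail, integral_sub i1 i3, integral_smul] at this
      rw [← this]
      simp only [tail, sub_sub_cancel]
      rw [smul_smul, inv_mul_cancel₀ hμ0, one_smul]
    have hNM : tail (fun y => ‖bOp c q y (m y)‖) 0 ≤ I * M := by
      have : I * M = tail (fun y => b y * M) 0 := (integral_mul_const _ _).symm
      rw [this]
      refine setIntegral_mono_on i1.norm ((h.weight.integrable 0).mul_const _) measurableSet_Ioi
        fun y (hy : 0 < y) => ((bOp c q y).le_opNorm _).trans ?_
      exact mul_le_mul (hP.bound y) (hM z hz hzn y hy.le) (norm_nonneg _) (h.weight.nonneg y)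
    have n1 : ‖tail (fun y => bOp c q y (m y)) 0‖ ≤ I * M :=
      (norm_tail_le i1.norm fun _ _ => le_rfl).trans hNM
    have n2 : ‖jOp (mu q0 z) (bOp c q) m 0‖ ≤ I * M := (hP.norm_jOp_le' hre hmc hN hmN 0).trans hNM
    have n3 : ‖tail (jOp (mu q0 z) (bOp c q) m) 0‖ ≤ 2 * (2 * (I * M)) / ‖z‖ := by
      rw [e2, norm_smul, norm_inv]
      have h1 : ‖mu q0 z‖⁻¹ ≤ 2 / ‖z‖ := by
        rw [inv_le_comm₀ (by linarith) (by positivity), inv_div]; exact hμ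
      calc _ ≤ 2 / ‖z‖ * (I * M + I * M) := by
            gcongr
            exact (norm_sub_le _ _).trans (add_le_add n1 n2)
        _ = _ := by ring
    -- The first component of Bm is (q - c)m₁, and m₁ is already known to be O(1/z).
    have n4 : ‖tail (fun y => bOp c q y (m y)) 0 0‖ ≤ I * C / ‖z‖ := by
      have e3 : tail (fun y => bOp c q y (m y)) 0 0 = tail (fun y => bOp c q y (m y) 0) 0 :=
        ((ContinuousLinearMap.proj (R := ℂ) (φ := fun _ : Fin 2 => ℂ) 0).integral_comp_comm i1).symm
      have : I * C / ‖z‖ = tail (fun y => b y * (C / ‖z‖)) 0 := by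
        rw [mul_div_assoc]; exact (integral_mul_const _ _).symm
      rw [e3, this]
      refine norm_tail_le ((h.weight.integrable 0).mul_const _) fun y hy => ?_
      rw [bOp, op2_zero, zero_mul, zero_add, norm_mul]
      have := norm_nonneg (q y - c)
      exact mul_le_mul (by simp only [hb]; linarith) (hC z hz hzn y hy.le) (norm_nonneg _)
        (h.weight.nonneg y)
    have e4 : m 0 0 - 1 = aOp q0 c z (tail (jOp (mu q0 z) (bOp c q) m) 0) 0 -
        tail (fun y => bOp c q y (m y)) 0 0 := by
      rw [e0, e1]; simp [asympCol]
    rw [e4]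
    refine (norm_sub_le _ _).trans ?_
    have n5 := aOp_zero_le h.pos h.norm_eq hzn (tail (jOp (mu q0 z) (bOp c q) m) 0)
    calc _ ≤ 2 * q0 * (2 * (2 * (I * M)) / ‖z‖) + I * C / ‖z‖ :=
          add_le_add (n5.trans (mul_le_mul_of_nonneg_left n3 (by linarith [h.pos]))) n4
      _ ≤ C / ‖z‖ + (2 * q0 * (2 * (2 * (I * M)) / ‖z‖) + I * C / ‖z‖) :=
          le_add_of_nonneg_left (by positivity)
      _ = _ := by ring
  · refine (hC z hz hzn 0 le_rfl).trans ?_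
    have := h.pos.le
    gcongr
    exact le_add_of_nonneg_right (by positivity)

/-- `s₁₁ = 1 + O(1/z)`. -/
theorem s11_asymp {q0 : ℝ} {qm qp : ℂ} {q : ℝ → ℂ} (hq : IsPotential q0 qm qp q) (t : ℝ) :
    ∃ C, 0 ≤ C ∧ ∀ z ∈ lowerSet q0, 2 * q0 ≤ ‖z‖ → 1 ≤ ‖z‖ →
      ‖s11 q0 qm qp q t z - 1‖ ≤ C / ‖z‖ := by
  obtain ⟨C, hC0, hC⟩ := hq.right.jm_asymp
  obtain ⟨D, hD0, hD⟩ := hq.left.jm_asymp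
  have h0 := hq.pos
  -- The factor 2 comes from |γ| ≥ 1/2; the other terms bound γs₁₁ - γ, expanded around the columns
  -- (1, 0) and (0, 1).
  refine ⟨2 * (C + D + 2 * (C * D) + q0 ^ 2), by positivity, fun z hz hzn hz1 => ?_⟩
  have hzp : 0 < ‖z‖ := by linarith
  obtain ⟨a0, a1⟩ := hC z hz hzn
  obtain ⟨b0, b1⟩ := hD z hz hzn
  have hgd : ‖gam q0 z - 1‖ ≤ q0 ^ 2 / ‖z‖ ^ 2 := by
    rw [gam, add_sub_cancel_left, norm_div, norm_pow, norm_pow, Complex.norm_real,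
      Real.norm_of_nonneg h0.le]
  have hsq : q0 ^ 2 / ‖z‖ ^ 2 ≤ 1 / 2 := by
    rw [div_le_iff₀ (by positivity)]; nlinarith
  have hg : 1 / 2 ≤ ‖gam q0 z‖ := by
    have h1 := norm_sub_norm_le (1 : ℂ) (1 - gam q0 z)
    rw [sub_sub_cancel, norm_one, norm_sub_rev] at h1
    linarith
  have hg0 : gam q0 z ≠ 0 := norm_pos_iff.1 (by linarith)
  have hle : ∀ a : ℝ, 0 ≤ a → a / ‖z‖ ^ 2 ≤ a / ‖z‖ := fun a ha => by
    gcongr; nlinarith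
  have hnum : ‖wrAB q0 qm qp q z - gam q0 z‖ ≤ (C + D + 2 * (C * D) + q0 ^ 2) / ‖z‖ := by
    set x0 := jm q0 qp q z 0 0
    set x1 := jm q0 qp q z 0 1
    set y0 := jm q0 (conj qm) (refl q) z 0 0
    set y1 := jm q0 (conj qm) (refl q) z 0 1
    have e : wrAB q0 qm qp q z - gam q0 z =
        (x0 - 1) + (y0 - 1) + (x0 - 1) * (y0 - 1) - x1 * y1 - (gam q0 z - 1) := by
      simp only [wrAB, wr, colA, colB, swap, Matrix.cons_val_zero, Matrix.cons_val_one]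
      ring
    rw [e]
    have p1 : ‖(x0 - 1) * (y0 - 1)‖ ≤ (C * D) / ‖z‖ := by
      rw [norm_mul]
      refine (mul_le_mul a0 b0 (norm_nonneg _) (by positivity)).trans ((hle _ (by positivity)).trans_eq' ?_)
      field_simp
    have p2 : ‖x1 * y1‖ ≤ (C * D) / ‖z‖ := by
      rw [norm_mul]
      refine (mul_le_mul a1 b1 (norm_nonneg _) (by positivity)).trans ((hle _ (by positivity)).trans_eq' ?_)
      field_simp
    have p3 := hgd.trans (hle _ (by positivity))
    calc _ ≤ C / ‖z‖ + D / ‖z‖ + C * D / ‖z‖ + C * D / ‖z‖ + q0 ^ 2 / ‖z‖ := by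
          refine (norm_sub_le _ _).trans (add_le_add ((norm_sub_le _ _).trans (add_le_add
            ((norm_add_le _ _).trans (add_le_add ((norm_add_le _ _).trans (add_le_add a0 b0)) p1))
            p2)) p3)
      _ = _ := by ring
  have e2 : s11 q0 qm qp q t z - 1 = (wrAB q0 qm qp q z - gam q0 z) / gam q0 z := by
    rw [s11_eq hq hz]; field_simp
  rw [e2, norm_div, div_le_iff₀ (by linarith)]
  refine hnum.trans ?_
  have : 0 ≤ (C + D + 2 * (C * D) + q0 ^ 2) / ‖z‖ := by positivity
  calc _ = (2 * ((C + D + 2 * (C * D) + q0 ^ 2) / ‖z‖)) * (1 / 2) := by ring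
    _ ≤ (2 * ((C + D + 2 * (C * D) + q0 ^ 2) / ‖z‖)) * ‖gam q0 z‖ := by gcongr
    _ = _ := by ring

/-! ### The branch points -/

/-- The derivative `(X + iλ) m`. -/
noncomputable def dm (q0 : ℝ) (c : ℂ) (q : ℝ → ℂ) (z : ℂ) (x : ℝ) : Fin 2 → ℂ :=
  aOp q0 c z (jm q0 c q z x) + bOp c q x (jm q0 c q z x)

/-- Near a point of the closed region, `m` and `m'` are bounded uniformly, with integrable bound
for `m'`. -/
theorem HalfPotential.local_bound {q0 : ℝ} {c : ℂ} {q : ℝ → ℂ} (h : HalfPotential q0 c q) {z0 : ℂ}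
    (hz0 : z0 ∈ lowerSet q0) : ∃ (M : ℝ) (w : ℝ → ℝ), 0 ≤ M ∧ Weight w ∧
      ∀ᶠ z in 𝓝[lowerSet q0] z0, ∀ x, 0 ≤ x →
        ‖jm q0 c q z x‖ ≤ M ∧ ‖dm q0 c q z x‖ ≤ w x * M := by
  have hs : lowerSet q0 ⊆ {z | z ≠ 0} := fun z hz => hz.1
  have cA := ((differentiableOn_aOp q0 c).continuousOn.mono hs) z0 hz0
  have ce := ((differentiableOn_asympCol c).continuousOn.mono hs) z0 hz0
  set K := ‖aOp q0 c z0‖ + 1 with hK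
  set E := ‖asympCol c z0 0‖ + 1 with hE
  have hK0 : 0 ≤ K := by positivity
  have hE0 : 0 ≤ E := by positivity
  have hP := h.perturbation
  have hw := hP.weight_add hK0
  refine ⟨2 * E * Real.exp (2 * tail (fun x => 2 * ‖q x - c‖ +
    K * tail (fun x => 2 * ‖q x - c‖) x) 0), _, by positivity, hw, ?_⟩
  filter_upwards [self_mem_nhdsWithin, cA.norm.eventually_le_const (lt_add_one _),
    ce.norm.eventually_le_const (lt_add_one _)] with z hz hA he
  have hre := mu_re_nonneg hz
  have hm : ∀ x, 0 ≤ x → ‖jm q0 c q z x‖ ≤ 2 * E * Real.exp (2 * tail (fun x => 2 * ‖q x - c‖ +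
      K * tail (fun x => 2 * ‖q x - c‖) x) 0) := fun x hx => by
    refine (hP.norm_volterra_le hA hre x).trans ?_
    have := hw.exp_antitone hx
    gcongr
  intro x hx
  refine ⟨hm x hx, ?_⟩
  -- As for the decay in z, the Volterra form Bm - AJ of the derivative is the one that is visibly
  -- integrable.
  have e1 : dm q0 c q z x = bOp c q x (jm q0 c q z x) -
      aOp q0 c z (jOp (mu q0 z) (bOp c q) (jm q0 c q z) x) :=
    (h.hasDerivAt_jm hz x).unique (hP.hasDerivAt_volterra hre x)
  rw [e1]
  refine (norm_sub_le _ _).trans ?_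
  rw [add_mul]
  refine add_le_add ?_ ?_
  · exact ((bOp c q x).le_opNorm _).trans
      (mul_le_mul (hP.bound x) (hm x hx) (norm_nonneg _) (h.weight.nonneg x))
  · refine ((aOp q0 c z).le_opNorm _).trans ?_
    rw [mul_assoc K]
    refine mul_le_mul hA ?_ (norm_nonneg _) hK0
    have : ∀ M, tail (fun x => 2 * ‖q x - c‖) x * M = tail (fun y => 2 * ‖q y - c‖ * M) x :=
      fun M => (integral_mul_const _ _).symm
    rw [this]
    refine norm_tail_le ((h.weight.integrable x).mul_const _) fun y hy => ?_
    rw [norm_smul]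
    refine (mul_le_of_le_one_left (norm_nonneg _) (norm_exp_mul_sub_le hre hy.le)).trans ?_
    refine ((bOp c q y).le_opNorm _).trans ?_
    exact mul_le_mul (hP.bound y) (hm y (hx.trans hy.le)) (norm_nonneg _) (h.weight.nonneg y)

theorem HalfPotential.continuousOn_dm {q0 : ℝ} {c : ℂ} {q : ℝ → ℂ} (h : HalfPotential q0 c q)
    (x : ℝ) : ContinuousOn (fun z => dm q0 c q z x) (lowerSet q0) := by
  have hs : lowerSet q0 ⊆ {z | z ≠ 0} := fun z hz => hz.1
  have cA := (differentiableOn_aOp q0 c).continuousOn.mono hs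
  exact (cA.clm_apply (h.continuousOn_jm x)).add
    ((bOp c q x).continuous.comp_continuousOn (h.continuousOn_jm x))

theorem HalfPotential.continuous_jm {q0 : ℝ} {c : ℂ} {q : ℝ → ℂ} (h : HalfPotential q0 c q) {z : ℂ}
    (hz : z ∈ lowerSet q0) : Continuous (jm q0 c q z) :=
  h.perturbation.continuous_volterra (mu_re_nonneg hz)

theorem HalfPotential.continuous_dm {q0 : ℝ} {c : ℂ} {q : ℝ → ℂ} (h : HalfPotential q0 c q) {z : ℂ}
    (hz : z ∈ lowerSet q0) : Continuous (dm q0 c q z) :=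
  ((aOp q0 c z).continuous.comp (h.continuous_jm hz)).add
    (h.perturbation.cont_apply (h.continuous_jm hz))

/-- `f₀ g₁ + f₁ g₀`. -/
def symPair (f g : Fin 2 → ℂ) : ℂ := f 0 * g 1 + f 1 * g 0

theorem norm_symPair_le (f g : Fin 2 → ℂ) : ‖symPair f g‖ ≤ 2 * (‖f‖ * ‖g‖) := by
  have f0 := norm_le_pi_norm f 0
  have f1 := norm_le_pi_norm f 1
  have g0 := norm_le_pi_norm g 0
  have g1 := norm_le_pi_norm g 1
  refine (norm_add_le _ _).trans ?_
  rw [norm_mul, norm_mul, two_mul]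
  gcongr

/-- The difference of k is divisible by λ. This lets the off-diagonal term in the equation for the
Wronskian be absorbed by a multiple of the symmetric pairing. -/
theorem kOf_sub_branch {q0 : ℝ} {z zs : ℂ} (hzs : zs ^ 2 = -(q0 : ℂ) ^ 2) (hz : z ≠ 0)
    (h : z + zs ≠ 0) :
    kOf q0 z - kOf q0 zs = lamOf q0 z * ((z - zs) / (z + zs)) := by
  have e : (q0 : ℂ) ^ 2 = -zs ^ 2 := by rw [hzs, neg_neg]
  unfold kOf lamOf
  rw [e]; field_simp; ring

theorem lamOf_branch {q0 : ℝ} {zs : ℂ} (hzs : zs ^ 2 = -(q0 : ℂ) ^ 2) : lamOf q0 zs = 0 := by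
  have e : (q0 : ℂ) ^ 2 = -zs ^ 2 := by rw [hzs, neg_neg]
  unfold lamOf
  rw [e]; field_simp; ring

/-- `Wr(ψ(0; z), ψ(0; z_*))` is `(z - z_*) / (z + z_*)` times a function that is continuous at the
branch point `z_*`. -/
theorem HalfPotential.wr_branch {q0 : ℝ} {c : ℂ} {q : ℝ → ℂ} (h : HalfPotential q0 c q) {zs : ℂ}
    (hzs : zs ^ 2 = -(q0 : ℂ) ^ 2) (hs : zs ∈ lowerSet q0) :
    ∃ D : ℂ → ℂ, ContinuousWithinAt D (lowerSet q0) zs ∧ ∀ z ∈ lowerSet q0, z + zs ≠ 0 →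
      wr (jm q0 c q z 0) (jm q0 c q zs 0) = (z - zs) / (z + zs) * D z := by
  set φ := jm q0 c q zs with hφ
  set φd := dm q0 c q zs with hφd
  obtain ⟨M, w, hM0, hw, hb⟩ := h.local_bound hs
  have hbs := hb.self_of_nhdsWithin hs
  set hd : ℂ → ℝ → ℂ := fun z x =>
    symPair (dm q0 c q z x) (φ x) + symPair (jm q0 c q z x) (φd x) with hhd
  have hdc : ∀ z ∈ lowerSet q0, Continuous (hd z) := fun z hz => by
    have c1 := h.continuous_jm hz
    have c2 := h.continuous_dm hz
    have c3 : Continuous φ := h.continuous_jm hs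
    have c4 : Continuous φd := h.continuous_dm hs
    simp only [hhd, symPair]
    fun_prop
  have hexp : ∀ z ∈ lowerSet q0, ∀ x : ℝ, 0 ≤ x →
      ‖Complex.exp (-(Complex.I * lamOf q0 z * x))‖ ≤ 1 := fun z hz x hx => by
    rw [Complex.norm_exp, Real.exp_le_one_iff, Complex.neg_re, Complex.re_mul_ofReal]
    have := hz.2
    simp
    nlinarith
  -- D(z) is S(0) plus ∫ e^{-iλx}S' over the half-line, with S the symmetric pairing of the columns
  -- at z and z_*. It is continuous by dominated convergence, since m' has a locally uniform
  -- integrable bound.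
  refine ⟨fun z => symPair (jm q0 c q z 0) (φ 0) + ∫ x in Ioi (0 : ℝ),
    Complex.exp (-(Complex.I * lamOf q0 z * x)) * hd z x, ?_, fun z hz hne => ?_⟩
  · refine ContinuousWithinAt.add ?_ ?_
    · have h1 := continuousWithinAt_pi.1 (h.continuousOn_jm 0 zs hs)
      exact ((h1 0).mul continuousWithinAt_const).add ((h1 1).mul continuousWithinAt_const)
    · refine continuousWithinAt_of_dominated
        (bound := fun x => 2 * (w x * M * M) + 2 * (M * (w x * M))) ?_ ?_ ?_ ?_
      · filter_upwards [self_mem_nhdsWithin] with z hz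
        have := hdc z hz
        exact Continuous.aestronglyMeasurable (by fun_prop)
      · filter_upwards [self_mem_nhdsWithin, hb] with z hz hbz
        refine (ae_restrict_iff' measurableSet_Ioi).2 (Eventually.of_forall fun x (hx : 0 < x) => ?_)
        rw [norm_mul]
        refine (mul_le_of_le_one_left (norm_nonneg _) (hexp z hz x hx.le)).trans ?_
        obtain ⟨b1, b2⟩ := hbz x hx.le
        obtain ⟨b3, b4⟩ := hbs x hx.le
        refine (norm_add_le _ _).trans (add_le_add ((norm_symPair_le _ _).trans ?_)
          ((norm_symPair_le _ _).trans ?_))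
        · have := hw.nonneg x
          gcongr
        · gcongr
      · have := (hw.integrable 0)
        exact (((this.mul_const M).mul_const M).const_mul 2).add
          (((this.mul_const M).const_mul M).const_mul 2)
      · refine Eventually.of_forall fun x => ?_
        have h0 : zs ≠ 0 := hs.1
        have h1 : ContinuousWithinAt (lamOf q0) (lowerSet q0) zs := by
          refine ContinuousAt.continuousWithinAt ?_
          unfold lamOf
          fun_prop (disch := assumption)
        have h2 := continuousWithinAt_pi.1 (h.continuousOn_jm x zs hs)
        have h3 := continuousWithinAt_pi.1 (h.continuousOn_dm x zs hs)
        refine ContinuousWithinAt.mul ?_ ?_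
        · exact ((continuousWithinAt_const.mul h1).mul continuousWithinAt_const).neg.cexp
        · exact (((h3 0).mul continuousWithinAt_const).add ((h3 1).mul continuousWithinAt_const)).add
            (((h2 0).mul continuousWithinAt_const).add ((h2 1).mul continuousWithinAt_const))
  · set κ := (z - zs) / (z + zs) with hκ
    set m := jm q0 c q z with hm
    obtain ⟨Mz, wz, -, hwz, hbz⟩ := h.local_bound hz
    have hbz' := hbz.self_of_nhdsWithin hz
    have hz0 : z ≠ 0 := hz.1
    have hs0 : zs ≠ 0 := hs.1
    have hk := kOf_sub_branch hzs hz0 hne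
    have hlam := lamOf_branch hzs
    -- the derivatives of the Wronskian and of the symmetric pairing
    have hW : ∀ x, HasDerivAt (fun x => wr (m x) (φ x)) (Complex.I * lamOf q0 z * wr (m x) (φ x) -
        Complex.I * (kOf q0 z - kOf q0 zs) * symPair (m x) (φ x)) x := fun x => by
      obtain ⟨a, b⟩ := h.hasDerivAt_jm_comp hz x
      obtain ⟨a', b'⟩ := h.hasDerivAt_jm_comp hs x
      refine ((a.mul b').sub (b.mul a')).congr_deriv ?_
      simp only [wr, symPair, hlam]; ring
    have hS : ∀ x, HasDerivAt (fun x => symPair (m x) (φ x)) (hd z x) x := fun x => by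
      have a := hasDerivAt_pi.1 (h.hasDerivAt_jm hz x)
      have a' := hasDerivAt_pi.1 (h.hasDerivAt_jm hs x)
      refine (((a 0).mul (a' 1)).add ((a 1).mul (a' 0))).congr_deriv ?_
      simp only [hhd, symPair, dm, hφd, hφ]; ring
    -- With k(z) - k(z_*) = κλ, the terms in λ cancel and the derivative of e^{-iλx}(W - κS) is
    -- -κe^{-iλx}S'. At +∞ the asymptotic columns satisfy W = κS exactly, so there is no boundary
    -- term.
    have hmain := integral_Ioi_of_hasDerivAt_of_tendsto' (a := 0)
      (f := fun x : ℝ => Complex.exp (-(Complex.I * lamOf q0 z * x)) *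
        (wr (m x) (φ x) - κ * symPair (m x) (φ x)))
      (f' := fun x : ℝ => -κ * (Complex.exp (-(Complex.I * lamOf q0 z * x)) * hd z x))
      (m := 0) (fun x _ => by
        have h1 : HasDerivAt (fun x : ℝ => Complex.exp (-(Complex.I * lamOf q0 z * x)))
            (Complex.exp (-(Complex.I * lamOf q0 z * x)) * -(Complex.I * lamOf q0 z)) x := by
          have := ((Complex.ofRealCLM.hasDerivAt (x := x)).const_mul
            (Complex.I * lamOf q0 z)).neg.cexp
          exact this.congr_deriv (by simp)
        refine (h1.mul ((hW x).sub ((hS x).const_mul κ))).congr_deriv ?_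
        simp only [Pi.sub_apply]
        rw [hk]; ring)
      (by
        refine Integrable.const_mul ?_ _
        have hc := hdc z hz
        refine integrableOn_Ioi_of_bound (g := fun x => 2 * (wz x * Mz * M) + 2 * (Mz * (w x * M)))
          (by fun_prop) ((((hwz.integrable 0).mul_const Mz).mul_const M).const_mul 2 |>.add
          ((((hw.integrable 0).mul_const M).const_mul Mz).const_mul 2)) fun x hx => ?_
        rw [norm_mul]
        refine (mul_le_of_le_one_left (norm_nonneg _) (hexp z hz x hx.le)).trans ?_
        obtain ⟨b1, b2⟩ := hbz' x hx.le
        obtain ⟨b3, b4⟩ := hbs x hx.le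
        have hMz : 0 ≤ Mz := (norm_nonneg _).trans b1
        refine (norm_add_le _ _).trans (add_le_add ((norm_symPair_le _ _).trans ?_)
          ((norm_symPair_le _ _).trans ?_))
        · have := hwz.nonneg x
          gcongr
        · gcongr)
      (by
        have t1 := tendsto_pi_nhds.1 (h.tendsto_jm hz)
        have t2 := tendsto_pi_nhds.1 (h.tendsto_jm hs)
        have t3 : Tendsto (fun x => wr (m x) (φ x) - κ * symPair (m x) (φ x)) atTop (𝓝 0) := by
          refine tendsto_nhds_of_eq ((((t1 0).mul (t2 1)).sub ((t1 1).mul (t2 0))).sub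
            ((((t1 0).mul (t2 1)).add ((t1 1).mul (t2 0))).const_mul κ)) ?_
          simp only [asympCol, Matrix.cons_val_zero, Matrix.cons_val_one, hκ]
          field_simp; ring
        refine squeeze_zero_norm' ?_ (tendsto_norm_zero.comp t3)
        filter_upwards [eventually_ge_atTop 0] with x hx
        rw [norm_mul]
        exact mul_le_of_le_one_left (norm_nonneg _) (hexp z hz x hx))
    rw [integral_const_mul] at hmain
    simp only [Complex.ofReal_zero, mul_zero, neg_zero, Complex.exp_zero, one_mul] at hmain
    linear_combination hmain

theorem HalfPotential.jm_ne_zero {q0 : ℝ} {c : ℂ} {q : ℝ → ℂ} (h : HalfPotential q0 c q) {z : ℂ}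
    (hz : z ∈ lowerSet q0) : jm q0 c q z 0 ≠ 0 := by
  intro h0
  obtain ⟨C, hC⟩ := h.bounded
  have hj := h.isJostColumn hz 0
  have h1 := IsSol.eq_of_eq hC hj.1 isSol_zero (by simp [h0])
  have h2 := hj.2
  rw [h1] at h2
  simp only [Pi.zero_apply, smul_zero] at h2
  exact asympCol_ne_zero c z 0 (tendsto_nhds_unique h2 tendsto_const_nhds)

theorem exists_wr_eq_one {f : Fin 2 → ℂ} (hf : f ≠ 0) : ∃ g, wr f g = 1 := by
  by_cases h0 : f 0 = 0
  · have h1 : f 1 ≠ 0 := fun h1 => hf (funext fun i => by fin_cases i <;> assumption)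
    exact ⟨![-(f 1)⁻¹, 0], by simp [wr, h1]⟩
  · exact ⟨![0, (f 0)⁻¹], by simp [wr, h0]⟩

section

variable {q0 : ℝ} {qm qp : ℂ} {q : ℝ → ℂ} (hq : IsPotential q0 qm qp q) {zs : ℂ}
include hq

/-- If `γ s₁₁` vanishes at a branch point, it does so at least to first order. -/
theorem wrAB_branch (hzs : zs ^ 2 = -(q0 : ℂ) ^ 2) (hs : zs ∈ lowerSet q0)
    (h0 : wrAB q0 qm qp q zs = 0) :
    ∃ D : ℂ → ℂ, ContinuousWithinAt D (lowerSet q0) zs ∧ ∀ z ∈ lowerSet q0, z + zs ≠ 0 →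
      wrAB q0 qm qp q z = (z - zs) / (z + zs) * D z := by
  obtain ⟨D1, hD1, e1⟩ := hq.right.wr_branch hzs hs
  obtain ⟨D2, hD2, e2⟩ := hq.left.wr_branch hzs hs
  have hA : colA q0 qp q zs ≠ 0 := hq.right.jm_ne_zero hs
  have hB : colB q0 qm q zs ≠ 0 := by
    intro h
    refine hq.left.jm_ne_zero hs (funext fun i => ?_)
    fin_cases i
    · exact congrFun h 1
    · exact congrFun h 0
  -- At z_* the two columns are proportional. Against the auxiliary vector χ, the Plücker identity
  -- writes Wr(A, B) through Wr(A, A_*) and Wr(B, A_*) = Wr(B, B_*)/r, and both are divisible by z -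
  -- z_*.
  obtain ⟨r, hr⟩ := exists_smul_of_wr_eq_zero hA h0
  have hr0 : r ≠ 0 := fun h => hB (by rw [hr, h, zero_smul])
  obtain ⟨χ, hχ⟩ := exists_wr_eq_one hA
  refine ⟨fun z => D1 z * wr (colB q0 qm q z) χ + wr (colA q0 qp q z) χ * D2 z / r,
    ((hD1.mul (tendsto_wr (continuousOn_colB hq zs hs) tendsto_const_nhds)).add
      ((ContinuousWithinAt.mul (tendsto_wr (continuousOn_colA hq zs hs) tendsto_const_nhds)
        hD2).div_const r)), fun z hz hne => ?_⟩
  have p1 : wr (colA q0 qp q z) (colA q0 qp q zs) = (z - zs) / (z + zs) * D1 z := e1 z hz hne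
  have p2 : wr (colB q0 qm q z) (colB q0 qm q zs) = -((z - zs) / (z + zs) * D2 z) := by
    rw [colB, colB, wr_swap, e2 z hz hne]
  have p3 : wr (colB q0 qm q z) (colA q0 qp q zs) * r = -((z - zs) / (z + zs) * D2 z) := by
    rw [← p2, hr]; simp only [wr, Pi.smul_apply, smul_eq_mul]; ring
  have pl : wrAB q0 qm qp q z * wr (colA q0 qp q zs) χ =
      wr (colA q0 qp q z) (colA q0 qp q zs) * wr (colB q0 qm q z) χ -
      wr (colA q0 qp q z) χ * wr (colB q0 qm q z) (colA q0 qp q zs) := by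
    unfold wrAB wr; ring
  have p4 : wr (colB q0 qm q z) (colA q0 qp q zs) = -((z - zs) / (z + zs) * D2 z) / r := by
    rw [← p3]; field_simp
  rw [hχ, mul_one, p1, p4] at pl
  rw [pl]; ring

/-- γ has a simple zero at the branch point. If γs₁₁ is nonzero there, n = 1. Otherwise the zeros
cancel and n = 0; the limit is nonzero because it is approached along Σ₀, where the modulus of `s11`
is bounded below. -/
theorem s11_branch_aux {t : ℝ} (hzs : zs ^ 2 = -(q0 : ℂ) ^ 2) (hs : zs ∈ lowerSet q0)
    (hspec : ∃ c : ℝ, 0 < c ∧ ∀ ζ ∈ contour0 q0, c ≤ ‖s11 q0 qm qp q t ζ‖)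
    (hcl : (𝓝[contour0 q0] zs).NeBot) :
    ∃ (n : ℕ) (L : ℂ), n ≤ 1 ∧ L ≠ 0 ∧
      Tendsto (fun z => s11 q0 qm qp q t z * (z - zs) ^ n) (𝓝[lowerSet q0 \ {zs}] zs) (𝓝 L) := by
  have hs0 : zs ≠ 0 := hs.1
  have hmono : 𝓝[lowerSet q0 \ {zs}] zs ≤ 𝓝[lowerSet q0] zs := nhdsWithin_mono _ sdiff_subset
  have hev : ∀ᶠ z in 𝓝[lowerSet q0 \ {zs}] zs, z ∈ lowerSet q0 ∧ z - zs ≠ 0 ∧ z + zs ≠ 0 := by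
    have h1 : ∀ᶠ z in 𝓝 zs, z + zs ≠ 0 := by
      refine ContinuousAt.eventually_ne (by fun_prop) ?_
      rw [← two_mul]; exact mul_ne_zero two_ne_zero hs0
    filter_upwards [self_mem_nhdsWithin, mem_nhdsWithin_of_mem_nhds h1] with z hz h1
    exact ⟨hz.1, sub_ne_zero.2 hz.2, h1⟩
  have hgam : ∀ z, z ≠ 0 → gam q0 z = (z - zs) * (z + zs) / z ^ 2 := fun z hz => by
    have e : (q0 : ℂ) ^ 2 = -zs ^ 2 := by rw [hzs, neg_neg]
    rw [gam, e]; field_simp; ring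
  have h2s : zs + zs ≠ 0 := by rw [← two_mul]; exact mul_ne_zero two_ne_zero hs0
  by_cases h0 : wrAB q0 qm qp q zs = 0
  · obtain ⟨D, hD, e⟩ := wrAB_branch hq hzs hs h0
    set f : ℂ → ℂ := fun z => D z * z ^ 2 / (z + zs) ^ 2 with hf
    have hfc : Tendsto f (𝓝[lowerSet q0 \ {zs}] zs) (𝓝 (f zs)) := by
      refine Tendsto.mono_left ?_ hmono
      exact (hD.mul (continuousWithinAt_id.pow 2)).div
        ((continuousWithinAt_id.add continuousWithinAt_const).pow 2) (pow_ne_zero _ h2s)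
    have hfe : ∀ᶠ z in 𝓝[lowerSet q0 \ {zs}] zs, f z = s11 q0 qm qp q t z := by
      filter_upwards [hev] with z ⟨hz, h1, h2⟩
      have hz0 : z ≠ 0 := hz.1
      rw [s11_eq hq hz, e z hz h2, hgam z hz0]
      simp only [hf]; field_simp
    refine ⟨0, f zs, zero_le_one, ?_, (hfc.congr' hfe).congr fun z => by rw [pow_zero, mul_one]⟩
    obtain ⟨c, hc, hcb⟩ := hspec
    have hsub : 𝓝[contour0 q0] zs ≤ 𝓝[lowerSet q0 \ {zs}] zs := by
      refine nhdsWithin_mono _ fun z hz => ⟨contour0_subset q0 hz, fun h => ?_⟩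
      rw [mem_singleton_iff] at h
      subst h
      exact gam_ne_zero_contour hz (by rw [hgam _ hs0]; simp)
    have h3 := ((hfc.congr' hfe).mono_left hsub).norm
    have h4 : c ≤ ‖f zs‖ := by
      refine ge_of_tendsto h3 ?_
      filter_upwards [self_mem_nhdsWithin] with z hz using hcb z hz
    exact norm_pos_iff.1 (hc.trans_le h4)
  · refine ⟨1, wrAB q0 qm qp q zs * zs ^ 2 / (zs + zs), le_rfl,
      div_ne_zero (mul_ne_zero h0 (pow_ne_zero _ hs0)) h2s, ?_⟩
    have h1 : Tendsto (fun z => wrAB q0 qm qp q z * z ^ 2 / (z + zs)) (𝓝[lowerSet q0 \ {zs}] zs)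
        (𝓝 (wrAB q0 qm qp q zs * zs ^ 2 / (zs + zs))) := by
      refine Tendsto.mono_left ?_ hmono
      exact ((continuousOn_wrAB hq zs hs).mul (continuousWithinAt_id.pow 2)).div
        (continuousWithinAt_id.add continuousWithinAt_const) h2s
    refine h1.congr' ?_
    filter_upwards [hev] with z ⟨hz, h1, h2⟩
    have hz0 : z ≠ 0 := hz.1
    rw [s11_eq hq hz, hgam z hz0]
    field_simp

theorem I_q0_mem_lowerSet : Complex.I * q0 ∈ lowerSet q0 := by
  have h0 : (q0 : ℂ) ≠ 0 := by exact_mod_cast hq.pos.ne'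
  have : Complex.I * (q0 : ℂ) ≠ 0 := mul_ne_zero Complex.I_ne_zero h0
  refine ⟨this, ?_⟩
  rw [lamOf_branch (by rw [mul_pow, Complex.I_sq]; ring)]; simp

/-- At the branch point `i q₀`, `s₁₁` has a nonzero limit or a simple pole. -/
theorem s11_branch {t : ℝ}
    (hspec : ∃ c : ℝ, 0 < c ∧ ∀ ζ ∈ contour0 q0, c ≤ ‖s11 q0 qm qp q t ζ‖) :
    ∃ (n : ℕ) (L : ℂ), n ≤ 1 ∧ L ≠ 0 ∧
      Tendsto (fun z => s11 q0 qm qp q t z * (z - Complex.I * q0) ^ n)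
        (𝓝[lowerSet q0 \ {Complex.I * (q0 : ℂ)}] (Complex.I * q0)) (𝓝 L) := by
  have h0 : (q0 : ℂ) ≠ 0 := by exact_mod_cast hq.pos.ne'
  refine s11_branch_aux hq (by rw [mul_pow, Complex.I_sq]; ring) (I_q0_mem_lowerSet hq) hspec ?_
  have hcirc : circ q0 (Real.pi / 2) = Complex.I * q0 := by
    unfold circ
    have : Complex.I * ((Real.pi / 2 : ℝ) : ℂ) = (Real.pi : ℂ) / 2 * Complex.I := by push_cast; ring
    rw [this, Complex.exp_pi_div_two_mul_I, mul_comm]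
  have hc : Continuous (circ q0) := by unfold circ; fun_prop
  -- The branch point is a limit of points of Σ₀, reached along the circle from the side with
  -- positive real part.
  have h1 : Tendsto (circ q0) (𝓝[<] (Real.pi / 2)) (𝓝[contour0 q0] (Complex.I * q0)) := by
    rw [tendsto_nhdsWithin_iff]
    refine ⟨hcirc ▸ (hc.tendsto _).mono_left nhdsWithin_le_nhds, ?_⟩
    have hpos : (0 : ℝ) < Real.pi / 2 := by positivity
    filter_upwards [Ioo_mem_nhdsLT hpos] with α hα
    have hre : 0 < (circ q0 α).re := by
      unfold circ
      rw [Complex.re_ofReal_mul, mul_comm Complex.I, Complex.exp_ofReal_mul_I_re]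
      exact mul_pos hq.pos (Real.cos_pos_of_mem_Ioo ⟨by linarith [hα.1], hα.2⟩)
    refine ⟨Or.inr ?_, fun h => ?_, fun h => ?_, fun h => ?_⟩
    · unfold circ
      rw [norm_mul, mul_comm Complex.I, Complex.norm_exp_ofReal_mul_I, Complex.norm_real,
        Real.norm_of_nonneg hq.pos.le, mul_one]
    · rw [h] at hre; simp at hre
    · rw [h] at hre; simp at hre
    · rw [h] at hre; simp at hre
  exact h1.neBot

end

/-! ### Cauchy's theorem on a half disc -/

/-- The closed upper half disc. -/
def halfDisc (r : ℝ) : Set ℂ := {η | ‖η‖ ≤ r ∧ 0 ≤ η.im}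

/-- The open upper half disc. -/
def openHalfDisc (r : ℝ) : Set ℂ := {η | ‖η‖ < r ∧ 0 < η.im}

/-- The integral along the boundary of the upper half disc. -/
noncomputable def bdInt (r : ℝ) (g : ℂ → ℂ) : ℂ :=
  (∫ x in (-r)..r, g (x : ℂ)) + ∫ α in (0 : ℝ)..Real.pi, g (circ r α) * (Complex.I * circ r α)

/-- A weight with a logarithmic singularity on the imaginary axis. -/
noncomputable def logWt (η : ℂ) : ℝ := 1 + |Real.log (η.re / ‖η‖)|

theorem one_le_logWt (η : ℂ) : 1 ≤ logWt η := le_add_of_nonneg_right (abs_nonneg _)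

/-- Analytic functions on the half disc with continuous boundary values, except for a logarithmic
singularity at the top and boundedness at the origin. -/
structure HalfDiscFun (r : ℝ) (g : ℂ → ℂ) : Prop where
  diff : DifferentiableOn ℂ g (openHalfDisc r)
  cont : ContinuousOn g (halfDisc r \ {0, Complex.I * r})
  -- The imaginary axis is excluded: there `Real.log 0 = 0` would make `logWt` equal to 1 and forbid
  -- the singularity at the top.
  bound : ∃ C : ℝ, 0 ≤ C ∧ ∀ η ∈ halfDisc r, η ≠ 0 → η.re ≠ 0 → ‖g η‖ ≤ C * logWt η

theorem norm_circ {s : ℝ} (hs : 0 ≤ s) (α : ℝ) : ‖circ s α‖ = s := by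
  rw [circ, norm_mul, mul_comm Complex.I, Complex.norm_exp_ofReal_mul_I, Complex.norm_real,
    Real.norm_of_nonneg hs, mul_one]

theorem circ_re (s α : ℝ) : (circ s α).re = s * Real.cos α := by
  rw [circ, Complex.re_ofReal_mul, mul_comm Complex.I, Complex.exp_ofReal_mul_I_re]

theorem circ_im (s α : ℝ) : (circ s α).im = s * Real.sin α := by
  rw [circ, Complex.im_ofReal_mul, mul_comm Complex.I, Complex.exp_ofReal_mul_I_im]

theorem circ_zero (s : ℝ) : circ s 0 = s := by simp [circ]

theorem circ_pi (s : ℝ) : circ s Real.pi = -s := by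
  rw [circ, mul_comm Complex.I, Complex.exp_pi_mul_I]; simp

theorem continuous_circ (s : ℝ) : Continuous (circ s) := by unfold circ; fun_prop

theorem conj_circ (s α : ℝ) : conj (circ s α) = circ s (-α) := by
  simp [circ, ← Complex.exp_conj]

theorem circ_mem_halfDisc {r s α : ℝ} (hs : 0 ≤ s) (hsr : s ≤ r) (hα : α ∈ Icc 0 Real.pi) :
    circ s α ∈ halfDisc r := by
  refine ⟨(norm_circ hs α).trans_le hsr, ?_⟩
  rw [circ_im]
  exact mul_nonneg hs (Real.sin_nonneg_of_mem_Icc hα)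

theorem cos_ne_zero_of_mem {α : ℝ} (hα : α ∈ Icc 0 Real.pi) (h : α ≠ Real.pi / 2) :
    Real.cos α ≠ 0 := by
  intro h0
  refine h (Real.injOn_cos hα ⟨by positivity, by linarith [Real.pi_pos]⟩ ?_)
  rw [h0, Real.cos_pi_div_two]

theorem ofReal_mem_halfDisc {r x : ℝ} (hx : |x| ≤ r) : (x : ℂ) ∈ halfDisc r :=
  ⟨by simpa using hx, by simp⟩

/-- The weight depends on the direction of η only, so one integrable function of α dominates on all
arcs at once. -/
theorem logWt_circ {s : ℝ} (hs : 0 < s) (α : ℝ) : logWt (circ s α) = 1 + |Real.log (Real.cos α)| := by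
  rw [logWt, norm_circ hs.le, circ_re, mul_div_cancel_left₀ _ hs.ne']

theorem logWt_ofReal (x : ℝ) : logWt x = 1 := by
  rw [logWt, Complex.ofReal_re, Complex.norm_real, Real.norm_eq_abs]
  rcases lt_trichotomy x 0 with h | rfl | h
  · rw [abs_of_neg h, div_neg, div_self h.ne]; simp
  · simp
  · rw [abs_of_pos h, div_self h.ne']; simp

/-- One exceptional point p is allowed for the singularity at the origin or at the top. -/
theorem intervalIntegrable_of_bound {a b p : ℝ} (hab : a ≤ b) {f : ℝ → ℂ} {φ : ℝ → ℝ}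
    (hf : ContinuousOn f (Icc a b \ {p})) (hφ : IntervalIntegrable φ volume a b)
    (h : ∀ x ∈ Icc a b, x ≠ p → ‖f x‖ ≤ φ x) : IntervalIntegrable f volume a b := by
  have hne : ∀ᵐ x : ℝ, x ≠ p := by simp [ae_iff]
  rw [intervalIntegrable_iff_integrableOn_Icc_of_le hab] at hφ ⊢
  refine Integrable.mono' hφ ?_ ?_
  · have : (Icc a b \ {p} : Set ℝ) =ᵐ[volume] Icc a b := by
      filter_upwards [hne] with x hx
      exact propext ⟨fun h => h.1, fun h => ⟨h, hx⟩⟩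
    rw [← Measure.restrict_congr_set this]
    exact hf.aestronglyMeasurable (measurableSet_Icc.diff (measurableSet_singleton p))
  · rw [ae_restrict_iff' measurableSet_Icc]
    filter_upwards [hne] with x hx hx' using h x hx' hx

theorem intervalIntegrable_logWt (C a b : ℝ) :
    IntervalIntegrable (fun α => C * (1 + |Real.log (Real.cos α)|)) volume a b :=
  ((_root_.intervalIntegrable_const).add intervalIntegrable_log_cos.abs).const_mul C

namespace HalfDiscFun

variable {r : ℝ} {g : ℂ → ℂ}

theorem circ_cont (h : HalfDiscFun r g) {s : ℝ} (hs : 0 < s) (hsr : s ≤ r) :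
    ContinuousOn (fun α => g (circ s α)) (Icc 0 Real.pi \ {Real.pi / 2}) := by
  refine h.cont.comp (continuous_circ s).continuousOn fun α hα => ⟨circ_mem_halfDisc hs.le hsr hα.1, ?_⟩
  have h1 := mul_ne_zero hs.ne' (cos_ne_zero_of_mem hα.1 hα.2)
  rw [← circ_re] at h1
  rintro (h2 | h2)
  · simp [h2] at h1
  · rw [mem_singleton_iff] at h2; simp [h2] at h1

theorem arc_intervalIntegrable (h : HalfDiscFun r g) {s : ℝ} (hs : 0 < s) (hsr : s ≤ r) :
    IntervalIntegrable (fun α => g (circ s α)) volume 0 Real.pi := by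
  obtain ⟨C, hC, hb⟩ := h.bound
  refine intervalIntegrable_of_bound Real.pi_pos.le (h.circ_cont hs hsr)
    (intervalIntegrable_logWt C _ _) fun α hα hne => ?_
  have h1 := mul_ne_zero hs.ne' (cos_ne_zero_of_mem hα hne)
  rw [← circ_re] at h1
  rw [← logWt_circ hs]
  exact hb _ (circ_mem_halfDisc hs.le hsr hα) (fun h2 => by simp [h2] at h1) h1

theorem norm_ofReal_le (h : HalfDiscFun r g) :
    ∃ C : ℝ, 0 ≤ C ∧ ∀ x : ℝ, |x| ≤ r → x ≠ 0 → ‖g x‖ ≤ C := by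
  obtain ⟨C, hC, hb⟩ := h.bound
  refine ⟨C, hC, fun x hx hx0 => ?_⟩
  have := hb x (ofReal_mem_halfDisc hx) (by exact_mod_cast hx0) (by simpa using hx0)
  rwa [logWt_ofReal, mul_one] at this

theorem seg_cont (h : HalfDiscFun r g) (hr : 0 < r) :
    ContinuousOn (fun x : ℝ => g x) (Icc (-r) r \ {0}) := by
  refine h.cont.comp Complex.continuous_ofReal.continuousOn fun x hx =>
    ⟨ofReal_mem_halfDisc (abs_le.2 hx.1), ?_⟩
  rintro (h2 | h2)
  · exact hx.2 (by exact_mod_cast h2)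
  · rw [mem_singleton_iff] at h2
    have := congrArg Complex.im h2
    simp [hr.ne] at this

theorem seg_intervalIntegrable (h : HalfDiscFun r g) (hr : 0 < r) :
    IntervalIntegrable (fun x : ℝ => g x) volume (-r) r := by
  obtain ⟨C, hC, hb⟩ := h.norm_ofReal_le
  exact intervalIntegrable_of_bound (by linarith) (h.seg_cont hr)
    (intervalIntegrable_const (c := C)) fun x hx hne => hb x (abs_le.2 hx) hne

/-- The boundary of a half annulus. -/
theorem half_annulus (h : HalfDiscFun r g) {ρ s : ℝ} (hρ : 0 < ρ) (hρs : ρ ≤ s) (hs : s < r) :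
    (∫ x in ρ..s, (g x + g (-x : ℝ))) + (∫ α in (0 : ℝ)..Real.pi, g (circ s α) *
      (Complex.I * circ s α)) -
      (∫ α in (0 : ℝ)..Real.pi, g (circ ρ α) * (Complex.I * circ ρ α)) = 0 := by
  have hs0 : 0 < s := hρ.trans_le hρs
  have hr : 0 < r := hs0.trans hs
  have hlog : Real.log ρ ≤ Real.log s := Real.log_le_log hρ hρs
  have hnorm : ∀ w : ℂ, w.re ≤ Real.log s → ‖Complex.exp w‖ ≤ s := fun w hw => by
    rw [Complex.norm_exp, ← Real.exp_log hs0]; exact Real.exp_le_exp.2 hw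
  -- The exponential maps the rectangle [log ρ, log s] × [0, π] onto the half annulus, so Cauchy's
  -- theorem for rectangles applies to the pullback.
  have hcont : ContinuousOn (fun w => g (Complex.exp w) * Complex.exp w)
      ((uIcc (Real.log ρ) (Real.log s)) ×ℂ (uIcc 0 Real.pi)) := by
    refine ContinuousOn.mul (h.cont.comp Complex.continuous_exp.continuousOn fun w hw => ?_)
      Complex.continuous_exp.continuousOn
    rw [uIcc_of_le hlog, uIcc_of_le Real.pi_pos.le] at hw
    have hn := hnorm w hw.1.2
    refine ⟨⟨hn.trans hs.le, ?_⟩, ?_⟩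
    · rw [Complex.exp_im]
      exact mul_nonneg (Real.exp_pos _).le (Real.sin_nonneg_of_mem_Icc hw.2)
    · rintro (h2 | h2)
      · exact Complex.exp_ne_zero _ h2
      · rw [mem_singleton_iff] at h2
        rw [h2] at hn
        simp [abs_of_pos hr] at hn
        linarith
  have hdiff : DifferentiableOn ℂ (fun w => g (Complex.exp w) * Complex.exp w)
      (Ioo (min (Real.log ρ) (Real.log s)) (max (Real.log ρ) (Real.log s)) ×ℂ
        Ioo (min 0 Real.pi) (max 0 Real.pi)) := by
    refine DifferentiableOn.mul (h.diff.comp Complex.differentiable_exp.differentiableOn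
      fun w hw => ?_) Complex.differentiable_exp.differentiableOn
    rw [min_eq_left hlog, max_eq_right hlog, min_eq_left Real.pi_pos.le,
      max_eq_right Real.pi_pos.le] at hw
    refine ⟨(hnorm w hw.1.2.le).trans_lt hs, ?_⟩
    rw [Complex.exp_im]
    exact mul_pos (Real.exp_pos _) (Real.sin_pos_of_mem_Ioo hw.2)
  have key := Complex.integral_boundary_rect_eq_zero_of_continuousOn_of_differentiableOn
    (fun w => g (Complex.exp w) * Complex.exp w) (Real.log ρ : ℂ) (⟨Real.log s, Real.pi⟩ : ℂ)
    (by simpa using hcont) (by simpa using hdiff)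
  simp only [Complex.ofReal_re, Complex.ofReal_im, Complex.ofReal_zero, zero_mul, add_zero] at key
  have himg : Real.exp '' (uIcc (Real.log ρ) (Real.log s)) ⊆ Icc ρ s := by
    rintro _ ⟨x, hx, rfl⟩
    rw [uIcc_of_le hlog] at hx
    exact ⟨(Real.log_le_iff_le_exp hρ).1 hx.1, (Real.le_log_iff_exp_le hs0).1 hx.2⟩
  have hsub : ∀ f : ℝ → ℂ, ContinuousOn f (Icc ρ s) →
      ∫ x in Real.log ρ..Real.log s, (Real.exp x : ℂ) * f (Real.exp x) = ∫ x in ρ..s, f x := by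
    intro f hf
    have := intervalIntegral.integral_deriv_smul_comp' (a := Real.log ρ) (b := Real.log s)
      (f := Real.exp) (f' := Real.exp) (g := f) (fun x _ => Real.hasDerivAt_exp x)
      Real.continuous_exp.continuousOn (hf.mono himg)
    rw [Real.exp_log hρ, Real.exp_log hs0] at this
    rw [← this]
    refine intervalIntegral.integral_congr fun x _ => ?_
    simp [Complex.real_smul]
  have hc1 : ContinuousOn (fun x : ℝ => g x) (Icc ρ s) :=
    (h.seg_cont hr).mono fun x hx => ⟨⟨by linarith [hx.1], by linarith [hx.2]⟩,
      (hρ.trans_le hx.1).ne'⟩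
  have hc2 : ContinuousOn (fun x : ℝ => g (-x : ℝ)) (Icc ρ s) :=
    (h.seg_cont hr).comp continuous_neg.continuousOn fun x hx =>
      ⟨⟨by linarith [hx.2], by linarith [hx.1]⟩, neg_ne_zero.2 (hρ.trans_le hx.1).ne'⟩
  have e1 : (∫ x in Real.log ρ..Real.log s, g (Complex.exp x) * Complex.exp x) =
      ∫ x in ρ..s, g x := by
    rw [← hsub _ hc1]
    refine intervalIntegral.integral_congr fun x _ => ?_
    simp [mul_comm]
  have e2 : (∫ x in Real.log ρ..Real.log s, g (Complex.exp (x + Real.pi * Complex.I)) *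
      Complex.exp (x + Real.pi * Complex.I)) = -∫ x in ρ..s, g (-x : ℝ) := by
    rw [← hsub _ hc2, ← intervalIntegral.integral_neg]
    refine intervalIntegral.integral_congr fun x _ => ?_
    simp only [Complex.exp_add, Complex.exp_pi_mul_I, Complex.ofReal_neg, Complex.ofReal_exp,
      mul_neg, mul_one]
    ring
  have e3 : ∀ u : ℝ, 0 < u → Complex.I • (∫ y in (0 : ℝ)..Real.pi, g (Complex.exp (Real.log u +
      y * Complex.I)) * Complex.exp (Real.log u + y * Complex.I)) =
      ∫ α in (0 : ℝ)..Real.pi, g (circ u α) * (Complex.I * circ u α) := fun u hu => by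
    rw [← intervalIntegral.integral_smul]
    refine intervalIntegral.integral_congr fun y _ => ?_
    have : Complex.exp (Real.log u + y * Complex.I) = circ u y := by
      rw [Complex.exp_add, ← Complex.ofReal_exp, Real.exp_log hu, circ, mul_comm Complex.I]
    simp only [this, smul_eq_mul]; ring
  rw [e1, e2, e3 s hs0, e3 ρ hρ] at key
  have hi1 : IntervalIntegrable (fun x : ℝ => g x) volume ρ s :=
    ContinuousOn.intervalIntegrable (by rwa [uIcc_of_le hρs])
  have hi2 : IntervalIntegrable (fun x : ℝ => g (-x : ℝ)) volume ρ s :=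
    ContinuousOn.intervalIntegrable (by rwa [uIcc_of_le hρs])
  rw [intervalIntegral.integral_add hi1 hi2]
  linear_combination key

/-- Cauchy's theorem. -/
theorem bdInt_eq_zero (h : HalfDiscFun r g) (hr : 0 < r) : bdInt r g = 0 := by
  have hi := h.seg_intervalIntegrable hr
  have hi1 : IntervalIntegrable (fun x : ℝ => g x) volume 0 r :=
    hi.mono_set (by rw [uIcc_of_le hr.le, uIcc_of_le (by linarith)]
                    exact Icc_subset_Icc (by linarith) le_rfl)
  have hi2 : IntervalIntegrable (fun x : ℝ => g x) volume (-r) 0 :=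
    hi.mono_set (by rw [uIcc_of_le (by linarith), uIcc_of_le (by linarith)]
                    exact Icc_subset_Icc le_rfl hr.le)
  have hi3 : IntervalIntegrable (fun x : ℝ => g (-x : ℝ)) volume 0 r := by
    have := (hi2.comp_sub_left 0).symm
    simpa using this
  set g1 : ℝ → ℂ := fun x => g x + g (-x : ℝ) with hg1
  have hgi : IntervalIntegrable g1 volume 0 r := hi1.add hi3
  set A : ℝ → ℂ := fun s => ∫ α in (0 : ℝ)..Real.pi, g (circ s α) * (Complex.I * circ s α) with hA
  have hsplit : bdInt r g = (∫ x in (0 : ℝ)..r, g1 x) + A r := by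
    rw [bdInt, ← intervalIntegral.integral_add_adjacent_intervals hi2 hi1, hg1,
      intervalIntegral.integral_add hi1 hi3]
    have : ∫ x in (0 : ℝ)..r, g (-x : ℝ) = ∫ x in (-r)..0, g x := by
      have := intervalIntegral.integral_comp_neg (a := 0) (b := r) (fun x : ℝ => g x)
      simpa using this
    rw [this]; ring
  obtain ⟨C, hC, hb⟩ := h.bound
  have hcirc : ∀ s, 0 < s → s ≤ r → ∀ α ∈ Icc 0 Real.pi, α ≠ Real.pi / 2 → ‖g (circ s α)‖ ≤
      C * (1 + |Real.log (Real.cos α)|) := fun s hs hsr α hα hne => by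
    have h1 := mul_ne_zero hs.ne' (cos_ne_zero_of_mem hα hne)
    rw [← circ_re] at h1
    rw [← logWt_circ hs]
    exact hb _ (circ_mem_halfDisc hs.le hsr hα) (fun h2 => by simp [h2] at h1) h1
  have hae : ∀ᵐ α : ℝ, α ≠ Real.pi / 2 := by simp [ae_iff]
  have hUI : uIoc (0 : ℝ) Real.pi ⊆ Icc 0 Real.pi := by
    rw [uIoc_of_le Real.pi_pos.le]; exact Ioc_subset_Icc_self
  have hsα : ∀ s, 0 ≤ s → s ≤ r → ∀ α ∈ Icc 0 Real.pi, α ≠ Real.pi / 2 →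
      ‖g (circ s α) * (Complex.I * circ s α)‖ ≤ s * (C * (1 + |Real.log (Real.cos α)|)) := by
    intro s hs hsr α hα hne
    rcases hs.eq_or_lt with rfl | hs0
    · simp [circ]
    · rw [norm_mul, norm_mul, Complex.norm_I, one_mul, norm_circ hs, mul_comm]
      exact mul_le_mul_of_nonneg_left (hcirc s hs0 hsr α hα hne) hs
  -- Dominated convergence in the radius, down to s = 0 and up to s = r, with a bound that does not
  -- depend on the radius.
  have hAc : ContinuousOn A (Icc 0 r) := by
    intro s0 hs0
    refine intervalIntegral.continuousWithinAt_of_dominated_interval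
      (bound := fun α => r * (C * (1 + |Real.log (Real.cos α)|))) ?_ ?_
      ((intervalIntegrable_logWt C _ _).const_mul r) ?_
    · filter_upwards [self_mem_nhdsWithin] with s hs
      rcases hs.1.eq_or_lt with rfl | hs1
      · simpa [circ] using aestronglyMeasurable_const
      · have h1 := (intervalIntegrable_iff.1 (h.arc_intervalIntegrable hs1 hs.2)).aestronglyMeasurable
        have := continuous_circ s
        exact h1.mul (Continuous.aestronglyMeasurable (by fun_prop))
    · filter_upwards [self_mem_nhdsWithin] with s hs
      filter_upwards [hae] with α hne hα
      refine (hsα s hs.1 hs.2 α (hUI hα) hne).trans ?_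
      have := hs.2
      gcongr
    · filter_upwards [hae] with α hne hα
      have hcs : Continuous fun s : ℝ => circ s α := by unfold circ; fun_prop
      rcases hs0.1.eq_or_lt with rfl | hs1
      · have h0 : g (circ 0 α) * (Complex.I * circ 0 α) = 0 := by simp [circ]
        rw [ContinuousWithinAt, h0]
        refine squeeze_zero_norm' (a := fun s => s * (C * (1 + |Real.log (Real.cos α)|))) ?_ ?_
        · filter_upwards [self_mem_nhdsWithin] with s hs
          exact hsα s hs.1 hs.2 α (hUI hα) hne
        · have : Continuous fun s : ℝ => s * (C * (1 + |Real.log (Real.cos α)|)) := by fun_prop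
          have h2 := (this.tendsto 0).mono_left (nhdsWithin_le_nhds (s := Icc 0 r))
          rwa [zero_mul] at h2
      · refine ContinuousWithinAt.mul ?_ (by fun_prop)
        have h1 := mul_ne_zero hs1.ne' (cos_ne_zero_of_mem (hUI hα) hne)
        rw [← circ_re] at h1
        have hmem : circ s0 α ∈ halfDisc r \ {0, Complex.I * r} := by
          refine ⟨circ_mem_halfDisc hs0.1 hs0.2 (hUI hα), ?_⟩
          rintro (h2 | h2)
          · simp [h2] at h1
          · rw [mem_singleton_iff] at h2; simp [h2] at h1
        refine ContinuousWithinAt.mono_of_mem_nhdsWithin (t := Icc 0 r ∩ Ioi 0)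
          (ContinuousWithinAt.comp (t := halfDisc r \ {0, Complex.I * r}) (h.cont _ hmem)
          hcs.continuousWithinAt ?_) (inter_mem self_mem_nhdsWithin
            (mem_nhdsWithin_of_mem_nhds (Ioi_mem_nhds hs1)))
        intro s hs
        have h1 := mul_ne_zero (ne_of_gt hs.2) (cos_ne_zero_of_mem (hUI hα) hne)
        rw [← circ_re] at h1
        refine ⟨circ_mem_halfDisc hs.1.1 hs.1.2 (hUI hα), ?_⟩
        rintro (h2 | h2)
        · simp [h2] at h1
        · rw [mem_singleton_iff] at h2; simp [h2] at h1
  have hPc : ContinuousOn (fun s => ∫ x in (0 : ℝ)..s, g1 x) (Icc 0 r) := by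
    have := intervalIntegral.continuousOn_primitive_interval' hgi left_mem_uIcc
    rwa [uIcc_of_le hr.le] at this
  -- The difference of the values at two radii is the integral around a half annulus. The common
  -- value is found by continuity at s = 0, where both terms vanish.
  have hconst : EqOn (fun s => (∫ x in (0 : ℝ)..s, g1 x) + A s)
      (fun _ => (∫ x in (0 : ℝ)..(r / 2), g1 x) + A (r / 2)) (Ioo 0 r) := by
    have hI : ∀ a b, a ∈ Icc 0 r → b ∈ Icc 0 r → IntervalIntegrable g1 volume a b :=
      fun a b ha hb => hgi.mono_set (by
        rw [uIcc_of_le hr.le]; exact (convex_Icc 0 r).ordConnected.uIcc_subset ha hb)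
    have hann : ∀ ρ s, 0 < ρ → ρ ≤ s → s < r →
        (∫ x in (0 : ℝ)..s, g1 x) + A s = (∫ x in (0 : ℝ)..ρ, g1 x) + A ρ := by
      intro ρ s h1 h2 h3
      have := h.half_annulus h1 h2 h3
      rw [← intervalIntegral.integral_add_adjacent_intervals (b := ρ)
        (hI 0 ρ ⟨le_rfl, hr.le⟩ ⟨h1.le, (h2.trans h3.le)⟩)
        (hI ρ s ⟨h1.le, (h2.trans h3.le)⟩ ⟨h1.le.trans h2, h3.le⟩)]
      linear_combination this
    intro s hs
    rcases le_total s (r / 2) with h1 | h1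
    · exact (hann s (r / 2) hs.1 h1 (by linarith)).symm
    · exact hann (r / 2) s (by linarith) h1 hs.2
  have hall := hconst.of_subset_closure (hPc.add hAc) continuousOn_const Ioo_subset_Icc_self
    (closure_Ioo hr.ne).ge
  have e0 := hall ⟨le_rfl, hr.le⟩
  have er := hall ⟨hr.le, le_rfl⟩
  simp only at e0 er
  rw [hsplit, er, ← e0]
  simp [hA, circ]

end HalfDiscFun

/-! ### Cauchy's formula on a half disc -/

theorem isOpen_openHalfDisc (r : ℝ) : IsOpen (openHalfDisc r) :=
  (isOpen_lt continuous_norm continuous_const).inter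
    (isOpen_lt continuous_const Complex.continuous_im)

theorem isClosed_halfDisc (r : ℝ) : IsClosed (halfDisc r) :=
  (isClosed_le continuous_norm continuous_const).inter
    (isClosed_le continuous_const Complex.continuous_im)

theorem openHalfDisc_subset {r : ℝ} : openHalfDisc r ⊆ halfDisc r \ {0, Complex.I * r} := by
  intro η hη
  refine ⟨⟨hη.1.le, hη.2.le⟩, ?_⟩
  rintro (h | h)
  · have := hη.2; rw [h] at this; simp at this
  · have h1 := hη.1
    have h2 := hη.2
    rw [mem_singleton_iff] at h
    rw [h] at h1 h2
    simp at h1 h2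
    rw [abs_of_pos h2] at h1
    exact lt_irrefl _ h1

namespace HalfDiscFun

variable {r : ℝ} {g : ℂ → ℂ}

theorem const (r : ℝ) (c : ℂ) : HalfDiscFun r fun _ => c where
  diff := differentiableOn_const c
  cont := continuousOn_const
  bound := ⟨‖c‖, norm_nonneg _, fun η _ _ _ =>
    le_mul_of_one_le_right (norm_nonneg _) (one_le_logWt η)⟩

theorem sub {g' : ℂ → ℂ} (h : HalfDiscFun r g) (h' : HalfDiscFun r g') :
    HalfDiscFun r fun η => g η - g' η where
  diff := h.diff.sub h'.diff
  cont := h.cont.sub h'.cont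
  bound := by
    obtain ⟨C, hC, hb⟩ := h.bound
    obtain ⟨C', hC', hb'⟩ := h'.bound
    refine ⟨C + C', add_nonneg hC hC', fun η h1 h2 h3 => ?_⟩
    rw [add_mul]
    exact (norm_sub_le _ _).trans (add_le_add (hb η h1 h2 h3) (hb' η h1 h2 h3))

theorem mul_bounded {m : ℂ → ℂ} (h : HalfDiscFun r g) (hd : DifferentiableOn ℂ m (openHalfDisc r))
    (hc : ContinuousOn m (halfDisc r \ {0, Complex.I * r})) {K : ℝ}
    (hK : ∀ η ∈ halfDisc r, ‖m η‖ ≤ K) : HalfDiscFun r fun η => g η * m η where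
  diff := h.diff.mul hd
  cont := h.cont.mul hc
  bound := by
    obtain ⟨C, hC, hb⟩ := h.bound
    refine ⟨C * |K|, by positivity, fun η h1 h2 h3 => ?_⟩
    rw [norm_mul, mul_right_comm]
    have := hb η h1 h2 h3
    have h4 := (hK η h1).trans (le_abs_self K)
    exact mul_le_mul this h4 (norm_nonneg _) ((norm_nonneg _).trans this)

theorem div_sub (h : HalfDiscFun r g) {w : ℂ} (hw : w ∉ halfDisc r) :
    HalfDiscFun r fun η => g η / (η - w) := by
  have hne : ∀ η ∈ halfDisc r, η - w ≠ 0 := fun η hη h0 => hw (sub_eq_zero.1 h0 ▸ hη)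
  obtain ⟨δ, hδ, hball⟩ := Metric.isOpen_iff.1 (isClosed_halfDisc r).isOpen_compl w hw
  have hd : ∀ η ∈ halfDisc r, δ ≤ ‖η - w‖ := fun η hη => by
    by_contra! h1
    exact hball (by rwa [Metric.mem_ball, dist_eq_norm]) hη
  have := h.mul_bounded (m := fun η => (η - w)⁻¹) (K := δ⁻¹)
    (DifferentiableOn.inv (by fun_prop) fun η hη => hne η (openHalfDisc_subset hη).1)
    (ContinuousOn.inv₀ (by fun_prop) fun η hη => hne η hη.1) (fun η hη => by
      rw [norm_inv]
      exact inv_anti₀ hδ (hd η hη))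
  simpa only [div_eq_mul_inv] using this

theorem bdInt_div_sub_eq_zero (h : HalfDiscFun r g) (hr : 0 < r) {w : ℂ} (hw : w ∉ halfDisc r) :
    bdInt r (fun η => g η / (η - w)) = 0 := (h.div_sub hw).bdInt_eq_zero hr

end HalfDiscFun

/-- The full circle gives 2πi. The boundary of the lower half disc contributes nothing, being the
mirror image of the upper one with conj w outside. Subtracting it leaves the upper half disc. -/
theorem bdInt_inv_sub {r : ℝ} {w : ℂ} (hw : w ∈ openHalfDisc r) :
    bdInt r (fun η => 1 / (η - w)) = 2 * Real.pi * Complex.I := by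
  have hr : 0 < r := (norm_nonneg w).trans_lt hw.1
  have hw' : conj w ∉ halfDisc r := fun h => by
    have := h.2; rw [Complex.conj_im] at this; linarith [hw.2]
  have h1 := congrArg conj ((HalfDiscFun.const r 1).bdInt_div_sub_eq_zero hr hw')
  have hne : ∀ α, circ r α - w ≠ 0 := fun α h => by
    have := hw.1; rw [← sub_eq_zero.1 h, norm_circ hr.le] at this; exact lt_irrefl _ this
  have hi : ∀ a b, IntervalIntegrable (fun α => 1 / (circ r α - w) * (Complex.I * circ r α))
      volume a b := fun a b => by
    refine Continuous.intervalIntegrable ?_ _ _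
    have := continuous_circ r
    exact (continuous_const.div (by fun_prop) hne).mul (by fun_prop)
  have h2 : (∫ x in (-r)..r, 1 / ((x : ℂ) - w)) -
      (∫ α in (-Real.pi)..0, 1 / (circ r α - w) * (Complex.I * circ r α)) = 0 := by
    rw [bdInt, map_add, map_zero, ← intervalIntegral.intervalIntegral_conj, ← intervalIntegral.intervalIntegral_conj] at h1
    rw [← h1, sub_eq_add_neg]
    congr 1
    · refine intervalIntegral.integral_congr fun x _ => ?_
      simp
    · have := intervalIntegral.integral_comp_neg (a := 0) (b := Real.pi)
        (fun α => 1 / (circ r α - w) * (Complex.I * circ r α))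
      rw [neg_zero] at this
      rw [← this, ← intervalIntegral.integral_neg]
      refine intervalIntegral.integral_congr fun α _ => ?_
      simp [conj_circ]
  have h3 := circleIntegral.integral_sub_inv_of_mem_ball (c := 0) (w := w) (R := r)
    (by simpa using hw.1)
  rw [circleIntegral] at h3
  have h4 : (∫ α in (-Real.pi)..Real.pi, 1 / (circ r α - w) * (Complex.I * circ r α)) =
      2 * Real.pi * Complex.I := by
    rw [← h3]
    have hp : Function.Periodic (fun α => 1 / (circ r α - w) * (Complex.I * circ r α))
        (2 * Real.pi) := fun α => by
      have : circ r (α + 2 * Real.pi) = circ r α := by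
        simp only [circ]
        push_cast
        rw [mul_add, Complex.exp_add]
        have : Complex.I * (2 * (Real.pi : ℂ)) = 2 * Real.pi * Complex.I := by ring
        rw [this, Complex.exp_two_pi_mul_I, mul_one]
      simp only [this]
    have e := hp.intervalIntegral_add_eq (-Real.pi) 0
    rw [zero_add, show -Real.pi + 2 * Real.pi = Real.pi by ring] at e
    rw [e]
    refine intervalIntegral.integral_congr fun α _ => ?_
    simp only [deriv_circleMap, circleMap, circ, smul_eq_mul, zero_add, one_div, mul_comm Complex.I]
    ring
  rw [← intervalIntegral.integral_add_adjacent_intervals (hi (-Real.pi) 0) (hi 0 Real.pi)] at h4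
  rw [bdInt]
  linear_combination h2 + h4

namespace HalfDiscFun

variable {r : ℝ} {g : ℂ → ℂ}

/-- Cauchy's formula. -/
theorem bdInt_div_sub (h : HalfDiscFun r g) {w : ℂ} (hw : w ∈ openHalfDisc r) :
    bdInt r (fun η => g η / (η - w)) = 2 * Real.pi * Complex.I * g w := by
  have hr : 0 < r := (norm_nonneg w).trans_lt hw.1
  have hU : openHalfDisc r ∈ 𝓝 w := (isOpen_openHalfDisc r).mem_nhds hw
  have hS : halfDisc r \ {0, Complex.I * r} ∈ 𝓝 w := mem_of_superset hU openHalfDisc_subset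
  have hds : ∀ η, η ≠ w → dslope g w η = (g η - g w) / (η - w) := fun η hη => by
    rw [dslope_of_ne _ hη, slope_def_field]
  have hdw : DifferentiableAt ℂ g w := h.diff.differentiableAt hU
  -- Cauchy's theorem is applied to the slope of g at w. It is bounded near w by continuity; away
  -- from w, division by η - w costs a constant.
  have hfun : HalfDiscFun r (dslope g w) := by
    have hcont := (continuousOn_dslope hS).2 ⟨h.cont, hdw⟩
    refine ⟨(Complex.differentiableOn_dslope hU).2 h.diff, hcont, ?_⟩
    obtain ⟨C, hC, hb⟩ := h.bound
    have hca : ContinuousAt (dslope g w) w := hcont.continuousAt hS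
    obtain ⟨δ, hδ, hball⟩ := Metric.mem_nhds_iff.1
      (hca.norm.eventually_le_const (lt_add_one _))
    refine ⟨(‖dslope g w w‖ + 1) + (C + ‖g w‖) / δ, by positivity, fun η h1 h2 h3 => ?_⟩
    have hl := one_le_logWt η
    by_cases hη : ‖η - w‖ < δ
    · have : ‖dslope g w η‖ ≤ ‖dslope g w w‖ + 1 := hball (by rwa [Metric.mem_ball, dist_eq_norm])
      refine this.trans ?_
      refine le_trans (le_add_of_nonneg_right (by positivity)) (le_mul_of_one_le_right ?_ hl)
      positivity
    · rw [not_lt] at hη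
      have hne : η ≠ w := fun h0 => by rw [h0, sub_self, norm_zero] at hη; linarith
      rw [hds η hne, norm_div, add_mul]
      refine le_trans ?_ (le_add_of_nonneg_left (by positivity))
      have e1 : ‖g η - g w‖ ≤ (C + ‖g w‖) * logWt η := by
        rw [add_mul]
        exact (norm_sub_le _ _).trans (add_le_add (hb η h1 h2 h3)
          (le_mul_of_one_le_right (norm_nonneg _) hl))
      rw [div_mul_eq_mul_div]
      exact div_le_div₀ (by positivity) e1 hδ hη
  have hnc : ∀ α, circ r α ≠ w := fun α h0 => by
    have := hw.1; rw [← h0, norm_circ hr.le] at this; exact lt_irrefl _ this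
  have hnr : ∀ x : ℝ, (x : ℂ) ≠ w := fun x h0 => by
    have := hw.2; rw [← h0] at this; simp at this
  have h1 := bdInt_inv_sub hw
  have h0 := hfun.bdInt_eq_zero hr
  have hi1 := hfun.seg_intervalIntegrable hr
  have hi2 := hfun.arc_intervalIntegrable hr le_rfl
  have hcc := continuous_circ r
  have hi3 : IntervalIntegrable (fun x : ℝ => 1 / ((x : ℂ) - w)) volume (-r) r :=
    Continuous.intervalIntegrable (continuous_const.div (by fun_prop)
      fun x => sub_ne_zero.2 (hnr x)) _ _
  have hi4 : IntervalIntegrable (fun α : ℝ => 1 / (circ r α - w) * (Complex.I * circ r α)) volume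
      0 Real.pi :=
    Continuous.intervalIntegrable ((continuous_const.div (by fun_prop)
      fun x => sub_ne_zero.2 (hnc x)).mul (by fun_prop)) _ _
  have hi5 : IntervalIntegrable (fun α : ℝ => dslope g w (circ r α) * (Complex.I * circ r α)) volume
      0 Real.pi := hi2.mul_continuousOn (by fun_prop)
  have e1 : (∫ x in (-r)..r, g x / ((x : ℂ) - w)) = (∫ x in (-r)..r, dslope g w x) +
      g w * ∫ x in (-r)..r, 1 / ((x : ℂ) - w) := by
    rw [← intervalIntegral.integral_const_mul, ← intervalIntegral.integral_add hi1
      (hi3.const_mul _)]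
    refine intervalIntegral.integral_congr fun x _ => ?_
    simp only [hds _ (hnr x)]
    ring
  have e2 : (∫ α in (0 : ℝ)..Real.pi, g (circ r α) / (circ r α - w) * (Complex.I * circ r α)) =
      (∫ α in (0 : ℝ)..Real.pi, dslope g w (circ r α) * (Complex.I * circ r α)) +
      g w * ∫ α in (0 : ℝ)..Real.pi, 1 / (circ r α - w) * (Complex.I * circ r α) := by
    rw [← intervalIntegral.integral_const_mul, ← intervalIntegral.integral_add hi5
      (hi4.const_mul _)]
    refine intervalIntegral.integral_congr fun α _ => ?_
    simp only [hds _ (hnc α)]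
    ring
  rw [bdInt] at h0 h1 ⊢
  rw [e1, e2]
  linear_combination h0 + g w * h1

/-- A function that vanishes at the origin to first order can be divided by `η`. -/
theorem div_id (h : HalfDiscFun r g) {δ K : ℝ} (hδ : 0 < δ)
    (hK : ∀ η ∈ halfDisc r, ‖η‖ < δ → ‖g η‖ ≤ K * ‖η‖) : HalfDiscFun r fun η => g η / η where
  diff := h.diff.div differentiableOn_id fun η hη h0 => (openHalfDisc_subset hη).2 (Or.inl h0)
  cont := h.cont.div continuousOn_id fun η hη h0 => hη.2 (Or.inl h0)
  bound := by
    obtain ⟨C, hC, hb⟩ := h.bound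
    refine ⟨|K| + C / δ, by positivity, fun η h1 h2 h3 => ?_⟩
    have hl := one_le_logWt η
    have hη0 : 0 < ‖η‖ := norm_pos_iff.2 h2
    rw [norm_div]
    by_cases hη : ‖η‖ < δ
    · have : ‖g η‖ / ‖η‖ ≤ |K| := by
        rw [div_le_iff₀ hη0]
        exact (hK η h1 hη).trans (by gcongr; exact le_abs_self K)
      refine this.trans (le_trans (le_add_of_nonneg_right (by positivity))
        (le_mul_of_one_le_right (by positivity) hl))
    · rw [not_lt] at hη
      rw [add_mul]
      refine le_trans ?_ (le_add_of_nonneg_left (by positivity))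
      rw [div_mul_eq_mul_div]
      exact div_le_div₀ (by positivity) (hb η h1 h2 h3) hδ hη

end HalfDiscFun

/-! ### Logarithms on a half disc -/

/-- A retraction of the plane onto the half disc. -/
noncomputable def toHalfDisc (r : ℝ) (η : ℂ) : ℂ :=
  ((r / max r ‖(⟨η.re, max η.im 0⟩ : ℂ)‖ : ℝ) : ℂ) * ⟨η.re, max η.im 0⟩

theorem toHalfDisc_mem {r : ℝ} (hr : 0 < r) (η : ℂ) : toHalfDisc r η ∈ halfDisc r := by
  set w : ℂ := ⟨η.re, max η.im 0⟩ with hw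
  have hm : 0 < max r ‖w‖ := lt_max_of_lt_left hr
  refine ⟨?_, ?_⟩
  · rw [toHalfDisc, norm_mul, Complex.norm_real, Real.norm_of_nonneg (by positivity),
      div_mul_eq_mul_div, div_le_iff₀ hm]
    exact mul_le_mul_of_nonneg_left (le_max_right _ _) hr.le
  · rw [toHalfDisc, Complex.im_ofReal_mul]
    exact mul_nonneg (by positivity) (le_max_right _ _)

theorem toHalfDisc_of_mem {r : ℝ} (hr : 0 < r) {η : ℂ} (h : η ∈ halfDisc r) :
    toHalfDisc r η = η := by
  have e : (⟨η.re, max η.im 0⟩ : ℂ) = η := Complex.ext rfl (max_eq_left h.2)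
  rw [toHalfDisc, e, max_eq_left h.1, div_self hr.ne', Complex.ofReal_one, one_mul]

theorem continuous_toHalfDisc {r : ℝ} (hr : 0 < r) : Continuous (toHalfDisc r) := by
  have h1 : Continuous fun η : ℂ => (⟨η.re, max η.im 0⟩ : ℂ) := by
    have : (fun η : ℂ => (⟨η.re, max η.im 0⟩ : ℂ)) =
        fun η : ℂ => (η.re : ℂ) + (max η.im 0 : ℝ) * Complex.I := by
      funext η; apply Complex.ext <;> simp
    rw [this]; fun_prop
  unfold toHalfDisc
  refine (Complex.continuous_ofReal.comp (continuous_const.div (continuous_const.max h1.norm)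
    fun η => (lt_max_of_lt_left hr).ne')).mul h1

/-- A continuous function without zeros on the half disc has a continuous logarithm. -/
theorem exists_log_halfDisc {r : ℝ} (hr : 0 < r) {f : ℂ → ℂ} (hf : ContinuousOn f (halfDisc r))
    (h0 : ∀ η ∈ halfDisc r, f η ≠ 0) :
    ∃ l : ℂ → ℂ, Continuous l ∧ ∀ η ∈ halfDisc r, Complex.exp (l η) = f η := by
  -- The retraction turns f into a nowhere vanishing function on the simply connected plane, which
  -- lifts through the covering `Complex.exp`.
  have hc : Continuous (f ∘ toHalfDisc r) :=
    hf.comp_continuous (continuous_toHalfDisc hr) (toHalfDisc_mem hr)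
  obtain ⟨l, ⟨-, hl⟩, -⟩ := Complex.isCoveringMapOn_exp.existsUnique_continuousMap_lifts
    (⟨f ∘ toHalfDisc r, hc⟩ : C(ℂ, ℂ)) (a₀ := 0) (Complex.exp_log (h0 _ (toHalfDisc_mem hr 0)))
    (fun η => h0 _ (toHalfDisc_mem hr η))
  refine ⟨l, l.continuous, fun η hη => ?_⟩
  have := congrFun hl η
  simpa [toHalfDisc_of_mem hr hη] using this

/-- A continuous logarithm of a differentiable function is differentiable. -/
theorem differentiableAt_of_exp {l f : ℂ → ℂ} {w : ℂ} (hl : ContinuousAt l w)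
    (hf : DifferentiableAt ℂ f w) (h : ∀ᶠ z in 𝓝 w, Complex.exp (l z) = f z) :
    DifferentiableAt ℂ l w := by
  have h1 : ∀ᶠ z in 𝓝 w, |(l z - l w).im| < Real.pi := by
    have : ContinuousAt (fun z => |(l z - l w).im|) w :=
      (Complex.continuous_im.continuousAt.comp (hl.sub continuousAt_const)).abs
    refine this.eventually_lt_const ?_
    simpa using Real.pi_pos
  -- Near w the increment of l has small imaginary part, so it is the principal logarithm of f/f(w).
  have h2 : l =ᶠ[𝓝 w] fun z => l w + Complex.log (f z / f w) := by
    filter_upwards [h, h1] with z hz hz'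
    rw [abs_lt] at hz'
    rw [← hz, ← h.self_of_nhds, ← Complex.exp_sub, Complex.log_exp hz'.1 hz'.2.le]
    ring
  have hw : f w ≠ 0 := by rw [← h.self_of_nhds]; exact Complex.exp_ne_zero _
  refine DifferentiableAt.congr_of_eventuallyEq ?_ h2
  refine (differentiableAt_const _).add (DifferentiableAt.clog (hf.div_const _) ?_)
  rw [div_self hw]
  exact Complex.one_mem_slitPlane

section

variable {r : ℝ} (hr : 0 < r)
include hr

omit hr in
theorem branch_re (η : ℂ) : (1 + Complex.I * η / r).re = 1 - η.im / r := by
  rw [Complex.add_re, Complex.div_ofReal_re]; simp; ring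

omit hr in
theorem branch_im (η : ℂ) : (1 + Complex.I * η / r).im = η.re / r := by
  rw [Complex.add_im, Complex.div_ofReal_im]; simp

theorem branch_slitPlane {η : ℂ} (hη : η ∈ halfDisc r) (hne : η ≠ Complex.I * r) :
    1 + Complex.I * η / r ∈ Complex.slitPlane := by
  rw [Complex.mem_slitPlane_iff, branch_re, branch_im]
  by_cases h : η.re = 0
  · left
    have h1 : η.im ≤ r := (Complex.im_le_norm η).trans hη.1
    have h2 : η.im ≠ r := fun h2 => hne (Complex.ext (by simp [h]) (by simp [h2]))
    rw [sub_pos, div_lt_one hr]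
    exact lt_of_le_of_ne h1 h2
  · right
    exact div_ne_zero h hr.ne'

/-- The squared modulus of 1 + iη/r equals (|η|/r - Im η/|η|)² + (Re η/|η|)², so it is at least the
squared cosine of the argument of η. This is where `logWt` comes from. -/
theorem norm_log_branch_le {η : ℂ} (hη : η ∈ halfDisc r) (h0 : η ≠ 0) (hre : η.re ≠ 0) :
    ‖Complex.log (1 + Complex.I * η / r)‖ ≤ (Real.log 2 + 1 + Real.pi) * logWt η := by
  set u := 1 + Complex.I * η / r with hu
  have hs : 0 < ‖η‖ := norm_pos_iff.2 h0
  have hsq : ‖η‖ ^ 2 = η.re ^ 2 + η.im ^ 2 := by rw [Complex.sq_norm, Complex.normSq_apply]; ring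
  have hu2 : ‖u‖ ^ 2 = (‖η‖ / r - η.im / ‖η‖) ^ 2 + (η.re / ‖η‖) ^ 2 := by
    rw [Complex.sq_norm, Complex.normSq_apply, hu, branch_re, branch_im]
    field_simp
    linear_combination (r ^ 2 - ‖η‖ ^ 2) * hsq
  have hlow : |η.re / ‖η‖| ≤ ‖u‖ := by
    rw [← abs_of_nonneg (norm_nonneg u)]
    refine sq_le_sq.1 ?_
    rw [hu2]; nlinarith [sq_nonneg (‖η‖ / r - η.im / ‖η‖)]
  have hupp : ‖u‖ ≤ 2 := by
    refine (norm_add_le _ _).trans ?_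
    rw [norm_one, norm_div, norm_mul, Complex.norm_I, one_mul, Complex.norm_real,
      Real.norm_of_nonneg hr.le]
    have := (div_le_one hr).2 hη.1
    linarith
  have hp : 0 < |η.re / ‖η‖| := abs_pos.2 (div_ne_zero hre hs.ne')
  have h2 : 0 ≤ Real.log 2 := Real.log_nonneg one_le_two
  have hlog : |Real.log ‖u‖| ≤ Real.log 2 + |Real.log (η.re / ‖η‖)| := by
    rw [abs_le]
    have a1 := Real.log_le_log hp hlow
    rw [Real.log_abs] at a1
    have a2 := Real.log_le_log (hp.trans_le hlow) hupp
    constructor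
    · linarith [neg_abs_le (Real.log (η.re / ‖η‖))]
    · linarith [abs_nonneg (Real.log (η.re / ‖η‖))]
  refine (Complex.norm_le_abs_re_add_abs_im _).trans ?_
  rw [Complex.log_re, Complex.log_im]
  have h3 := Complex.abs_arg_le_pi u
  have hpi := Real.pi_pos
  rw [logWt]
  nlinarith [abs_nonneg (Real.log (η.re / ‖η‖)), mul_nonneg h2 (abs_nonneg (Real.log (η.re / ‖η‖))),
    mul_nonneg hpi.le (abs_nonneg (Real.log (η.re / ‖η‖)))]

omit hr in
theorem exists_norm_le_halfDisc {f : ℂ → ℂ} (hf : Continuous f) :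
    ∃ C : ℝ, 0 ≤ C ∧ ∀ η ∈ halfDisc r, ‖f η‖ ≤ C := by
  have hcomp : IsCompact (halfDisc r) :=
    Metric.isCompact_of_isClosed_isBounded (isClosed_halfDisc r)
      ((Metric.isBounded_closedBall (x := (0 : ℂ)) (r := r)).subset fun η hη => by
        simpa using hη.1)
  obtain ⟨C, hC⟩ := hcomp.exists_bound_of_continuousOn hf.continuousOn
  exact ⟨|C|, abs_nonneg _, fun η hη => (hC η hη).trans (le_abs_self C)⟩

/-- A function without zeros on the half disc that has at most a pole at the top has a logarithm
with at most a logarithmic singularity. -/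
theorem exists_log_of_pole {f : ℂ → ℂ} (hd : DifferentiableOn ℂ f (openHalfDisc r))
    (hc : ContinuousOn f (halfDisc r \ {Complex.I * (r : ℂ)}))
    (h0 : ∀ η ∈ halfDisc r \ {Complex.I * (r : ℂ)}, f η ≠ 0) {n : ℕ} {L : ℂ} (hL : L ≠ 0)
    (hl : Tendsto (fun η => f η * (1 + Complex.I * η / r) ^ n)
      (𝓝[halfDisc r \ {Complex.I * (r : ℂ)}] (Complex.I * r)) (𝓝 L)) :
    ∃ l : ℂ → ℂ, HalfDiscFun r l ∧ ContinuousOn l (halfDisc r \ {Complex.I * (r : ℂ)}) ∧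
      ∀ η ∈ halfDisc r \ {Complex.I * (r : ℂ)}, Complex.exp (l η) = f η := by
  classical
  set p : ℂ := Complex.I * r with hp
  have hslit : ∀ η ∈ halfDisc r \ {p}, 1 + Complex.I * η / r ∈ Complex.slitPlane := fun η hη =>
    branch_slitPlane hr hη.1 hη.2
  -- The factor (1 + iη/r)ⁿ cancels the pole, and F takes the nonzero limit at the top. A logarithm
  -- of f is then one of F minus n times the principal logarithm of that factor, which stays in the
  -- slit plane.
  set F : ℂ → ℂ := Function.update (fun η => f η * (1 + Complex.I * η / r) ^ n) p L with hF
  have hFne : ∀ η, η ≠ p → F η = f η * (1 + Complex.I * η / r) ^ n := fun η hη =>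
    Function.update_of_ne hη _ _
  have hFp : F p = L := Function.update_self _ _ _
  have hFc : ContinuousOn F (halfDisc r) := by
    rw [hF, continuousOn_update_iff]
    exact ⟨hc.mul (by fun_prop), fun _ => hl⟩
  obtain ⟨lc, hlc, hle⟩ := exists_log_halfDisc hr hFc (fun η hη => by
    by_cases h : η = p
    · rw [h, hFp]; exact hL
    · rw [hFne η h]
      exact mul_ne_zero (h0 η ⟨hη, h⟩) (pow_ne_zero _ (Complex.slitPlane_ne_zero (hslit η ⟨hη, h⟩))))
  set l : ℂ → ℂ := fun η => lc η - n * Complex.log (1 + Complex.I * η / r) with hldef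
  have hlog : ContinuousOn (fun η => Complex.log (1 + Complex.I * η / r)) (halfDisc r \ {p}) :=
    ContinuousOn.clog (by fun_prop) hslit
  have hlcont : ContinuousOn l (halfDisc r \ {p}) := hlc.continuousOn.sub (continuousOn_const.mul hlog)
  have hexp : ∀ η ∈ halfDisc r \ {p}, Complex.exp (l η) = f η := fun η hη => by
    have hu := Complex.slitPlane_ne_zero (hslit η hη)
    rw [hldef, Complex.exp_sub, hle η hη.1, hFne η hη.2, Complex.exp_nat_mul, Complex.exp_log hu,
      mul_div_cancel_right₀ _ (pow_ne_zero _ hu)]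
  have hsub : halfDisc r \ {0, p} ⊆ halfDisc r \ {p} := fun η hη => ⟨hη.1, fun h => hη.2 (Or.inr h)⟩
  refine ⟨l, ⟨fun w hw => ?_, hlcont.mono hsub, ?_⟩, hlcont, hexp⟩
  · have hU : openHalfDisc r ∈ 𝓝 w := (isOpen_openHalfDisc r).mem_nhds hw
    have hS : halfDisc r \ {p} ∈ 𝓝 w := mem_of_superset hU (openHalfDisc_subset.trans hsub)
    refine (differentiableAt_of_exp (hlcont.continuousAt hS) (hd.differentiableAt hU) ?_).differentiableWithinAt
    filter_upwards [hS] with z hz using hexp z hz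
  · obtain ⟨C, hC, hb⟩ := exists_norm_le_halfDisc hlc
    have hpi := Real.pi_pos
    have h2 : 0 ≤ Real.log 2 := Real.log_nonneg one_le_two
    refine ⟨C + n * (Real.log 2 + 1 + Real.pi), by positivity, fun η h1 h2 h3 => ?_⟩
    refine (norm_sub_le _ _).trans ?_
    rw [norm_mul, Complex.norm_natCast, add_mul, mul_assoc]
    refine add_le_add ((hb η h1).trans (le_mul_of_one_le_right hC (one_le_logWt η))) ?_
    exact mul_le_mul_of_nonneg_left (norm_log_branch_le hr h1 h2 h3) (Nat.cast_nonneg n)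

end

/-! ### The outer region and the half disc -/

/-- The closed outer region of the lower half-plane. -/
def outer (q0 : ℝ) : Set ℂ := {z | q0 ≤ ‖z‖ ∧ z.im ≤ 0}

/-- The open outer region of the lower half-plane. -/
def openOuter (q0 : ℝ) : Set ℂ := {z | q0 < ‖z‖ ∧ z.im < 0}

theorem isOpen_openOuter (q0 : ℝ) : IsOpen (openOuter q0) :=
  (isOpen_lt continuous_const continuous_norm).inter
    (isOpen_lt Complex.continuous_im continuous_const)

theorem openOuter_subset (q0 : ℝ) : openOuter q0 ⊆ outer q0 := fun _ h => ⟨h.1.le, h.2.le⟩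

theorem norm_inv_eq (q0 : ℝ) (z : ℂ) : ‖inv q0 z‖ = q0 ^ 2 / ‖z‖ := by
  rw [inv, norm_neg, norm_div, norm_pow, Complex.norm_real, RCLike.norm_conj, Real.norm_eq_abs,
    sq_abs]

theorem inv_im (q0 : ℝ) (z : ℂ) : (inv q0 z).im = -(q0 ^ 2 * z.im / ‖z‖ ^ 2) := by
  rw [inv, ← Complex.ofReal_pow, Complex.neg_im, Complex.div_im, Complex.normSq_conj,
    Complex.normSq_eq_norm_sq, Complex.ofReal_re, Complex.ofReal_im, Complex.conj_im]
  ring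

section

variable {q0 : ℝ} (h0 : 0 < q0) {z : ℂ}
include h0

theorem inv_mem_outer (hz : z ∈ halfDisc q0) (hz0 : z ≠ 0) : inv q0 z ∈ outer q0 := by
  have hn : 0 < ‖z‖ := norm_pos_iff.2 hz0
  refine ⟨?_, ?_⟩
  · rw [norm_inv_eq, le_div_iff₀ hn, sq]
    exact mul_le_mul_of_nonneg_left hz.1 h0.le
  · rw [inv_im, Left.neg_nonpos_iff]
    have := hz.2
    positivity

theorem inv_mem_openOuter (hz : z ∈ openHalfDisc q0) : inv q0 z ∈ openOuter q0 := by
  have hn : 0 < ‖z‖ := by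
    refine norm_pos_iff.2 fun h => ?_
    have := hz.2; rw [h] at this; simp at this
  refine ⟨?_, ?_⟩
  · rw [norm_inv_eq, lt_div_iff₀ hn, sq]
    exact mul_lt_mul_of_pos_left hz.1 h0
  · rw [inv_im, Left.neg_neg_iff]
    have := hz.2
    positivity

theorem outer_ne_zero (hz : z ∈ outer q0) : z ≠ 0 := norm_pos_iff.1 (h0.trans_le hz.1)

theorem inv_mem_halfDisc (hz : z ∈ outer q0) : inv q0 z ∈ halfDisc q0 := by
  have hn : 0 < ‖z‖ := h0.trans_le hz.1
  refine ⟨?_, ?_⟩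
  · rw [norm_inv_eq, div_le_iff₀ hn, sq]
    exact mul_le_mul_of_nonneg_left hz.1 h0.le
  · rw [inv_im, Left.nonneg_neg_iff]
    have := hz.2
    exact div_nonpos_of_nonpos_of_nonneg (mul_nonpos_of_nonneg_of_nonpos (sq_nonneg _) this)
      (sq_nonneg _)

theorem inv_mem_openHalfDisc (hz : z ∈ openOuter q0) : inv q0 z ∈ openHalfDisc q0 := by
  have hn : 0 < ‖z‖ := h0.trans hz.1
  refine ⟨?_, ?_⟩
  · rw [norm_inv_eq, div_lt_iff₀ hn, sq]
    exact mul_lt_mul_of_pos_left hz.1 h0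
  · rw [inv_im, Left.neg_pos_iff]
    have := hz.2
    exact div_neg_of_neg_of_pos (mul_neg_of_pos_of_neg (by positivity) this) (by positivity)

omit h0 in
theorem lowerSet_of (hz0 : z ≠ 0) (h : (‖z‖ ^ 2 - q0 ^ 2) * z.im ≤ 0) : z ∈ lowerSet q0 := by
  refine ⟨hz0, ?_⟩
  have hn : 0 < 2 * ‖z‖ ^ 2 := by positivity
  rw [← im_lamOf] at h
  exact nonpos_of_mul_nonpos_right h hn

theorem outer_subset_lowerSet (hz : z ∈ outer q0) : z ∈ lowerSet q0 :=
  lowerSet_of (outer_ne_zero h0 hz) (mul_nonpos_of_nonneg_of_nonpos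
    (by have := hz.1; nlinarith) hz.2)

theorem halfDisc_subset_lowerSet (hz : z ∈ halfDisc q0) (hz0 : z ≠ 0) : z ∈ lowerSet q0 :=
  lowerSet_of hz0 (mul_nonpos_of_nonpos_of_nonneg
    (by have := hz.1; have := norm_nonneg z; nlinarith) hz.2)

/-- The two components of D⁻, which `inv` exchanges. -/
theorem mem_regionMinus_iff : z ∈ regionMinus q0 ↔ z ∈ openHalfDisc q0 ∨ z ∈ openOuter q0 := by
  have hn := norm_nonneg z
  rw [regionMinus, mem_ofPred_eq, mul_neg_iff, or_comm]
  refine or_congr (and_congr ?_ Iff.rfl) (and_congr ?_ Iff.rfl)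
  · rw [sub_neg, sq_lt_sq₀ hn h0.le]
  · rw [sub_pos, sq_lt_sq₀ h0.le hn]

theorem mem_contour0_of_outer (hz : z ∈ outer q0) (hz' : z ∉ openOuter q0)
    (hne : z ≠ -(Complex.I * q0)) : z ∈ contour0 q0 := by
  refine ⟨?_, outer_ne_zero h0 hz, fun h => ?_, hne⟩
  · by_contra! h
    exact hz' ⟨lt_of_le_of_ne hz.1 h.2.symm, lt_of_le_of_ne hz.2 h.1⟩
  · have := hz.2; rw [h] at this; simp at this; linarith

end

/-! ### The Blaschke-type products -/

section

variable {q0 : ℝ} {N : ℕ} {ζ : Fin N → ℂ}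

theorem blaschkeInv_eq (z : ℂ) : blaschkeInv q0 ζ z = (blaschke q0 ζ z)⁻¹ := by
  rw [blaschkeInv, blaschke, ← Finset.prod_inv_distrib]
  exact Finset.prod_congr rfl fun n _ => (inv_div _ _).symm

theorem blaschke_conj (z : ℂ) : conj (blaschke q0 ζ (conj z)) = blaschkeInv q0 ζ z := by
  rw [blaschkeInv, blaschke, map_prod]
  exact Finset.prod_congr rfl fun n _ => by simp

/-- The value of the Blaschke-type product at the origin. -/
noncomputable def blaschkeZero (ζ : Fin N → ℂ) : ℂ := ∏ n, (ζ n / conj (ζ n)) ^ 4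

theorem norm_blaschkeZero (h : ∀ n, ζ n ≠ 0) : ‖blaschkeZero ζ‖ = 1 := by
  rw [blaschkeZero, norm_prod]
  refine Finset.prod_eq_one fun n _ => ?_
  rw [norm_pow, norm_div, RCLike.norm_conj, div_self (norm_ne_zero_iff.2 (h n)), one_pow]

theorem blaschke_zero (h0 : q0 ≠ 0) (h : ∀ n, ζ n ≠ 0) : blaschke q0 ζ 0 = blaschkeZero ζ := by
  refine Finset.prod_congr rfl fun n _ => ?_
  have h1 := h n
  have h2 : conj (ζ n) ≠ 0 := by simpa using h1
  have h3 : (q0 : ℂ) ≠ 0 := by exact_mod_cast h0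
  simp only [zero_sub, zero_add]
  field_simp

/-- `inv` permutes the four factors belonging to each zero up to constants, so the product has the
symmetry of `s11` with q₋/q₊ replaced by its value at the origin. -/
theorem blaschke_inv (h0 : q0 ≠ 0) (h : ∀ n, ζ n ≠ 0) {z : ℂ} (hz : z ≠ 0) :
    blaschke q0 ζ (inv q0 z) = blaschkeZero ζ * conj (blaschke q0 ζ z) := by
  rw [blaschke, blaschke, blaschkeZero, map_prod, ← Finset.prod_mul_distrib]
  refine Finset.prod_congr rfl fun n _ => ?_
  have h1 := h n
  have h2 : conj (ζ n) ≠ 0 := by simpa using h1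
  have h3 : (q0 : ℂ) ≠ 0 := by exact_mod_cast h0
  have h4 : conj z ≠ 0 := by simpa using hz
  have e1 : inv q0 z - ζ n = -(ζ n / conj z) * (conj z + q0 ^ 2 / ζ n) := by
    rw [inv]; field_simp; ring
  have e2 : inv q0 z - conj (ζ n) = -(conj (ζ n) / conj z) * (conj z + q0 ^ 2 / conj (ζ n)) := by
    rw [inv]; field_simp; ring
  have e3 : inv q0 z + q0 ^ 2 / conj (ζ n) = q0 ^ 2 / (conj (ζ n) * conj z) *
      (conj z - conj (ζ n)) := by
    rw [inv]; field_simp; ring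
  have e4 : inv q0 z + q0 ^ 2 / ζ n = q0 ^ 2 / (ζ n * conj z) * (conj z - ζ n) := by
    rw [inv]; field_simp; ring
  rw [e1, e2, e3, e4]
  simp only [map_div₀, map_mul, map_pow, map_sub, map_add, Complex.conj_conj, Complex.conj_ofReal]
  set A := conj z - ζ n
  set B := conj z - conj (ζ n)
  set C := conj z + q0 ^ 2 / ζ n
  set D := conj z + q0 ^ 2 / conj (ζ n)
  have e5 : (-(ζ n / conj z) * C) ^ 2 * (q0 ^ 2 / (conj (ζ n) * conj z) * B) ^ 2 =
      (ζ n / conj z * (q0 ^ 2 / (conj (ζ n) * conj z))) ^ 2 * (B ^ 2 * C ^ 2) := by ring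
  have e6 : (-(conj (ζ n) / conj z) * D) ^ 2 * (q0 ^ 2 / (ζ n * conj z) * A) ^ 2 =
      (conj (ζ n) / conj z * (q0 ^ 2 / (ζ n * conj z))) ^ 2 * (A ^ 2 * D ^ 2) := by ring
  rw [e5, e6, mul_div_mul_comm]
  congr 1
  field_simp

theorem differentiableAt_blaschkeInv {z : ℂ} (h1 : ∀ n, z - ζ n ≠ 0)
    (h2 : ∀ n, z + (q0 : ℂ) ^ 2 / conj (ζ n) ≠ 0) : DifferentiableAt ℂ (blaschkeInv q0 ζ) z := by
  unfold blaschkeInv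
  refine DifferentiableAt.fun_finsetProd fun n _ => ?_
  exact DifferentiableAt.div (by fun_prop) (by fun_prop)
    (mul_ne_zero (pow_ne_zero _ (h1 n)) (pow_ne_zero _ (h2 n)))

section

variable (h0 : 0 < q0) {z w : ℂ} (hz : z ∈ outer q0) (hw : w ∈ openOuter q0)
include h0 hz hw

omit h0 in
theorem outer_sub_conj : z - conj w ≠ 0 := fun h => by
  have h1 := hz.2
  have h2 := hw.2
  rw [sub_eq_zero.1 h, Complex.conj_im] at h1
  linarith

/-- The point q₀²/u lies strictly inside the circle, while z does not. In the outer region only the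
factors z - zₙ can therefore vanish. -/
theorem outer_add_div {u : ℂ} (hu : ‖u‖ = ‖w‖) : z + (q0 : ℂ) ^ 2 / u ≠ 0 := fun h => by
  have h1 : ‖z‖ = q0 ^ 2 / ‖w‖ := by
    rw [eq_neg_of_add_eq_zero_left h, norm_neg, norm_div, norm_pow, Complex.norm_real, hu,
      Real.norm_of_nonneg h0.le]
  have h2 : q0 ^ 2 / ‖w‖ < q0 := by
    rw [div_lt_iff₀ (h0.trans hw.1), sq]
    exact mul_lt_mul_of_pos_left hw.1 h0
  have h3 := hz.1
  linarith

end

end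

/-! ### Removing the double zeros -/

open Classical in
/-- `s₁₁ B⁻¹` on the closed outer region, with the removable singularities filled in. -/
noncomputable def outerTheta (q0 : ℝ) (qm qp : ℂ) (q : ℝ → ℂ) (t : ℝ) {N : ℕ} (ζ : Fin N → ℂ)
    (z : ℂ) : ℂ :=
  if z ∈ range ζ then limUnder (𝓝[≠] z) fun z => s11 q0 qm qp q t z * blaschkeInv q0 ζ z
  else s11 q0 qm qp q t z * blaschkeInv q0 ζ z

section

variable {q0 : ℝ} {qm qp : ℂ} {q : ℝ → ℂ} {t : ℝ} {N : ℕ} {ζ : Fin N → ℂ}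

theorem outerTheta_of_notMem {z : ℂ} (h : z ∉ range ζ) :
    outerTheta q0 qm qp q t ζ z = s11 q0 qm qp q t z * blaschkeInv q0 ζ z := if_neg h

variable (hq : IsPotential q0 qm qp q)
  (hspec : ∃ c : ℝ, 0 < c ∧ ∀ ζ ∈ contour0 q0, c ≤ ‖s11 q0 qm qp q t ζ‖)
  (hz : HasDoubleZeros q0 qm qp q t ζ)

omit hq in
theorem eventually_notMem_range (ζ : Fin N → ℂ) (z : ℂ) : ∀ᶠ w in 𝓝[≠] z, w ∉ range ζ := by
  have : (range ζ \ {z}).Finite := (finite_range ζ).sdiff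
  filter_upwards [mem_nhdsWithin_of_mem_nhds (this.isClosed.isOpen_compl.mem_nhds
    (fun h => h.2 rfl : z ∉ range ζ \ {z})), self_mem_nhdsWithin] with w h1 h2 h3
  exact h1 ⟨h3, h2⟩

omit hq in
theorem eventually_notMem_range_of_notMem {z : ℂ} (h : z ∉ range ζ) : ∀ᶠ w in 𝓝 z, w ∉ range ζ :=
  (finite_range ζ).isClosed.isOpen_compl.mem_nhds h

include hspec in
theorem s11_ne_zero_contour {z : ℂ} (h : z ∈ contour0 q0) : s11 q0 qm qp q t z ≠ 0 := by
  obtain ⟨c, hc, hb⟩ := hspec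
  exact norm_pos_iff.1 (hc.trans_le (hb z h))

include hq hz in
theorem zero_mem_openOuter (n : Fin N) : ζ n ∈ openOuter q0 := by
  obtain ⟨h1, h2⟩ := hz.mem n
  refine ((mem_regionMinus_iff hq.pos).1 h1).resolve_left fun h => ?_
  linarith [h.2]

include hq hspec hz in
theorem s11_eq_zero_iff_outer {z : ℂ} (h : z ∈ outer q0) (hne : z ≠ -(Complex.I * q0)) :
    s11 q0 qm qp q t z = 0 ↔ z ∈ range ζ := by
  by_cases ho : z ∈ openOuter q0
  · rw [hz.zero_iff z ((mem_regionMinus_iff hq.pos).2 (Or.inr ho)) ho.2]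
    simp only [mem_range, eq_comm]
  · have h1 := s11_ne_zero_contour hspec (mem_contour0_of_outer hq.pos h ho hne)
    refine ⟨fun h2 => absurd h2 h1, ?_⟩
    rintro ⟨n, rfl⟩
    exact absurd (zero_mem_openOuter hq hz n) ho

include hq hz in
theorem blaschkeInv_ne_zero_outer {z : ℂ} (h : z ∈ outer q0) (hr : z ∉ range ζ) :
    blaschkeInv q0 ζ z ≠ 0 := by
  refine Finset.prod_ne_zero_iff.2 fun n _ => ?_
  have ho := zero_mem_openOuter hq hz n
  have h0 := hq.pos
  refine div_ne_zero (mul_ne_zero (pow_ne_zero _ (outer_sub_conj h ho))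
    (pow_ne_zero _ (outer_add_div h0 h ho rfl))) (mul_ne_zero (pow_ne_zero _ ?_)
    (pow_ne_zero _ (outer_add_div h0 h ho (RCLike.norm_conj _))))
  exact fun h1 => hr ⟨n, (sub_eq_zero.1 h1).symm⟩

include hq hz in
theorem differentiableAt_blaschkeInv_outer {z : ℂ} (h : z ∈ outer q0) (hr : z ∉ range ζ) :
    DifferentiableAt ℂ (blaschkeInv q0 ζ) z :=
  differentiableAt_blaschkeInv (fun n h1 => hr ⟨n, (sub_eq_zero.1 h1).symm⟩)
    fun n => outer_add_div hq.pos h (zero_mem_openOuter hq hz n) (RCLike.norm_conj _)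

include hq in
theorem differentiableAt_s11 {z : ℂ} (h : z ∈ regionMinus q0) :
    DifferentiableAt ℂ (s11 q0 qm qp q t) z :=
  (differentiableOn_s11 hq t).differentiableAt ((isOpen_regionMinus q0).mem_nhds h)

include hq hz in
/-- Near a zero of `s₁₁`, the singularity of `s₁₁ B⁻¹` is removable, and the value is not zero. -/
theorem exists_local_factor (n : Fin N) : ∃ f : ℂ → ℂ, DifferentiableAt ℂ f (ζ n) ∧
    f (ζ n) ≠ 0 ∧ ∀ᶠ z in 𝓝[≠] (ζ n), s11 q0 qm qp q t z * blaschkeInv q0 ζ z = f z := by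
  have ho := zero_mem_openOuter hq hz n
  have ho' := openOuter_subset q0 ho
  have h0 := hq.pos
  obtain ⟨h1, h2⟩ := hz.mem n
  have han : AnalyticAt ℂ (s11 q0 qm qp q t) (ζ n) :=
    (differentiableOn_s11 hq t).analyticAt ((isOpen_regionMinus q0).mem_nhds h1)
  have hzero : s11 q0 qm qp q t (ζ n) = 0 := (hz.zero_iff _ h1 h2).2 ⟨n, rfl⟩
  have hd2 : deriv (deriv (s11 q0 qm qp q t)) (ζ n) ≠ 0 := by
    have := hz.deriv_two_ne_zero n
    rwa [iteratedDeriv_succ, iteratedDeriv_one] at this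
  -- The derivative has a simple zero, so `s11`, which vanishes at the point, has order exactly two.
  -- The factor (z - zₙ)² in the denominator then cancels and leaves a nonzero value.
  have o1 := han.deriv.analyticOrderAt_eq_one_of_zero_deriv_ne_zero (hz.deriv_eq_zero n) hd2
  have o2 := han.analyticOrderAt_deriv_add_one
  rw [o1, hzero] at o2
  simp only [sub_zero] at o2
  obtain ⟨g, hg, hg0, hge⟩ := (han.analyticOrderAt_eq_natCast (n := 2)).1 (by
    rw [← o2]; norm_num)
  set b : ℂ → ℂ := fun z => ((z - conj (ζ n)) ^ 2 * (z + (q0 : ℂ) ^ 2 / ζ n) ^ 2) /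
      (z + (q0 : ℂ) ^ 2 / conj (ζ n)) ^ 2 *
    ∏ m ∈ Finset.univ.erase n, ((z - conj (ζ m)) ^ 2 * (z + (q0 : ℂ) ^ 2 / ζ m) ^ 2) /
      ((z - ζ m) ^ 2 * (z + (q0 : ℂ) ^ 2 / conj (ζ m)) ^ 2) with hb
  have hne : ∀ m ∈ Finset.univ.erase n, ζ n - ζ m ≠ 0 := fun m hm h => by
    exact (Finset.mem_erase.1 hm).1 (hz.injective (sub_eq_zero.1 h)).symm
  have k1 : ∀ m, ζ n - conj (ζ m) ≠ 0 := fun m =>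
    outer_sub_conj ho' (zero_mem_openOuter hq hz m)
  have k2 : ∀ m, ζ n + (q0 : ℂ) ^ 2 / ζ m ≠ 0 := fun m =>
    outer_add_div h0 ho' (zero_mem_openOuter hq hz m) rfl
  have k3 : ∀ m, ζ n + (q0 : ℂ) ^ 2 / conj (ζ m) ≠ 0 := fun m =>
    outer_add_div h0 ho' (zero_mem_openOuter hq hz m) (RCLike.norm_conj _)
  refine ⟨fun z => g z * b z, hg.differentiableAt.mul ?_, mul_ne_zero hg0 ?_, ?_⟩
  · refine DifferentiableAt.mul (DifferentiableAt.div (by fun_prop) (by fun_prop)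
      (pow_ne_zero _ (k3 n))) (DifferentiableAt.fun_finsetProd fun m hm => ?_)
    exact DifferentiableAt.div (by fun_prop) (by fun_prop)
      (mul_ne_zero (pow_ne_zero _ (hne m hm)) (pow_ne_zero _ (k3 m)))
  · refine mul_ne_zero (div_ne_zero (mul_ne_zero (pow_ne_zero _ (k1 n)) (pow_ne_zero _ (k2 n)))
      (pow_ne_zero _ (k3 n))) (Finset.prod_ne_zero_iff.2 fun m hm => ?_)
    exact div_ne_zero (mul_ne_zero (pow_ne_zero _ (k1 m)) (pow_ne_zero _ (k2 m)))
      (mul_ne_zero (pow_ne_zero _ (hne m hm)) (pow_ne_zero _ (k3 m)))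
  · filter_upwards [mem_nhdsWithin_of_mem_nhds hge, self_mem_nhdsWithin] with z e1 e2
    have e3 : z - ζ n ≠ 0 := sub_ne_zero.2 e2
    rw [e1, blaschkeInv, ← Finset.mul_prod_erase _ _ (Finset.mem_univ n), hb, smul_eq_mul]
    simp only
    rw [← mul_assoc, ← mul_assoc]
    congr 1
    by_cases e4 : z + (q0 : ℂ) ^ 2 / conj (ζ n) = 0
    · simp [e4]
    · field_simp

include hq hspec hz in
theorem outerTheta_differentiableAt {z : ℂ} (h : z ∈ openOuter q0) :
    DifferentiableAt ℂ (outerTheta q0 qm qp q t ζ) z ∧ outerTheta q0 qm qp q t ζ z ≠ 0 := by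
  have h' := openOuter_subset q0 h
  by_cases hr : z ∈ range ζ
  · obtain ⟨n, rfl⟩ := hr
    obtain ⟨f, hf, hf0, hfe⟩ := exists_local_factor hq hz n
    have e0 : outerTheta q0 qm qp q t ζ (ζ n) = f (ζ n) := by
      rw [outerTheta, if_pos (mem_range_self n)]
      refine Tendsto.limUnder_eq ?_
      exact (hf.continuousAt.tendsto.mono_left nhdsWithin_le_nhds).congr'
        (hfe.mono fun z hz => hz.symm)
    have e1 : outerTheta q0 qm qp q t ζ =ᶠ[𝓝[≠] (ζ n)] f := by
      filter_upwards [hfe, eventually_notMem_range ζ (ζ n)] with z h1 h2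
      rw [outerTheta_of_notMem h2, h1]
    have e2 : outerTheta q0 qm qp q t ζ =ᶠ[𝓝 (ζ n)] f := by
      rw [EventuallyEq, ← nhdsNE_sup_pure, eventually_sup]
      exact ⟨e1, by simpa using e0⟩
    exact ⟨hf.congr_of_eventuallyEq e2, e0 ▸ hf0⟩
  · have e2 : outerTheta q0 qm qp q t ζ =ᶠ[𝓝 z]
        fun z => s11 q0 qm qp q t z * blaschkeInv q0 ζ z := by
      filter_upwards [eventually_notMem_range_of_notMem hr] with w hw
      exact outerTheta_of_notMem hw
    refine ⟨DifferentiableAt.congr_of_eventuallyEq ?_ e2, ?_⟩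
    · exact (differentiableAt_s11 hq ((mem_regionMinus_iff hq.pos).2 (Or.inr h))).mul
        (differentiableAt_blaschkeInv_outer hq hz h' hr)
    · rw [outerTheta_of_notMem hr]
      refine mul_ne_zero (fun h1 => hr ((s11_eq_zero_iff_outer hq hspec hz h' ?_).1 h1))
        (blaschkeInv_ne_zero_outer hq hz h' hr)
      intro h2
      have := h.1
      rw [h2] at this
      simp [abs_of_pos hq.pos] at this

include hq hspec hz in
theorem outerTheta_continuousOn :
    ContinuousOn (outerTheta q0 qm qp q t ζ) (outer q0 \ {-(Complex.I * (q0 : ℂ))}) := by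
  intro z hzo
  by_cases h : z ∈ openOuter q0
  · exact (outerTheta_differentiableAt hq hspec hz h).1.continuousAt.continuousWithinAt
  · have hr : z ∉ range ζ := by rintro ⟨n, rfl⟩; exact h (zero_mem_openOuter hq hz n)
    have hcs : outer q0 \ {-(Complex.I * (q0 : ℂ))} ⊆
        {z | z ∈ lowerSet q0 ∧ z ≠ Complex.I * q0 ∧ z ≠ -(Complex.I * q0)} := fun w hw => by
      refine ⟨outer_subset_lowerSet hq.pos hw.1, fun h1 => ?_, hw.2⟩
      have := hw.1.2
      rw [h1] at this
      simp at this
      linarith [hq.pos]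
    have h1 := (continuousOn_s11 hq t).mono hcs z hzo
    refine (h1.mul (differentiableAt_blaschkeInv_outer hq hz hzo.1
      hr).continuousAt.continuousWithinAt).congr_of_eventuallyEq ?_ (outerTheta_of_notMem hr)
    filter_upwards [mem_nhdsWithin_of_mem_nhds (eventually_notMem_range_of_notMem hr)] with w hw
    exact outerTheta_of_notMem hw

include hq hspec hz in
theorem outerTheta_ne_zero {z : ℂ} (h : z ∈ outer q0) (hne : z ≠ -(Complex.I * q0)) :
    outerTheta q0 qm qp q t ζ z ≠ 0 := by
  by_cases ho : z ∈ openOuter q0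
  · exact (outerTheta_differentiableAt hq hspec hz ho).2
  · have hr : z ∉ range ζ := by rintro ⟨n, rfl⟩; exact ho (zero_mem_openOuter hq hz n)
    rw [outerTheta_of_notMem hr]
    exact mul_ne_zero (s11_ne_zero_contour hspec (mem_contour0_of_outer hq.pos h ho hne))
      (blaschkeInv_ne_zero_outer hq hz h hr)

end

/-! ### The logarithm on the half disc -/

/-- Logarithms on the half disc that extend to the outer region by `z ↦ -q₀² / z^*`. -/
structure ReflLog (q0 : ℝ) (l : ℂ → ℂ) : Prop where
  halfDiscFun : HalfDiscFun q0 l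
  cont : ContinuousOn l (halfDisc q0 \ {Complex.I * (q0 : ℂ)})
  -- This bounds (l(η) - l(0))/η at the origin, as the kernel 1/ζ requires; through `inv` it is also
  -- the decay at infinity.
  lin : ∃ δ K : ℝ, 0 < δ ∧ ∀ η ∈ halfDisc q0, ‖η‖ < δ → ‖l η - l 0‖ ≤ K * ‖η‖
  zero_re : (l 0).re = 0
  -- `inv` exchanges q₀ and -q₀, the only points common to the half disc and the outer region. The
  -- condition makes the two pieces of the logarithm agree there.
  corner : l q0 = conj (l (-q0 : ℝ)) + l 0

/-- The value at the origin of `s₁₁ B⁻¹`. -/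
noncomputable def thetaZero {N : ℕ} (qm qp : ℂ) (ζ : Fin N → ℂ) : ℂ := qm / qp / blaschkeZero ζ

open Classical in
/-- `s₁₁ B⁻¹` on the half disc, with the removable singularities filled in. -/
noncomputable def innerTheta (q0 : ℝ) (qm qp : ℂ) (q : ℝ → ℂ) (t : ℝ) {N : ℕ} (ζ : Fin N → ℂ)
    (η : ℂ) : ℂ :=
  if η = 0 then thetaZero qm qp ζ
  else thetaZero qm qp ζ * conj (outerTheta q0 qm qp q t ζ (inv q0 η))

theorem inv_I_mul {q0 : ℝ} (h0 : q0 ≠ 0) : inv q0 (Complex.I * q0) = -(Complex.I * q0) := by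
  have h0' : (q0 : ℂ) ≠ 0 := by exact_mod_cast h0
  rw [inv, map_mul, Complex.conj_I, Complex.conj_ofReal, neg_inj, div_eq_iff (by simp [h0])]
  linear_combination (q0 : ℂ) ^ 2 * Complex.I_sq

theorem inv_eq_conj (q0 : ℝ) (z : ℂ) : inv q0 z = conj (-((q0 : ℂ) ^ 2 / z)) := by
  simp [inv]

theorem continuousAt_inv {q0 : ℝ} {z : ℂ} (hz : z ≠ 0) : ContinuousAt (inv q0) z := by
  have : conj z ≠ 0 := by simpa using hz
  unfold inv
  exact (continuousAt_const.div Complex.continuous_conj.continuousAt this).neg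

section

variable {q0 : ℝ} {qm qp : ℂ} {q : ℝ → ℂ} {t : ℝ} {N : ℕ} {ζ : Fin N → ℂ}

variable (hq : IsPotential q0 qm qp q)
  (hspec : ∃ c : ℝ, 0 < c ∧ ∀ ζ ∈ contour0 q0, c ≤ ‖s11 q0 qm qp q t ζ‖)
  (hz : HasDoubleZeros q0 qm qp q t ζ)

include hq in
theorem norm_div_eq_one : ‖qm / qp‖ = 1 := by
  rw [norm_div, hq.norm_minus, hq.norm_plus, div_self hq.pos.ne']

include hq hz

theorem zero_ne_zero (n : Fin N) : ζ n ≠ 0 :=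
  outer_ne_zero hq.pos (openOuter_subset q0 (zero_mem_openOuter hq hz n))

theorem norm_thetaZero : ‖thetaZero qm qp ζ‖ = 1 := by
  rw [thetaZero, norm_div, norm_div_eq_one hq, norm_blaschkeZero (zero_ne_zero hq hz), div_one]

theorem thetaZero_ne_zero : thetaZero qm qp ζ ≠ 0 :=
  norm_ne_zero_iff.1 (by rw [norm_thetaZero hq hz]; exact one_ne_zero)

/-- `s11` and the product have the same symmetry, with constants q₋/q₊ and `blaschkeZero`; the
quotient of these is `thetaZero`. -/
theorem theta_symm {w : ℂ} (hw : w ∈ lowerSet q0) :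
    s11 q0 qm qp q t (inv q0 w) * blaschkeInv q0 ζ (inv q0 w) =
      thetaZero qm qp ζ * conj (s11 q0 qm qp q t w * blaschkeInv q0 ζ w) := by
  rw [s11_inv hq hw, blaschkeInv_eq, blaschke_inv hq.pos.ne' (zero_ne_zero hq hz) hw.1,
    blaschkeInv_eq, map_mul, map_inv₀, thetaZero, mul_inv, div_eq_mul_inv (qm / qp)]
  ring

theorem innerTheta_eq {η : ℂ} (h : η ∈ halfDisc q0) (h0 : η ≠ 0) (hr : inv q0 η ∉ range ζ) :
    innerTheta q0 qm qp q t ζ η = s11 q0 qm qp q t η * blaschkeInv q0 ζ η := by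
  have hw := outer_subset_lowerSet hq.pos (inv_mem_outer hq.pos h h0)
  have := theta_symm (t := t) hq hz hw
  rw [inv_inv' hq.pos.ne' h0] at this
  rw [innerTheta, if_neg h0, outerTheta_of_notMem hr, this]

include hspec in
theorem innerTheta_ne_zero {η : ℂ} (h : η ∈ halfDisc q0) (hne : η ≠ Complex.I * q0) :
    innerTheta q0 qm qp q t ζ η ≠ 0 := by
  rw [innerTheta]
  split_ifs with h0
  · exact thetaZero_ne_zero hq hz
  · refine mul_ne_zero (thetaZero_ne_zero hq hz) ((map_ne_zero _).2 ?_)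
    refine outerTheta_ne_zero hq hspec hz (inv_mem_outer hq.pos h h0) fun h1 => hne ?_
    rw [← inv_inv' hq.pos.ne' h0, h1, ← inv_I_mul hq.pos.ne', inv_inv' hq.pos.ne']
    simp [hq.pos.ne']

include hspec in
theorem differentiableOn_innerTheta :
    DifferentiableOn ℂ (innerTheta q0 qm qp q t ζ) (openHalfDisc q0) := by
  intro η hη
  have h0 : η ≠ 0 := fun h => (openHalfDisc_subset hη).2 (Or.inl h)
  refine DifferentiableAt.differentiableWithinAt ?_
  have h1 := (outerTheta_differentiableAt hq hspec hz (inv_mem_openOuter hq.pos hη)).1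
  rw [inv_eq_conj] at h1
  have h2 := h1.conj_conj
  rw [Complex.conj_conj] at h2
  have h3 : DifferentiableAt ℂ (fun z : ℂ => -((q0 : ℂ) ^ 2 / z)) η := by
    fun_prop (disch := assumption)
  refine ((DifferentiableAt.comp η h2 h3).const_mul (thetaZero qm qp ζ)).congr_of_eventuallyEq ?_
  filter_upwards [isOpen_ne.mem_nhds h0] with z hz
  rw [innerTheta, if_neg hz, inv_eq_conj]
  rfl

omit hz in
theorem eventually_inv_notMem : ∀ᶠ η in 𝓝[≠] (0 : ℂ), inv q0 η ∉ range ζ := by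
  obtain ⟨M, hM⟩ := (finite_range fun n => ‖ζ n‖).bddAbove
  have h1 : ∀ᶠ η : ℂ in 𝓝 0, ‖η‖ * (|M| + 1) < q0 ^ 2 := by
    have : ContinuousAt (fun η : ℂ => ‖η‖ * (|M| + 1)) 0 := by fun_prop
    refine this.eventually_lt_const ?_
    simp [hq.pos]
  filter_upwards [mem_nhdsWithin_of_mem_nhds h1, self_mem_nhdsWithin] with η h2 h3
  rintro ⟨n, hn⟩
  have h4 : ‖ζ n‖ ≤ M := hM ⟨n, rfl⟩
  have h5 : 0 < ‖η‖ := norm_pos_iff.2 h3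
  rw [hn, norm_inv_eq, div_le_iff₀ h5] at h4
  nlinarith [le_abs_self M]

/-- s₁₁ = 1 + O(1/z) at infinity, carried to the origin by `inv`, together with differentiability of
the product at 0. -/
theorem innerTheta_isBigO :
    (fun η => innerTheta q0 qm qp q t ζ η - thetaZero qm qp ζ) =O[𝓝[halfDisc q0 \ {0}] 0]
      fun η => η := by
  have hmono : 𝓝[halfDisc q0 \ {0}] (0 : ℂ) ≤ 𝓝[≠] 0 := nhdsWithin_mono _ fun _ h => h.2
  have hd : DifferentiableAt ℂ (blaschkeInv q0 ζ) 0 := by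
    refine differentiableAt_blaschkeInv (fun n => ?_) fun n => ?_
    · simpa using zero_ne_zero hq hz n
    · rw [zero_add]
      have := zero_ne_zero hq hz n
      exact div_ne_zero (by simp [hq.pos.ne']) (by simpa using this)
  have hb0 : blaschkeInv q0 ζ 0 = (blaschkeZero ζ)⁻¹ := by
    rw [blaschkeInv_eq, blaschke_zero hq.pos.ne' (zero_ne_zero hq hz)]
  have o1 : (fun η => blaschkeInv q0 ζ η - blaschkeInv q0 ζ 0) =O[𝓝[halfDisc q0 \ {0}] 0]
      fun η => η := by
    simpa using hd.hasDerivAt.differentiableAt.isBigO_sub.mono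
      (nhdsWithin_le_nhds (s := halfDisc q0 \ {0}))
  have o2 : (fun η => blaschkeInv q0 ζ η) =O[𝓝[halfDisc q0 \ {0}] 0] fun _ => (1 : ℂ) :=
    (hd.continuousAt.tendsto.mono_left nhdsWithin_le_nhds).isBigO_one ℂ
  obtain ⟨C, hC, hb⟩ := s11_asymp hq t
  have o3 : (fun η => conj (s11 q0 qm qp q t (inv q0 η)) - 1) =O[𝓝[halfDisc q0 \ {0}] 0]
      fun η => η := by
    refine Asymptotics.IsBigO.of_bound (C / q0 ^ 2) ?_
    have e1 : ∀ᶠ η : ℂ in 𝓝 0, ‖η‖ * (2 * q0 + 1) < q0 ^ 2 := by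
      have : ContinuousAt (fun η : ℂ => ‖η‖ * (2 * q0 + 1)) 0 := by fun_prop
      refine this.eventually_lt_const ?_
      simp [hq.pos]
    filter_upwards [mem_nhdsWithin_of_mem_nhds e1, self_mem_nhdsWithin] with η h1 h2
    have hn : 0 < ‖η‖ := norm_pos_iff.2 h2.2
    have h3 : 2 * q0 + 1 ≤ ‖inv q0 η‖ := by
      rw [norm_inv_eq, le_div_iff₀ hn, mul_comm]; exact h1.le
    have h4 := hb _ (outer_subset_lowerSet hq.pos (inv_mem_outer hq.pos h2.1 h2.2))
      (by linarith) (by linarith [hq.pos])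
    have e : conj (s11 q0 qm qp q t (inv q0 η)) - 1 = conj (s11 q0 qm qp q t (inv q0 η) - 1) := by
      simp
    rw [e, RCLike.norm_conj]
    refine h4.trans_eq ?_
    rw [norm_inv_eq, div_div_eq_mul_div, div_mul_eq_mul_div]
  have o4 := ((o3.mul o2).trans (by simpa using Asymptotics.isBigO_refl _ _)
    : _ =O[𝓝[halfDisc q0 \ {0}] 0] fun η : ℂ => η)
  refine ((o4.add o1).const_mul_left (qm / qp)).congr' ?_ EventuallyEq.rfl
  filter_upwards [hmono (eventually_inv_notMem hq), self_mem_nhdsWithin] with η h1 h2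
  have hw := outer_subset_lowerSet hq.pos (inv_mem_outer hq.pos h2.1 h2.2)
  have h3 := s11_inv hq (t := t) hw
  rw [inv_inv' hq.pos.ne' h2.2] at h3
  rw [innerTheta_eq hq hz h2.1 h2.2 h1, h3, hb0, thetaZero]
  ring

include hspec in
theorem continuousOn_innerTheta :
    ContinuousOn (innerTheta q0 qm qp q t ζ) (halfDisc q0 \ {Complex.I * (q0 : ℂ)}) := by
  intro η hη
  by_cases h0 : η = 0
  · subst h0
    have h1 := (innerTheta_isBigO (t := t) hq hz).trans_tendsto
      (tendsto_id.mono_left (nhdsWithin_le_nhds (a := (0 : ℂ)) (s := halfDisc q0 \ {0})))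
    have h2 := (h1.add_const (thetaZero qm qp ζ))
    simp only [sub_add_cancel, zero_add] at h2
    have h3 : innerTheta q0 qm qp q t ζ 0 = thetaZero qm qp ζ := if_pos rfl
    rw [← h3] at h2
    have h4 : ContinuousWithinAt (innerTheta q0 qm qp q t ζ) (halfDisc q0) 0 :=
      continuousWithinAt_sdiff_self.1 h2
    exact h4.mono sdiff_subset
  · have hm : MapsTo (inv q0) (halfDisc q0 \ {Complex.I * (q0 : ℂ)} ∩ {0}ᶜ)
        (outer q0 \ {-(Complex.I * (q0 : ℂ))}) := fun z hz => by
      refine ⟨inv_mem_outer hq.pos hz.1.1 hz.2, fun h1 => hz.1.2 ?_⟩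
      rw [mem_singleton_iff] at h1 ⊢
      rw [← inv_inv' hq.pos.ne' hz.2, h1, ← inv_I_mul hq.pos.ne', inv_inv' hq.pos.ne']
      simp [hq.pos.ne']
    have h1 : ContinuousWithinAt (innerTheta q0 qm qp q t ζ)
        (halfDisc q0 \ {Complex.I * (q0 : ℂ)} ∩ {0}ᶜ) η := by
      have h2 := (outerTheta_continuousOn hq hspec hz _ (hm ⟨hη, h0⟩)).comp
        (continuousAt_inv h0).continuousWithinAt hm
      have h3 : ContinuousWithinAt (fun z => conj (outerTheta q0 qm qp q t ζ (inv q0 z)))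
        (halfDisc q0 \ {Complex.I * (q0 : ℂ)} ∩ {0}ᶜ) η := tendsto_conj h2
      refine (continuousWithinAt_const.mul h3 : ContinuousWithinAt (fun z => thetaZero qm qp ζ *
        conj (outerTheta q0 qm qp q t ζ (inv q0 z))) _ _).congr (fun z hz => ?_) ?_
      · exact if_neg hz.2
      · exact if_neg h0
    exact (continuousWithinAt_inter (isOpen_ne.mem_nhds h0)).1 h1

-- The product has neither zero nor pole at iq₀, because all zₙ have modulus different from q₀. The
-- singularity is that of `s11`, rescaled since 1 + iη/q₀ = (i/q₀)(η - iq₀).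
include hspec in
theorem innerTheta_pole : ∃ (n : ℕ) (L : ℂ), L ≠ 0 ∧
    Tendsto (fun η => innerTheta q0 qm qp q t ζ η * (1 + Complex.I * η / q0) ^ n)
      (𝓝[halfDisc q0 \ {Complex.I * (q0 : ℂ)}] (Complex.I * q0)) (𝓝 L) := by
  obtain ⟨n, L, -, hL, hl⟩ := s11_branch hq hspec
  have h0 := hq.pos
  have hc0 : (q0 : ℂ) ≠ 0 := by exact_mod_cast h0.ne'
  set p : ℂ := Complex.I * q0 with hp
  have hpn : ‖p‖ = q0 := by simp [hp, abs_of_pos h0]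
  have hp0 : p ≠ 0 := mul_ne_zero Complex.I_ne_zero hc0
  have hne : ∀ m, ∀ u : ℂ, ‖u‖ = ‖ζ m‖ → p - u ≠ 0 := fun m u hu h => by
    have := (zero_mem_openOuter hq hz m).1
    rw [← hu, ← sub_eq_zero.1 h, hpn] at this
    exact lt_irrefl _ this
  have hne' : ∀ m, ∀ u : ℂ, ‖u‖ = ‖ζ m‖ → p + (q0 : ℂ) ^ 2 / u ≠ 0 := fun m u hu h => by
    have h1 := (zero_mem_openOuter hq hz m).1
    have h2 : ‖p‖ = q0 ^ 2 / ‖ζ m‖ := by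
      rw [eq_neg_of_add_eq_zero_left h, norm_neg, norm_div, norm_pow, Complex.norm_real, hu,
        Real.norm_of_nonneg h0.le]
    rw [hpn, eq_div_iff (h0.trans h1).ne', sq] at h2
    exact h1.ne' (mul_left_cancel₀ h0.ne' h2)
  have hd : DifferentiableAt ℂ (blaschkeInv q0 ζ) p :=
    differentiableAt_blaschkeInv (fun m => hne m _ rfl) fun m => hne' m _ (RCLike.norm_conj _)
  have hb0 : blaschkeInv q0 ζ p ≠ 0 := by
    refine Finset.prod_ne_zero_iff.2 fun m _ => ?_
    exact div_ne_zero (mul_ne_zero (pow_ne_zero _ (hne m _ (RCLike.norm_conj _)))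
      (pow_ne_zero _ (hne' m _ rfl))) (mul_ne_zero (pow_ne_zero _ (hne m _ rfl))
      (pow_ne_zero _ (hne' m _ (RCLike.norm_conj _))))
  have hnr : inv q0 p ∉ range ζ := by
    rintro ⟨m, hm⟩
    have := (zero_mem_openOuter hq hz m).1
    rw [hm, hp, inv_I_mul h0.ne', norm_neg, ← hp, hpn] at this
    exact lt_irrefl _ this
  have hev : ∀ᶠ η in 𝓝[halfDisc q0 \ {p}] p, η ≠ 0 ∧ inv q0 η ∉ range ζ :=
    mem_nhdsWithin_of_mem_nhds (inter_mem (isOpen_ne.mem_nhds hp0)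
      ((continuousAt_inv hp0).eventually (eventually_notMem_range_of_notMem hnr)))
  have hsub : halfDisc q0 \ {p} ∩ {0}ᶜ ⊆ lowerSet q0 \ {p} := fun η hη =>
    ⟨halfDisc_subset_lowerSet h0 hη.1.1 hη.2, hη.1.2⟩
  have hle : 𝓝[halfDisc q0 \ {p}] p ≤ 𝓝[lowerSet q0 \ {p}] p := by
    rw [← nhdsWithin_inter_of_mem' (mem_nhdsWithin_of_mem_nhds (isOpen_ne.mem_nhds hp0))]
    exact nhdsWithin_mono _ hsub
  refine ⟨n, L * (Complex.I / q0) ^ n * blaschkeInv q0 ζ p,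
    mul_ne_zero (mul_ne_zero hL (pow_ne_zero _ (div_ne_zero Complex.I_ne_zero hc0))) hb0, ?_⟩
  refine (((hl.mono_left hle).mul_const _).mul
    (hd.continuousAt.tendsto.mono_left nhdsWithin_le_nhds)).congr' ?_
  filter_upwards [hev, self_mem_nhdsWithin] with η h1 h2
  rw [innerTheta_eq hq hz h2.1 h1.1 h1.2]
  have e : 1 + Complex.I * η / q0 = (η - p) * (Complex.I / q0) := by
    rw [hp]; field_simp; linear_combination (q0 : ℂ) * Complex.I_sq
  rw [e, mul_pow]; ring

include hspec in
theorem exists_reflLog : ∃ l : ℂ → ℂ, ReflLog q0 l ∧ Complex.exp (l 0) = thetaZero qm qp ζ ∧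
    (∀ η ∈ halfDisc q0, η ≠ 0 → η ≠ Complex.I * q0 → s11 q0 qm qp q t η ≠ 0 →
      Complex.exp (l η) = s11 q0 qm qp q t η * blaschkeInv q0 ζ η) ∧
    ∀ z ∈ outer q0, z ≠ -(Complex.I * q0) → s11 q0 qm qp q t z ≠ 0 →
      Complex.exp (conj (l (inv q0 z)) + l 0) = s11 q0 qm qp q t z * blaschkeInv q0 ζ z := by
  obtain ⟨n, L, hL, hl⟩ := innerTheta_pole hq hspec hz
  have h0 := hq.pos
  have hc0 : (q0 : ℂ) ≠ 0 := by exact_mod_cast h0.ne'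
  obtain ⟨l, hfun, hcont, hexp⟩ := exists_log_of_pole h0 (differentiableOn_innerTheta hq hspec hz)
    (continuousOn_innerTheta hq hspec hz)
    (fun η hη => innerTheta_ne_zero hq hspec hz hη.1 hη.2) hL hl
  have hmem0 : (0 : ℂ) ∈ halfDisc q0 \ {Complex.I * (q0 : ℂ)} :=
    ⟨⟨by simpa using h0.le, le_rfl⟩, fun h => by
      rw [mem_singleton_iff] at h; exact mul_ne_zero Complex.I_ne_zero hc0 h.symm⟩
  have hreal : ∀ x : ℝ, |x| ≤ q0 → (x : ℂ) ∈ halfDisc q0 \ {Complex.I * (q0 : ℂ)} := fun x hx =>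
    ⟨ofReal_mem_halfDisc hx, fun h => by
      rw [mem_singleton_iff] at h
      have := congrArg Complex.im h
      simp [h0.ne] at this⟩
  have hexp0 : Complex.exp (l 0) = thetaZero qm qp ζ := (hexp 0 hmem0).trans (if_pos rfl)
  -- values where `s₁₁` does not vanish
  have hin : ∀ η ∈ halfDisc q0, η ≠ 0 → η ≠ Complex.I * q0 → s11 q0 qm qp q t η ≠ 0 →
      Complex.exp (l η) = s11 q0 qm qp q t η * blaschkeInv q0 ζ η := by
    intro η h1 h2 h3 h4
    rw [hexp η ⟨h1, h3⟩, innerTheta_eq hq hz h1 h2]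
    rintro ⟨m, hm⟩
    obtain ⟨h5, h6⟩ := hz.mem m
    -- By symmetry the zeros of `s11` in the half disc are the images of the zₙ, so the removed
    -- singularities are not met where `s11` is nonzero.
    have h7 : s11 q0 qm qp q t (inv q0 η) = 0 := by
      rw [← hm]; exact (hz.zero_iff _ h5 h6).2 ⟨m, rfl⟩
    have h8 := s11_inv hq (t := t) (halfDisc_subset_lowerSet h0 h1 h2)
    rw [h7, zero_eq_mul, map_eq_zero] at h8
    have h9 : qm / qp ≠ 0 := norm_ne_zero_iff.1 (by rw [norm_div_eq_one hq]; exact one_ne_zero)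
    exact h8.elim h9 h4
  have hout : ∀ z ∈ outer q0, z ≠ -(Complex.I * q0) → s11 q0 qm qp q t z ≠ 0 →
      Complex.exp (conj (l (inv q0 z)) + l 0) = s11 q0 qm qp q t z * blaschkeInv q0 ζ z := by
    intro z h1 h2 h3
    have hz0 := outer_ne_zero h0 h1
    have h4 := inv_mem_halfDisc h0 h1
    have h5 : s11 q0 qm qp q t (inv q0 z) ≠ 0 := by
      rw [s11_inv hq (outer_subset_lowerSet h0 h1)]
      refine mul_ne_zero (norm_ne_zero_iff.1 (by rw [norm_div_eq_one hq]; exact one_ne_zero)) ?_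
      simpa using h3
    have h6 : inv q0 z ≠ Complex.I * q0 := fun h => h2 (by
      rw [← inv_inv' h0.ne' hz0, h, inv_I_mul h0.ne'])
    have h7 := inv_ne_zero' h0.ne' hz0
    have h8 := theta_symm (t := t) hq hz (halfDisc_subset_lowerSet h0 h4 h7)
    rw [inv_inv' h0.ne' hz0, ← hin _ h4 h7 h6 h5] at h8
    rw [h8, Complex.exp_add, hexp0, Complex.exp_conj, mul_comm]
  have hre : (l 0).re = 0 := by
    have := norm_thetaZero hq hz
    rw [← hexp0, Complex.norm_exp] at this
    exact Real.exp_eq_one_iff _ |>.1 this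
  have hlin : ∃ δ K : ℝ, 0 < δ ∧ ∀ η ∈ halfDisc q0, ‖η‖ < δ → ‖l η - l 0‖ ≤ K * ‖η‖ := by
    obtain ⟨K, hK, hb⟩ := (innerTheta_isBigO (t := t) hq hz).exists_pos
    have hne := thetaZero_ne_zero hq hz
    have hc1 : ContinuousWithinAt l (halfDisc q0 \ {Complex.I * (q0 : ℂ)}) 0 := hcont 0 hmem0
    have hc2 : ContinuousWithinAt l (halfDisc q0 \ {0}) 0 := by
      refine (hc1.mono_of_mem_nhdsWithin ?_).mono sdiff_subset
      exact inter_mem self_mem_nhdsWithin (mem_nhdsWithin_of_mem_nhds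
        (isOpen_ne.mem_nhds (fun h => hmem0.2 h)))
    have e1 : ∀ᶠ η in 𝓝[halfDisc q0 \ {0}] 0, |(l η - l 0).im| < Real.pi := by
      have : ContinuousWithinAt (fun z => |(l z - l 0).im|) (halfDisc q0 \ {0}) 0 :=
        (Complex.continuous_im.continuousAt.comp_continuousWithinAt
          (hc2.sub continuousWithinAt_const)).abs
      refine this.eventually_lt_const ?_
      simpa using Real.pi_pos
    have e2 : ∀ᶠ η : ℂ in 𝓝[halfDisc q0 \ {0}] 0, K * ‖η‖ < 1 / 2 := by
      have : ContinuousAt (fun η : ℂ => K * ‖η‖) 0 := by fun_prop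
      refine mem_nhdsWithin_of_mem_nhds (this.eventually_lt_const ?_)
      simp
    have e3 : ∀ᶠ η : ℂ in 𝓝[halfDisc q0 \ {0}] 0, η ≠ Complex.I * q0 :=
      mem_nhdsWithin_of_mem_nhds (isOpen_ne.mem_nhds (fun h => hmem0.2 h))
    have e4 : ∀ᶠ η in 𝓝[halfDisc q0 \ {0}] 0, ‖l η - l 0‖ ≤ 3 / 2 * K * ‖η‖ := by
      filter_upwards [e1, e2, e3, hb.bound, self_mem_nhdsWithin] with η f1 f2 f3 f4 f5
      rw [abs_lt] at f1
      -- Near the origin l(η) - l(0) is the principal logarithm of 1 + u. The bound by 3/2 times the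
      -- modulus of u holds because that modulus is at most 1/2.
      set u := innerTheta q0 qm qp q t ζ η / thetaZero qm qp ζ - 1 with hu
      have f6 : l η - l 0 = Complex.log (1 + u) := by
        rw [hu, add_sub_cancel, ← hexp η ⟨f5.1, f3⟩, ← hexp0, ← Complex.exp_sub,
          Complex.log_exp f1.1 f1.2.le]
      have f7 : ‖u‖ ≤ K * ‖η‖ := by
        rw [hu, div_sub_one hne, norm_div, norm_thetaZero hq hz, div_one]
        exact f4
      rw [f6]
      refine (Complex.norm_log_one_add_half_le_self (f7.trans f2.le)).trans ?_
      linarith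
    obtain ⟨δ, hδ, hball⟩ := Metric.mem_nhdsWithin_iff.1 e4
    refine ⟨δ, 3 / 2 * K, hδ, fun η h1 h2 => ?_⟩
    by_cases h3 : η = 0
    · simp [h3]
    · exact hball ⟨by simpa using h2, h1, h3⟩
  -- the choice of the branch
  have hcorner : Complex.exp (l q0) = Complex.exp (conj (l (-q0 : ℝ)) + l 0) := by
    have hq1 : (q0 : ℂ) ∈ outer q0 := ⟨by simp [abs_of_pos h0], by simp⟩
    have hb1 := hreal q0 (abs_of_pos h0).le
    have hq2 : (q0 : ℂ) ∈ contour0 q0 := by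
      refine ⟨Or.inl (by simp), hc0, hb1.2, fun h => ?_⟩
      have := congrArg Complex.im h
      simp [h0.ne'] at this
    have h5 := s11_ne_zero_contour hspec hq2
    have h6 : inv q0 (q0 : ℂ) = ((-q0 : ℝ) : ℂ) := by
      rw [inv, Complex.conj_ofReal]; push_cast; field_simp
    rw [hin _ hb1.1 hc0 hb1.2 h5, ← h6, hout _ hq1 hq2.2.2.2 h5]
  obtain ⟨m, hm⟩ := Complex.exp_eq_exp_iff_exists_int.1 hcorner
  -- The corner relation holds up to 2πim. Adding c = -2πim to l changes its left side by c and
  -- leaves conj(l(·)) + l(0) unchanged, since conj c = -c; the outer formula is therefore not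
  -- affected.
  set c : ℂ := -(m * (2 * Real.pi * Complex.I)) with hc
  have hec : Complex.exp c = 1 := by
    rw [hc, Complex.exp_neg, Complex.exp_int_mul_two_pi_mul_I, inv_one]
  have hcc : conj c = -c := by
    simp [hc, map_ofNat]
  have hcre : c.re = 0 := by
    have h1 := congrArg Complex.re hcc
    have h2 := Complex.conj_re c
    have h3 := Complex.neg_re c
    linarith
  refine ⟨fun η => l η + c, ⟨?_, hcont.add continuousOn_const, ?_, ?_, ?_⟩, ?_, ?_, ?_⟩
  · simpa using hfun.sub (HalfDiscFun.const q0 (-c))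
  · simpa using hlin
  · simp [hre, hcre]
  · rw [map_add, hcc]
    linear_combination hm + hc
  · rw [Complex.exp_add, hec, mul_one, hexp0]
  · intro η h1 h2 h3 h4
    rw [Complex.exp_add, hec, mul_one, hin η h1 h2 h3 h4]
  · intro z h1 h2 h3
    rw [← hout z h1 h2 h3, map_add, hcc]
    congr 1
    ring

end

/-! ### Integrals along the contour -/

/-- Integrability along the boundary of the half disc. -/
def BdIntegrable (r : ℝ) (g : ℂ → ℂ) : Prop :=
  IntervalIntegrable (fun x : ℝ => g x) volume (-r) r ∧
    IntervalIntegrable (fun α => g (circ r α)) volume 0 Real.pi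

theorem HalfDiscFun.bdIntegrable {r : ℝ} {g : ℂ → ℂ} (h : HalfDiscFun r g) (hr : 0 < r) :
    BdIntegrable r g := ⟨h.seg_intervalIntegrable hr, h.arc_intervalIntegrable hr le_rfl⟩

theorem BdIntegrable.div_sub {r : ℝ} {g : ℂ → ℂ} (h : BdIntegrable r g) (hr : 0 < r) {w : ℂ}
    (hw : w ∈ openHalfDisc r ∨ w ∉ halfDisc r) : BdIntegrable r fun η => g η / (η - w) := by
  have h1 : ∀ x : ℝ, x ∈ Icc (-r) r → (x : ℂ) - w ≠ 0 := fun x hx h0 => by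
    rw [sub_eq_zero] at h0
    rcases hw with hw | hw
    · have := hw.2; rw [← h0] at this; simp at this
    · exact hw (h0 ▸ ofReal_mem_halfDisc (abs_le.2 hx))
  have h2 : ∀ α, α ∈ Icc 0 Real.pi → circ r α - w ≠ 0 := fun α hα h0 => by
    rw [sub_eq_zero] at h0
    rcases hw with hw | hw
    · have := hw.1; rw [← h0, norm_circ hr.le] at this; exact lt_irrefl _ this
    · exact hw (h0 ▸ circ_mem_halfDisc hr.le le_rfl hα)
  have hc := continuous_circ r
  simp only [BdIntegrable, div_eq_mul_inv]
  refine ⟨h.1.mul_continuousOn (ContinuousOn.inv₀ (by fun_prop) fun x hx => h1 x ?_),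
    h.2.mul_continuousOn (ContinuousOn.inv₀ (by fun_prop) fun α hα => h2 α ?_)⟩
  · rwa [uIcc_of_le (by linarith)] at hx
  · rwa [uIcc_of_le Real.pi_pos.le] at hα

theorem bdInt_sub {r : ℝ} {g g' : ℂ → ℂ} (h : BdIntegrable r g) (h' : BdIntegrable r g') :
    bdInt r (fun η => g η - g' η) = bdInt r g - bdInt r g' := by
  have hc := continuous_circ r
  have i1 : IntervalIntegrable (fun α => g (circ r α) * (Complex.I * circ r α)) volume 0 Real.pi :=
    h.2.mul_continuousOn (by fun_prop)
  have i2 : IntervalIntegrable (fun α => g' (circ r α) * (Complex.I * circ r α)) volume 0 Real.pi :=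
    h'.2.mul_continuousOn (by fun_prop)
  simp only [bdInt, sub_mul]
  rw [intervalIntegral.integral_sub h.1 h'.1, intervalIntegral.integral_sub i1 i2]
  ring

section

variable {q0 : ℝ} {f g : ℂ → ℂ}

theorem ContourIntegrable.add (hf : ContourIntegrable q0 f) (hg : ContourIntegrable q0 g) :
    ContourIntegrable q0 fun ζ => f ζ + g ζ := ⟨hf.1.add hg.1, hf.2.add hg.2⟩

theorem ContourIntegrable.neg (hf : ContourIntegrable q0 f) :
    ContourIntegrable q0 fun ζ => -f ζ := ⟨hf.1.neg, hf.2.neg⟩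

theorem ContourIntegrable.arc (hf : ContourIntegrable q0 f) {a b : ℝ}
    (ha : a ∈ Icc (-Real.pi) Real.pi) (hb : b ∈ Icc (-Real.pi) Real.pi) :
    IntervalIntegrable (fun α => f (circ q0 α) * (Complex.I * circ q0 α)) volume a b := by
  have hc := continuous_circ q0
  refine (hf.2.mul_continuousOn (g := fun α => Complex.I * circ q0 α) (by fun_prop)).mono_set ?_
  rw [uIcc_of_le (by linarith [Real.pi_pos] : -Real.pi ≤ Real.pi)]
  exact ordConnected_Icc.uIcc_subset ha hb

theorem contourInt_add (hf : ContourIntegrable q0 f) (hg : ContourIntegrable q0 g) :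
    contourInt q0 (fun ζ => f ζ + g ζ) = contourInt q0 f + contourInt q0 g := by
  have hpi := Real.pi_pos
  have m0 : (0 : ℝ) ∈ Icc (-Real.pi) Real.pi := ⟨by linarith, hpi.le⟩
  have m1 : Real.pi ∈ Icc (-Real.pi) Real.pi := ⟨by linarith, le_rfl⟩
  have m2 : -Real.pi ∈ Icc (-Real.pi) Real.pi := ⟨le_rfl, by linarith⟩
  simp only [contourInt, add_mul]
  rw [intervalIntegral.integral_add hf.1.intervalIntegrable hg.1.intervalIntegrable,
    integral_add hf.1.integrableOn hg.1.integrableOn,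
    integral_add hf.1.integrableOn hg.1.integrableOn,
    intervalIntegral.integral_add (hf.arc m0 m1) (hg.arc m0 m1),
    intervalIntegral.integral_add (hf.arc m0 m2) (hg.arc m0 m2)]
  ring

theorem contourInt_neg : contourInt q0 (fun ζ => -f ζ) = -contourInt q0 f := by
  simp only [contourInt, neg_mul, intervalIntegral.integral_neg, integral_neg]
  ring

/-- Conjugation fixes ℝ and exchanges the semicircles. Both semicircles run from q₀ to -q₀, so the
orientation of Σ is preserved. -/
theorem contourInt_conj : contourInt q0 (fun ζ => conj (f (conj ζ))) = conj (contourInt q0 f) := by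
  have h : ∀ a : ℝ, (∫ α in (0 : ℝ)..a, conj (f (conj (circ q0 α))) * (Complex.I * circ q0 α)) =
      conj (∫ α in (0 : ℝ)..-a, f (circ q0 α) * (Complex.I * circ q0 α)) := fun a => by
    rw [← intervalIntegral.intervalIntegral_conj]
    have := intervalIntegral.integral_comp_neg (a := 0) (b := a)
      (fun α => conj (f (circ q0 α) * (Complex.I * circ q0 α)))
    rw [neg_zero] at this
    rw [intervalIntegral.integral_symm (-a) 0, ← this, ← intervalIntegral.integral_neg]
    refine intervalIntegral.integral_congr fun α _ => ?_
    simp [conj_circ]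
  simp only [contourInt, map_add, map_sub, ← intervalIntegral.intervalIntegral_conj, ← integral_conj]
  rw [h, h, neg_neg]
  simp only [Complex.conj_ofReal, ← intervalIntegral.intervalIntegral_conj]
  ring

theorem ContourIntegrable.conj' (hf : ContourIntegrable q0 f) :
    ContourIntegrable q0 fun ζ => conj (f (conj ζ)) := by
  refine ⟨?_, ?_⟩
  · simp only [Complex.conj_ofReal]
    exact Complex.conjCLE.toContinuousLinearMap.integrable_comp hf.1
  · simp only [conj_circ]
    have h1 := hf.2.comp_sub_left 0
    simp only [zero_sub, neg_neg] at h1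
    have h2 := h1.symm
    rw [intervalIntegrable_iff] at h2 ⊢
    exact Complex.conjCLE.toContinuousLinearMap.integrable_comp h2

theorem inv_circ (h0 : 0 < q0) (β : ℝ) : inv q0 (circ q0 β) = circ q0 (β - Real.pi) := by
  have h1 : circ q0 (β - Real.pi) = -circ q0 β := by
    simp only [circ]
    push_cast
    rw [mul_sub, Complex.exp_sub]
    have : Complex.I * (Real.pi : ℂ) = Real.pi * Complex.I := mul_comm _ _
    rw [this, Complex.exp_pi_mul_I]; ring
  have h2 : circ q0 β ≠ 0 := norm_pos_iff.1 (by rw [norm_circ h0.le]; exact h0)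
  have h3 : conj (circ q0 β) ≠ 0 := by simpa using h2
  have h4 : circ q0 β * conj (circ q0 β) = (q0 : ℂ) ^ 2 := mul_conj_eq (norm_circ h0.le β)
  rw [h1, inv, ← h4, mul_div_cancel_right₀ _ h3]

theorem integrableOn_conj_iff {h : ℝ → ℂ} {s : Set ℝ} :
    IntegrableOn (fun x => conj (h x)) s ↔ IntegrableOn h s := by
  refine ⟨fun H => ?_, fun H => ?_⟩
  · have := Complex.conjCLE.toContinuousLinearMap.integrable_comp H
    simp at this
    exact this
  · exact Complex.conjCLE.toContinuousLinearMap.integrable_comp H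

/-- A function on the contour that is given by two functions on the half disc. -/
theorem contour_glue (h0 : 0 < q0) {g1 g2 : ℂ → ℂ} (h1 : BdIntegrable q0 g1)
    (h2 : BdIntegrable q0 g2) (e1 : ∀ ζ ∈ halfDisc q0, f ζ = g1 ζ)
    (e2 : ∀ ζ ∈ outer q0, ζ ∉ halfDisc q0 → ζ.im = 0 ∨ ‖ζ‖ = q0 →
      f ζ = conj (g2 (inv q0 ζ)) * ((q0 : ℂ) ^ 2 / ζ ^ 2)) :
    ContourIntegrable q0 f ∧ contourInt q0 f = bdInt q0 g1 - conj (bdInt q0 g2) := by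
  have hc0 : (q0 : ℂ) ≠ 0 := by exact_mod_cast h0.ne'
  have hpi := Real.pi_pos
  -- the half-lines
  set φ : ℝ → ℝ := fun y => -(q0 ^ 2 / y) with hφ
  have hφd : ∀ y : ℝ, y ≠ 0 → HasDerivAt φ (q0 ^ 2 / y ^ 2) y := fun y hy => by
    have := ((hasDerivAt_inv hy).const_mul (q0 ^ 2)).neg
    refine (this.congr_deriv ?_).congr_of_eventuallyEq (Eventually.of_forall fun x => ?_)
    · field_simp
    · simp only [hφ, div_eq_mul_inv, Pi.neg_apply]
  have hinj : ∀ s : Set ℝ, InjOn φ s := fun s x _ y _ hxy => by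
    simp only [hφ, neg_inj] at hxy
    have := h0.ne'
    exact inv_injective (mul_left_cancel₀ (pow_ne_zero 2 this) (by simpa [div_eq_mul_inv] using hxy))
  have hφi : ∀ y : ℝ, ((φ y : ℝ) : ℂ) = inv q0 y := fun y => by
    simp [hφ, inv]
  have hpull : ∀ y : ℝ, y ≠ 0 → |y| < q0 → |q0 ^ 2 / y ^ 2| • f (φ y : ℝ) = conj (g2 y) := by
    intro y hy hyq
    have hyc : (y : ℂ) ≠ 0 := by exact_mod_cast hy
    have m1 : (y : ℂ) ∈ halfDisc q0 := ofReal_mem_halfDisc hyq.le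
    have m2 : inv q0 (y : ℂ) ∉ halfDisc q0 := fun h => by
      have := h.1
      rw [norm_inv_eq, Complex.norm_real, Real.norm_eq_abs, div_le_iff₀ (abs_pos.2 hy), sq] at this
      exact absurd (le_of_mul_le_mul_left this h0) (not_le.2 hyq)
    rw [hφi, e2 _ (inv_mem_outer h0 m1 hyc) m2 (Or.inl (by rw [← hφi]; simp)), inv_inv' h0.ne' hyc, abs_of_nonneg (by positivity),
      Complex.real_smul, inv, Complex.conj_ofReal]
    push_cast
    field_simp
  have himg1 : φ '' Ioo (-q0) 0 = Ioi q0 := by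
    ext x
    constructor
    · rintro ⟨y, hy, rfl⟩
      have : 0 < -y := by linarith [hy.2]
      show q0 < -(q0 ^ 2 / y)
      rw [← div_neg, lt_div_iff₀ this]
      nlinarith [hy.1]
    · intro hx
      have hx' : q0 < x := hx
      have hx0 : 0 < x := h0.trans hx'
      refine ⟨-(q0 ^ 2 / x), ⟨?_, ?_⟩, ?_⟩
      · rw [neg_lt_neg_iff, div_lt_iff₀ hx0]; nlinarith
      · rw [Left.neg_neg_iff]; positivity
      · simp only [hφ]; field_simp
  have himg2 : φ '' Ioo 0 q0 = Iio (-q0) := by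
    ext x
    constructor
    · rintro ⟨y, hy, rfl⟩
      show -(q0 ^ 2 / y) < -q0
      rw [neg_lt_neg_iff, lt_div_iff₀ hy.1]
      nlinarith [hy.2]
    · intro hx
      have hx' : x < -q0 := hx
      have hx0 : 0 < -x := by linarith
      have hx1 : x ≠ 0 := by linarith
      refine ⟨q0 ^ 2 / (-x), ⟨by positivity, ?_⟩, ?_⟩
      · rw [div_lt_iff₀ hx0]; nlinarith
      · simp only [hφ]; field_simp
  have hg2 : IntegrableOn (fun x : ℝ => conj (g2 x)) (Ioo (-q0) q0) := by
    rw [integrableOn_conj_iff]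
    exact ((intervalIntegrable_iff_integrableOn_Ioo_of_le (by linarith)).1 h2.1)
  have hs : ∀ a b : ℝ, -q0 ≤ a → b ≤ q0 → (b ≤ 0 ∨ 0 ≤ a) →
      IntegrableOn (fun x : ℝ => f x) (φ '' Ioo a b) ∧
      ∫ x in φ '' Ioo a b, f (x : ℂ) = ∫ x in Ioo a b, conj (g2 x) := by
    intro a b ha hb hab
    have hy0 : ∀ y ∈ Ioo a b, y ≠ 0 := fun y hy h => by
      rw [h] at hy
      rcases hab with h | h
      · exact absurd hy.2 (not_lt.2 h)
      · exact absurd hy.1 (not_lt.2 h)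
    have hd : ∀ y ∈ Ioo a b, HasDerivWithinAt φ (q0 ^ 2 / y ^ 2) (Ioo a b) y := fun y hy =>
      (hφd y (hy0 y hy)).hasDerivWithinAt
    have he : EqOn (fun y : ℝ => |q0 ^ 2 / y ^ 2| • f (φ y : ℝ)) (fun y : ℝ => conj (g2 y))
        (Ioo a b) := fun y hy => hpull y (hy0 y hy)
      (abs_lt.2 ⟨by linarith [hy.1], by linarith [hy.2]⟩)
    refine ⟨?_, ?_⟩
    · rw [integrableOn_image_iff_integrableOn_abs_deriv_smul measurableSet_Ioo hd (hinj _),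
        integrableOn_congr_fun he measurableSet_Ioo]
      exact hg2.mono_set (Ioo_subset_Ioo ha hb)
    · rw [integral_image_eq_integral_abs_deriv_smul measurableSet_Ioo hd (hinj _),
        setIntegral_congr_fun measurableSet_Ioo he]
  obtain ⟨i1, j1⟩ := hs (-q0) 0 le_rfl h0.le (Or.inl le_rfl)
  obtain ⟨i2, j2⟩ := hs 0 q0 (by linarith) le_rfl (Or.inr le_rfl)
  rw [himg1] at i1 j1
  rw [himg2] at i2 j2
  have hseg : EqOn (fun x : ℝ => f x) (fun x : ℝ => g1 x) (Icc (-q0) q0) := fun x hx =>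
    e1 x (ofReal_mem_halfDisc (abs_le.2 hx))
  have i3 : IntegrableOn (fun x : ℝ => f x) (Icc (-q0) q0) := by
    rw [integrableOn_congr_fun hseg measurableSet_Icc]
    exact (intervalIntegrable_iff_integrableOn_Icc_of_le (by linarith)).1 h1.1
  have hreal : Integrable fun x : ℝ => f x := by
    rw [← integrableOn_univ]
    refine ((i1.union i2).union i3).mono_set fun x _ => ?_
    rcases lt_or_ge x (-q0) with h | h
    · exact Or.inl (Or.inr h)
    · rcases lt_or_ge q0 x with h' | h'
      · exact Or.inl (Or.inl h')
      · exact Or.inr ⟨h, h'⟩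
  have j3 : (∫ x in (-q0)..q0, f (x : ℂ)) = ∫ x in (-q0)..q0, g1 x :=
    intervalIntegral.integral_congr (by rw [uIcc_of_le (by linarith)]; exact hseg)
  have j4 : (∫ x in Iio (-q0), f (x : ℂ)) + ∫ x in Ioi q0, f (x : ℂ) =
      conj (∫ x in (-q0)..q0, g2 x) := by
    have k1 : IntervalIntegrable (fun x : ℝ => conj (g2 x)) volume (-q0) 0 :=
      (intervalIntegrable_iff_integrableOn_Ioo_of_le (by linarith)).2
        (hg2.mono_set (Ioo_subset_Ioo le_rfl h0.le))
    have k2 : IntervalIntegrable (fun x : ℝ => conj (g2 x)) volume 0 q0 :=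
      (intervalIntegrable_iff_integrableOn_Ioo_of_le h0.le).2
        (hg2.mono_set (Ioo_subset_Ioo (by linarith) le_rfl))
    rw [← intervalIntegral.intervalIntegral_conj,
      ← intervalIntegral.integral_add_adjacent_intervals k1 k2, j1, j2,
      intervalIntegral.integral_of_le (by linarith), intervalIntegral.integral_of_le h0.le,
      integral_Ioc_eq_integral_Ioo, integral_Ioc_eq_integral_Ioo, add_comm]
  -- the semicircles
  have hup : ∀ α ∈ Icc 0 Real.pi, f (circ q0 α) = g1 (circ q0 α) := fun α hα =>
    e1 _ (circ_mem_halfDisc h0.le le_rfl hα)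
  have hcne : ∀ β, circ q0 β ≠ 0 := fun β => norm_pos_iff.1 (by rw [norm_circ h0.le]; exact h0)
  -- On the circle `inv` is the rotation β ↦ β - π, which takes the upper semicircle to the lower
  -- one.
  have hlow : ∀ β ∈ Ioo 0 Real.pi, f (circ q0 (β - Real.pi)) =
      conj (g2 (circ q0 β)) * ((q0 : ℂ) ^ 2 / circ q0 β ^ 2) := by
    intro β hβ
    have m1 : circ q0 β ∈ halfDisc q0 := circ_mem_halfDisc h0.le le_rfl ⟨hβ.1.le, hβ.2.le⟩
    have m2 : inv q0 (circ q0 β) ∉ halfDisc q0 := fun h => by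
      have := h.2
      rw [inv_circ h0, circ_im, Real.sin_sub_pi] at this
      nlinarith [Real.sin_pos_of_mem_Ioo hβ]
    have m3 : circ q0 (β - Real.pi) ^ 2 = circ q0 β ^ 2 := by
      have : circ q0 (β - Real.pi) = -circ q0 β := by
        have h4 : circ q0 β * conj (circ q0 β) = (q0 : ℂ) ^ 2 := mul_conj_eq (norm_circ h0.le β)
        rw [← inv_circ h0, inv, ← h4, mul_div_cancel_right₀ _ (by simpa using hcne β)]
      rw [this, neg_sq]
    rw [← inv_circ h0, e2 _ (inv_mem_outer h0 m1 (hcne β)) m2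
      (Or.inr (by rw [inv_circ h0, norm_circ h0.le])), inv_inv' h0.ne' (hcne β),
      inv_circ h0, m3]
  have hne_pi : ∀ᵐ β : ℝ, β ≠ Real.pi := by simp [ae_iff]
  have hcc := continuous_circ q0
  have hlow_int : IntervalIntegrable (fun β => f (circ q0 (β - Real.pi))) volume 0 Real.pi := by
    rw [intervalIntegrable_iff_integrableOn_Ioo_of_le hpi.le,
      integrableOn_congr_fun hlow measurableSet_Ioo,
      ← intervalIntegrable_iff_integrableOn_Ioo_of_le hpi.le]
    refine IntervalIntegrable.mul_continuousOn ?_ (continuousOn_const.div (by fun_prop)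
      fun β _ => pow_ne_zero _ (hcne β))
    rw [intervalIntegrable_iff_integrableOn_Ioo_of_le hpi.le]
    exact integrableOn_conj_iff.2 ((intervalIntegrable_iff_integrableOn_Ioo_of_le hpi.le).1 h2.2)
  have harc : IntervalIntegrable (fun α => f (circ q0 α)) volume (-Real.pi) Real.pi := by
    refine IntervalIntegrable.trans (b := 0) ?_ ?_
    · have := hlow_int.comp_add_right Real.pi
      simpa using this
    · refine h1.2.congr fun α hα => (hup α ?_).symm
      rw [uIoc_of_le hpi.le] at hα
      exact ⟨hα.1.le, hα.2⟩
  refine ⟨⟨hreal, harc⟩, ?_⟩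
  have j5 : (∫ α in (0 : ℝ)..Real.pi, f (circ q0 α) * (Complex.I * circ q0 α)) =
      ∫ α in (0 : ℝ)..Real.pi, g1 (circ q0 α) * (Complex.I * circ q0 α) := by
    refine intervalIntegral.integral_congr fun α hα => ?_
    rw [uIcc_of_le hpi.le] at hα
    simp only [hup α hα]
  have j6 : (∫ α in (0 : ℝ)..-Real.pi, f (circ q0 α) * (Complex.I * circ q0 α)) =
      -conj (∫ α in (0 : ℝ)..Real.pi, g2 (circ q0 α) * (Complex.I * circ q0 α)) := by
    have s1 := intervalIntegral.integral_comp_sub_right (a := 0) (b := Real.pi)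
      (fun α => f (circ q0 α) * (Complex.I * circ q0 α)) Real.pi
    rw [zero_sub, sub_self] at s1
    rw [intervalIntegral.integral_symm, ← s1, ← intervalIntegral.intervalIntegral_conj]
    congr 1
    refine intervalIntegral.integral_congr_ae ?_
    filter_upwards [hne_pi] with β hβ hβ'
    rw [uIoc_of_le hpi.le] at hβ'
    have h4 : circ q0 β * conj (circ q0 β) = (q0 : ℂ) ^ 2 := mul_conj_eq (norm_circ h0.le β)
    have h5 : circ q0 (β - Real.pi) = -circ q0 β := by
      rw [← inv_circ h0, inv, ← h4, mul_div_cancel_right₀ _ (by simpa using hcne β)]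
    have h6 := hcne β
    rw [hlow β ⟨hβ'.1, lt_of_le_of_ne hβ'.2 hβ⟩, h5, ← h4]
    simp only [map_mul, Complex.conj_I]
    field_simp
  rw [contourInt, bdInt, bdInt, j3, j5, j6, map_add, ← j4]
  ring

end

/-! ### The Cauchy integrals of the logarithms -/

open Classical in
/-- The logarithm in `D⁻` that extends a logarithm on the half disc. -/
noncomputable def logMinus (q0 : ℝ) (l : ℂ → ℂ) (z : ℂ) : ℂ :=
  if z ∈ halfDisc q0 then l z else conj (l (inv q0 z)) + l 0

/-- The reflected logarithm in `D⁺`. -/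
noncomputable def logPlus (q0 : ℝ) (l : ℂ → ℂ) (z : ℂ) : ℂ := conj (logMinus q0 l (conj z))

/-- The logarithm of the jump. -/
noncomputable def logJump (q0 : ℝ) (l : ℂ → ℂ) (z : ℂ) : ℂ := -(logMinus q0 l z + logPlus q0 l z)

theorem logMinus_of_halfDisc {q0 : ℝ} {l : ℂ → ℂ} {z : ℂ} (hz : z ∈ halfDisc q0) :
    logMinus q0 l z = l z := if_pos hz

theorem logMinus_of_notMem {q0 : ℝ} {l : ℂ → ℂ} {z : ℂ} (hz : z ∉ halfDisc q0) :
    logMinus q0 l z = conj (l (inv q0 z)) + l 0 := if_neg hz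

theorem mem_halfDisc_or_mem_outer {q0 : ℝ} {z : ℂ} (hz : z ∈ contour0 q0) :
    z ∈ halfDisc q0 ∨ z ∈ outer q0 := by
  rcases hz.1 with h | h
  · rcases le_total ‖z‖ q0 with h' | h'
    · exact Or.inl ⟨h', h.ge⟩
    · exact Or.inr ⟨h', h.le⟩
  · rcases le_total 0 z.im with h' | h'
    · exact Or.inl ⟨h.le, h'⟩
    · exact Or.inr ⟨h.ge, h'⟩

namespace ReflLog

variable {q0 : ℝ} {l : ℂ → ℂ} (hl : ReflLog q0 l) (h0 : 0 < q0)
include hl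

theorem conj_zero : conj (l 0) = -l 0 := by
  have := hl.zero_re
  apply Complex.ext <;> simp [this]

include h0

/-- The half disc and the outer region meet only at ±q₀. The corner relation gives the claim at q₀,
and its conjugate gives it at -q₀ because l(0) is imaginary. -/
theorem logMinus_of_outer {z : ℂ} (hz : z ∈ outer q0) :
    logMinus q0 l z = conj (l (inv q0 z)) + l 0 := by
  by_cases h : z ∈ halfDisc q0
  · rw [logMinus_of_halfDisc h]
    have h1 : z.im = 0 := le_antisymm hz.2 h.2
    have h2 : |z.re| = q0 := by
      have := le_antisymm h.1 hz.1
      rwa [← Complex.abs_re_eq_norm.2 h1] at this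
    have h3 : z = (z.re : ℂ) := Complex.ext rfl (by simpa using h1)
    have hc0 : (q0 : ℂ) ≠ 0 := by exact_mod_cast h0.ne'
    rcases (abs_eq h0.le).1 h2 with h4 | h4
    · have h5 : inv q0 (q0 : ℂ) = ((-q0 : ℝ) : ℂ) := by
        rw [inv, Complex.conj_ofReal]; push_cast; field_simp
      rw [h3, h4, h5, hl.corner]
    · have h5 : inv q0 ((-q0 : ℝ) : ℂ) = (q0 : ℂ) := by
        rw [inv, Complex.conj_ofReal]; push_cast; field_simp
      rw [h3, h4, h5, hl.corner, map_add, Complex.conj_conj, hl.conj_zero]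
      ring
  · exact logMinus_of_notMem h

theorem bdIntegrable : BdIntegrable q0 l := hl.halfDiscFun.bdIntegrable h0

omit h0 in
theorem halfDiscFun_div : HalfDiscFun q0 fun η => (l η - l 0) / η := by
  obtain ⟨δ, K, hδ, hb⟩ := hl.lin
  exact (hl.halfDiscFun.sub (HalfDiscFun.const q0 (l 0))).div_id hδ hb

/-- The Cauchy integral of the logarithm in `D⁻`. -/
theorem contourInt_logMinus {z : ℂ} (hz : z ∈ regionMinus q0 ∪ regionPlus q0) :
    ContourIntegrable q0 (fun ζ => logMinus q0 l ζ / (ζ - z)) ∧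
      (z ∈ regionMinus q0 → contourInt q0 (fun ζ => logMinus q0 l ζ / (ζ - z)) =
        2 * Real.pi * Complex.I * logMinus q0 l z) ∧
      (z ∈ regionPlus q0 → contourInt q0 (fun ζ => logMinus q0 l ζ / (ζ - z)) = 0) := by
  have hz0 : z ≠ 0 := fun h => by
    rcases hz with hz | hz
    · exact regionMinus_ne_zero hz h
    · simp [regionPlus, h] at hz
  -- For z in D⁺ neither z nor its image is in the half disc, so both Cauchy integrals vanish. For z
  -- in D⁻ exactly one of the two points is inside.
  have hplus : z ∈ regionPlus q0 → z ∉ halfDisc q0 ∧ inv q0 z ∉ halfDisc q0 := by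
    intro hp
    have hp' : 0 < (‖z‖ ^ 2 - q0 ^ 2) * z.im := hp
    have key : ∀ w : ℂ, w ∈ lowerSet q0 → w ∉ regionPlus q0 := fun w hw hw' => by
      have h1 := im_lamOf q0 w
      have h2 : 0 < (‖w‖ ^ 2 - q0 ^ 2) * w.im := hw'
      have h3 := hw.2
      have : 0 < ‖w‖ := norm_pos_iff.2 hw.1
      nlinarith [mul_nonneg (sq_nonneg ‖w‖) (neg_nonneg.2 h3)]
    refine ⟨fun h => key z (halfDisc_subset_lowerSet h0 h hz0) hp, fun h => ?_⟩
    have h1 := inv_mem_lowerSet h0.ne' (halfDisc_subset_lowerSet h0 h (inv_ne_zero' h0.ne' hz0))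
    rw [inv_inv' h0.ne' hz0] at h1
    exact key z h1 hp
  have hminus1 : z ∈ openHalfDisc q0 → inv q0 z ∉ halfDisc q0 := fun h h' => by
    have h1 := (inv_mem_openOuter h0 h).1
    linarith [h'.1]
  have hminus2 : z ∈ openOuter q0 → z ∉ halfDisc q0 := fun h h' => by
    linarith [h.1, h'.1]
  have c1 : z ∈ openHalfDisc q0 ∨ z ∉ halfDisc q0 := by
    rcases hz with hz | hz
    · rcases (mem_regionMinus_iff h0).1 hz with h | h
      · exact Or.inl h
      · exact Or.inr (hminus2 h)
    · exact Or.inr (hplus hz).1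
  have c2 : inv q0 z ∈ openHalfDisc q0 ∨ inv q0 z ∉ halfDisc q0 := by
    rcases hz with hz | hz
    · rcases (mem_regionMinus_iff h0).1 hz with h | h
      · exact Or.inr (hminus1 h)
      · exact Or.inl (inv_mem_openHalfDisc h0 h)
    · exact Or.inr (hplus hz).2
  have hsub := hl.halfDiscFun.sub (HalfDiscFun.const q0 (l 0))
  have hdiv := hl.halfDiscFun_div
  have b1 := (hl.bdIntegrable h0).div_sub h0 c1
  have b2 := (hsub.bdIntegrable h0).div_sub h0 c2
  have b3 := hdiv.bdIntegrable h0
  -- Under η = inv ζ the kernel dζ/(ζ - z) becomes the conjugate of (1/(η - inv z) - 1/η)dη. The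
  -- outer logarithm is conj(l(η) - l(0)), so the term in 1/η has no pole.
  obtain ⟨hci, hval⟩ := contour_glue (f := fun ζ => logMinus q0 l ζ / (ζ - z)) h0 b1
    (g2 := fun η => (l η - l 0) / (η - inv q0 z) - (l η - l 0) / η) ⟨b2.1.sub b3.1, b2.2.sub b3.2⟩
    (fun ζ hζ => by rw [logMinus_of_halfDisc hζ]) (fun ζ hζ hζ' hζc => by
      have hζ0 := outer_ne_zero h0 hζ
      rw [logMinus_of_notMem hζ']
      have hc0 : (q0 : ℂ) ≠ 0 := by exact_mod_cast h0.ne'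
      simp only [map_sub, map_div₀, hl.conj_zero]
      have e1 : ∀ w, conj (inv q0 w) = -((q0 : ℂ) ^ 2 / w) := fun w => by
        rw [inv_eq_conj, Complex.conj_conj]
      rw [e1, e1]
      by_cases h : ζ = z
      · subst h
        have h1 : (‖ζ‖ ^ 2 - q0 ^ 2) * ζ.im = 0 := by
          rcases hζc with h | h <;> simp [h]
        rcases hz with h | h
        · exact absurd h1 (ne_of_lt h)
        · exact absurd h1 (ne_of_gt h)
      · have h' : ζ - z ≠ 0 := sub_ne_zero.2 h
        have e2 : -((q0 : ℂ) ^ 2 / ζ) - -((q0 : ℂ) ^ 2 / z) = q0 ^ 2 * (ζ - z) / (ζ * z) := by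
          field_simp; ring
        rw [e2]
        field_simp
        ring)
  refine ⟨hci, ?_, ?_⟩
  all_goals
    intro hzz
    rw [hval, bdInt_sub b2 b3, hdiv.bdInt_eq_zero h0, sub_zero]
  · rcases (mem_regionMinus_iff h0).1 hzz with h | h
    · rw [hl.halfDiscFun.bdInt_div_sub h, hsub.bdInt_div_sub_eq_zero h0 (hminus1 h),
        logMinus_of_halfDisc ⟨h.1.le, h.2.le⟩]
      simp
    · rw [hl.halfDiscFun.bdInt_div_sub_eq_zero h0 (hminus2 h),
        hsub.bdInt_div_sub (inv_mem_openHalfDisc h0 h), logMinus_of_notMem (hminus2 h)]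
      simp only [map_mul, map_sub, Complex.conj_I, Complex.conj_ofReal, map_ofNat, hl.conj_zero]
      ring
  · rw [hl.halfDiscFun.bdInt_div_sub_eq_zero h0 (hplus hzz).1,
      hsub.bdInt_div_sub_eq_zero h0 (hplus hzz).2]
    simp

/-- The Cauchy integral of the reflected logarithm is the conjugate of the one for `logMinus` at
conj z, which lies in the other region. So each side of Σ sees only its own logarithm. -/
theorem contourInt_logJump {z : ℂ} (hz : z ∈ regionMinus q0 ∪ regionPlus q0) :
    ContourIntegrable q0 (fun ζ => logJump q0 l ζ / (ζ - z)) ∧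
      (z ∈ regionMinus q0 → contourInt q0 (fun ζ => logJump q0 l ζ / (ζ - z)) =
        -(2 * Real.pi * Complex.I * logMinus q0 l z)) ∧
      (z ∈ regionPlus q0 → contourInt q0 (fun ζ => logJump q0 l ζ / (ζ - z)) =
        2 * Real.pi * Complex.I * logPlus q0 l z) := by
  have m1 : z ∈ regionMinus q0 ↔ conj z ∈ regionPlus q0 := by
    rw [← conj_mem_regionMinus, Complex.conj_conj]
  have m2 : z ∈ regionPlus q0 ↔ conj z ∈ regionMinus q0 := conj_mem_regionMinus.symm
  have hz' : conj z ∈ regionMinus q0 ∪ regionPlus q0 := by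
    rcases hz with h | h
    · exact Or.inr (m1.1 h)
    · exact Or.inl (m2.1 h)
  obtain ⟨a1, a2, a3⟩ := hl.contourInt_logMinus h0 hz
  obtain ⟨b1, b2, b3⟩ := hl.contourInt_logMinus h0 hz'
  have e : (fun ζ => logJump q0 l ζ / (ζ - z)) = fun ζ => -(logMinus q0 l ζ / (ζ - z) +
      (fun ζ => conj ((fun ζ => logMinus q0 l ζ / (ζ - conj z)) (conj ζ))) ζ) := by
    funext ζ
    simp only [logJump, logPlus, map_div₀, map_sub, Complex.conj_conj]
    ring
  have c1 := b1.conj'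
  refine ⟨?_, fun h => ?_, fun h => ?_⟩
  · rw [e]; exact (a1.add c1).neg
  · rw [e, contourInt_neg, contourInt_add a1 c1,
      contourInt_conj (f := fun ζ => logMinus q0 l ζ / (ζ - conj z)), a2 h, b3 (m1.1 h)]
    simp
  · rw [e, contourInt_neg, contourInt_add a1 c1,
      contourInt_conj (f := fun ζ => logMinus q0 l ζ / (ζ - conj z)), a3 h, b2 (m2.1 h), logPlus]
    simp [map_ofNat]

/-- The integral of the logarithm of the jump against `1 / ζ`. -/
theorem contourInt_logJump_zero : ContourIntegrable q0 (fun ζ => logJump q0 l ζ / ζ) ∧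
    contourInt q0 (fun ζ => logJump q0 l ζ / ζ) = -(2 * Real.pi * Complex.I * l 0) := by
  classical
  have hpi := Real.pi_pos
  have hdiv := hl.halfDiscFun_div
  have b1 := hdiv.bdIntegrable h0
  -- The pole of 1/ζ lies on Σ, so l(0) is subtracted on the half disc. On ℝ this changes nothing,
  -- as l(0) is imaginary and cancels between f and its reflection. On the open semicircles it
  -- leaves ±l(0)/ζ, collected in the function c below.
  set f : ℂ → ℂ := fun ζ => (if ζ ∈ halfDisc q0 then l ζ - l 0 else conj (l (inv q0 ζ)) + l 0) / ζ
    with hf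
  obtain ⟨hfi, hfv⟩ := contour_glue (f := f) h0 b1
    (g2 := fun η => 0 - (l η - l 0) / η)
    ⟨(intervalIntegrable_const (c := (0 : ℂ))).sub b1.1,
      (intervalIntegrable_const (c := (0 : ℂ))).sub b1.2⟩
    (fun ζ hζ => by simp only [hf, if_pos hζ]) (fun ζ hζ hζ' _ => by
      have hζ0 := outer_ne_zero h0 hζ
      have hc0 : (q0 : ℂ) ≠ 0 := by exact_mod_cast h0.ne'
      simp only [hf, if_neg hζ', map_sub, map_div₀, hl.conj_zero, map_zero]
      rw [inv_eq_conj, Complex.conj_conj, ← inv_eq_conj]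
      field_simp
      ring)
  have hg2 : bdInt q0 (fun η => 0 - (l η - l 0) / η) = 0 :=
    ((HalfDiscFun.const q0 0).sub hdiv).bdInt_eq_zero h0
  rw [hdiv.bdInt_eq_zero h0, hg2, map_zero, sub_zero] at hfv
  -- the correction on the semicircles
  set c : ℂ → ℂ := fun ζ => if ζ.im = 0 then 0 else if 0 < ζ.im then l 0 / ζ else -l 0 / ζ with hc
  have hcne : ∀ β, circ q0 β ≠ 0 := fun β => norm_pos_iff.1 (by rw [norm_circ h0.le]; exact h0)
  have hc1 : ∀ α ∈ Ioo 0 Real.pi, c (circ q0 α) = l 0 / circ q0 α := fun α hα => by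
    have : 0 < (circ q0 α).im := by
      rw [circ_im]; exact mul_pos h0 (Real.sin_pos_of_mem_Ioo hα)
    simp only [hc, if_neg this.ne', if_pos this]
  have hc2 : ∀ α ∈ Ioo (-Real.pi) 0, c (circ q0 α) = -l 0 / circ q0 α := fun α hα => by
    have : (circ q0 α).im < 0 := by
      rw [circ_im]; exact mul_neg_of_pos_of_neg h0 (Real.sin_neg_of_neg_of_neg_pi_lt hα.2 hα.1)
    simp only [hc, if_neg this.ne, if_neg this.not_gt]
  have hcc := continuous_circ q0
  have hci : ContourIntegrable q0 c := by
    refine ⟨by simp [hc], IntervalIntegrable.trans (b := 0) ?_ ?_⟩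
    · rw [intervalIntegrable_iff_integrableOn_Ioo_of_le (by linarith),
        integrableOn_congr_fun hc2 measurableSet_Ioo,
        ← intervalIntegrable_iff_integrableOn_Ioo_of_le (by linarith)]
      exact (continuous_const.div hcc hcne).intervalIntegrable _ _
    · rw [intervalIntegrable_iff_integrableOn_Ioo_of_le hpi.le,
        integrableOn_congr_fun hc1 measurableSet_Ioo,
        ← intervalIntegrable_iff_integrableOn_Ioo_of_le hpi.le]
      exact (continuous_const.div hcc hcne).intervalIntegrable _ _
  -- Each semicircle contributes iπ l(0): on the lower one the sign of c and the direction of the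
  -- path are both reversed.
  have hcv : contourInt q0 c = 2 * Real.pi * Complex.I * l 0 := by
    have k1 : (∫ α in (0 : ℝ)..Real.pi, c (circ q0 α) * (Complex.I * circ q0 α)) =
        Real.pi * (Complex.I * l 0) := by
      rw [intervalIntegral.integral_of_le hpi.le, integral_Ioc_eq_integral_Ioo,
        setIntegral_congr_fun (g := fun _ => Complex.I * l 0) measurableSet_Ioo fun α hα => ?_]
      · simp [hpi.le]
      · have := hcne α
        simp only [hc1 α hα]; field_simp
    have k2 : (∫ α in (0 : ℝ)..-Real.pi, c (circ q0 α) * (Complex.I * circ q0 α)) =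
        Real.pi * (Complex.I * l 0) := by
      rw [intervalIntegral.integral_symm, intervalIntegral.integral_of_le (by linarith),
        integral_Ioc_eq_integral_Ioo,
        setIntegral_congr_fun (g := fun _ => -(Complex.I * l 0)) measurableSet_Ioo fun α hα => ?_]
      · simp [hpi.le]
      · have := hcne α
        simp only [hc2 α hα]; field_simp
    rw [contourInt, k1, k2]
    simp only [hc, Complex.ofReal_im, if_true, integral_zero, intervalIntegral.integral_zero]
    ring
  have hf' := hfi.conj'
  have hsum := (hfi.add hf').add hci
  -- the integrand on the contour
  have hpt : ∀ ζ : ℂ, ζ.im = 0 ∨ ‖ζ‖ = q0 → logJump q0 l ζ / ζ =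
      -((f ζ + conj (f (conj ζ))) + c ζ) := by
    intro ζ hζ
    simp only [logJump, logPlus, logMinus, hf, hc, map_div₀, Complex.conj_conj]
    by_cases hi : ζ.im = 0
    · have hcj : conj ζ = ζ := Complex.conj_eq_iff_im.2 hi
      rw [if_pos hi, hcj]
      split_ifs
      · rw [map_sub, hl.conj_zero]; ring
      · ring
    · have hn : ‖ζ‖ = q0 := hζ.resolve_left hi
      have hn' : ‖conj ζ‖ = q0 := by rw [RCLike.norm_conj, hn]
      rw [if_neg hi]
      rcases lt_or_gt_of_ne hi with h | h
      · have m1 : ζ ∉ halfDisc q0 := fun h' => absurd h'.2 (not_le.2 h)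
        have m2 : conj ζ ∈ halfDisc q0 := ⟨hn'.le, by rw [Complex.conj_im]; linarith⟩
        rw [if_neg m1, if_pos m2, if_neg m1, if_pos m2, if_neg h.not_gt, map_sub, hl.conj_zero]
        ring
      · have m1 : ζ ∈ halfDisc q0 := ⟨hn.le, h.le⟩
        have m2 : conj ζ ∉ halfDisc q0 := fun h' => by
          have := h'.2; rw [Complex.conj_im] at this; linarith
        rw [if_pos m1, if_neg m2, if_pos m1, if_neg m2, if_pos h]
        ring
  have hr : ∀ x : ℝ, logJump q0 l x / x = -((f x + conj (f (conj (x : ℂ)))) + c x) := fun x =>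
    hpt x (Or.inl (Complex.ofReal_im x))
  have ha : ∀ α : ℝ, logJump q0 l (circ q0 α) / circ q0 α =
      -((f (circ q0 α) + conj (f (conj (circ q0 α)))) + c (circ q0 α)) := fun α =>
    hpt _ (Or.inr (norm_circ h0.le α))
  constructor
  · have := hsum.neg
    refine ⟨?_, ?_⟩
    · simp only [hr]; exact this.1
    · simp only [ha]; exact this.2
  · have e : contourInt q0 (fun ζ => logJump q0 l ζ / ζ) =
        contourInt q0 fun ζ => -((f ζ + conj (f (conj ζ))) + c ζ) := by
      simp only [contourInt, hr, ha]
    rw [e, contourInt_neg, contourInt_add (hfi.add hf') hci, contourInt_add hfi hf',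
      contourInt_conj, hfv, hcv]
    simp

/-- Two closed pieces cover Σ₀. On each the logarithm is continuous away from one branch point, and
the formulas agree on the overlap. -/
theorem continuousOn_logMinus : ContinuousOn (logMinus q0 l) (contour0 q0) := by
  intro z hz
  have hsub : contour0 q0 ⊆ (halfDisc q0 \ {Complex.I * (q0 : ℂ)}) ∪
      (outer q0 \ {-(Complex.I * (q0 : ℂ))}) := fun w hw =>
    (mem_halfDisc_or_mem_outer hw).imp (fun h => ⟨h, hw.2.2.1⟩) fun h => ⟨h, hw.2.2.2⟩
  refine ContinuousWithinAt.mono (ContinuousWithinAt.union ?_ ?_) hsub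
  · by_cases h : z ∈ halfDisc q0
    · exact (hl.cont z ⟨h, hz.2.2.1⟩).congr (fun w hw => logMinus_of_halfDisc hw.1)
        (logMinus_of_halfDisc h)
    · refine continuousWithinAt_of_notMem_closure fun h' => h ?_
      exact (isClosed_halfDisc q0).closure_subset_iff.2 sdiff_subset h'
  · have hcl : IsClosed (outer q0) := (isClosed_le continuous_const continuous_norm).inter
      (isClosed_le Complex.continuous_im continuous_const)
    by_cases h : z ∈ outer q0
    · have hz0 := outer_ne_zero h0 h
      have hm : MapsTo (inv q0) (outer q0 \ {-(Complex.I * (q0 : ℂ))})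
          (halfDisc q0 \ {Complex.I * (q0 : ℂ)}) := fun w hw => by
        refine ⟨inv_mem_halfDisc h0 hw.1, fun h1 => hw.2 ?_⟩
        rw [mem_singleton_iff] at h1 ⊢
        rw [← inv_inv' h0.ne' (outer_ne_zero h0 hw.1), h1, inv_I_mul h0.ne']
      have h2 := (hl.cont _ (hm ⟨h, hz.2.2.2⟩)).comp (continuousAt_inv hz0).continuousWithinAt hm
      have h3 : ContinuousWithinAt (fun z => conj (l (inv q0 z)))
        (outer q0 \ {-(Complex.I * (q0 : ℂ))}) z := tendsto_conj h2
      exact (h3.add continuousWithinAt_const).congr (fun w hw => hl.logMinus_of_outer h0 hw.1)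
        (hl.logMinus_of_outer h0 h)
    · refine continuousWithinAt_of_notMem_closure fun h' => h ?_
      exact hcl.closure_subset_iff.2 sdiff_subset h'

theorem continuousOn_logJump : ContinuousOn (logJump q0 l) (contour0 q0) := by
  have h1 := hl.continuousOn_logMinus h0
  have h2 : ContinuousOn (logPlus q0 l) (contour0 q0) := fun z hz => tendsto_conj
    ((h1 _ (conj_mem_contour0.2 hz)).comp Complex.continuous_conj.continuousWithinAt
      fun w hw => conj_mem_contour0.2 hw)
  exact (h1.add h2).neg

theorem differentiableOn_logMinus : DifferentiableOn ℂ (logMinus q0 l) (regionMinus q0) := by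
  intro z hz
  refine DifferentiableAt.differentiableWithinAt ?_
  rcases (mem_regionMinus_iff h0).1 hz with h | h
  · refine (hl.halfDiscFun.diff.differentiableAt
      ((isOpen_openHalfDisc q0).mem_nhds h)).congr_of_eventuallyEq ?_
    filter_upwards [(isOpen_openHalfDisc q0).mem_nhds h] with w hw
    exact logMinus_of_halfDisc ⟨hw.1.le, hw.2.le⟩
  · have hz0 := outer_ne_zero h0 (openOuter_subset q0 h)
    have h1 := hl.halfDiscFun.diff.differentiableAt
      ((isOpen_openHalfDisc q0).mem_nhds (inv_mem_openHalfDisc h0 h))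
    rw [inv_eq_conj] at h1
    have h2 := h1.conj_conj
    rw [Complex.conj_conj] at h2
    have h3 : DifferentiableAt ℂ (fun z : ℂ => -((q0 : ℂ) ^ 2 / z)) z := by
      fun_prop (disch := assumption)
    refine ((DifferentiableAt.comp z h2 h3).add_const (l 0)).congr_of_eventuallyEq ?_
    filter_upwards [(isOpen_openOuter q0).mem_nhds h] with w hw
    rw [hl.logMinus_of_outer h0 (openOuter_subset q0 hw), inv_eq_conj]
    rfl

theorem differentiableOn_logPlus : DifferentiableOn ℂ (logPlus q0 l) (regionPlus q0) := by
  intro z hz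
  refine DifferentiableAt.differentiableWithinAt ?_
  have hz' := conj_mem_regionMinus.2 hz
  have h1 := (hl.differentiableOn_logMinus h0).differentiableAt
    ((isOpen_regionMinus q0).mem_nhds hz')
  have h2 := h1.conj_conj
  rw [Complex.conj_conj] at h2
  exact h2

omit hl h0 in
theorem logJump_im (x : ℝ) : (logJump q0 l x).im = 0 := by
  simp [logJump, logPlus]

end ReflLog

/-! ### The scattering coefficients in terms of the logarithms -/

/-- A logarithm of `s₁₁ B⁻¹` on the half disc and its reflection. -/
structure ThetaLog (q0 : ℝ) (qm qp : ℂ) (q : ℝ → ℂ) (t : ℝ) {N : ℕ} (ζ : Fin N → ℂ) (l : ℂ → ℂ) :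
    Prop where
  reflLog : ReflLog q0 l
  exp_zero : Complex.exp (l 0) = thetaZero qm qp ζ
  exp_minus : ∀ z ∈ regionMinus q0 ∪ contour0 q0, s11 q0 qm qp q t z ≠ 0 →
    Complex.exp (logMinus q0 l z) = s11 q0 qm qp q t z * blaschkeInv q0 ζ z

theorem lower_of_mem {q0 : ℝ} {z : ℂ} (hz : z ∈ regionMinus q0 ∪ contour0 q0) : z ∈ lowerSet q0 :=
  hz.elim (fun h => regionMinus_subset q0 h) fun h => contour0_subset q0 h

theorem conj_mem_of_mem {q0 : ℝ} {z : ℂ} (hz : z ∈ regionPlus q0 ∪ contour0 q0) :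
    conj z ∈ regionMinus q0 ∪ contour0 q0 :=
  hz.imp (fun h => conj_mem_regionMinus.2 h) fun h => conj_mem_contour0.2 h

/-- Uniform limits at infinity transfer to cobounded filters. -/
theorem tendsto_one_of_norm_le {f : ℂ → ℂ} {S : Set ℂ} {C R : ℝ}
    (h : ∀ z ∈ S, R ≤ ‖z‖ → ‖f z - 1‖ ≤ C / ‖z‖) :
    Tendsto f (Bornology.cobounded ℂ ⊓ 𝓟 S) (𝓝 1) := by
  rw [tendsto_iff_norm_sub_tendsto_zero]
  have h1 : Tendsto (fun z : ℂ => C / ‖z‖) (Bornology.cobounded ℂ ⊓ 𝓟 S) (𝓝 0) :=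
    (tendsto_norm_cobounded_atTop.const_div_atTop C).mono_left inf_le_left
  refine squeeze_zero' (Eventually.of_forall fun z => norm_nonneg _) ?_ h1
  have h2 : ∀ᶠ z : ℂ in Bornology.cobounded ℂ ⊓ 𝓟 S, R ≤ ‖z‖ :=
    (tendsto_norm_cobounded_atTop.mono_left inf_le_left).eventually_ge_atTop R
  filter_upwards [h2, mem_inf_of_right (mem_principal_self S)] with z hz hS using h z hS hz

section

variable {q0 : ℝ} {qm qp : ℂ} {q : ℝ → ℂ} {t : ℝ} {N : ℕ} {ζ : Fin N → ℂ}

variable (hq : IsPotential q0 qm qp q)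
  (hspec : ∃ c : ℝ, 0 < c ∧ ∀ ζ ∈ contour0 q0, c ≤ ‖s11 q0 qm qp q t ζ‖)
  (hz : HasDoubleZeros q0 qm qp q t ζ)

include hq hspec hz in
theorem exists_thetaLog : ∃ l : ℂ → ℂ, ThetaLog q0 qm qp q t ζ l := by
  obtain ⟨l, hl, hl0, hin, hout⟩ := exists_reflLog hq hspec hz
  have h0 := hq.pos
  refine ⟨l, hl, hl0, fun z hzm hs => ?_⟩
  have hin' : ∀ z ∈ openHalfDisc q0, s11 q0 qm qp q t z ≠ 0 →
      Complex.exp (logMinus q0 l z) = s11 q0 qm qp q t z * blaschkeInv q0 ζ z := fun z h hs => by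
    obtain ⟨h1, h2⟩ := openHalfDisc_subset h
    rw [logMinus_of_halfDisc h1]
    exact hin z h1 (fun h => h2 (Or.inl h)) (fun h => h2 (Or.inr h)) hs
  rcases hzm with h | h
  · rcases (mem_regionMinus_iff h0).1 h with h | h
    · exact hin' z h hs
    · rw [hl.logMinus_of_outer h0 (openOuter_subset q0 h)]
      refine hout z (openOuter_subset q0 h) (fun h1 => ?_) hs
      have := h.1
      rw [h1] at this
      simp [abs_of_pos h0] at this
  · rcases mem_halfDisc_or_mem_outer h with h' | h'
    · rw [logMinus_of_halfDisc h']
      exact hin z h' h.2.1 h.2.2.1 hs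
    · rw [hl.logMinus_of_outer h0 h']
      exact hout z h' h.2.2.2 hs

include hq hz in
/-- The product vanishes at the zeros of `s₁₁`. -/
theorem blaschke_eq_zero {z : ℂ} (h : z ∈ regionMinus q0) (hs : s11 q0 qm qp q t z = 0) :
    blaschke q0 ζ z = 0 := by
  have h0 := hq.pos
  have key : ∀ w ∈ openOuter q0, s11 q0 qm qp q t w = 0 → blaschke q0 ζ w = 0 := fun w hw hw0 => by
    obtain ⟨n, rfl⟩ := (hz.zero_iff w ((mem_regionMinus_iff h0).2 (Or.inr hw)) hw.2).1 hw0
    exact Finset.prod_eq_zero (Finset.mem_univ n) (by simp)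
  rcases (mem_regionMinus_iff h0).1 h with h' | h'
  · have hz0 := regionMinus_ne_zero h
    have h1 := s11_inv hq (t := t) (regionMinus_subset q0 h)
    rw [hs, map_zero, mul_zero] at h1
    have h2 := key _ (inv_mem_openOuter h0 h') h1
    rw [← inv_inv' h0.ne' hz0, blaschke_inv h0.ne' (zero_ne_zero hq hz) (inv_ne_zero' h0.ne' hz0),
      h2, map_zero, mul_zero]
  · exact key z h' hs

namespace ThetaLog

variable {l : ℂ → ℂ} (hl : ThetaLog q0 qm qp q t ζ l)
include hl

/-- At a zero of the product the convention 0⁻¹ = 0 would make the right side of `exp_minus` vanish,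
which an exponential never does. -/
theorem blaschke_ne_zero {z : ℂ} (h : z ∈ regionMinus q0 ∪ contour0 q0)
    (hs : s11 q0 qm qp q t z ≠ 0) : blaschke q0 ζ z ≠ 0 := fun h0 => by
  have := hl.exp_minus z h hs
  rw [blaschkeInv_eq, h0, inv_zero, mul_zero] at this
  exact Complex.exp_ne_zero _ this

include hq

theorem exp_plus {z : ℂ} (h : z ∈ regionPlus q0 ∪ contour0 q0) (hs : s22 q0 qm qp q t z ≠ 0) :
    Complex.exp (logPlus q0 l z) = s22 q0 qm qp q t z * blaschke q0 ζ z := by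
  have h' := conj_mem_of_mem h
  have e := s22_eq hq (t := t) (lower_of_mem h')
  have hs' : s11 q0 qm qp q t (conj z) ≠ 0 := fun h1 => hs (by rw [e, h1, map_zero])
  rw [logPlus, Complex.exp_conj, hl.exp_minus _ h' hs', map_mul, e, ← blaschke_conj,
    Complex.conj_conj, Complex.conj_conj]

include hz

/-- At a zero of `s11` the relation `exp_minus` is not available, but the product vanishes as well.
-/
theorem s11_eq_exp {z : ℂ} (h : z ∈ regionMinus q0) :
    s11 q0 qm qp q t z = Complex.exp (logMinus q0 l z) * blaschke q0 ζ z := by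
  by_cases hs : s11 q0 qm qp q t z = 0
  · rw [hs, blaschke_eq_zero hq hz h hs, mul_zero]
  · rw [hl.exp_minus z (Or.inl h) hs, blaschkeInv_eq,
      inv_mul_cancel_right₀ (hl.blaschke_ne_zero (Or.inl h) hs)]

theorem s22_eq_exp {z : ℂ} (h : z ∈ regionPlus q0) :
    s22 q0 qm qp q t z = Complex.exp (logPlus q0 l z) * blaschkeInv q0 ζ z := by
  have h' := conj_mem_regionMinus.2 h
  rw [s22_eq hq (regionMinus_subset q0 h'), hl.s11_eq_exp hq hz h', map_mul, blaschke_conj, logPlus,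
    Complex.exp_conj]

omit hz in
theorem tendsto_minus : Tendsto (fun z => Complex.exp (logMinus q0 l z))
    (Bornology.cobounded ℂ ⊓ 𝓟 (regionMinus q0 ∪ contour0 q0)) (𝓝 1) := by
  have h0 := hq.pos
  obtain ⟨δ, K, hδ, hb⟩ := hl.reflLog.lin
  have h1 : Tendsto (logMinus q0 l) (Bornology.cobounded ℂ ⊓ 𝓟 (regionMinus q0 ∪ contour0 q0))
      (𝓝 0) := by
    have h2 : Tendsto (fun z : ℂ => K * q0 ^ 2 / ‖z‖)
        (Bornology.cobounded ℂ ⊓ 𝓟 (regionMinus q0 ∪ contour0 q0)) (𝓝 0) :=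
      (tendsto_norm_cobounded_atTop.const_div_atTop (K * q0 ^ 2)).mono_left inf_le_left
    have h3 : ∀ᶠ z : ℂ in Bornology.cobounded ℂ ⊓ 𝓟 (regionMinus q0 ∪ contour0 q0),
        q0 ^ 2 / δ + q0 < ‖z‖ :=
      (tendsto_norm_cobounded_atTop.mono_left inf_le_left).eventually_gt_atTop _
    refine squeeze_zero_norm' ?_ h2
    filter_upwards [h3, mem_inf_of_right (mem_principal_self _)] with z h4 h5
    have h6 : 0 ≤ q0 ^ 2 / δ := by positivity
    have h7 : q0 < ‖z‖ := by linarith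
    have h8 : z ∈ outer q0 := ⟨h7.le, im_nonpos_of_mem_lowerSet h0 (lower_of_mem h5) h7⟩
    have h9 : ‖inv q0 z‖ < δ := by
      rw [norm_inv_eq, div_lt_iff₀ (h0.trans h7), mul_comm, ← div_lt_iff₀ hδ]
      linarith
    have h10 := hb _ (inv_mem_halfDisc h0 h8) h9
    have e : logMinus q0 l z = conj (l (inv q0 z) - l 0) := by
      rw [hl.reflLog.logMinus_of_outer h0 h8, map_sub, hl.reflLog.conj_zero, sub_neg_eq_add]
    rw [e, RCLike.norm_conj]
    rwa [norm_inv_eq, ← mul_div_assoc] at h10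
  have := (Complex.continuous_exp.tendsto 0).comp h1
  rwa [Complex.exp_zero] at this

end ThetaLog

theorem tendsto_conj_cobounded {f g : ℂ → ℂ}
    (h : Tendsto f (Bornology.cobounded ℂ ⊓ 𝓟 (regionMinus q0 ∪ contour0 q0)) (𝓝 1))
    (hfg : ∀ z ∈ regionPlus q0 ∪ contour0 q0, g z = conj (f (conj z))) :
    Tendsto g (Bornology.cobounded ℂ ⊓ 𝓟 (regionPlus q0 ∪ contour0 q0)) (𝓝 1) := by
  have h1 : Tendsto (starRingEnd ℂ) (Bornology.cobounded ℂ ⊓ 𝓟 (regionPlus q0 ∪ contour0 q0))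
      (Bornology.cobounded ℂ ⊓ 𝓟 (regionMinus q0 ∪ contour0 q0)) := by
    refine tendsto_inf.2 ⟨?_, ?_⟩
    · rw [← tendsto_norm_atTop_iff_cobounded]
      refine (tendsto_norm_cobounded_atTop.mono_left inf_le_left).congr fun z => ?_
      rw [RCLike.norm_conj]
    · exact tendsto_principal.2 (mem_inf_of_right fun z hz => conj_mem_of_mem hz)
  have h2 := tendsto_conj (h.comp h1)
  rw [map_one] at h2
  refine h2.congr' ?_
  filter_upwards [mem_inf_of_right (mem_principal_self _)] with z hz
  exact (hfg z hz).symm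

include hq in
theorem tendsto_s11 : Tendsto (s11 q0 qm qp q t)
    (Bornology.cobounded ℂ ⊓ 𝓟 (regionMinus q0 ∪ contour0 q0)) (𝓝 1) := by
  obtain ⟨C, -, hb⟩ := s11_asymp hq t
  refine tendsto_one_of_norm_le (C := C) (R := max (2 * q0) 1) fun z hz hR => ?_
  exact hb z (lower_of_mem hz) ((le_max_left _ _).trans hR) ((le_max_right _ _).trans hR)

include hq in
theorem one_sub_rho {z : ℂ} (h : z ∈ contour0 q0) :
    1 - rho q0 qm qp q t z * rhoTilde q0 qm qp q t z = jump q0 qm qp q t z := by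
  have h1 := contour0_subset q0 h
  have h2 := contour0_subset q0 (conj_mem_contour0.2 h)
  rw [jump, rhoTilde, s12_eq hq h1 h2, s22_eq hq h2, rho, rho, map_div₀]
  ring

include hq hspec in
theorem s22_ne_zero_contour {z : ℂ} (h : z ∈ contour0 q0) : s22 q0 qm qp q t z ≠ 0 := by
  have h2 := conj_mem_contour0.2 h
  rw [s22_eq hq (contour0_subset q0 h2)]
  exact (map_ne_zero _).2 (s11_ne_zero_contour hspec h2)

include hq hspec in
theorem one_div_mul {z : ℂ} (h : z ∈ contour0 q0) :
    1 / (s11 q0 qm qp q t z * s22 q0 qm qp q t z) =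
      1 - rho q0 qm qp q t z * rhoTilde q0 qm qp q t z := by
  have h1 := s11_ne_zero_contour hspec h
  have h2 := s22_ne_zero_contour hq hspec h
  rw [rho, rhoTilde, div_eq_iff (mul_ne_zero h1 h2)]
  field_simp
  linear_combination -s_det hq (t := t) h

include hq hspec in
theorem jump_eq {z : ℂ} (h : z ∈ contour0 q0) :
    jump q0 qm qp q t z = 1 / (s11 q0 qm qp q t z * s22 q0 qm qp q t z) := by
  rw [one_div_mul hq hspec h, one_sub_rho hq h]

-- The factors from the product cancel, and s₁₁s₂₂ is the reciprocal of the jump by the determinant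
-- relation.
include hq hspec in
theorem ThetaLog.exp_mul_exp {l : ℂ → ℂ} (hl : ThetaLog q0 qm qp q t ζ l) {z : ℂ}
    (h : z ∈ contour0 q0) : Complex.exp (logPlus q0 l z) * Complex.exp (logMinus q0 l z) =
      1 / jump q0 qm qp q t z := by
  have h1 := s11_ne_zero_contour hspec h
  have h2 := s22_ne_zero_contour hq hspec h
  have h3 := hl.blaschke_ne_zero (Or.inr h) h1
  rw [hl.exp_plus hq (Or.inr h) h2, hl.exp_minus z (Or.inr h) h1, jump_eq hq hspec h, one_div_one_div,
    blaschkeInv_eq]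
  field_simp

include hq hspec in
theorem ThetaLog.isLogJump {l : ℂ → ℂ} (hl : ThetaLog q0 qm qp q t ζ l) :
    IsLogJump q0 qm qp q t (logJump q0 l) := by
  refine ⟨hl.reflLog.continuousOn_logJump hq.pos, fun z h => ?_, fun x _ => ReflLog.logJump_im x⟩
  rw [logJump, Complex.exp_neg, add_comm, Complex.exp_add, hl.exp_mul_exp hq hspec h, one_div,
    inv_inv]

include hq hz in
/-- The phases of the boundary values. -/
theorem ThetaLog.arg_eq {l : ℂ → ℂ} (hl : ThetaLog q0 qm qp q t ζ l) :
    ((qm / qp).arg : Real.Angle) = (((l 0).im + 8 * ∑ n, (ζ n).arg : ℝ) : Real.Angle) := by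
  have e1 : l 0 = ((l 0).im : ℂ) * Complex.I :=
    Complex.ext (by simpa using hl.reflLog.zero_re) (by simp)
  -- zₙ/conj zₙ has argument 2 arg zₙ and enters to the fourth power; this is the 8 of the theta
  -- condition.
  have e2 : blaschkeZero ζ = Complex.exp (((8 * ∑ n, (ζ n).arg : ℝ) : ℂ) * Complex.I) := by
    rw [blaschkeZero, Finset.mul_sum, Complex.ofReal_sum, Finset.sum_mul, Complex.exp_sum]
    refine Finset.prod_congr rfl fun n _ => ?_
    have hn := zero_ne_zero hq hz n
    have hn' : (‖ζ n‖ : ℂ) ≠ 0 := by exact_mod_cast norm_ne_zero_iff.2 hn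
    have p := Complex.norm_mul_exp_arg_mul_I (ζ n)
    have p' : conj (ζ n) = ‖ζ n‖ * Complex.exp (-((ζ n).arg * Complex.I)) := by
      conv_lhs => rw [← p]
      rw [map_mul, Complex.conj_ofReal, ← Complex.exp_conj]
      simp
    have p2 : ζ n / conj (ζ n) = Complex.exp (2 * ((ζ n).arg * Complex.I)) := by
      rw [p']
      nth_rw 1 [← p]
      rw [mul_div_mul_left _ _ hn', ← Complex.exp_sub]
      congr 1; ring
    rw [p2, ← Complex.exp_nat_mul]
    congr 1; push_cast; ring
  have hne : blaschkeZero ζ ≠ 0 := by rw [e2]; exact Complex.exp_ne_zero _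
  have e3 : qm / qp = Complex.exp ((((l 0).im + 8 * ∑ n, (ζ n).arg : ℝ) : ℂ) * Complex.I) := by
    rw [Complex.ofReal_add, add_mul, Complex.exp_add, ← e2, ← e1, hl.exp_zero, thetaZero,
      div_mul_cancel₀ _ hne]
  rw [e3, Complex.arg_exp_mul_I, Real.Angle.coe_toIocMod]

theorem circ_mem_contour0 (h0 : 0 < q0) {α : ℝ} (h : Real.cos α ≠ 0) : circ q0 α ∈ contour0 q0 := by
  have h1 : (circ q0 α).re ≠ 0 := by rw [circ_re]; exact mul_ne_zero h0.ne' h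
  exact ⟨Or.inr (norm_circ h0.le α), fun h2 => h1 (by simp [h2]), fun h2 => h1 (by simp [h2]),
    fun h2 => h1 (by simp [h2])⟩

theorem ofReal_mem_contour0 {x : ℝ} (h : x ≠ 0) : (x : ℂ) ∈ contour0 q0 :=
  ⟨Or.inl (by simp), by exact_mod_cast h, fun h2 => h (by simpa using congrArg Complex.re h2),
    fun h2 => h (by simpa using congrArg Complex.re h2)⟩

theorem contourInt_eq_zero (h0 : 0 < q0) {f : ℂ → ℂ} (h : ∀ z ∈ contour0 q0, f z = 0) :
    contourInt q0 f = 0 := by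
  have hx : ∀ᵐ x : ℝ, f x = 0 := by
    have : ∀ᵐ x : ℝ, x ≠ 0 := by simp [ae_iff]
    filter_upwards [this] with x hx using h _ (ofReal_mem_contour0 hx)
  have hα : ∀ᵐ α : ℝ, f (circ q0 α) * (Complex.I * circ q0 α) = 0 := by
    have hc : {α : ℝ | Real.cos α = 0}.Countable := by
      have : {α : ℝ | Real.cos α = 0} = range fun k : ℤ => (2 * k + 1) * Real.pi / 2 := by
        ext α
        rw [mem_ofPred_eq, Real.cos_eq_zero_iff]
        simp only [mem_range, eq_comm]
      rw [this]
      exact countable_range _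
    filter_upwards [hc.ae_notMem volume] with α hα
    rw [h _ (circ_mem_contour0 h0 hα), zero_mul]
  have z1 : ∀ a b : ℝ, ∫ x in a..b, f (x : ℂ) = 0 := fun a b =>
    intervalIntegral.integral_zero_ae (hx.mono fun x hx _ => hx)
  have z2 : ∀ a b : ℝ, ∫ α in a..b, f (circ q0 α) * (Complex.I * circ q0 α) = 0 := fun a b =>
    intervalIntegral.integral_zero_ae (hα.mono fun x hx _ => hx)
  have z3 : ∀ s : Set ℝ, ∫ x in s, f (x : ℂ) = 0 := fun s =>
    integral_eq_zero_of_ae (ae_restrict_of_ae hx)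
  rw [contourInt, z1, z2, z2, z3, z3]
  ring

/-- A continuous logarithm of `1` on the contour that is real on the real axis vanishes. -/
theorem IsLogJump.eq_zero (h0 : 0 < q0) {L : ℂ → ℂ} (hL : IsLogJump q0 qm qp q t L)
    (hj : ∀ z ∈ contour0 q0, jump q0 qm qp q t z = 1) {z : ℂ} (hz : z ∈ contour0 q0) : L z = 0 := by
  have hone : ∀ z ∈ contour0 q0, Complex.exp (L z) = 1 := fun z hz => by rw [hL.2.1 z hz, hj z hz]
  have hreal : ∀ x : ℝ, x ≠ 0 → L x = 0 := fun x hx => by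
    have h1 := hone _ (ofReal_mem_contour0 hx)
    have h2 := hL.2.2 x hx
    have h3 : L x = ((L x).re : ℂ) := Complex.ext rfl (by simpa using h2)
    rw [h3] at h1 ⊢
    have h4 : Real.exp (L x).re = 1 := by exact_mod_cast h1
    rw [(Real.exp_eq_one_iff _).1 h4, Complex.ofReal_zero]
  -- On Σ₀ the values of L lie in 2πiℤ, which is discrete; so L is constant on every arc that avoids
  -- the branch points.
  have hD : IsDiscrete ((AddSubgroup.zmultiples (2 * Real.pi * Complex.I) : AddSubgroup ℂ) :
      Set ℂ) := by
    rw [isDiscrete_iff_discreteTopology]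
    exact NormedSpace.discreteTopology_zmultiples _
  have hmaps : ∀ z ∈ contour0 q0, L z ∈ ((AddSubgroup.zmultiples (2 * Real.pi * Complex.I) :
      AddSubgroup ℂ) : Set ℂ) := fun z hz => by
    obtain ⟨n, hn⟩ := Complex.exp_eq_one_iff.1 (hone z hz)
    exact AddSubgroup.mem_zmultiples_iff.2 ⟨n, by rw [hn, zsmul_eq_mul]⟩
  have harc : ∀ a b : ℝ, (∀ α ∈ Icc a b, Real.cos α ≠ 0) → a ≤ b →
      L (circ q0 a) = L (circ q0 b) := fun a b hcos hab =>
    isPreconnected_Icc.constant_of_mapsTo hD (hL.1.comp (continuous_circ q0).continuousOn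
      fun α hα => circ_mem_contour0 h0 (hcos α hα))
      (fun α hα => hmaps _ (circ_mem_contour0 h0 (hcos α hα))) (left_mem_Icc.2 hab)
      (right_mem_Icc.2 hab)
  rcases hz.1 with h | h
  · have h3 : z = (z.re : ℂ) := Complex.ext rfl (by simpa using h)
    have h4 : z.re ≠ 0 := fun h5 => hz.2.1 (by rw [h3, h5, Complex.ofReal_zero])
    rw [h3]; exact hreal _ h4
  · set α := z.arg with hα
    have hzc : z = circ q0 α := by
      rw [circ, ← h, hα, mul_comm Complex.I, Complex.norm_mul_exp_arg_mul_I]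
    have hre : z.re ≠ 0 := fun hr => by
      have h1 : |z.im| = q0 := by rw [← h]; exact (Complex.abs_im_eq_norm.2 hr)
      rcases (abs_eq h0.le).1 h1 with h2 | h2
      · exact hz.2.2.1 (Complex.ext (by simp [hr]) (by simp [h2]))
      · exact hz.2.2.2 (Complex.ext (by simp [hr]) (by simp [h2]))
    have hcos : Real.cos α ≠ 0 := fun h1 => hre (by rw [hzc, circ_re, h1, mul_zero])
    have hpi := Real.pi_pos
    have b1 := Complex.neg_pi_lt_arg z
    have b2 := Complex.arg_le_pi z
    have c0 : L (circ q0 0) = 0 := by rw [circ_zero]; exact hreal q0 h0.ne'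
    have cpi : L (circ q0 Real.pi) = 0 := by
      rw [circ_pi, ← Complex.ofReal_neg]; exact hreal (-q0) (neg_ne_zero.2 h0.ne')
    have cpi' : L (circ q0 (-Real.pi)) = 0 := by
      rw [← conj_circ, circ_pi, map_neg, Complex.conj_ofReal, ← Complex.ofReal_neg]
      exact hreal (-q0) (neg_ne_zero.2 h0.ne')
    rw [hzc]
    -- The sign of cos α tells which of 0, π, -π can be reached along the circle without passing a
    -- branch point; the real points ±q₀ found there have L = 0.
    rcases lt_or_gt_of_ne hcos with hc | hc
    · rcases le_total 0 α with h1 | h1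
      · have h2 : Real.pi / 2 < α := by
          by_contra! h2
          exact absurd hc (not_lt.2 (Real.cos_nonneg_of_mem_Icc ⟨by linarith, h2⟩))
        rw [harc α Real.pi (fun β hβ => ?_) b2, cpi]
        exact (Real.cos_neg_of_pi_div_two_lt_of_lt (by linarith [hβ.1]) (by linarith [hβ.2])).ne
      · have h2 : α < -(Real.pi / 2) := by
          by_contra! h2
          exact absurd hc (not_lt.2 (Real.cos_nonneg_of_mem_Icc ⟨by linarith, by linarith⟩))
        rw [← harc (-Real.pi) α (fun β hβ => ?_) b1.le, cpi']
        rw [← Real.cos_neg]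
        exact (Real.cos_neg_of_pi_div_two_lt_of_lt (by linarith [hβ.2]) (by linarith [hβ.1])).ne
    · have h3 : -(Real.pi / 2) < α ∧ α < Real.pi / 2 := by
        constructor
        · by_contra! h2
          have := Real.cos_nonpos_of_pi_div_two_le_of_le (x := -α) (by linarith) (by linarith)
          rw [Real.cos_neg] at this
          linarith
        · by_contra! h2
          have := Real.cos_nonpos_of_pi_div_two_le_of_le (x := α) (by linarith) (by linarith)
          linarith
      rcases le_total 0 α with h1 | h1
      · rw [← harc 0 α (fun β hβ => ?_) h1, c0]
        exact (Real.cos_pos_of_mem_Ioo ⟨by linarith [hβ.1], by linarith [hβ.2, h3.2]⟩).ne'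
      · rw [harc α 0 (fun β hβ => ?_) h1, c0]
        exact (Real.cos_pos_of_mem_Ioo ⟨by linarith [hβ.1, h3.1], by linarith [hβ.2]⟩).ne'

end

end KE

/-! ### Trace formulae and theta condition -/

theorem mainTheorem10 (q0 : ℝ) (qm qp : ℂ) (q : ℝ → ℂ) (t : ℝ)
    (hq : KE.IsPotential q0 qm qp q)
    -- no zeros of the scattering coefficient on the contour, the branch points included
    (hspec : ∃ c : ℝ, 0 < c ∧ ∀ ζ ∈ KE.contour0 q0, c ≤ ‖KE.s11 q0 qm qp q t ζ‖)
    {N : ℕ} (zn : Fin N → ℂ) (hz : KE.HasDoubleZeros q0 qm qp q t zn) :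
    -- the functions `ϑ⁻`, `ϑ⁺`: no zeros, analyticity, behaviour at infinity, product on `Σ`
    (∃ ϑm ϑp : ℂ → ℂ,
      (∀ z ∈ KE.regionMinus q0 ∪ KE.contour0 q0, KE.s11 q0 qm qp q t z ≠ 0 →
        ϑm z = KE.s11 q0 qm qp q t z * KE.blaschkeInv q0 zn z) ∧
      (∀ z ∈ KE.regionPlus q0 ∪ KE.contour0 q0, KE.s22 q0 qm qp q t z ≠ 0 →
        ϑp z = KE.s22 q0 qm qp q t z * KE.blaschke q0 zn z) ∧
      DifferentiableOn ℂ ϑm (KE.regionMinus q0) ∧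
      DifferentiableOn ℂ ϑp (KE.regionPlus q0) ∧
      (∀ z ∈ KE.regionMinus q0 ∪ KE.contour0 q0, ϑm z ≠ 0) ∧
      (∀ z ∈ KE.regionPlus q0 ∪ KE.contour0 q0, ϑp z ≠ 0) ∧
      Filter.Tendsto (KE.s11 q0 qm qp q t)
        (Bornology.cobounded ℂ ⊓ Filter.principal (KE.regionMinus q0 ∪ KE.contour0 q0))
        (nhds 1) ∧
      Filter.Tendsto ϑm
        (Bornology.cobounded ℂ ⊓ Filter.principal (KE.regionMinus q0 ∪ KE.contour0 q0))
        (nhds 1) ∧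
      Filter.Tendsto (KE.s22 q0 qm qp q t)
        (Bornology.cobounded ℂ ⊓ Filter.principal (KE.regionPlus q0 ∪ KE.contour0 q0))
        (nhds 1) ∧
      Filter.Tendsto ϑp
        (Bornology.cobounded ℂ ⊓ Filter.principal (KE.regionPlus q0 ∪ KE.contour0 q0))
        (nhds 1) ∧
      (∀ ζ ∈ KE.contour0 q0, KE.jump q0 qm qp q t ζ ≠ 0 ∧
        ϑp ζ * ϑm ζ = 1 / KE.jump q0 qm qp q t ζ)) ∧
    (∀ ζ ∈ KE.contour0 q0,
      KE.s11 q0 qm qp q t ζ ≠ 0 ∧ KE.s22 q0 qm qp q t ζ ≠ 0 ∧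
      1 / (KE.s11 q0 qm qp q t ζ * KE.s22 q0 qm qp q t ζ)
        = 1 - KE.rho q0 qm qp q t ζ * KE.rhoTilde q0 qm qp q t ζ ∧
      1 - KE.rho q0 qm qp q t ζ * KE.rhoTilde q0 qm qp q t ζ = KE.jump q0 qm qp q t ζ) ∧
    -- trace formulae and theta condition
    (∃ L : ℂ → ℂ, KE.IsLogJump q0 qm qp q t L ∧
      (∀ z ∈ KE.regionMinus q0 ∪ KE.regionPlus q0,
        KE.ContourIntegrable q0 (fun ζ => L ζ / (ζ - z))) ∧
      (∀ z ∈ KE.regionMinus q0, KE.s11 q0 qm qp q t z =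
        Complex.exp (-(1 / (2 * (Real.pi : ℂ) * Complex.I) *
          KE.contourInt q0 (fun ζ => L ζ / (ζ - z)))) * KE.blaschke q0 zn z) ∧
      (∀ z ∈ KE.regionPlus q0, KE.s22 q0 qm qp q t z =
        Complex.exp (1 / (2 * (Real.pi : ℂ) * Complex.I) *
          KE.contourInt q0 (fun ζ => L ζ / (ζ - z))) * KE.blaschkeInv q0 zn z) ∧
      KE.ContourIntegrable q0 (fun ζ => L ζ / ζ) ∧
      (KE.contourInt q0 (fun ζ => L ζ / ζ)).im = 0 ∧
      ((qm / qp).arg : Real.Angle) =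
        ((1 / (2 * Real.pi) * (KE.contourInt q0 (fun ζ => L ζ / ζ)).re
          + 8 * ∑ n, (zn n).arg : ℝ) : Real.Angle)) ∧
    ((qm / qp).arg : Real.Angle) = (qm.arg : Real.Angle) - (qp.arg : Real.Angle) ∧
    -- the reflectionless case
    ((∀ ζ ∈ KE.contour0 q0, KE.rho q0 qm qp q t ζ = 0) →
      (∀ z ∈ KE.regionMinus q0, KE.s11 q0 qm qp q t z = KE.blaschke q0 zn z) ∧
      (∀ z ∈ KE.regionPlus q0, KE.s22 q0 qm qp q t z = KE.blaschkeInv q0 zn z) ∧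
      ((qm / qp).arg : Real.Angle) = ((8 * ∑ n, (zn n).arg : ℝ) : Real.Angle)) := by
  have h0 := hq.pos
  have hpi : (2 * (Real.pi : ℂ) * Complex.I) ≠ 0 := Complex.two_pi_I_ne_zero
  obtain ⟨l, hl⟩ := KE.exists_thetaLog hq hspec hz
  have hr := hl.reflLog
  have harg := hl.arg_eq hq hz
  have hqp : qp ≠ 0 := norm_ne_zero_iff.1 (by rw [hq.norm_plus]; exact h0.ne')
  have hqm : qm ≠ 0 := norm_ne_zero_iff.1 (by rw [hq.norm_minus]; exact h0.ne')
  have htr1 : ∀ z ∈ KE.regionMinus q0, -(1 / (2 * (Real.pi : ℂ) * Complex.I) *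
      KE.contourInt q0 (fun ζ => KE.logJump q0 l ζ / (ζ - z))) = KE.logMinus q0 l z :=
    fun z h => by
      rw [(hr.contourInt_logJump h0 (Or.inl h)).2.1 h]
      field_simp
  have htr2 : ∀ z ∈ KE.regionPlus q0, 1 / (2 * (Real.pi : ℂ) * Complex.I) *
      KE.contourInt q0 (fun ζ => KE.logJump q0 l ζ / (ζ - z)) = KE.logPlus q0 l z :=
    fun z h => by
      rw [(hr.contourInt_logJump h0 (Or.inr h)).2.2 h]
      field_simp
  obtain ⟨hzi, hzv⟩ := hr.contourInt_logJump_zero h0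
  -- l(0) is imaginary, so -2πi l(0) is the real number 2π Im l(0).
  have hzv' : KE.contourInt q0 (fun ζ => KE.logJump q0 l ζ / ζ) =
      ((2 * Real.pi * (l 0).im : ℝ) : ℂ) := by
    have e1 : l 0 = ((l 0).im : ℂ) * Complex.I :=
      Complex.ext (by simpa using hr.zero_re) (by simp)
    rw [hzv]
    nth_rw 1 [e1]
    push_cast
    linear_combination -(2 * Real.pi * ((l 0).im : ℂ)) * Complex.I_sq
  refine ⟨⟨fun z => Complex.exp (KE.logMinus q0 l z), fun z => Complex.exp (KE.logPlus q0 l z),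
    hl.exp_minus, fun z h hs => hl.exp_plus hq h hs, (hr.differentiableOn_logMinus h0).cexp,
    (hr.differentiableOn_logPlus h0).cexp, fun z _ => Complex.exp_ne_zero _,
    fun z _ => Complex.exp_ne_zero _, KE.tendsto_s11 hq, hl.tendsto_minus hq,
    KE.tendsto_conj_cobounded (KE.tendsto_s11 hq) fun z h =>
      KE.s22_eq hq (KE.lower_of_mem (KE.conj_mem_of_mem h)),
    KE.tendsto_conj_cobounded (hl.tendsto_minus hq) fun z _ => Complex.exp_conj _,
    fun ζ h => ⟨?_, hl.exp_mul_exp hq hspec h⟩⟩,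
    fun ζ h => ⟨KE.s11_ne_zero_contour hspec h, KE.s22_ne_zero_contour hq hspec h,
      KE.one_div_mul hq hspec h, KE.one_sub_rho hq h⟩,
    ⟨KE.logJump q0 l, hl.isLogJump hq hspec, fun z h => (hr.contourInt_logJump h0 h).1,
      fun z h => ?_, fun z h => ?_, hzi, ?_, ?_⟩, Complex.arg_div_coe_angle hqm hqp, fun hrho => ?_⟩
  · rw [KE.jump_eq hq hspec h]
    exact one_div_ne_zero (mul_ne_zero (KE.s11_ne_zero_contour hspec h)
      (KE.s22_ne_zero_contour hq hspec h))
  · rw [htr1 z h, hl.s11_eq_exp hq hz h]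
  · rw [htr2 z h, hl.s22_eq_exp hq hz h]
  · rw [hzv', Complex.ofReal_im]
  · rw [harg, hzv', Complex.ofReal_re]
    congr 2
    have := Real.pi_pos
    field_simp
  · have hL : ∀ ζ ∈ KE.contour0 q0, KE.logJump q0 l ζ = 0 := fun ζ h =>
      (hl.isLogJump hq hspec).eq_zero h0 (fun z hz => by
        rw [KE.jump, hrho z hz, zero_mul, add_zero]) h
    -- A general denominator covers both the Cauchy kernel and the kernel 1/ζ.
    have hint : ∀ k : ℂ → ℂ, KE.contourInt q0 (fun ζ => KE.logJump q0 l ζ / k ζ) = 0 := fun k =>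
      KE.contourInt_eq_zero h0 fun ζ h => by rw [hL ζ h, zero_div]
    refine ⟨fun z h => ?_, fun z h => ?_, ?_⟩
    · rw [hl.s11_eq_exp hq hz h, ← htr1 z h, hint]
      simp
    · rw [hl.s22_eq_exp hq hz h, ← htr2 z h, hint]
      simp
    · have h1 := hint fun ζ => ζ
      rw [hzv'] at h1
      have h2 : 2 * Real.pi * (l 0).im = 0 := by exact_mod_cast h1
      have h3 : (l 0).im = 0 := (mul_eq_zero.1 h2).resolve_left (by positivity)
      rw [harg, h3, zero_add]
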